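/- **Model.** There are $M$ prosumers $v=1,\dots,M$. Prosumer $v$ has state $x^v=(\zeta^v,q^v)\in\mathbb R^2$ (energy shift, state of charge), input $u^v=(e^v,s^v)\in\mathbb R^2$ (consumption, charging), and dynamics $$\zeta^v_{t+1}=\zeta^v_t+e^v_t-e^{v,\mathrm{ref}},\qquad q^v_{t+1}=\alpha^vq^v_t+\beta^vs^v_t ,\qquad \alpha^v,\beta^v\in[0,1].$$ We write the collected dynamics as $x_{t+1}=Ax_t+Bu_t+d$. The load of $v$ is $l^v=e^v+s^v-g^v$ and the aggregate load is $L=\sum_v l^v+L^{\mathcal P}$. The constraints are - $x^v\in\mathcal X^v$: $\underline\zeta^v\le\zeta^v\le\bar\zeta^v$ and $0\le q^v\le\bar q^v$; - $u^v\in\mathcal U^v$: $\underline s^v\le\beta^vs^v\le\bar s^v$, $\underline e^v\le e^v\le\bar e^v$ and $0\le l^v\le\bar l^v$, where $0\le\underline e^v<\bar e^v$; - $u^v\in\mathcal C(u^{-v})$: $\underline L\le L\le\bar L$, where $0<\underline L<\bar L$. Let $\mathcal X=\prod_v\mathcal X^v$ and $U=\{u: u^v\in\mathcal U^v\cap\mathcal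 C(u^{-v})\ \forall v\}$. The stage cost of $v$ is $$\ell^v(x^v,u)=(\rho_1^vL+\rho_2^v)\,l^v+\gamma_1^v(\zeta^v)^2+\gamma_2^v(q^v)^2,\qquad \rho_1^v,\gamma_1^v,\gamma_2^v>0,\ \rho_2^v\ge0 .$$ All parameters are constant in time and over the prediction horizon. **Games.** A variational generalized Nash equilibrium (v-GNE) of a game with costs $J^v$ and joint strategy set $Z$ is a $z\in Z$ with $\sum_v\langle\nabla_{z^v}J^v(z),z'^v-z^v\rangle\ge0$ for all $z'\in Z$. In the horizon-$N$ game with initial state $\mathbf x$, prosumer $v$ minimizes $\sum_{k<N}\ell^v(x^v_k,u_k)$ over $(u^v_0,\dots,u^v_{N-1},x^v_0,\dots,x^v_N)$ subject to the dynamics, $x_0=\mathbf x$, $u_k^v\in\mathcal U^v\cap\mathcal C(u_k^{-v})$ for $k<N$ and $x_k^v\in\mathcal X^v$ for $k\le N$. The receding-horizon feedback $\kappa_N(\mathbf x)$ is the first input of a v-GNE of this game, and the closed loop is $x_{t+1}=Ax_t+Bu_t+d$ with $u_t=\kappa_N(x_t)$. In the steady-state game, $v$ minimizes $\ell^v(x^v,u)$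 over $(x^v,u^v)$ subject to $x^v=A^vx^v+B^vu^v+d^v$, $x^v\in\mathcal X^v$ and $u^v\in\mathcal U^v\cap\mathcal C(u^{-v})$. **Theorem.** Assume symmetric pricing, $\rho^v_1=\rho_1$ and $\rho_2^v=\rho_2$ for all $v$, and that there is at least one admissible steady state, i.e. $x\in\mathcal X$, $u\in U$ with $x=Ax+Bu+d$. Then the steady-state game has a unique v-GNE $(\bar x,\bar u)$. Let $\mathcal R$ be the set of all $\mathbf x\in\mathcal X$ for which there is an input sequence in $U$ whose trajectory from $\mathbf x$ stays in $\mathcal X$ and converges to $\bar x$. Then $\bar x\in\mathcal R$, and $\mathcal R$ is the largest possible region of attraction: every trajectory, under any (possibly time-varying) feedback policy, that satisfies the constraints $x_t\in\mathcal X$, $u_t\in U$ and converges to $\bar x$ starts in $\mathcal R$. Moreover, there are $\bar N\in\mathbb N$, a function $\eta$ of class $\mathcal{KL}$ and a function $\gamma:\mathbb N\to\mathbb R_{\ge0}$ with $\lim_{N\to\infty}\gamma(N)=0$ such that for every $N\ge\bar N$ and every $x_0\in\mathcal R$ the closed loop from $x_0$ is recursively feasible (for every $t\ge0$ the horizon-$N$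 game with initial state $x_t$ has a v-GNE, and all its v-GNEs have the same first input $u_t$, so that $\kappa_N(x_t)$ is well defined), and for all $t\ge0$ $$x_t\in\mathcal X,\qquad u_t\in U,\qquad \|x_t-\bar x\|\le\eta(\|x_0-\bar x\|,t)+\gamma(N).$$ -/

import Mathlib

open Filter Topology

/-- State of one prosumer: the pair `(ζ, q)` of energy-shift state and state of charge. -/
abbrev PState := ℝ × ℝ

/-- Input of one prosumer: the pair `(e, s)` of consumption and storage charging. -/
abbrev PInput := ℝ × ℝ

/-- Data of a distribution grid with `M` active prosumers, all constant in time.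
The generation `g v` is `0` for a prosumer without generation units. -/
structure Grid (M : ℕ) where
  /-- leakage rate -/
  α : Fin M → ℝ
  /-- charging efficiency -/
  β : Fin M → ℝ
  /-- storage capacity -/
  qMax : Fin M → ℝ
  /-- lower charging limit -/
  sMin : Fin M → ℝ
  /-- upper charging limit -/
  sMax : Fin M → ℝ
  /-- lower consumption bound -/
  eMin : Fin M → ℝ
  /-- upper consumption bound -/
  eMax : Fin M → ℝ
  /-- nominal consumption -/
  eRef : Fin M → ℝ
  /-- lower bound on the energy-shift state -/
  ζMin : Fin M → ℝ
  /-- upper bound on the energy-shift state -/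
  ζMax : Fin M → ℝ
  /-- maximal individual load on the main grid -/
  lMax : Fin M → ℝ
  /-- non-dispatchable generation -/
  g : Fin M → ℝ
  /-- weight of the energy shift -/
  γ₁ : Fin M → ℝ
  /-- weight of the battery usage -/
  γ₂ : Fin M → ℝ
  /-- price rate multiplying the aggregate load -/
  ρ₁ : Fin M → ℝ
  /-- base price rate -/
  ρ₂ : Fin M → ℝ
  /-- aggregate load of the passive consumers -/
  passiveLoad : ℝ
  /-- lower limit on the aggregate load -/
  LMin : ℝ
  /-- upper limit on the aggregate load -/
  LMax : ℝ
  α_mem : ∀ v, α v ∈ Set.Icc (0 : ℝ) 1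
  β_mem : ∀ v, β v ∈ Set.Icc (0 : ℝ) 1
  eMin_nonneg : ∀ v, 0 ≤ eMin v
  eMin_lt_eMax : ∀ v, eMin v < eMax v
  LMin_pos : 0 < LMin
  LMin_lt_LMax : LMin < LMax
  γ₁_pos : ∀ v, 0 < γ₁ v
  γ₂_pos : ∀ v, 0 < γ₂ v
  ρ₁_pos : ∀ v, 0 < ρ₁ v
  ρ₂_nonneg : ∀ v, 0 ≤ ρ₂ v

/-- The solutions of the variational inequality `F(z) + N_Z(z) ∋ 0`, where `F` is the
pseudo-gradient `col (∇_{z^v} J^v (z^v, z^{-v}))_v` and `N_Z(z)` is the normal cone of the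
(convex) joint strategy set `Z` at `z`: the variational generalized Nash equilibria of the
game in which player `v` minimizes `J v` over its own component `z v`. -/
def variationalEquilibria {M : ℕ} {E : Type} [NormedAddCommGroup E] [NormedSpace ℝ E]
    (J : Fin M → (Fin M → E) → ℝ) (Z : Set (Fin M → E)) : Set (Fin M → E) :=
  {z | z ∈ Z ∧ ∀ z' ∈ Z,
    0 ≤ ∑ v, fderiv ℝ (fun y : E => J v (Function.update z v y)) (z v) (z' v - z v)}

/-- Euclidean norm of a stacked state `col (ζ^v, q^v)_v`. -/
noncomputable def stackedNorm {M : ℕ} (x : Fin M → PState) : ℝ :=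
  Real.sqrt (∑ v, ((x v).1 ^ 2 + (x v).2 ^ 2))

/-- Comparison functions of class `KL` on `[0, ∞) × [0, ∞)`. -/
structure IsClassKL (η : ℝ → ℝ → ℝ) : Prop where
  continuousOn : ContinuousOn (Function.uncurry η) (Set.Ici 0 ×ˢ Set.Ici 0)
  map_zero : ∀ t, 0 ≤ t → η 0 t = 0
  strictMonoOn : ∀ t, 0 ≤ t → StrictMonoOn (fun r => η r t) (Set.Ici 0)
  antitoneOn : ∀ r, 0 ≤ r → AntitoneOn (fun t => η r t) (Set.Ici 0)
  tendsto_zero : ∀ r, 0 ≤ r → Tendsto (fun t => η r t) atTop (𝓝 0)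

namespace Grid

variable {M : ℕ} (G : Grid M)

/-- Dynamics of prosumer `v`: `ζ⁺ = ζ + (e - eRef)` and `q⁺ = α q + β s`. -/
def stepAgent (v : Fin M) (x : PState) (u : PInput) : PState :=
  (x.1 + (u.1 - G.eRef v), G.α v * x.2 + G.β v * u.2)

/-- Collected dynamics `x⁺ = A x + B u + d`. -/
def step (x : Fin M → PState) (u : Fin M → PInput) : Fin M → PState :=
  fun v => G.stepAgent v (x v) (u v)

/-- Load of prosumer `v` on the main grid, `l = e + s - g`. -/
def load (v : Fin M) (u : PInput) : ℝ := u.1 + u.2 - G.g v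

/-- Aggregate load `L` of active prosumers and passive consumers. -/
def aggregateLoad (u : Fin M → PInput) : ℝ := (∑ v, G.load v (u v)) + G.passiveLoad

/-- Stage cost of prosumer `v`: energy cost, energy shift and battery usage. -/
def stageCost (v : Fin M) (x : PState) (u : Fin M → PInput) : ℝ :=
  (G.ρ₁ v * G.aggregateLoad u + G.ρ₂ v) * G.load v (u v)
    + G.γ₁ v * x.1 ^ 2 + G.γ₂ v * x.2 ^ 2

/-- Local state constraint set of prosumer `v`. -/
def agentStates (v : Fin M) : Set PState :=
  {x | G.ζMin v ≤ x.1 ∧ x.1 ≤ G.ζMax v ∧ 0 ≤ x.2 ∧ x.2 ≤ G.qMax v}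

/-- Local input constraint set of prosumer `v`. -/
def agentInputs (v : Fin M) : Set PInput :=
  {u | G.sMin v ≤ G.β v * u.2 ∧ G.β v * u.2 ≤ G.sMax v ∧
    G.eMin v ≤ u.1 ∧ u.1 ≤ G.eMax v ∧
    0 ≤ G.load v u ∧ G.load v u ≤ G.lMax v}

/-- Coupling constraint set of prosumer `v`: the aggregate load limits, given the inputs
`u w`, `w ≠ v`, of the others (the entry `u v` is overwritten). -/
def coupling (v : Fin M) (u : Fin M → PInput) : Set PInput :=
  {uv | G.LMin ≤ G.aggregateLoad (Function.update u v uv) ∧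
    G.aggregateLoad (Function.update u v uv) ≤ G.LMax}

/-- Collected state constraint set. -/
def states : Set (Fin M → PState) := {x | ∀ v, x v ∈ G.agentStates v}

/-- Collected input constraint set. -/
def inputs : Set (Fin M → PInput) := {u | ∀ v, u v ∈ G.agentInputs v ∩ G.coupling v u}

/-! ### The finite-horizon game -/

/-- Decision of one prosumer over the horizon `N`: inputs `u_0, …, u_{N-1}` and
states `x_0, …, x_N`. -/
abbrev Plan (N : ℕ) := (Fin N → PInput) × (Fin (N + 1) → PState)

/-- Global action set of the horizon-`N` game with initial state `x₀`. -/
def actionSet (N : ℕ) (x₀ : Fin M → PState) : Set (Fin M → Plan N) :=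
  {z | ∀ v,
    (∀ k : Fin N, (z v).2 k.succ = G.stepAgent v ((z v).2 k.castSucc) ((z v).1 k)) ∧
    (∀ k : Fin N, (z v).1 k ∈ G.agentInputs v ∩ G.coupling v (fun w => (z w).1 k)) ∧
    (∀ k : Fin (N + 1), (z v).2 k ∈ G.agentStates v) ∧
    (z v).2 0 = x₀ v}

/-- Cost of prosumer `v` over the horizon, `∑_{k < N} ℓ^v (x_k^v, u_k^v, u_k^{-v})`. -/
def horizonCost (N : ℕ) (v : Fin M) (z : Fin M → Plan N) : ℝ :=
  ∑ k : Fin N, G.stageCost v ((z v).2 k.castSucc) (fun w => (z w).1 k)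

/-- The v-GNEs of the horizon-`N` game with initial state `x₀`. -/
def gameSolutions (N : ℕ) (x₀ : Fin M → PState) : Set (Fin M → Plan N) :=
  variationalEquilibria (G.horizonCost N) (G.actionSet N x₀)

/-- The receding-horizon feedback: the first inputs of the v-GNEs of the horizon-`N` game. -/
def feedback (N : ℕ) (x₀ : Fin M → PState) : Set (Fin M → PInput) :=
  {u | ∃ h : 0 < N, ∃ z ∈ G.gameSolutions N x₀, u = fun v => (z v).1 ⟨0, h⟩}

/-! ### The steady-state game -/

/-- Joint strategy set of the steady-state game; the strategy of `v` is `(u^v, x^v)`. -/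
def steadySet : Set (Fin M → PInput × PState) :=
  {z | ∀ v, (z v).2 ∈ G.agentStates v ∧ (z v).2 = G.stepAgent v (z v).2 (z v).1 ∧
    (z v).1 ∈ G.agentInputs v ∩ G.coupling v (fun w => (z w).1)}

/-- Cost of prosumer `v` in the steady-state game. -/
def steadyCost (v : Fin M) (z : Fin M → PInput × PState) : ℝ :=
  G.stageCost v (z v).2 (fun w => (z w).1)

/-- `(x, u)` is a v-GNE of the steady-state game. -/
def IsSteadyVGNE (x : Fin M → PState) (u : Fin M → PInput) : Prop :=
  (fun v => (u v, x v)) ∈ variationalEquilibria G.steadyCost G.steadySet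

/-- The initial states that admissible inputs can drive to `xbar` through admissible states. -/
def region (xbar : Fin M → PState) : Set (Fin M → PState) :=
  {x₀ | ∃ (x : ℕ → Fin M → PState) (u : ℕ → Fin M → PInput),
    x 0 = x₀ ∧ (∀ k, x (k + 1) = G.step (x k) (u k)) ∧
    (∀ k, u k ∈ G.inputs) ∧ (∀ k, x k ∈ G.states) ∧ Tendsto x atTop (𝓝 xbar)}

end Grid

/-! Under symmetric pricing the game has a potential: the own-strategy gradients of the players form
the gradient of a convex quadratic, with price part `r / 2 * (L ^ 2 + ∑ l ^ 2)`. Since the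
constraint sets are convex, the v-GNEs are exactly its minimizers (`mem_variationalEquilibria_iff`).
The potential is strictly convex in states and loads, and the dynamics recover the inputs, which
gives the uniqueness claims. Receding-horizon play is thus economic model predictive control,
without terminal constraint or cost, of a convex linear-quadratic problem. Multipliers of the steady
state rotate the stage cost, by a telescoping sum, into one that is nonnegative and minimal at the
equilibrium, at the price of a linear terminal cost. Deviations from the equilibrium form a leaky
flow network (`Net`): stocks at nodes, flows on edges, interval capacities containing `0`.

No controllability is available, since stocks without leakage may be moved in irreversible ways. The
least stage cost that can be sustained forever from `x`, called `rho x`, is nondecreasing along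
every plan. Near the origin the optimal value is `n * rho x + bias` up to a small error
(`val_le_of_small`, `le_val_of_small`). The lower bound combines convexity of the value with
Hoffman's error bound, which replaces long plans by small one-stage flows. Consequently an optimal
plan of bounded excess passes, at bounded distance from its end, through a stock where one more
stage costs almost nothing (`exists_good_stage`), and inserting that stage shows that the value
decreases along the closed loop up to a small error.

This yields stability provided that `rho` stays small along the loop, and that is the main
difficulty, because small irreversible losses might accumulate over infinitely many steps. Losses
are measured on closed sets of nodes, which no admissible flow enters. The deficit at marginal cost
`h` is the largest shortage of a closed set relative to the contents whose marginal cost is `h`, and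
linear programming duality bounds `rho` by deficits of the network and of its sign reversal
(`exists_rho_le_deficit`). Optimal plans carry prices; flows run towards higher prices, and the drop
of a price over one stage is the marginal cost of the stock. Following the price threshold of slope
`h` backwards in time from the end of the plan shows that the deficit at level `h` does not increase
in the first step, unless some first price lies near that threshold
(`PriceSystem.exists_shortage_le`). Among well separated levels at most as many as there are nodes
are bad, and at a bad level the deficit grows at most by the content lost. Hence the sum of the
deficits over many levels, corrected by a bounded loss term, is nonincreasing along the loop
(`exists_potential_step_le`). Averaging over many levels makes the bounded correction negligible and
keeps `rho` small; this gives `loop_stable`.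

Attraction needs a bound on the value that is uniform over the region, although convergence to the
equilibrium may be arbitrarily slow there. It comes from an explicit plan: wait until the nodes that
cannot be replenished forever are nearly empty, then empty the nodes without leakage slowly while a
sustainable flow replenishes the other one-sided nodes (`exists_val_bound`). With such a bound the
decrease of the value forces a visit near the origin within a uniform time, after which stability
takes over. Uniform stability and attraction for long horizons are finally converted into a
comparison function and an error that vanishes with the horizon (`exists_isClassKL_bound`). -/

/-! ### Hoffman's error bound for linear inequalities. -/

/-- Hoffman's error bound for systems of linear inequalities on `E`: a point that violates the
inequalities of a solvable system by at most `δ` is within `C * δ` of a solution. -/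
def HoffmanBound (E : Type) [NormedAddCommGroup E] [NormedSpace ℝ E] : Prop :=
  ∀ (ι : Type) [Fintype ι] (a : ι → E →ₗ[ℝ] ℝ), ∃ C : ℝ, 0 ≤ C ∧ ∀ (b : ι → ℝ) (x₀ : E) (δ : ℝ),
    0 ≤ δ → (∀ i, a i x₀ ≤ b i + δ) → (∃ x, ∀ i, a i x ≤ b i) →
    ∃ x, (∀ i, a i x ≤ b i) ∧ ‖x - x₀‖ ≤ C * δ

/-- The one-dimensional back-substitution of an elimination: among the solutions, the one nearest to
`t₀` is either `t₀` moved up to the largest lower bound or, through the artificial lower bound `t₀ -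
s`, a point at most `s` below it. -/
theorem exists_between_finite {ι κ : Type} [Fintype ι] [Fintype κ] (L : ι → ℝ) (U : κ → ℝ)
    (t₀ s : ℝ) (hs : 0 ≤ s) (hLU : ∀ i j, L i ≤ U j) (hL : ∀ i, L i ≤ t₀ + s)
    (hU : ∀ j, t₀ - s ≤ U j) :
    ∃ t, (∀ i, L i ≤ t) ∧ (∀ j, t ≤ U j) ∧ |t - t₀| ≤ s := by
  classical
  let f : Option ι → ℝ := fun o => o.elim (t₀ - s) L
  obtain ⟨o, -, ho⟩ := Finset.exists_max_image Finset.univ f ⟨none, Finset.mem_univ _⟩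
  refine ⟨f o, fun i => ho (some i) (Finset.mem_univ _), fun j => ?_, ?_⟩
  · cases o with
    | none => exact hU j
    | some i => exact hLU i j
  · have h1 : t₀ - s ≤ f o := ho none (Finset.mem_univ _)
    have h2 : f o ≤ t₀ + s := by
      cases o with
      | none => simp only [f, Option.elim]; linarith
      | some i => exact hL i
    rw [abs_le]; constructor <;> linarith

/-- Fourier–Motzkin elimination of the real coordinate. The eliminated system lives on `E`, where
the bound is known. Its solution near `x₀.2` is lifted by choosing the real coordinate between the
remaining lower and upper bounds. -/
theorem HoffmanBound.real_prod {E : Type} [NormedAddCommGroup E] [NormedSpace ℝ E]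
    [FiniteDimensional ℝ E] (hE : HoffmanBound E) : HoffmanBound (ℝ × E) := by
  classical
  intro ι _ a
  set c : ι → ℝ := fun i => a i (1, 0) with hc
  set p : ι → E →ₗ[ℝ] ℝ := fun i => a i ∘ₗ LinearMap.inr ℝ ℝ E with hp
  have ha : ∀ i (z : ℝ × E), a i z = c i * z.1 + p i z.2 := by
    intro i z
    have : z = z.1 • ((1 : ℝ), (0 : E)) + (0, z.2) := by ext <;> simp
    conv_lhs => rw [this, map_add, map_smul]
    simp [hc, hp, mul_comm]
  -- Rows without the real variable are kept, and each row with positive coefficient is paired with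
  -- each row with negative coefficient so that the variable cancels. The other indices carry the
  -- trivial row `0 ≤ 0`.
  let A : ι ⊕ (ι × ι) → E →ₗ[ℝ] ℝ := Sum.elim
    (fun i => if c i = 0 then p i else 0)
    (fun q => if 0 < c q.1 ∧ c q.2 < 0 then (-c q.2) • p q.1 + c q.1 • p q.2 else 0)
  obtain ⟨C, hC0, hC⟩ := hE _ A
  obtain ⟨Γ, hΓ⟩ : ∃ Γ : ℝ, ∀ i, |c i| ≤ Γ := by
    obtain ⟨Γ, hΓ⟩ := (Set.finite_range fun i => |c i|).bddAbove
    exact ⟨Γ, fun i => hΓ ⟨i, rfl⟩⟩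
  obtain ⟨K, hK0, hK⟩ : ∃ K : ℝ, 0 ≤ K ∧ ∀ i y, |p i y| ≤ K * ‖y‖ := by
    obtain ⟨K, hK⟩ := (Set.finite_range fun i => ‖(p i).toContinuousLinearMap‖).bddAbove
    refine ⟨max K 0, le_max_right _ _, fun i y => ?_⟩
    have := (p i).toContinuousLinearMap.le_opNorm y
    simp only [LinearMap.coe_toContinuousLinearMap', Real.norm_eq_abs] at this
    exact this.trans (mul_le_mul_of_nonneg_right ((hK ⟨i, rfl⟩).trans (le_max_left _ _))
      (norm_nonneg _))
  obtain ⟨k, hk0, hk⟩ : ∃ k : ℝ, 0 ≤ k ∧ ∀ i, c i ≠ 0 → 1 ≤ k * |c i| := by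
    obtain ⟨k, hk⟩ := (Set.finite_range fun i => |c i|⁻¹).bddAbove
    refine ⟨max k 0, le_max_right _ _, fun i hi => ?_⟩
    have h1 : |c i|⁻¹ ≤ max k 0 := (hk ⟨i, rfl⟩).trans (le_max_left _ _)
    have h2 : 0 < |c i| := abs_pos.2 hi
    calc (1 : ℝ) = |c i|⁻¹ * |c i| := by field_simp
      _ ≤ _ := mul_le_mul_of_nonneg_right h1 h2.le
  set G : ℝ := 2 * max Γ 0 + 1 with hG
  have hG1 : 1 ≤ G := by have := le_max_right Γ 0; linarith
  -- After the move in `E` by at most `C * G * δ`, each row is violated by at most `(1 + K * C * G)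
  -- * δ`; dividing by `|c i| ≥ 1 / k` gives the admissible move of the real coordinate.
  set S : ℝ := k * (1 + K * (C * G)) with hS
  have hS0 : 0 ≤ S := by positivity
  refine ⟨max S (C * G), le_max_of_le_left hS0, fun b x₀ δ hδ hx₀ ⟨x, hx⟩ => ?_⟩
  let b' : ι ⊕ (ι × ι) → ℝ := Sum.elim
    (fun i => if c i = 0 then b i else 0)
    (fun q => if 0 < c q.1 ∧ c q.2 < 0 then (-c q.2) * b q.1 + c q.1 * b q.2 else 0)
  have key : ∀ (z : ℝ × E) (η : ℝ), 0 ≤ η → (∀ i, a i z ≤ b i + η) →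
      ∀ q, A q z.2 ≤ b' q + G * η := by
    intro z η hη hz q
    rcases q with i | ⟨i, j⟩
    · simp only [A, b', Sum.elim_inl]
      split_ifs with h
      · have := hz i
        rw [ha, h] at this
        nlinarith
      · simp; positivity
    · simp only [A, b', Sum.elim_inr]
      split_ifs with h
      · have h1 := hz i
        have h2 := hz j
        rw [ha] at h1 h2
        simp only [LinearMap.add_apply, LinearMap.smul_apply, smul_eq_mul]
        have h3 : c i ≤ max Γ 0 := (le_abs_self _).trans ((hΓ i).trans (le_max_left _ _))
        have h4 : -c j ≤ max Γ 0 := (neg_le_abs _).trans ((hΓ j).trans (le_max_left _ _))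
        have h5 := mul_le_mul_of_nonneg_left h1 (neg_nonneg.2 h.2.le)
        have h6 := mul_le_mul_of_nonneg_left h2 h.1.le
        have h7 : (-c j + c i) * η ≤ G * η := mul_le_mul_of_nonneg_right (by linarith) hη
        nlinarith
      · simp; positivity
  obtain ⟨y, hy, hyd⟩ := hC b' x₀.2 (G * δ) (by positivity) (key x₀ δ hδ hx₀)
    ⟨x.2, fun q => by simpa using key x 0 le_rfl (by simpa using hx) q⟩
  have hpy : ∀ i, p i y - p i x₀.2 ≤ K * (C * G) * δ ∧ p i x₀.2 - p i y ≤ K * (C * G) * δ := by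
    intro i
    have h1 := hK i (y - x₀.2)
    rw [map_sub] at h1
    have h2 : K * ‖y - x₀.2‖ ≤ K * (C * (G * δ)) := mul_le_mul_of_nonneg_left hyd hK0
    have h3 := abs_le.1 (h1.trans h2)
    constructor <;> nlinarith
  have hex := exists_between_finite
    (fun j : {j // c j < 0} => (b j - p j y) / c j) (fun i : {i // 0 < c i} => (b i - p i y) / c i)
    x₀.1 (S * δ) (by positivity) ?_ ?_ ?_
  · obtain ⟨t, htL, htU, htd⟩ := hex
    refine ⟨(t, y), fun i => ?_, ?_⟩
    · rw [ha]
      rcases lt_trichotomy (c i) 0 with h | h | h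
      · have := htL ⟨i, h⟩
        simp only [div_le_iff_of_neg h] at this
        simp only; linarith
      · have := hy (Sum.inl i)
        simp only [A, b', Sum.elim_inl, if_pos h] at this
        simp only [h]; linarith
      · have := htU ⟨i, h⟩
        simp only [le_div_iff₀ h] at this
        simp only; linarith
    · rw [Prod.norm_def]
      refine max_le ?_ ?_
      · exact (by simpa using htd : ‖((t, y) - x₀).1‖ ≤ S * δ).trans
          (mul_le_mul_of_nonneg_right (le_max_left _ _) hδ)
      · calc ‖((t, y) - x₀).2‖ ≤ C * (G * δ) := by simpa using hyd
          _ = C * G * δ := by ring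
          _ ≤ _ := mul_le_mul_of_nonneg_right (le_max_right _ _) hδ
  · rintro ⟨j, hj⟩ ⟨i, hi⟩
    have := hy (Sum.inr (i, j))
    simp only [A, b', Sum.elim_inr, if_pos (And.intro hi hj), LinearMap.add_apply,
      LinearMap.smul_apply, smul_eq_mul] at this
    rw [div_le_iff_of_neg hj, div_mul_eq_mul_div, div_le_iff₀ hi]
    nlinarith
  · rintro ⟨j, hj⟩
    rw [div_le_iff_of_neg hj]
    have h1 := hx₀ j
    rw [ha] at h1
    have h2 := (hpy j).1
    have h3 := hk j hj.ne
    rw [abs_of_neg hj] at h3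
    have h4 : (1 + K * (C * G)) * δ ≤ (k * -c j) * ((1 + K * (C * G)) * δ) :=
      le_mul_of_one_le_left (by positivity) h3
    have h5 : (k * -c j) * ((1 + K * (C * G)) * δ) = -(S * δ * c j) := by rw [hS]; ring
    nlinarith
  · rintro ⟨i, hi⟩
    rw [le_div_iff₀ hi]
    have h1 := hx₀ i
    rw [ha] at h1
    have h2 := (hpy i).1
    have h3 := hk i hi.ne'
    rw [abs_of_pos hi] at h3
    have h4 : (1 + K * (C * G)) * δ ≤ (k * c i) * ((1 + K * (C * G)) * δ) :=
      le_mul_of_one_le_left (by positivity) h3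
    have h5 : (k * c i) * ((1 + K * (C * G)) * δ) = S * δ * c i := by rw [hS]; ring
    nlinarith

theorem HoffmanBound.of_equiv {E E' : Type} [NormedAddCommGroup E] [NormedSpace ℝ E]
    [NormedAddCommGroup E'] [NormedSpace ℝ E'] (hE : HoffmanBound E) (e : E' ≃L[ℝ] E) :
    HoffmanBound E' := by
  intro ι _ a
  obtain ⟨C, hC0, hC⟩ := hE ι fun i => a i ∘ₗ (e.symm : E →ₗ[ℝ] E')
  refine ⟨‖(e.symm : E →L[ℝ] E')‖ * C, by positivity, fun b x₀ δ hδ hx₀ ⟨x, hx⟩ => ?_⟩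
  obtain ⟨y, hy, hyd⟩ := hC b (e x₀) δ hδ (by simpa using hx₀) ⟨e x, by simpa using hx⟩
  refine ⟨e.symm y, by simpa using hy, ?_⟩
  have h : e.symm y - x₀ = e.symm (y - e x₀) := by simp
  rw [h, mul_assoc]
  exact ((e.symm : E →L[ℝ] E').le_opNorm _).trans
    (mul_le_mul_of_nonneg_left hyd (norm_nonneg _))

theorem hoffmanBound_fin : ∀ n : ℕ, HoffmanBound (Fin n → ℝ)
  | 0 => fun ι _ a => ⟨0, le_rfl, fun b x₀ δ _ _ ⟨x, hx⟩ =>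
      ⟨x, hx, by rw [Subsingleton.elim x x₀]; simp⟩⟩
  | n + 1 => (hoffmanBound_fin n).real_prod.of_equiv
      (LinearEquiv.ofFinrankEq (Fin (n + 1) → ℝ) (ℝ × (Fin n → ℝ))
        (by simp [add_comm])).toContinuousLinearEquiv

theorem hoffmanBound (E : Type) [NormedAddCommGroup E] [NormedSpace ℝ E]
    [FiniteDimensional ℝ E] : HoffmanBound E :=
  (hoffmanBound_fin (Module.finrank ℝ E)).of_equiv
    (LinearEquiv.ofFinrankEq E (Fin (Module.finrank ℝ E) → ℝ) (by simp)).toContinuousLinearEquiv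

/-- Hoffman's bound for a system of linear inequalities and equations. -/
theorem hoffman {E : Type} [NormedAddCommGroup E] [NormedSpace ℝ E] [FiniteDimensional ℝ E]
    {ι κ : Type} [Fintype ι] [Fintype κ] (a : ι → E →ₗ[ℝ] ℝ) (q : κ → E →ₗ[ℝ] ℝ) :
    ∃ C : ℝ, 0 ≤ C ∧ ∀ (b : ι → ℝ) (r : κ → ℝ) (x₀ : E) (δ : ℝ), 0 ≤ δ →
      (∀ i, a i x₀ ≤ b i + δ) → (∀ k, |q k x₀ - r k| ≤ δ) →
      (∃ x, (∀ i, a i x ≤ b i) ∧ ∀ k, q k x = r k) →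
      ∃ x, (∀ i, a i x ≤ b i) ∧ (∀ k, q k x = r k) ∧ ‖x - x₀‖ ≤ C * δ := by
  obtain ⟨C, hC0, hC⟩ := hoffmanBound E (ι ⊕ (κ ⊕ κ)) (Sum.elim a (Sum.elim q fun k => -q k))
  refine ⟨C, hC0, fun b r x₀ δ hδ h1 h2 ⟨x, hx1, hx2⟩ => ?_⟩
  have hex := hC (Sum.elim b (Sum.elim r fun k => -r k)) x₀ δ hδ ?_ ⟨x, ?_⟩
  · obtain ⟨y, hy, hyd⟩ := hex
    refine ⟨y, fun i => hy (Sum.inl i), fun k => le_antisymm (hy (Sum.inr (Sum.inl k))) ?_, hyd⟩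
    have := hy (Sum.inr (Sum.inr k))
    simp at this
    linarith
  · rintro (i | k | k)
    · exact h1 i
    · have := (abs_le.1 (h2 k)).2
      simp; linarith
    · have := (abs_le.1 (h2 k)).1
      simp; linarith
  · rintro (i | k | k)
    · exact hx1 i
    · simp [hx2]
    · simp [hx2]

/-! ### Multipliers from exact penalties. -/

/-- Fenchel duality without attainment: a convex function composed with an affine map is
separated from a continuous convex penalty by a linear functional. -/
theorem exists_multiplier {E H : Type} [AddCommGroup E] [Module ℝ E] [NormedAddCommGroup H]
    [NormedSpace ℝ H] {s : Set E} (hs : s.Nonempty) {φ : E → ℝ} (hφ : ConvexOn ℝ s φ)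
    (A : E →ₗ[ℝ] H) (r : H) {W : H → ℝ} (hW : ConvexOn ℝ Set.univ W) (hWc : Continuous W) (m : ℝ)
    (hm : ∀ x ∈ s, m ≤ φ x + W (A x - r)) :
    ∃ l : H →L[ℝ] ℝ, ∀ x ∈ s, ∀ h, m ≤ φ x + W h + l (A x - r - h) := by
  -- The strict epigraph of the penalized value as a function of a shift `h` of the constraint.
  -- Continuity of `W` makes it open, so that it can be separated from `(0, m)` without a constraint
  -- qualification.
  let O : Set (H × ℝ) := {z | ∃ x ∈ s, φ x + W (A x - r - z.1) < z.2}
  have hO : IsOpen O := by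
    have : O = ⋃ x ∈ s, {z : H × ℝ | φ x + W (A x - r - z.1) < z.2} := by
      ext z; simp [O]
    rw [this]
    exact isOpen_biUnion fun x _ => isOpen_lt (by fun_prop) continuous_snd
  have hOc : Convex ℝ O := by
    rintro ⟨h1, t1⟩ ⟨x1, hx1, hlt1⟩ ⟨h2, t2⟩ ⟨x2, hx2, hlt2⟩ p q hp hq hpq
    refine ⟨p • x1 + q • x2, hφ.1 hx1 hx2 hp hq hpq, ?_⟩
    have e1 := hφ.2 hx1 hx2 hp hq hpq
    have e2 := hW.2 (Set.mem_univ (A x1 - r - h1)) (Set.mem_univ (A x2 - r - h2)) hp hq hpq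
    have e3 : A (p • x1 + q • x2) - r - (p • h1 + q • h2) =
        p • (A x1 - r - h1) + q • (A x2 - r - h2) := by
      have : r = p • r + q • r := by rw [← add_smul, hpq, one_smul]
      rw [map_add, map_smul, map_smul]
      nth_rewrite 1 [this]
      simp only [smul_sub]
      abel
    simp only [Prod.smul_mk, Prod.mk_add_mk, smul_eq_mul] at *
    rw [e3]
    rcases hp.eq_or_lt with rfl | hp'
    · have : q = 1 := by linarith
      subst this
      linarith
    · nlinarith [mul_lt_mul_of_pos_left hlt1 hp', mul_le_mul_of_nonneg_left hlt2.le hq]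
  have h0 : ((0 : H), m) ∉ O := by
    rintro ⟨x, hx, hlt⟩
    simp only [sub_zero] at hlt
    exact absurd (hm x hx) (not_le.2 hlt)
  obtain ⟨f, hf⟩ := geometric_hahn_banach_point_open hOc hO h0
  have hfs : ∀ (h : H) (t : ℝ), f (h, t) = f (h, 0) + t * f (0, 1) := by
    intro h t
    have : ((h, t) : H × ℝ) = (h, 0) + t • ((0 : H), (1 : ℝ)) := by ext <;> simp
    rw [this, map_add, map_smul, smul_eq_mul]
  obtain ⟨x0, hx0⟩ := hs
  -- The separating functional is not horizontal: `O` contains points vertically above `(0, m)`.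
  have hpos : 0 < f (0, 1) := by
    have h1 := hf (0, max (φ x0 + W (A x0 - r - 0)) m + 1)
      ⟨x0, hx0, by have := le_max_left (φ x0 + W (A x0 - r - 0)) m; simp only; linarith⟩
    rw [hfs 0 m, hfs 0 (max _ m + 1)] at h1
    have h2 := le_max_right (φ x0 + W (A x0 - r - 0)) m
    by_contra hneg
    nlinarith
  refine ⟨(f (0, 1))⁻¹ • (f ∘L ContinuousLinearMap.inl ℝ H ℝ), fun x hx h => ?_⟩
  refine le_of_forall_pos_lt_add fun ε hε => ?_
  have h1 := hf (A x - r - h, φ x + W h + ε) ⟨x, hx, by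
    simp only [sub_sub_cancel]; linarith⟩
  rw [hfs 0 m, hfs (A x - r - h)] at h1
  have h2 : f ((0 : H), (0 : ℝ)) = 0 := by
    rw [show ((0 : H), (0 : ℝ)) = 0 from rfl, map_zero]
  rw [h2, zero_add] at h1
  simp only [_root_.smul_apply, ContinuousLinearMap.comp_apply,
    ContinuousLinearMap.inl_apply, smul_eq_mul]
  have h3 : m < (f (0, 1))⁻¹ * (f (A x - r - h, 0) + (φ x + W h + ε) * f (0, 1)) := by
    rw [lt_inv_mul_iff₀ hpos]; linarith
  have h4 : (f (0, 1))⁻¹ * (f (A x - r - h, 0) + (φ x + W h + ε) * f (0, 1)) =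
      (f (0, 1))⁻¹ * f (A x - r - h, 0) + (φ x + W h + ε) := by field_simp
  linarith

/-! ### From uniform stability and attraction to a class `KL` bound. -/

/-- At the accuracies `ε j = D' * 2⁻ʲ` there are `δ j` and `T j` such that `r t ≤ ε j` as soon as `r
0 ≤ δ j` or `T j ≤ t`, for long horizons. The term `u j` of `η` equals `ε j` while neither condition
for `j + 1` holds. Hence a sequence exceeding the bound would have to pass from accuracy `j` to `j +
1` for every `j` up to `J N`, and would end below `γ N = ε (J N)` after all. -/
theorem exists_isClassKL_bound (D : ℝ) (fam : ℕ → Set (ℕ → ℝ))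
    (h0 : ∀ N, ∀ r ∈ fam N, ∀ t, 0 ≤ r t) (hD : ∀ N, ∀ r ∈ fam N, ∀ t, r t ≤ D)
    (hstable : ∀ ε > 0, ∃ δ > 0, ∃ N₀, ∀ N ≥ N₀, ∀ r ∈ fam N, r 0 ≤ δ → ∀ t, r t ≤ ε)
    (hattr : ∀ ε > 0, ∃ T : ℕ, ∃ N₀, ∀ N ≥ N₀, ∀ r ∈ fam N, ∀ t ≥ T, r t ≤ ε) :
    ∃ (η : ℝ → ℝ → ℝ) (γ : ℕ → ℝ), IsClassKL η ∧ (∀ N, 0 ≤ γ N) ∧ Tendsto γ atTop (𝓝 0) ∧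
      ∀ N, ∀ r ∈ fam N, ∀ t : ℕ, r t ≤ η (r 0) t + γ N := by
  classical
  set D' : ℝ := max D 1 with hD'
  have hD'1 : 1 ≤ D' := le_max_right _ _
  set ε : ℕ → ℝ := fun j => D' * (1 / 2) ^ j with hε
  have hεpos : ∀ j, 0 < ε j := fun j => by simp only [hε]; positivity
  have hεsum : Summable ε := (summable_geometric_two).mul_left D'
  have hex : ∀ j, ∃ (δ : ℝ) (T n : ℕ), 0 < δ ∧ ∀ N ≥ n, ∀ r ∈ fam N, ∀ t,
      (r 0 ≤ δ ∨ T ≤ t) → r t ≤ ε j := by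
    intro j
    obtain ⟨δ, hδ, n1, h1⟩ := hstable (ε j) (hεpos j)
    obtain ⟨T, n2, h2⟩ := hattr (ε j) (hεpos j)
    refine ⟨δ, T, max n1 n2, hδ, fun N hN r hr t ht => ?_⟩
    rcases ht with ht | ht
    · exact h1 N (le_of_max_le_left hN) r hr ht t
    · exact h2 N (le_of_max_le_right hN) r hr t ht
  choose δ T n hδ hn using hex
  -- `J N` is the finest accuracy whose estimate, with all coarser ones, is available at horizon
  -- `N`. Accuracy `0` needs no horizon, because `D` bounds everything.
  let good : ℕ → ℕ → Prop := fun N j => ∀ i, 1 ≤ i → i ≤ j → n i ≤ N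
  let J : ℕ → ℕ := fun N => Nat.findGreatest (good N) N
  have hJ : ∀ N, good N (J N) := fun N =>
    Nat.findGreatest_spec (P := good N) (Nat.zero_le N) (fun i h1 h2 => by omega)
  let u : ℕ → ℝ → ℝ → ℝ := fun j r t =>
    ε j * min 1 (r / δ (j + 1)) * min 1 (Real.exp (T (j + 1) - t))
  have hu0 : ∀ j r t, 0 ≤ r → 0 ≤ u j r t := fun j r t hr => by
    have := hεpos j
    have := hδ (j + 1)
    simp only [u]
    have h1 : 0 ≤ min 1 (r / δ (j + 1)) := le_min zero_le_one (by positivity)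
    positivity
  have huε : ∀ j r t, 0 ≤ r → u j r t ≤ ε j := fun j r t hr => by
    have h1 : 0 ≤ min 1 (r / δ (j + 1)) := le_min zero_le_one (div_nonneg hr (hδ _).le)
    have h2 : min 1 (r / δ (j + 1)) ≤ 1 := min_le_left _ _
    have h3 : min 1 (Real.exp (T (j + 1) - t)) ≤ 1 := min_le_left _ _
    have h4 : 0 ≤ min 1 (Real.exp (T (j + 1) - t)) := by positivity
    calc u j r t ≤ ε j * 1 * 1 := by
          simp only [u]
          have := (hεpos j).le
          gcongr
      _ = ε j := by ring
  have husum : ∀ r t, 0 ≤ r → Summable fun j => u j r t := fun r t hr =>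
    Summable.of_nonneg_of_le (fun j => hu0 j r t hr) (fun j => huε j r t hr) hεsum
  have hmono : ∀ j t r r', 0 ≤ r → r ≤ r' → u j r t ≤ u j r' t := fun j t r r' hr hrr => by
    have := (hεpos j).le
    have := hδ (j + 1)
    simp only [u]
    gcongr
  have hanti : ∀ j r t t', 0 ≤ r → t ≤ t' → u j r t' ≤ u j r t := fun j r t t' hr htt => by
    have := (hεpos j).le
    have := hδ (j + 1)
    have h1 : 0 ≤ min 1 (r / δ (j + 1)) := le_min zero_le_one (by positivity)
    simp only [u]
    gcongr
  -- The summand `r * exp (-t)` makes `η` strictly increasing in `r`; the series alone saturates.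
  refine ⟨fun r t => (∑' j, u j r t) + r * Real.exp (-t), fun N => ε (J N), ?_, fun N => (hεpos _).le,
    ?_, ?_⟩
  · refine ⟨?_, ?_, ?_, ?_, ?_⟩
    · refine ContinuousOn.add ?_ (by fun_prop)
      refine continuousOn_tsum (u := ε) (fun j => ?_) hεsum ?_
      · refine Continuous.continuousOn ?_
        simp only [u]
        fun_prop
      · rintro j ⟨r, t⟩ ⟨hr, -⟩
        have hr' : 0 ≤ r := hr
        simp only [Real.norm_eq_abs]
        rw [abs_of_nonneg (hu0 j r t hr')]
        exact huε j r t hr'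
    · intro t _
      simp [u]
    · intro t _ r hr r' hr' hrr
      have hr0 : (0 : ℝ) ≤ r := hr
      have h1 : (∑' j, u j r t) ≤ ∑' j, u j r' t :=
        (husum r t hr0).tsum_le_tsum (fun j => hmono j t r r' hr0 hrr.le) (husum r' t hr')
      have h2 := mul_lt_mul_of_pos_right hrr (Real.exp_pos (-t))
      simp only
      linarith
    · intro r hr t _ t' _ htt
      have hr0 : (0 : ℝ) ≤ r := hr
      have h1 : (∑' j, u j r t') ≤ ∑' j, u j r t :=
        (husum r t' hr0).tsum_le_tsum (fun j => hanti j r t t' hr0 htt) (husum r t hr0)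
      have h2 : r * Real.exp (-t') ≤ r * Real.exp (-t) := by gcongr
      simp only
      linarith
    · intro r hr
      have hexp : ∀ a : ℝ, Tendsto (fun t : ℝ => Real.exp (a - t)) atTop (𝓝 0) := fun a =>
        Real.tendsto_exp_atBot.comp (tendsto_const_nhds.add_atBot tendsto_neg_atTop_atBot |>.congr
          fun t => (sub_eq_add_neg _ _).symm)
      have h1 : Tendsto (fun t => ∑' j, u j r t) atTop (𝓝 (∑' _ : ℕ, (0 : ℝ))) := by
        refine tendsto_tsum_of_dominated_convergence (bound := ε) hεsum (fun j => ?_)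
          (Eventually.of_forall fun t j => ?_)
        · have : Tendsto (fun t : ℝ => ε j * min 1 (r / δ (j + 1)) * min 1 (Real.exp (T (j + 1) - t)))
              atTop (𝓝 (ε j * min 1 (r / δ (j + 1)) * min 1 0)) :=
            (tendsto_const_nhds.min (hexp _)).const_mul _
          simpa using this
        · rw [Real.norm_eq_abs, abs_of_nonneg (hu0 j r t hr)]
          exact huε j r t hr
      have h2 : Tendsto (fun t : ℝ => r * Real.exp (-t)) atTop (𝓝 (r * 0)) := by
        have := hexp 0
        simp only [zero_sub] at this
        exact this.const_mul r
      simpa using h1.add h2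
  · have hJt : Tendsto J atTop atTop := by
      refine tendsto_atTop.2 fun m => ?_
      have : ∀ᶠ N in atTop, m ≤ N ∧ ∀ i ∈ Finset.range (m + 1), n i ≤ N :=
        (eventually_ge_atTop m).and
          ((Finset.eventually_all _).2 fun i _ => eventually_ge_atTop (n i))
      filter_upwards [this] with N hN
      exact Nat.le_findGreatest hN.1 fun i _ hi => hN.2 i (Finset.mem_range.2 (by omega))
    exact hεsum.tendsto_atTop_zero.comp hJt
  · intro N r hr t
    have hr0 := h0 N r hr 0
    by_contra! hlt
    have hS0 : 0 ≤ ∑' j, u j (r 0) t := tsum_nonneg fun j => hu0 j _ _ hr0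
    have hE0 : 0 ≤ r 0 * Real.exp (-(t : ℝ)) := by positivity
    have claim : ∀ j ≤ J N, r t ≤ ε j := by
      intro j
      induction j with
      | zero =>
        intro _
        simp only [hε, pow_zero, mul_one]
        exact (hD N r hr t).trans (le_max_left _ _)
      | succ j ih =>
        intro hj
        have h1 := ih (by omega)
        refine hn (j + 1) N (hJ N (j + 1) (by omega) hj) r hr t ?_
        by_contra! hc
        have h2 : u j (r 0) t = ε j := by
          have e1 : 1 ≤ r 0 / δ (j + 1) := by
            rw [le_div_iff₀ (hδ _)]; linarith [hc.1]
          have e2 : 1 ≤ Real.exp (T (j + 1) - t) := by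
            rw [Real.one_le_exp_iff]
            have : (t : ℝ) ≤ T (j + 1) := by exact_mod_cast hc.2.le
            linarith
          simp only [u]
          rw [min_eq_left e1, min_eq_left e2]; ring
        have h3 : u j (r 0) t ≤ ∑' j, u j (r 0) t :=
          (husum (r 0) t hr0).le_tsum j fun i _ => hu0 i _ _ hr0
        have := hεpos (J N)
        linarith
    have := claim (J N) le_rfl
    linarith

/-! ### Leaky flow networks: plans, costs and dynamic programming. -/

/-- A leaky flow network with capacities.  Node `n` holds the stock `x n`, which evolves by
`x⁺ n = α n * x n + β n * (net inflow at n)` inside `[lo n, hi n]`; edge `e` carries a flow in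
`[fl e, fu e]`.  All stage costs are quadratic and minimal at the origin. -/
structure Net (V E : Type) [Fintype V] [Fintype E] [DecidableEq V] where
  tail : E → V
  head : E → V
  α : V → ℝ
  β : V → ℝ
  lo : V → ℝ
  hi : V → ℝ
  γ : V → ℝ
  c : V → ℝ
  τ : V → ℝ
  fl : E → ℝ
  fu : E → ℝ
  ρ : E → ℝ
  d : E → ℝ
  α_nonneg : ∀ n, 0 ≤ α n
  α_le_one : ∀ n, α n ≤ 1
  β_nonneg : ∀ n, 0 ≤ β n
  lo_nonpos : ∀ n, lo n ≤ 0
  hi_nonneg : ∀ n, 0 ≤ hi n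
  fl_nonpos : ∀ e, fl e ≤ 0
  fu_nonneg : ∀ e, 0 ≤ fu e
  γ_nonneg : ∀ n, 0 ≤ γ n
  ρ_nonneg : ∀ e, 0 ≤ ρ e
  -- The linear costs are nonnegative at both capacities, hence on the whole interval, so that the
  -- origin minimizes the stage cost.
  c_lo : ∀ n, 0 ≤ c n * lo n
  c_hi : ∀ n, 0 ≤ c n * hi n
  d_fl : ∀ e, 0 ≤ d e * fl e
  d_fu : ∀ e, 0 ≤ d e * fu e
  γ_pos : ∀ n, 0 < γ n ∨ (lo n = 0 ∧ hi n = 0)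
  β_pos : ∀ n, α n = 1 → 0 < β n ∨ (lo n = 0 ∧ hi n = 0)
  -- No nonzero flow is both free of quadratic cost and without effect on the stocks; this makes
  -- cheap flows between small stocks small.
  inj : ∀ f : E → ℝ, (∀ e, 0 < ρ e → f e = 0) →
    (∀ n, β n * ∑ e, f e * ((if head e = n then 1 else 0) - if tail e = n then 1 else 0) = 0) →
    f = 0

namespace Net

/-- `f` for `k` steps, then `g`. -/
def concat {E : Type} (k : ℕ) (f g : ℕ → E → ℝ) : ℕ → E → ℝ :=
  fun j => if j < k then f j else g (j - k)

variable {V E : Type} [Fintype V] [Fintype E] [DecidableEq V] (G : Net V E)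

/-- Net inflow at the nodes. -/
def inflow : (E → ℝ) →ₗ[ℝ] (V → ℝ) where
  toFun f n := ∑ e, f e * ((if G.head e = n then 1 else 0) - if G.tail e = n then 1 else 0)
  map_add' f g := by ext n; simp [add_mul, Finset.sum_add_distrib]
  map_smul' r f := by ext n; simp [Finset.mul_sum, mul_assoc]

theorem inflow_apply (f : E → ℝ) (n : V) : G.inflow f n =
    ∑ e, f e * ((if G.head e = n then 1 else 0) - if G.tail e = n then 1 else 0) := rfl

theorem sum_mul_inflow (χ : V → ℝ) (f : E → ℝ) :
    ∑ n, χ n * G.inflow f n = ∑ e, f e * (χ (G.head e) - χ (G.tail e)) := by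
  simp only [inflow_apply, Finset.mul_sum]
  rw [Finset.sum_comm]
  refine Finset.sum_congr rfl fun e _ => ?_
  have : ∀ n, χ n * (f e * ((if G.head e = n then 1 else 0) - if G.tail e = n then 1 else 0)) =
      f e * ((if G.head e = n then χ n else 0) - if G.tail e = n then χ n else 0) := by
    intro n; split_ifs <;> ring
  simp only [this, ← Finset.mul_sum, Finset.sum_sub_distrib, Finset.sum_ite_eq, Finset.mem_univ,
    if_true]

/-- Admissible stocks. -/
def box : Set (V → ℝ) := Set.Icc G.lo G.hi

/-- Admissible flows. -/
def flows : Set (E → ℝ) := Set.Icc G.fl G.fu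

def step (x : V → ℝ) (f : E → ℝ) : V → ℝ := fun n => G.α n * x n + G.β n * G.inflow f n

def traj (x : V → ℝ) (f : ℕ → E → ℝ) : ℕ → V → ℝ
  | 0 => x
  | k + 1 => G.step (traj x f k) (f k)

def nodeCost (n : V) (t : ℝ) : ℝ := G.γ n * t ^ 2 + G.c n * t

def edgeCost (e : E) (t : ℝ) : ℝ := G.ρ e * t ^ 2 + G.d e * t

def stage (x : V → ℝ) (f : E → ℝ) : ℝ := ∑ n, G.nodeCost n (x n) + ∑ e, G.edgeCost e (f e)

/-- Flows are admissible at all times and not only before `N`, which makes the set of plans compact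
in the product topology. -/
def IsPlan (N : ℕ) (x : V → ℝ) (f : ℕ → E → ℝ) : Prop :=
  (∀ k, f k ∈ G.flows) ∧ ∀ k ≤ N, G.traj x f k ∈ G.box

def terminal (x : V → ℝ) : ℝ := ∑ n, G.τ n * x n

def cost (N : ℕ) (x : V → ℝ) (f : ℕ → E → ℝ) : ℝ :=
  ∑ k ∈ Finset.range N, G.stage (G.traj x f k) (f k) + G.terminal (G.traj x f N)

/-- Optimal value of the horizon-`N` problem. -/
noncomputable def val (N : ℕ) (x : V → ℝ) : ℝ := sInf (G.cost N x '' {f | G.IsPlan N x f})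

def IsOpt (N : ℕ) (x : V → ℝ) (f : ℕ → E → ℝ) : Prop := G.IsPlan N x f ∧ G.cost N x f = G.val N x

variable {G}

theorem zero_mem_box : (0 : V → ℝ) ∈ G.box := ⟨G.lo_nonpos, G.hi_nonneg⟩

theorem zero_mem_flows : (0 : E → ℝ) ∈ G.flows := ⟨G.fl_nonpos, G.fu_nonneg⟩

theorem linear_nonneg_of_mem_Icc {a b c t : ℝ} (ha : 0 ≤ c * a) (hb : 0 ≤ c * b)
    (ht : a ≤ t ∧ t ≤ b) : 0 ≤ c * t := by
  rcases le_total 0 c with h | h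
  · exact ha.trans (mul_le_mul_of_nonneg_left ht.1 h)
  · exact hb.trans (mul_le_mul_of_nonpos_left ht.2 h)

theorem nodeCost_ge {x : V → ℝ} (hx : x ∈ G.box) (n : V) :
    G.γ n * x n ^ 2 ≤ G.nodeCost n (x n) := by
  have := linear_nonneg_of_mem_Icc (G.c_lo n) (G.c_hi n) ⟨hx.1 n, hx.2 n⟩
  simp only [nodeCost]; linarith

theorem edgeCost_ge {f : E → ℝ} (hf : f ∈ G.flows) (e : E) :
    G.ρ e * f e ^ 2 ≤ G.edgeCost e (f e) := by
  have := linear_nonneg_of_mem_Icc (G.d_fl e) (G.d_fu e) ⟨hf.1 e, hf.2 e⟩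
  simp only [edgeCost]; linarith

theorem nodeCost_nonneg {x : V → ℝ} (hx : x ∈ G.box) (n : V) : 0 ≤ G.nodeCost n (x n) :=
  (mul_nonneg (G.γ_nonneg n) (sq_nonneg _)).trans (nodeCost_ge hx n)

theorem edgeCost_nonneg {f : E → ℝ} (hf : f ∈ G.flows) (e : E) : 0 ≤ G.edgeCost e (f e) :=
  (mul_nonneg (G.ρ_nonneg e) (sq_nonneg _)).trans (edgeCost_ge hf e)

theorem stage_nonneg {x : V → ℝ} {f : E → ℝ} (hx : x ∈ G.box) (hf : f ∈ G.flows) :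
    0 ≤ G.stage x f :=
  add_nonneg (Finset.sum_nonneg fun n _ => nodeCost_nonneg hx n)
    (Finset.sum_nonneg fun e _ => edgeCost_nonneg hf e)

theorem step_zero_zero : G.step 0 0 = 0 := by ext n; simp [step]

theorem step_add_smul (p q : ℝ) (x y : V → ℝ) (f g : E → ℝ) :
    G.step (p • x + q • y) (p • f + q • g) = p • G.step x f + q • G.step y g := by
  ext n; simp [step]; ring

theorem traj_add_smul (p q : ℝ) (x y : V → ℝ) (f g : ℕ → E → ℝ) (k : ℕ) :
    G.traj (p • x + q • y) (p • f + q • g) k = p • G.traj x f k + q • G.traj y g k := by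
  induction k with
  | zero => rfl
  | succ k ih =>
    simp only [traj]
    rw [ih, ← step_add_smul]; rfl

theorem traj_add (x : V → ℝ) (f : ℕ → E → ℝ) (k j : ℕ) :
    G.traj x f (k + j) = G.traj (G.traj x f k) (fun i => f (k + i)) j := by
  induction j with
  | zero => rfl
  | succ j ih =>
    rw [← add_assoc]
    simp only [traj]
    rw [ih]

theorem traj_congr {x : V → ℝ} {f g : ℕ → E → ℝ} {k : ℕ} (h : ∀ j < k, f j = g j) :
    G.traj x f k = G.traj x g k := by
  induction k with
  | zero => rfl
  | succ k ih =>
    simp only [traj]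
    rw [ih fun j hj => h j (by omega), h k (by omega)]

theorem continuous_inflow : Continuous G.inflow := G.inflow.continuous_of_finiteDimensional

theorem continuous_step : Continuous fun z : (V → ℝ) × (E → ℝ) => G.step z.1 z.2 := by
  refine continuous_pi fun n => ?_
  have h : Continuous fun z : (V → ℝ) × (E → ℝ) => G.inflow z.2 n :=
    (continuous_apply n).comp (continuous_inflow.comp continuous_snd)
  simp only [step]
  fun_prop

theorem continuous_traj (k : ℕ) :
    Continuous fun z : (V → ℝ) × (ℕ → E → ℝ) => G.traj z.1 z.2 k := by
  induction k with
  | zero => exact continuous_fst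
  | succ k ih =>
    exact continuous_step.comp (ih.prodMk ((continuous_apply k).comp continuous_snd))

theorem continuous_stage : Continuous fun z : (V → ℝ) × (E → ℝ) => G.stage z.1 z.2 := by
  simp only [stage, nodeCost, edgeCost]
  fun_prop

theorem continuous_terminal : Continuous G.terminal := by
  unfold terminal; fun_prop

theorem continuous_cost (N : ℕ) :
    Continuous fun z : (V → ℝ) × (ℕ → E → ℝ) => G.cost N z.1 z.2 := by
  refine Continuous.add (continuous_finsetSum _ fun k _ => ?_)
    (continuous_terminal.comp (continuous_traj N))
  exact continuous_stage.comp ((continuous_traj k).prodMk ((continuous_apply k).comp continuous_snd))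

theorem continuous_cost_right (N : ℕ) (x : V → ℝ) :
    Continuous fun f : ℕ → E → ℝ => G.cost N x f := by
  have h : Continuous fun f : ℕ → E → ℝ => ((x, f) : (V → ℝ) × (ℕ → E → ℝ)) := by fun_prop
  have h' := continuous_cost (G := G) N
  generalize hF : (fun z : (V → ℝ) × (ℕ → E → ℝ) => G.cost N z.1 z.2) = F at h'
  have : (fun f : ℕ → E → ℝ => G.cost N x f) = fun f => F (x, f) := by rw [← hF]
  rw [this]
  exact h'.comp h

theorem isCompact_plans (N : ℕ) (x : V → ℝ) : IsCompact {f | G.IsPlan N x f} := by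
  have h1 : IsCompact (Set.univ.pi fun _ : ℕ => G.flows) :=
    isCompact_univ_pi fun _ => isCompact_Icc
  have h2 : IsClosed {f : ℕ → E → ℝ | ∀ k ≤ N, G.traj x f k ∈ G.box} := by
    simp only [Set.ofPred_forall]
    refine isClosed_iInter fun k => isClosed_iInter fun _ => ?_
    exact isClosed_Icc.preimage ((continuous_traj k).comp (continuous_const.prodMk continuous_id))
  convert h1.inter_right h2 using 1
  ext f; simp [IsPlan]

theorem traj_zero (x : V → ℝ) (k : ℕ) (n : V) : G.traj x 0 k n = G.α n ^ k * x n := by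
  induction k with
  | zero => simp [traj]
  | succ k ih =>
    have : G.traj x 0 (k + 1) n = G.α n * G.traj x 0 k n + G.β n * G.inflow 0 n := rfl
    rw [this, ih, map_zero]
    simp only [Pi.zero_apply, mul_zero, add_zero]
    ring

theorem smul_mem_box {x : V → ℝ} (hx : x ∈ G.box) {a : V → ℝ} (ha0 : ∀ n, 0 ≤ a n)
    (ha1 : ∀ n, a n ≤ 1) : (fun n => a n * x n) ∈ G.box := by
  refine ⟨fun n => ?_, fun n => ?_⟩
  · rcases le_total 0 (x n) with h | h
    · exact (G.lo_nonpos n).trans (mul_nonneg (ha0 n) h)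
    · exact (hx.1 n).trans (by simpa using mul_le_mul_of_nonpos_right (ha1 n) h)
  · rcases le_total 0 (x n) with h | h
    · exact le_trans (by simpa using mul_le_mul_of_nonneg_right (ha1 n) h) (hx.2 n)
    · exact (mul_nonpos_of_nonneg_of_nonpos (ha0 n) h).trans (G.hi_nonneg n)

/-- Without flow each stock is multiplied by a power of `α n ∈ [0, 1]` and stays in a box that
contains the origin. Thus every admissible stock has plans of every length, and recursive
feasibility is automatic. -/
theorem isPlan_zero {x : V → ℝ} (hx : x ∈ G.box) (N : ℕ) : G.IsPlan N x 0 := by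
  refine ⟨fun k => zero_mem_flows, fun k _ => ?_⟩
  have : G.traj x 0 k = fun n => G.α n ^ k * x n := funext fun n => traj_zero x k n
  rw [this]
  exact smul_mem_box hx (fun n => pow_nonneg (G.α_nonneg n) k)
    fun n => pow_le_one₀ (G.α_nonneg n) (G.α_le_one n)

theorem IsPlan.start {N : ℕ} {x : V → ℝ} {f : ℕ → E → ℝ} (h : G.IsPlan N x f) : x ∈ G.box :=
  h.2 0 (Nat.zero_le _)

theorem IsPlan.mono {N M : ℕ} {x : V → ℝ} {f : ℕ → E → ℝ} (h : G.IsPlan N x f) (hM : M ≤ N) :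
    G.IsPlan M x f := ⟨h.1, fun k hk => h.2 k (hk.trans hM)⟩

theorem IsPlan.tail {k m : ℕ} {x : V → ℝ} {f : ℕ → E → ℝ} (h : G.IsPlan (k + m) x f) :
    G.IsPlan m (G.traj x f k) fun i => f (k + i) :=
  ⟨fun j => h.1 _, fun j hj => by rw [← traj_add]; exact h.2 _ (by omega)⟩

theorem traj_concat_lt (x : V → ℝ) (f g : ℕ → E → ℝ) {k j : ℕ} (hj : j ≤ k) :
    G.traj x (concat k f g) j = G.traj x f j :=
  traj_congr fun i hi => by simp [concat, show i < k by omega]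

theorem traj_concat_add (x : V → ℝ) (f g : ℕ → E → ℝ) (k j : ℕ) :
    G.traj x (concat k f g) (k + j) = G.traj (G.traj x f k) g j := by
  rw [traj_add, traj_concat_lt x f g le_rfl]
  congr 1
  funext i
  simp [concat]

theorem IsPlan.concat {k m : ℕ} {x : V → ℝ} {f g : ℕ → E → ℝ} (hf : G.IsPlan k x f)
    (hg : G.IsPlan m (G.traj x f k) g) : G.IsPlan (k + m) x (Net.concat k f g) := by
  refine ⟨fun j => ?_, fun j hj => ?_⟩
  · simp only [Net.concat]
    split_ifs
    · exact hf.1 _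
    · exact hg.1 _
  · rcases le_total j k with h | h
    · rw [traj_concat_lt x f g h]; exact hf.2 j h
    · obtain ⟨i, rfl⟩ := Nat.exists_eq_add_of_le h
      rw [traj_concat_add]; exact hg.2 i (by omega)

theorem cost_add (x : V → ℝ) (f : ℕ → E → ℝ) (k m : ℕ) : G.cost (k + m) x f =
    ∑ j ∈ Finset.range k, G.stage (G.traj x f j) (f j) +
      G.cost m (G.traj x f k) fun i => f (k + i) := by
  simp only [cost, Finset.sum_range_add, traj_add x f k, add_assoc]

theorem cost_concat (x : V → ℝ) (f g : ℕ → E → ℝ) (k m : ℕ) : G.cost (k + m) x (concat k f g) =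
    ∑ j ∈ Finset.range k, G.stage (G.traj x f j) (f j) + G.cost m (G.traj x f k) g := by
  rw [cost_add, traj_concat_lt x f g le_rfl]
  congr 1
  · refine Finset.sum_congr rfl fun j hj => ?_
    have := Finset.mem_range.1 hj
    rw [traj_concat_lt x f g this.le]
    simp [concat, this]
  · congr 1
    funext i
    simp [concat]

variable (G) in
/-- A bound for the terminal cost on the box. -/
theorem exists_terminal_bound : ∃ C : ℝ, 0 ≤ C ∧ ∀ x ∈ G.box, |G.terminal x| ≤ C := by
  obtain ⟨C, hC⟩ := (isCompact_Icc (a := G.lo) (b := G.hi)).exists_bound_of_continuousOn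
    (f := G.terminal) continuous_terminal.continuousOn
  exact ⟨max C 0, le_max_right _ _, fun x hx => (hC x hx).trans (le_max_left _ _)⟩

theorem bddBelow_cost (N : ℕ) (x : V → ℝ) : BddBelow (G.cost N x '' {f | G.IsPlan N x f}) := by
  have hc := continuous_cost_right (G := G) N x
  exact ((isCompact_plans N x).image hc).bddBelow

theorem IsPlan.val_le {N : ℕ} {x : V → ℝ} {f : ℕ → E → ℝ} (h : G.IsPlan N x f) :
    G.val N x ≤ G.cost N x f := csInf_le (bddBelow_cost N x) ⟨f, h, rfl⟩

theorem exists_isOpt {x : V → ℝ} (hx : x ∈ G.box) (N : ℕ) : ∃ f, G.IsOpt N x f := by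
  have hc := continuous_cost_right (G := G) N x
  obtain ⟨f, hf, hmin⟩ := (isCompact_plans (G := G) N x).exists_isMinOn ⟨0, isPlan_zero hx N⟩
    hc.continuousOn
  refine ⟨f, hf, le_antisymm (le_csInf ⟨_, f, hf, rfl⟩ ?_) hf.val_le⟩
  rintro _ ⟨g, hg, rfl⟩
  exact hmin hg

theorem IsPlan.val_add_le {k : ℕ} {x : V → ℝ} {f : ℕ → E → ℝ} (h : G.IsPlan k x f) (m : ℕ) :
    G.val (k + m) x ≤ ∑ j ∈ Finset.range k, G.stage (G.traj x f j) (f j) +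
      G.val m (G.traj x f k) := by
  obtain ⟨g, hg, hgo⟩ := exists_isOpt (h.2 k le_rfl) m
  rw [← hgo, ← cost_concat]
  exact (h.concat hg).val_le

theorem IsOpt.tail {k m : ℕ} {x : V → ℝ} {f : ℕ → E → ℝ} (h : G.IsOpt (k + m) x f) :
    G.IsOpt m (G.traj x f k) fun i => f (k + i) := by
  refine ⟨h.1.tail, le_antisymm ?_ h.1.tail.val_le⟩
  have h1 := (h.1.mono (Nat.le_add_right k m)).val_add_le m
  rw [← h.2, cost_add] at h1
  linarith

theorem IsOpt.val_eq {k m : ℕ} {x : V → ℝ} {f : ℕ → E → ℝ} (h : G.IsOpt (k + m) x f) :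
    G.val (k + m) x = ∑ j ∈ Finset.range k, G.stage (G.traj x f j) (f j) +
      G.val m (G.traj x f k) := by
  rw [← h.2, cost_add, h.tail.2]

theorem convexOn_quadratic (a b : ℝ) (ha : 0 ≤ a) (x y p q : ℝ) (hp : 0 ≤ p) (hq : 0 ≤ q)
    (hpq : p + q = 1) : a * (p * x + q * y) ^ 2 + b * (p * x + q * y) ≤
      p * (a * x ^ 2 + b * x) + q * (a * y ^ 2 + b * y) := by
  have hq' : q = 1 - p := by linarith
  subst hq'
  have : 0 ≤ a * (p * (1 - p) * (x - y) ^ 2) := by positivity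
  nlinarith

theorem stage_add_smul_le {p q : ℝ} (hp : 0 ≤ p) (hq : 0 ≤ q) (hpq : p + q = 1)
    (x y : V → ℝ) (f g : E → ℝ) : G.stage (p • x + q • y) (p • f + q • g) ≤
      p * G.stage x f + q * G.stage y g := by
  have h1 : ∑ n, G.nodeCost n ((p • x + q • y) n) ≤
      p * ∑ n, G.nodeCost n (x n) + q * ∑ n, G.nodeCost n (y n) := by
    rw [Finset.mul_sum, Finset.mul_sum, ← Finset.sum_add_distrib]
    exact Finset.sum_le_sum fun n _ =>
      convexOn_quadratic _ _ (G.γ_nonneg n) _ _ _ _ hp hq hpq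
  have h2 : ∑ e, G.edgeCost e ((p • f + q • g) e) ≤
      p * ∑ e, G.edgeCost e (f e) + q * ∑ e, G.edgeCost e (g e) := by
    rw [Finset.mul_sum, Finset.mul_sum, ← Finset.sum_add_distrib]
    exact Finset.sum_le_sum fun e _ =>
      convexOn_quadratic _ _ (G.ρ_nonneg e) _ _ _ _ hp hq hpq
  simp only [stage]
  linarith

theorem terminal_add_smul (p q : ℝ) (x y : V → ℝ) :
    G.terminal (p • x + q • y) = p * G.terminal x + q * G.terminal y := by
  simp only [terminal, Finset.mul_sum, ← Finset.sum_add_distrib, Pi.add_apply, Pi.smul_apply,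
    smul_eq_mul]
  exact Finset.sum_congr rfl fun n _ => by ring

theorem cost_add_smul_le {p q : ℝ} (hp : 0 ≤ p) (hq : 0 ≤ q) (hpq : p + q = 1) (N : ℕ)
    (x y : V → ℝ) (f g : ℕ → E → ℝ) : G.cost N (p • x + q • y) (p • f + q • g) ≤
      p * G.cost N x f + q * G.cost N y g := by
  simp only [cost, traj_add_smul, terminal_add_smul]
  have : ∑ k ∈ Finset.range N, G.stage (p • G.traj x f k + q • G.traj y g k) ((p • f + q • g) k) ≤
      p * ∑ k ∈ Finset.range N, G.stage (G.traj x f k) (f k) +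
        q * ∑ k ∈ Finset.range N, G.stage (G.traj y g k) (g k) := by
    rw [Finset.mul_sum, Finset.mul_sum, ← Finset.sum_add_distrib]
    exact Finset.sum_le_sum fun k _ => stage_add_smul_le hp hq hpq _ _ _ _
  linarith

theorem convex_box : Convex ℝ G.box := convex_Icc _ _

theorem convex_flows : Convex ℝ G.flows := convex_Icc _ _

theorem IsPlan.add_smul {p q : ℝ} (hp : 0 ≤ p) (hq : 0 ≤ q) (hpq : p + q = 1) {N : ℕ}
    {x y : V → ℝ} {f g : ℕ → E → ℝ} (hf : G.IsPlan N x f) (hg : G.IsPlan N y g) :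
    G.IsPlan N (p • x + q • y) (p • f + q • g) :=
  ⟨fun k => convex_flows (hf.1 k) (hg.1 k) hp hq hpq,
    fun k hk => by
      rw [traj_add_smul]; exact convex_box (hf.2 k hk) (hg.2 k hk) hp hq hpq⟩

theorem val_add_smul_le {p q : ℝ} (hp : 0 ≤ p) (hq : 0 ≤ q) (hpq : p + q = 1) (N : ℕ)
    {x y : V → ℝ} (hx : x ∈ G.box) (hy : y ∈ G.box) :
    G.val N (p • x + q • y) ≤ p * G.val N x + q * G.val N y := by
  obtain ⟨f, hf, hfo⟩ := exists_isOpt hx N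
  obtain ⟨g, hg, hgo⟩ := exists_isOpt hy N
  rw [← hfo, ← hgo]
  exact (hf.add_smul hp hq hpq hg).val_le.trans (cost_add_smul_le hp hq hpq N _ _ _ _)

theorem cost_ge {C : ℝ} (hC : ∀ x ∈ G.box, |G.terminal x| ≤ C) {N : ℕ} {x : V → ℝ}
    {f : ℕ → E → ℝ} (h : G.IsPlan N x f) : -C ≤ G.cost N x f := by
  have h1 : 0 ≤ ∑ k ∈ Finset.range N, G.stage (G.traj x f k) (f k) :=
    Finset.sum_nonneg fun k hk => stage_nonneg (h.2 k (Finset.mem_range.1 hk).le) (h.1 k)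
  have h2 := (abs_le.1 (hC _ (h.2 N le_rfl))).1
  simp only [cost]; linarith

theorem val_ge {C : ℝ} (hC : ∀ x ∈ G.box, |G.terminal x| ≤ C) (N : ℕ) {x : V → ℝ}
    (hx : x ∈ G.box) : -C ≤ G.val N x := by
  obtain ⟨f, hf, hfo⟩ := exists_isOpt hx N
  exact hfo ▸ cost_ge hC hf

end Net

/-! ### Repair of flows and Lipschitz continuity of the values. -/

namespace Net

variable {V E : Type} [Fintype V] [Fintype E] [DecidableEq V] {G : Net V E}

variable (G) in
/-- One-sided bounds on some of the flows and on some of the scaled inflows. -/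
structure Bounds (A B : V → Prop) (P Q : E → Prop) (lb ub : V → ℝ) (p q f : E → ℝ) : Prop where
  lb : ∀ n, A n → lb n ≤ G.β n * G.inflow f n
  ub : ∀ n, B n → G.β n * G.inflow f n ≤ ub n
  p : ∀ e, P e → p e ≤ f e
  q : ∀ e, Q e → f e ≤ q e

variable (G) in
/-- Hoffman's bound for `Bounds`, uniform in all the data. -/
theorem exists_repair : ∃ C : ℝ, 0 ≤ C ∧ ∀ (A B : V → Prop) (P Q : E → Prop) (lb ub : V → ℝ)
    (p q f₀ : E → ℝ) (δ : ℝ), 0 ≤ δ →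
    (∀ n, A n → lb n ≤ G.β n * G.inflow f₀ n + δ) →
    (∀ n, B n → G.β n * G.inflow f₀ n ≤ ub n + δ) →
    (∀ e, P e → p e ≤ f₀ e + δ) → (∀ e, Q e → f₀ e ≤ q e + δ) →
    (∃ f, G.Bounds A B P Q lb ub p q f) →
    ∃ f, G.Bounds A B P Q lb ub p q f ∧ ‖f - f₀‖ ≤ C * δ := by
  classical
  let a : V ⊕ V ⊕ E ⊕ E → (E → ℝ) →ₗ[ℝ] ℝ :=
    Sum.elim (fun n => -(G.β n • (LinearMap.proj n ∘ₗ G.inflow)))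
      (Sum.elim (fun n => G.β n • (LinearMap.proj n ∘ₗ G.inflow))
        (Sum.elim (fun e => -LinearMap.proj e) fun e => LinearMap.proj e))
  obtain ⟨C, hC0, hC⟩ := hoffmanBound (E → ℝ) _ a
  refine ⟨C, hC0, ?_⟩
  rintro A B P Q lb ub p q f₀ δ hδ h1 h2 h3 h4 ⟨g, g1, g2, g3, g4⟩
  -- The rows that are not selected receive a right-hand side that both `f₀` and `g` satisfy. One
  -- family of rows, hence one constant, then serves all selections.
  let b : V ⊕ V ⊕ E ⊕ E → ℝ := fun i =>
    Sum.elim (fun n => if A n then -lb n else max (a i f₀) (a i g))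
      (Sum.elim (fun n => if B n then ub n else max (a i f₀) (a i g))
        (Sum.elim (fun e => if P e then -p e else max (a i f₀) (a i g))
          fun e => if Q e then q e else max (a i f₀) (a i g))) i
  have hex := hC b f₀ δ hδ ?_ ⟨g, ?_⟩
  · obtain ⟨f, hf, hd⟩ := hex
    refine ⟨f, ⟨fun n hn => ?_, fun n hn => ?_, fun e he => ?_, fun e he => ?_⟩, hd⟩
    · have := hf (Sum.inl n)
      simp [a, b, hn] at this; linarith
    · have := hf (Sum.inr (Sum.inl n))
      simp [a, b, hn] at this; linarith
    · have := hf (Sum.inr (Sum.inr (Sum.inl e)))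
      simp [a, b, he] at this; linarith
    · have := hf (Sum.inr (Sum.inr (Sum.inr e)))
      simp [a, b, he] at this; linarith
  · have key : ∀ i, a i f₀ ≤ max (a i f₀) (a i g) + δ := fun i =>
      (le_max_left _ _).trans (by linarith)
    rintro (n | n | e | e)
    · by_cases hn : A n
      · have := h1 n hn
        simp [a, b, hn]; linarith
      · simpa [b, hn] using key (Sum.inl n)
    · by_cases hn : B n
      · have := h2 n hn
        simp [a, b, hn]; linarith
      · simpa [b, hn] using key (Sum.inr (Sum.inl n))
    · by_cases hn : P e
      · have := h3 e hn
        simp [a, b, hn]; linarith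
      · simpa [b, hn] using key (Sum.inr (Sum.inr (Sum.inl e)))
    · by_cases hn : Q e
      · have := h4 e hn
        simp [a, b, hn]; linarith
      · simpa [b, hn] using key (Sum.inr (Sum.inr (Sum.inr e)))
  · rintro (n | n | e | e)
    · by_cases hn : A n
      · have := g1 n hn
        simp [a, b, hn]; linarith
      · simp [b, hn]
    · by_cases hn : B n
      · have := g2 n hn
        simp [a, b, hn]; linarith
      · simp [b, hn]
    · by_cases hn : P e
      · have := g3 e hn
        simp [a, b, hn]; linarith
      · simp [b, hn]
    · by_cases hn : Q e
      · have := g4 e hn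
        simp [a, b, hn]; linarith
      · simp [b, hn]

theorem abs_apply_le_norm {ι : Type} [Fintype ι] (x : ι → ℝ) (i : ι) : |x i| ≤ ‖x‖ :=
  norm_le_pi_norm x i

theorem step_sub (x y : V → ℝ) (f g : E → ℝ) : G.step x f - G.step y g = G.step (x - y) (f - g) := by
  ext n; simp [step]; ring

theorem step_add (x y : V → ℝ) (f g : E → ℝ) : G.step (x + y) (f + g) = G.step x f + G.step y g := by
  ext n; simp [step]; ring

variable (G) in
theorem exists_inflow_bound : ∃ C : ℝ, 0 ≤ C ∧ ∀ f n, |G.inflow f n| ≤ C * ‖f‖ := by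
  obtain ⟨C, hC0, hC⟩ := G.inflow.toContinuousLinearMap.bound
  exact ⟨C, hC0.le, fun f n => (abs_apply_le_norm _ n).trans (hC f)⟩

variable (G) in
theorem exists_step_bound : ∃ C : ℝ, 0 ≤ C ∧ (∀ x f, ‖G.step x f‖ ≤ ‖x‖ + C * ‖f‖) ∧
    ∀ f n, |G.β n * G.inflow f n| ≤ C * ‖f‖ := by
  obtain ⟨C, hC0, hC⟩ := exists_inflow_bound G
  have hb : ∀ f n, |G.β n * G.inflow f n| ≤ (∑ m, G.β m) * C * ‖f‖ := by
    intro f n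
    rw [abs_mul, abs_of_nonneg (G.β_nonneg n), mul_assoc]
    exact mul_le_mul (Finset.single_le_sum (fun m _ => G.β_nonneg m) (Finset.mem_univ n)) (hC f n)
      (abs_nonneg _) (Finset.sum_nonneg fun m _ => G.β_nonneg m)
  have h0 : 0 ≤ (∑ m, G.β m) * C := mul_nonneg (Finset.sum_nonneg fun m _ => G.β_nonneg m) hC0
  refine ⟨_, h0, fun x f => ?_, hb⟩
  refine (pi_norm_le_iff_of_nonneg (by positivity)).2 fun n => ?_
  have h1 : |G.α n * x n| ≤ ‖x‖ := by
    rw [abs_mul, abs_of_nonneg (G.α_nonneg n)]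
    exact (mul_le_of_le_one_left (abs_nonneg _) (G.α_le_one n)).trans (abs_apply_le_norm x n)
  exact (abs_add_le _ _).trans (add_le_add h1 (hb f n))

variable (G) in
/-- A radius containing all admissible stocks and flows. -/
theorem exists_radius : ∃ D : ℝ, 0 ≤ D ∧ (∀ x ∈ G.box, ‖x‖ ≤ D) ∧ ∀ f ∈ G.flows, ‖f‖ ≤ D := by
  obtain ⟨C, hC⟩ := (isCompact_Icc (a := G.lo) (b := G.hi)).isBounded.exists_norm_le
  obtain ⟨C', hC'⟩ := (isCompact_Icc (a := G.fl) (b := G.fu)).isBounded.exists_norm_le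
  exact ⟨max (max C C') 0, le_max_right _ _,
    fun x hx => (hC x hx).trans ((le_max_left _ _).trans (le_max_left _ _)),
    fun x hx => (hC' x hx).trans ((le_max_right _ _).trans (le_max_left _ _))⟩

variable (G) in
/-- An inadmissible flow can be repaired at a cost proportional to its violation. -/
theorem exists_flow_repair : ∃ C : ℝ, 0 ≤ C ∧ ∀ x ∈ G.box, ∀ f ∈ G.flows, ∀ y ∈ G.box,
    ∃ f' ∈ G.flows, G.step x f' ∈ G.box ∧ ‖f' - f‖ ≤ C * ‖G.step x f - y‖ := by
  obtain ⟨C, hC0, hC⟩ := exists_repair G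
  refine ⟨C, hC0, fun x hx f hf y hy => ?_⟩
  have hd : ∀ n, |G.step x f n - y n| ≤ ‖G.step x f - y‖ := fun n =>
    abs_apply_le_norm (G.step x f - y) n
  have hst := (isPlan_zero hx 1).2 1 le_rfl
  have h0 : ∀ n, G.lo n ≤ G.α n * x n ∧ G.α n * x n ≤ G.hi n := fun n => by
    have h1 := hst.1 n
    have h2 := hst.2 n
    rw [traj_zero, pow_one] at h1 h2
    exact ⟨h1, h2⟩
  obtain ⟨g, hg, hgd⟩ := hC (fun _ => True) (fun _ => True) (fun _ => True) (fun _ => True)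
    (fun n => G.lo n - G.α n * x n) (fun n => G.hi n - G.α n * x n) G.fl G.fu f
    ‖G.step x f - y‖ (norm_nonneg _)
    (fun n _ => by
      have h1 := (abs_le.1 (hd n)).1
      have h2 := hy.1 n
      simp only [step] at h1 ⊢
      linarith)
    (fun n _ => by
      have h1 := (abs_le.1 (hd n)).2
      have h2 := hy.2 n
      simp only [step] at h1 ⊢
      linarith)
    (fun e _ => (hf.1 e).trans (by linarith [norm_nonneg (G.step x f - y)]))
    (fun e _ => (hf.2 e).trans (by linarith [norm_nonneg (G.step x f - y)]))
    ⟨0, fun n _ => by simpa using (h0 n).1, fun n _ => by simpa using (h0 n).2,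
      fun e _ => G.fl_nonpos e, fun e _ => G.fu_nonneg e⟩
  refine ⟨g, ⟨fun e => hg.p e trivial, fun e => hg.q e trivial⟩,
    ⟨fun n => ?_, fun n => ?_⟩, hgd⟩
  · have := hg.lb n trivial
    simp only [step]; linarith
  · have := hg.ub n trivial
    simp only [step]; linarith

theorem quadratic_sub_le {a b D s t : ℝ} (hs : |s| ≤ D) (ht : |t| ≤ D) :
    |(a * s ^ 2 + b * s) - (a * t ^ 2 + b * t)| ≤ (2 * |a| * D + |b|) * |s - t| := by
  have : (a * s ^ 2 + b * s) - (a * t ^ 2 + b * t) = (a * (s + t) + b) * (s - t) := by ring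
  rw [this, abs_mul]
  refine mul_le_mul_of_nonneg_right ?_ (abs_nonneg _)
  refine (abs_add_le _ _).trans (add_le_add_left ?_ _)
  rw [abs_mul]
  have : |s + t| ≤ 2 * D := (abs_add_le _ _).trans (by linarith)
  calc |a| * |s + t| ≤ |a| * (2 * D) := mul_le_mul_of_nonneg_left this (abs_nonneg _)
    _ = _ := by ring

variable (G) in
theorem exists_stage_lipschitz : ∃ L : ℝ, 0 ≤ L ∧ ∀ x ∈ G.box, ∀ y ∈ G.box, ∀ f ∈ G.flows,
    ∀ g ∈ G.flows, |G.stage x f - G.stage y g| ≤ L * (‖x - y‖ + ‖f - g‖) := by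
  obtain ⟨D, hD0, hDx, hDf⟩ := exists_radius G
  set L₁ : ℝ := ∑ n, (2 * |G.γ n| * D + |G.c n|)
  set L₂ : ℝ := ∑ e, (2 * |G.ρ e| * D + |G.d e|)
  have hL₁ : 0 ≤ L₁ := Finset.sum_nonneg fun n _ => by positivity
  have hL₂ : 0 ≤ L₂ := Finset.sum_nonneg fun n _ => by positivity
  refine ⟨L₁ + L₂, by positivity, fun x hx y hy f hf g hg => ?_⟩
  have h1 : |∑ n, G.nodeCost n (x n) - ∑ n, G.nodeCost n (y n)| ≤ L₁ * ‖x - y‖ := by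
    rw [← Finset.sum_sub_distrib, Finset.sum_mul]
    refine (Finset.abs_sum_le_sum_abs _ _).trans (Finset.sum_le_sum fun n _ => ?_)
    refine (quadratic_sub_le ((abs_apply_le_norm x n).trans (hDx x hx))
      ((abs_apply_le_norm y n).trans (hDx y hy))).trans ?_
    exact mul_le_mul_of_nonneg_left (abs_apply_le_norm (x - y) n) (by positivity)
  have h2 : |∑ n, G.edgeCost n (f n) - ∑ n, G.edgeCost n (g n)| ≤ L₂ * ‖f - g‖ := by
    rw [← Finset.sum_sub_distrib, Finset.sum_mul]
    refine (Finset.abs_sum_le_sum_abs _ _).trans (Finset.sum_le_sum fun n _ => ?_)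
    refine (quadratic_sub_le ((abs_apply_le_norm f n).trans (hDf f hf))
      ((abs_apply_le_norm g n).trans (hDf g hg))).trans ?_
    exact mul_le_mul_of_nonneg_left (abs_apply_le_norm (f - g) n) (by positivity)
  have h3 : G.stage x f - G.stage y g = (∑ n, G.nodeCost n (x n) - ∑ n, G.nodeCost n (y n)) +
      (∑ n, G.edgeCost n (f n) - ∑ n, G.edgeCost n (g n)) := by simp only [stage]; ring
  rw [h3]
  refine (abs_add_le _ _).trans ?_
  nlinarith [norm_nonneg (x - y), norm_nonneg (f - g)]

theorem stage_zero_zero : G.stage 0 0 = 0 := by simp [stage, nodeCost, edgeCost]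

theorem val_zero_eq {x : V → ℝ} (hx : x ∈ G.box) : G.val 0 x = G.terminal x := by
  obtain ⟨f, -, hf⟩ := exists_isOpt hx 0
  rw [← hf]; simp [cost, traj]

theorem isPlan_one {x : V → ℝ} {f : E → ℝ} (hx : x ∈ G.box) (hf : f ∈ G.flows)
    (hy : G.step x f ∈ G.box) : G.IsPlan 1 x fun _ => f := by
  refine ⟨fun _ => hf, fun k hk => ?_⟩
  interval_cases k
  · exact hx
  · exact hy

theorem val_succ_le {x : V → ℝ} {f : E → ℝ} (hx : x ∈ G.box) (hf : f ∈ G.flows)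
    (hy : G.step x f ∈ G.box) (n : ℕ) : G.val (n + 1) x ≤ G.stage x f + G.val n (G.step x f) := by
  have h := (isPlan_one hx hf hy).val_add_le n
  rw [add_comm 1 n] at h
  simpa [traj] using h

theorem IsOpt.val_succ {n : ℕ} {x : V → ℝ} {f : ℕ → E → ℝ} (h : G.IsOpt (n + 1) x f) :
    G.val (n + 1) x = G.stage x (f 0) + G.val n (G.step x (f 0)) := by
  rw [add_comm n 1] at h ⊢
  simpa [traj] using h.val_eq

variable (G) in
-- The optimal first flow from `x` is repaired so as to be admissible from `y`, at a cost
-- proportional to `‖x - y‖`, and the induction hypothesis covers the rest. The constant depends on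
-- the horizon, so the bound serves only where the number of remaining stages is bounded.
theorem exists_val_lipschitz (n : ℕ) : ∃ L : ℝ, 0 ≤ L ∧ ∀ x ∈ G.box, ∀ y ∈ G.box,
    G.val n y ≤ G.val n x + L * ‖x - y‖ := by
  induction n with
  | zero =>
    refine ⟨∑ n, |G.τ n|, Finset.sum_nonneg fun _ _ => abs_nonneg _, fun x hx y hy => ?_⟩
    rw [val_zero_eq hx, val_zero_eq hy, ← sub_le_iff_le_add']
    simp only [terminal]
    rw [← Finset.sum_sub_distrib, Finset.sum_mul]
    refine Finset.sum_le_sum fun n _ => ?_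
    rw [← mul_sub]
    refine (le_abs_self _).trans ?_
    rw [abs_mul, abs_sub_comm]
    exact mul_le_mul_of_nonneg_left (abs_apply_le_norm (x - y) n) (abs_nonneg _)
  | succ n ih =>
    obtain ⟨L, hL0, hL⟩ := ih
    obtain ⟨C, hC0, hC⟩ := exists_flow_repair G
    obtain ⟨S, hS0, hS⟩ := exists_stage_lipschitz G
    obtain ⟨K, hK0, hK, -⟩ := exists_step_bound G
    refine ⟨S * (1 + C) + L * (1 + K * C), by positivity, fun x hx y hy => ?_⟩
    obtain ⟨f, hf⟩ := exists_isOpt hx (n + 1)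
    have hx1 : G.step x (f 0) ∈ G.box := hf.1.2 1 (by omega)
    obtain ⟨g, hg, hyg, hgd⟩ := hC y hy (f 0) (hf.1.1 0) _ hx1
    have h1 : ‖G.step y (f 0) - G.step x (f 0)‖ ≤ ‖x - y‖ := by
      rw [step_sub, sub_self]
      refine (hK _ _).trans ?_
      rw [norm_zero, mul_zero, add_zero, norm_sub_rev]
    have h2 : ‖g - f 0‖ ≤ C * ‖x - y‖ := hgd.trans (mul_le_mul_of_nonneg_left h1 hC0)
    have h3 : ‖G.step x (f 0) - G.step y g‖ ≤ (1 + K * C) * ‖x - y‖ := by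
      rw [step_sub]
      refine (hK _ _).trans ?_
      rw [norm_sub_rev (f 0)]
      nlinarith [mul_le_mul_of_nonneg_left h2 hK0]
    have h4 := (abs_le.1 (hS y hy x hx g hg (f 0) (hf.1.1 0))).2
    rw [norm_sub_rev y x] at h4
    have h5 := hL _ hx1 _ hyg
    rw [hf.val_succ]
    have h6 := val_succ_le hy hg hyg n
    nlinarith [mul_le_mul_of_nonneg_left h3 hL0, mul_le_mul_of_nonneg_left h2 hS0]

end Net

/-! ### Total flows and the least permanent cost. -/

namespace Net

variable {V E : Type} [Fintype V] [Fintype E] [DecidableEq V] {G : Net V E}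

variable (G) in
/-- Directions of flow that are not blocked at the origin. -/
def Gates (f : E → ℝ) : Prop := (∀ e, G.fl e = 0 → 0 ≤ f e) ∧ ∀ e, G.fu e = 0 → f e ≤ 0

variable (G) in
/-- `w` equals `a` at the nodes without leakage and, at the other nodes, exceeds `a` by a direction
that is feasible at the origin. -/
def Dom (w a : V → ℝ) : Prop := ∀ n, (G.α n = 1 → w n = a n) ∧ (G.lo n = 0 → a n ≤ w n) ∧
  (G.hi n = 0 → w n ≤ a n)

variable (G) in
/-- `f` is a total flow moving the stock `x` to an admissible permanent stock. -/
def Reach (x : V → ℝ) (f : E → ℝ) : Prop := G.Gates f ∧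
  ∀ n, (G.α n = 1 ∨ G.lo n = 0 → G.lo n ≤ G.step x f n) ∧
    (G.α n = 1 ∨ G.hi n = 0 → G.step x f n ≤ G.hi n)

open Classical in
variable (G) in
/-- The cost of the stock at the nodes without leakage. -/
noncomputable def zCost (y : V → ℝ) : ℝ := ∑ n, if G.α n = 1 then G.nodeCost n (y n) else 0

variable (G) in
/-- The least permanent stage cost that can be reached from `x`. -/
noncomputable def rho (x : V → ℝ) : ℝ := sInf ((fun f => G.zCost (G.step x f)) '' {f | G.Reach x f})

theorem zCost_congr {y w : V → ℝ} (h : ∀ n, G.α n = 1 → y n = w n) : G.zCost y = G.zCost w := by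
  refine Finset.sum_congr rfl fun n _ => ?_
  split_ifs with hn
  · rw [h n hn]
  · rfl

theorem gates_of_mem_flows {f : E → ℝ} (hf : f ∈ G.flows) : G.Gates f :=
  ⟨fun e he => he ▸ hf.1 e, fun e he => he ▸ hf.2 e⟩

theorem Gates.add {f g : E → ℝ} (hf : G.Gates f) (hg : G.Gates g) : G.Gates (f + g) :=
  ⟨fun e he => add_nonneg (hf.1 e he) (hg.1 e he), fun e he => add_nonpos (hf.2 e he) (hg.2 e he)⟩

theorem step_add_right (x : V → ℝ) (f g : E → ℝ) (n : V) :
    G.step x (f + g) n = G.step x f n + G.β n * G.inflow g n := by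
  simp [step]; ring

/-- Adding up the flows of a plan. -/
theorem IsPlan.exists_dom {k : ℕ} {x : V → ℝ} {f : ℕ → E → ℝ} (h : G.IsPlan (k + 1) x f) :
    ∃ F, G.Gates F ∧ G.Dom (G.step x F) (G.traj x f (k + 1)) := by
  induction k with
  | zero => exact ⟨f 0, gates_of_mem_flows (h.1 0), fun n => ⟨fun _ => rfl, fun _ => le_rfl,
      fun _ => le_rfl⟩⟩
  | succ k ih =>
    obtain ⟨F, hF, hd⟩ := ih (h.mono (by omega))
    -- The trajectory keeps leaking, the total flow does not. At a one-sided node leakage moves the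
    -- stock towards its zero capacity, so the domination persists.
    refine ⟨F + f (k + 1), hF.add (gates_of_mem_flows (h.1 _)), fun n => ?_⟩
    obtain ⟨h1, h2, h3⟩ := hd n
    have hb := h.2 (k + 1) (by omega)
    have h4 : G.traj x f (k + 1 + 1) n =
      G.α n * G.traj x f (k + 1) n + G.β n * G.inflow (f (k + 1)) n := rfl
    rw [step_add_right, h4]
    refine ⟨fun hn => by rw [h1 hn, hn, one_mul], fun hn => ?_, fun hn => ?_⟩
    · have h5 := hb.1 n
      rw [hn] at h5
      nlinarith [h2 hn, G.α_le_one n]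
    · have h5 := hb.2 n
      rw [hn] at h5
      nlinarith [h3 hn, G.α_le_one n]

theorem Reach.of_dom {x a : V → ℝ} {F : E → ℝ} (hF : G.Gates F) (ha : a ∈ G.box)
    (h : G.Dom (G.step x F) a) : G.Reach x F := by
  refine ⟨hF, fun n => ⟨?_, ?_⟩⟩
  · rintro (hn | hn)
    · rw [(h n).1 hn]; exact ha.1 n
    · exact (ha.1 n).trans ((h n).2.1 hn)
  · rintro (hn | hn)
    · rw [(h n).1 hn]; exact ha.2 n
    · exact ((h n).2.2 hn).trans (ha.2 n)

/-- Total flows can be concatenated. Nothing is lost at nodes without leakage, and at one-sided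
leaky nodes the domination together with `α n ≤ 1` gives the correct sign. This is what makes `rho`
monotone along plans. -/
theorem Reach.add_of_dom {x a : V → ℝ} {F g : E → ℝ} (hF : G.Gates F) (ha : a ∈ G.box)
    (h : G.Dom (G.step x F) a) (hg : G.Reach a g) : G.Reach x (F + g) ∧
      ∀ n, G.α n = 1 → G.step x (F + g) n = G.step a g n := by
  have h1 : ∀ n, G.α n = 1 → G.step x (F + g) n = G.step a g n := fun n hn => by
    rw [step_add_right, (h n).1 hn]; simp [step, hn]
  refine ⟨⟨hF.add hg.1, fun n => ⟨?_, ?_⟩⟩, h1⟩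
  · intro hn
    have h2 := (hg.2 n).1 hn
    rcases hn with hn | hn
    · rwa [h1 n hn]
    · rw [step_add_right]
      refine h2.trans ?_
      have h3 := (h n).2.1 hn
      have h4 := ha.1 n
      rw [hn] at h4
      simp only [step] at h3 ⊢
      nlinarith [G.α_le_one n]
  · intro hn
    have h2 := (hg.2 n).2 hn
    rcases hn with hn | hn
    · rwa [h1 n hn]
    · rw [step_add_right]
      refine le_trans ?_ h2
      have h3 := (h n).2.2 hn
      have h4 := ha.2 n
      rw [hn] at h4
      simp only [step] at h3 ⊢
      nlinarith [G.α_le_one n]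

theorem reach_zero {x : V → ℝ} (hx : x ∈ G.box) : G.Reach x 0 := by
  have h := (isPlan_zero hx 1)
  exact Reach.of_dom (gates_of_mem_flows zero_mem_flows) (h.2 1 le_rfl)
    fun n => ⟨fun _ => rfl, fun _ => le_rfl, fun _ => le_rfl⟩

theorem continuous_zCost : Continuous G.zCost := by
  unfold zCost nodeCost
  refine continuous_finsetSum _ fun n _ => ?_
  split_ifs <;> fun_prop

variable (G) in
/-- A target can be reached by a flow of proportional size. -/
theorem exists_small_reach : ∃ C : ℝ, 0 ≤ C ∧ ∀ (x : V → ℝ) (f : E → ℝ) (δ : ℝ), G.Reach x f →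
    (∀ n, G.α n = 1 → |G.step x f n| ≤ δ) → 0 ≤ δ →
    ∃ g, G.Reach x g ∧ (∀ n, G.α n = 1 → G.step x g n = G.step x f n) ∧ ‖g‖ ≤ C * (‖x‖ + δ) := by
  classical
  obtain ⟨C, hC0, hC⟩ := exists_repair G
  refine ⟨C, hC0, fun x f δ hf hfδ hδ => ?_⟩
  have hαx : ∀ n, |G.α n * x n| ≤ ‖x‖ := fun n => by
    rw [abs_mul, abs_of_nonneg (G.α_nonneg n)]
    exact (mul_le_of_le_one_left (abs_nonneg _) (G.α_le_one n)).trans (abs_apply_le_norm x n)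
  obtain ⟨g, hg, hgd⟩ := hC (fun n => G.α n = 1 ∨ G.lo n = 0) (fun n => G.α n = 1 ∨ G.hi n = 0)
    (fun e => G.fl e = 0) (fun e => G.fu e = 0)
    (fun n => if G.α n = 1 then G.step x f n - G.α n * x n else -(G.α n * x n))
    (fun n => if G.α n = 1 then G.step x f n - G.α n * x n else -(G.α n * x n))
    0 0 0 (‖x‖ + δ) (by positivity)
    (fun n _ => by
      have h1 := abs_le.1 (hαx n)
      simp only [map_zero, Pi.zero_apply, mul_zero, zero_add]
      split_ifs with h
      · linarith [(abs_le.1 (hfδ n h)).2]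
      · linarith)
    (fun n _ => by
      have h1 := abs_le.1 (hαx n)
      simp only [map_zero, Pi.zero_apply, mul_zero]
      split_ifs with h
      · linarith [(abs_le.1 (hfδ n h)).1]
      · linarith)
    (fun e _ => by simp; positivity) (fun e _ => by simp; positivity)
    ⟨f, fun n hn => by
      split_ifs with h
      · simp [step]
      · rcases hn with hn | hn
        · exact absurd hn h
        · have := (hf.2 n).1 (Or.inr hn)
          rw [hn] at this
          simp only [step] at this
          linarith, fun n hn => by
      split_ifs with h
      · simp [step]
      · rcases hn with hn | hn
        · exact absurd hn h
        · have := (hf.2 n).2 (Or.inr hn)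
          rw [hn] at this
          simp only [step] at this
          linarith, hf.1.1, hf.1.2⟩
  have h1 : ∀ n, G.α n = 1 → G.step x g n = G.step x f n := fun n hn => by
    have h2 := hg.lb n (Or.inl hn)
    have h3 := hg.ub n (Or.inl hn)
    simp only [hn, if_true] at h2 h3
    simp only [step] at h2 h3 ⊢
    rw [hn] at h2 h3 ⊢
    linarith
  refine ⟨g, ⟨⟨hg.p, hg.q⟩, fun n => ⟨fun hn => ?_, fun hn => ?_⟩⟩, h1, by simpa using hgd⟩
  · by_cases h : G.α n = 1
    · rw [h1 n h]; exact (hf.2 n).1 hn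
    · have h2 := hg.lb n hn
      rw [if_neg h] at h2
      rw [hn.resolve_left h]
      simp only [step]; linarith
  · by_cases h : G.α n = 1
    · rw [h1 n h]; exact (hf.2 n).2 hn
    · have h2 := hg.ub n hn
      rw [if_neg h] at h2
      rw [hn.resolve_left h]
      simp only [step]; linarith

/-- The admissible total flows form an unbounded closed set, but by `exists_small_reach` every value
of the cost is attained within a fixed ball, so compactness applies. -/
theorem exists_rho_min {x : V → ℝ} (hx : x ∈ G.box) : ∃ f, G.Reach x f ∧
    G.rho x = G.zCost (G.step x f) ∧ ∀ g, G.Reach x g → G.zCost (G.step x f) ≤ G.zCost (G.step x g) := by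
  obtain ⟨C, hC0, hC⟩ := exists_small_reach G
  obtain ⟨D, hD0, hD, -⟩ := exists_radius G
  obtain ⟨D', hD'⟩ : ∃ D', ∀ f, G.Reach x f → ∀ n, G.α n = 1 → |G.step x f n| ≤ D' := by
    refine ⟨∑ n, (|G.lo n| + |G.hi n|), fun f hf n hn => ?_⟩
    have h1 := (hf.2 n).1 (Or.inl hn)
    have h2 := (hf.2 n).2 (Or.inl hn)
    refine le_trans ?_ (Finset.single_le_sum (f := fun n => |G.lo n| + |G.hi n|)
      (fun m _ => by positivity) (Finset.mem_univ n))
    rw [abs_le]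
    constructor <;> linarith [neg_abs_le (G.lo n), le_abs_self (G.hi n), abs_nonneg (G.lo n),
      abs_nonneg (G.hi n)]
  have hcs : Continuous fun f => G.step x f := by
    have h : Continuous fun f : E → ℝ => ((x, f) : (V → ℝ) × (E → ℝ)) := by fun_prop
    exact (continuous_step (G := G)).comp h
  have hcn : ∀ n, Continuous fun f => G.step x f n := fun n => (continuous_apply n).comp hcs
  have hclosed : IsClosed {f | G.Reach x f} := by
    simp only [Reach, Gates, Set.ofPred_and, Set.ofPred_forall]
    refine IsClosed.inter (IsClosed.inter ?_ ?_) ?_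
    · exact isClosed_iInter fun e => isClosed_iInter fun _ =>
        isClosed_le continuous_const (continuous_apply e)
    · exact isClosed_iInter fun e => isClosed_iInter fun _ =>
        isClosed_le (continuous_apply e) continuous_const
    · exact isClosed_iInter fun n => IsClosed.inter
        (isClosed_iInter fun _ => isClosed_le continuous_const (hcn n))
        (isClosed_iInter fun _ => isClosed_le (hcn n) continuous_const)
  set R := C * (‖x‖ + max D' 0)
  have hR0 : 0 ≤ R := by positivity
  have hcomp : IsCompact ({f | G.Reach x f} ∩ Metric.closedBall 0 R) :=
    (isCompact_closedBall _ _).inter_left hclosed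
  obtain ⟨f, ⟨hf, -⟩, hmin⟩ := hcomp.exists_isMinOn ⟨0, reach_zero hx, by simpa using hR0⟩
    ((continuous_zCost (G := G)).comp hcs).continuousOn
  have hall : ∀ g, G.Reach x g → G.zCost (G.step x f) ≤ G.zCost (G.step x g) := fun g hg => by
    obtain ⟨g', hg', he, hn⟩ := hC x g (max D' 0) hg
      (fun n hn => (hD' g hg n hn).trans (le_max_left _ _)) (le_max_right _ _)
    rw [← zCost_congr he]
    exact hmin ⟨hg', by simpa using hn⟩
  refine ⟨f, hf, le_antisymm (csInf_le ⟨G.zCost (G.step x f), ?_⟩ ⟨f, hf, rfl⟩)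
    (le_csInf ⟨_, f, hf, rfl⟩ ?_), hall⟩
  · rintro _ ⟨g, hg, rfl⟩; exact hall g hg
  · rintro _ ⟨g, hg, rfl⟩; exact hall g hg

theorem rho_le {x : V → ℝ} (hx : x ∈ G.box) {f : E → ℝ} (hf : G.Reach x f) :
    G.rho x ≤ G.zCost (G.step x f) := by
  obtain ⟨g, -, h, hmin⟩ := exists_rho_min hx
  rw [h]; exact hmin f hf

theorem nodeCost_nonneg_of_mem {n : V} {t : ℝ} (h1 : G.lo n ≤ t) (h2 : t ≤ G.hi n) :
    0 ≤ G.nodeCost n t ∧ G.γ n * t ^ 2 ≤ G.nodeCost n t := by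
  have := linear_nonneg_of_mem_Icc (G.c_lo n) (G.c_hi n) ⟨h1, h2⟩
  have h3 := mul_nonneg (G.γ_nonneg n) (sq_nonneg t)
  simp only [nodeCost]
  constructor <;> linarith

theorem zCost_step_ge {x : V → ℝ} {f : E → ℝ} (hf : G.Reach x f) {n : V} (hn : G.α n = 1) :
    0 ≤ G.zCost (G.step x f) ∧ G.nodeCost n (G.step x f n) ≤ G.zCost (G.step x f) := by
  classical
  have h : ∀ m ∈ Finset.univ, 0 ≤ if G.α m = 1 then G.nodeCost m (G.step x f m) else 0 := by
    intro m _
    split_ifs with hm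
    · exact (nodeCost_nonneg_of_mem ((hf.2 m).1 (Or.inl hm)) ((hf.2 m).2 (Or.inl hm))).1
    · exact le_rfl
  refine ⟨?_, ?_⟩
  · unfold zCost; convert Finset.sum_nonneg h
  · have h1 := Finset.single_le_sum h (Finset.mem_univ n)
    rw [if_pos hn] at h1
    unfold zCost
    convert h1

theorem zCost_step_nonneg {x : V → ℝ} {f : E → ℝ} (hf : G.Reach x f) :
    0 ≤ G.zCost (G.step x f) := by
  refine Finset.sum_nonneg fun n _ => ?_
  split_ifs with hm
  · exact (nodeCost_nonneg_of_mem ((hf.2 n).1 (Or.inl hm)) ((hf.2 n).2 (Or.inl hm))).1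
  · exact le_rfl

theorem rho_nonneg {x : V → ℝ} (hx : x ∈ G.box) : 0 ≤ G.rho x := by
  obtain ⟨f, hf, h, -⟩ := exists_rho_min hx
  rw [h]; exact zCost_step_nonneg hf

theorem rho_le_zCost {x : V → ℝ} (hx : x ∈ G.box) : G.rho x ≤ G.zCost x := by
  refine (rho_le hx (reach_zero hx)).trans (zCost_congr fun n hn => ?_).le
  simp [step, hn]

theorem zCost_le_stage {x : V → ℝ} {f : E → ℝ} (hx : x ∈ G.box) (hf : f ∈ G.flows) :
    G.zCost x ≤ G.stage x f := by
  have h1 : G.zCost x ≤ ∑ n, G.nodeCost n (x n) := by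
    refine Finset.sum_le_sum fun n _ => ?_
    split_ifs
    · exact le_rfl
    · exact nodeCost_nonneg hx n
  have h2 : 0 ≤ ∑ e, G.edgeCost e (f e) := Finset.sum_nonneg fun e _ => edgeCost_nonneg hf e
  simp only [stage]; linarith

/-- Whatever permanent stock can be reached after `k` stages can be reached from the start, by
adding the flows already used. Possibilities are only lost with time. -/
theorem IsPlan.rho_le_traj {k : ℕ} {x : V → ℝ} {f : ℕ → E → ℝ} (h : G.IsPlan k x f) :
    G.rho x ≤ G.rho (G.traj x f k) := by
  cases k with
  | zero => exact le_rfl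
  | succ k =>
    obtain ⟨F, hF, hd⟩ := h.exists_dom
    have ha := h.2 _ le_rfl
    obtain ⟨g, hg, he, -⟩ := exists_rho_min ha
    obtain ⟨h1, h2⟩ := Reach.add_of_dom hF ha hd hg
    rw [he, ← zCost_congr h2]
    exact rho_le h.start h1

theorem IsPlan.rho_le_stage {N k : ℕ} {x : V → ℝ} {f : ℕ → E → ℝ} (h : G.IsPlan N x f)
    (hk : k ≤ N) : G.rho x ≤ G.stage (G.traj x f k) (f k) :=
  (h.mono hk).rho_le_traj.trans
    ((rho_le_zCost (h.2 k hk)).trans (zCost_le_stage (h.2 k hk) (h.1 k)))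

theorem mul_rho_le_val {C : ℝ} (hC : ∀ x ∈ G.box, |G.terminal x| ≤ C) (N : ℕ) {x : V → ℝ}
    (hx : x ∈ G.box) : N * G.rho x - C ≤ G.val N x := by
  obtain ⟨f, hf, hfo⟩ := exists_isOpt hx N
  have h1 : ∑ k ∈ Finset.range N, G.rho x ≤ ∑ k ∈ Finset.range N, G.stage (G.traj x f k) (f k) :=
    Finset.sum_le_sum fun k hk => hf.rho_le_stage (Finset.mem_range.1 hk).le
  have h2 := (abs_le.1 (hC _ (hf.2 N le_rfl))).1
  rw [← hfo]
  simp at h1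
  simp only [cost]; linarith

theorem exists_pos_le_finite {ι : Type} [Fintype ι] (a : ι → ℝ) (ha : ∀ i, 0 < a i) :
    ∃ κ > 0, ∀ i, κ ≤ a i := by
  classical
  obtain ⟨o, -, ho⟩ := Finset.exists_min_image (Finset.univ : Finset (Option ι))
    (fun o => o.elim (1 : ℝ) a) ⟨none, Finset.mem_univ _⟩
  refine ⟨o.elim 1 a, ?_, fun i => ho (some i) (Finset.mem_univ _)⟩
  cases o with
  | none => exact one_pos
  | some i => exact ha i

variable (G) in
/-- Inside this radius only the capacities that vanish matter. -/
theorem exists_capacity_radius : ∃ κ > 0, (∀ n, G.lo n = 0 ∨ κ ≤ -G.lo n) ∧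
    (∀ n, G.hi n = 0 ∨ κ ≤ G.hi n) ∧ (∀ e, G.fl e = 0 ∨ κ ≤ -G.fl e) ∧
    ∀ e, G.fu e = 0 ∨ κ ≤ G.fu e := by
  classical
  obtain ⟨κ, h0, hκ⟩ := exists_pos_le_finite (ι := V ⊕ V ⊕ E ⊕ E)
    (Sum.elim (fun n => if G.lo n = 0 then 1 else -G.lo n)
      (Sum.elim (fun n => if G.hi n = 0 then 1 else G.hi n)
        (Sum.elim (fun e => if G.fl e = 0 then 1 else -G.fl e)
          fun e => if G.fu e = 0 then 1 else G.fu e))) (by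
      rintro (n | n | n | n) <;> simp only [Sum.elim_inl, Sum.elim_inr] <;> split_ifs with h
      all_goals first | exact one_pos | skip
      · exact neg_pos.2 (lt_of_le_of_ne (G.lo_nonpos n) h)
      · exact lt_of_le_of_ne (G.hi_nonneg n) (Ne.symm h)
      · exact neg_pos.2 (lt_of_le_of_ne (G.fl_nonpos n) h)
      · exact lt_of_le_of_ne (G.fu_nonneg n) (Ne.symm h))
  refine ⟨κ, h0, fun n => ?_, fun n => ?_, fun n => ?_, fun n => ?_⟩
  · have := hκ (Sum.inl n)
    by_cases h : G.lo n = 0 <;> simp_all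
  · have := hκ (Sum.inr (Sum.inl n))
    by_cases h : G.hi n = 0 <;> simp_all
  · have := hκ (Sum.inr (Sum.inr (Sum.inl n)))
    by_cases h : G.fl n = 0 <;> simp_all
  · have := hκ (Sum.inr (Sum.inr (Sum.inr n)))
    by_cases h : G.fu n = 0 <;> simp_all

variable (G) in
-- For small flows, and for small stocks of leaky nodes, only the vanishing capacities matter. The
-- box and the flows may then be replaced by cones, to which Hoffman's bound applies with no loss of
-- scale; nodes without leakage keep their capacities.
theorem exists_feasible_radius : ∃ κ > 0, (∀ f, G.Gates f → ‖f‖ ≤ κ → f ∈ G.flows) ∧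
    ∀ x, (∀ n, (G.α n = 1 → G.lo n ≤ x n ∧ x n ≤ G.hi n) ∧ (G.lo n = 0 → 0 ≤ x n) ∧
      (G.hi n = 0 → x n ≤ 0) ∧ (G.α n ≠ 1 → |x n| ≤ κ)) → x ∈ G.box := by
  obtain ⟨κ, h0, h1, h2, h3, h4⟩ := exists_capacity_radius G
  refine ⟨κ, h0, fun f hf hn => ⟨fun e => ?_, fun e => ?_⟩,
    fun x hx => ⟨fun n => ?_, fun n => ?_⟩⟩
  · rcases h3 e with h | h
    · rw [h]; exact hf.1 e h
    · linarith [(abs_le.1 ((abs_apply_le_norm f e).trans hn)).1]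
  · rcases h4 e with h | h
    · rw [h]; exact hf.2 e h
    · linarith [(abs_le.1 ((abs_apply_le_norm f e).trans hn)).2]
  · obtain ⟨ha, hb, -, hd⟩ := hx n
    by_cases h : G.α n = 1
    · exact (ha h).1
    · rcases h1 n with h' | h'
      · rw [h']; exact hb h'
      · linarith [(abs_le.1 (hd h)).1]
  · obtain ⟨ha, -, hb, hd⟩ := hx n
    by_cases h : G.α n = 1
    · exact (ha h).2
    · rcases h2 n with h' | h'
      · rw [h']; exact hb h'
      · linarith [(abs_le.1 (hd h)).2]

variable (G) in
theorem exists_small_of_nodeCost {ε : ℝ} (hε : 0 < ε) : ∃ η > 0, ∀ n t, G.lo n ≤ t → t ≤ G.hi n →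
    G.nodeCost n t ≤ η → |t| ≤ ε := by
  classical
  obtain ⟨κ, h0, hκ⟩ := exists_pos_le_finite (fun n => if 0 < G.γ n then G.γ n else 1) (by
    intro n; split_ifs with h
    · exact h
    · exact one_pos)
  refine ⟨κ * ε ^ 2, by positivity, fun n t h1 h2 h => ?_⟩
  rcases G.γ_pos n with hg | ⟨h3, h4⟩
  · have h5 := hκ n
    rw [if_pos hg] at h5
    have h6 := (nodeCost_nonneg_of_mem h1 h2).2.trans h
    have h7 : κ * t ^ 2 ≤ κ * ε ^ 2 :=
      (mul_le_mul_of_nonneg_right h5 (sq_nonneg t)).trans h6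
    exact abs_le_of_sq_le_sq (le_of_mul_le_mul_left h7 h0) hε.le
  · have : t = 0 := by linarith
    rw [this, abs_zero]; exact hε.le

theorem norm_traj_zero_le {x : V → ℝ} (k : ℕ) : ‖G.traj x 0 k‖ ≤ ‖x‖ := by
  refine (pi_norm_le_iff_of_nonneg (norm_nonneg _)).2 fun n => ?_
  rw [traj_zero, Real.norm_eq_abs, abs_mul, abs_of_nonneg (pow_nonneg (G.α_nonneg n) k)]
  exact (mul_le_of_le_one_left (abs_nonneg _) (pow_le_one₀ (G.α_nonneg n) (G.α_le_one n))).trans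
    (abs_apply_le_norm x n)

variable (G) in
/-- Letting the stock decay costs its permanent part and a transient. -/
theorem exists_stall_bound : ∃ C : ℝ, 0 ≤ C ∧ ∀ x ∈ G.box, ∀ N : ℕ,
    ∑ k ∈ Finset.range N, G.stage (G.traj x 0 k) 0 ≤ N * G.zCost x + C * ‖x‖ := by
  classical
  obtain ⟨D, hD0, hD, -⟩ := exists_radius G
  refine ⟨∑ n, (G.γ n * D + |G.c n|) * (1 - G.α n)⁻¹, Finset.sum_nonneg fun n _ =>
    mul_nonneg (add_nonneg (mul_nonneg (G.γ_nonneg n) hD0) (abs_nonneg _))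
      (inv_nonneg.2 (by linarith [G.α_le_one n])), fun x hx N => ?_⟩
  have h1 : ∀ k, G.stage (G.traj x 0 k) 0 = ∑ n, G.nodeCost n (G.α n ^ k * x n) := fun k => by
    simp [stage, traj_zero, edgeCost]
  simp only [h1]
  rw [Finset.sum_comm, Finset.sum_mul, zCost, Finset.mul_sum, ← Finset.sum_add_distrib]
  refine Finset.sum_le_sum fun n _ => ?_
  have hxn := (abs_apply_le_norm x n)
  have hxD := hxn.trans (hD x hx)
  by_cases h : G.α n = 1
  · simp [h]
  · have hα : G.α n < 1 := lt_of_le_of_ne (G.α_le_one n) h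
    have h2 : ∀ k, G.nodeCost n (G.α n ^ k * x n) ≤
        G.α n ^ k * ((G.γ n * D + |G.c n|) * ‖x‖) := fun k => by
      have hp0 := pow_nonneg (G.α_nonneg n) k
      have hp1 : G.α n ^ k ≤ 1 := pow_le_one₀ (G.α_nonneg n) (G.α_le_one n)
      have e : G.nodeCost n (G.α n ^ k * x n) =
        G.α n ^ k * (G.γ n * (G.α n ^ k * x n * x n) + G.c n * x n) := by
        simp only [nodeCost]; ring
      rw [e]
      refine mul_le_mul_of_nonneg_left ?_ hp0
      have h3 : G.α n ^ k * x n * x n ≤ D * ‖x‖ := by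
        calc G.α n ^ k * x n * x n = G.α n ^ k * (|x n| * |x n|) := by
              rw [mul_assoc, abs_mul_abs_self]
          _ ≤ 1 * (|x n| * |x n|) := mul_le_mul_of_nonneg_right hp1 (by positivity)
          _ ≤ D * ‖x‖ := by
              rw [one_mul]; exact mul_le_mul hxD hxn (abs_nonneg _) hD0
      have h4 : G.c n * x n ≤ |G.c n| * ‖x‖ := by
        refine (le_abs_self _).trans ?_
        rw [abs_mul]; exact mul_le_mul_of_nonneg_left hxn (abs_nonneg _)
      nlinarith [mul_le_mul_of_nonneg_left h3 (G.γ_nonneg n)]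
    rw [if_neg h, mul_zero, zero_add]
    refine (Finset.sum_le_sum fun k _ => h2 k).trans ?_
    rw [← Finset.sum_mul]
    have h3 : ∑ k ∈ Finset.range N, G.α n ^ k ≤ (1 - G.α n)⁻¹ := by
      rw [← tsum_geometric_of_lt_one (G.α_nonneg n) hα]
      exact (summable_geometric_of_lt_one (G.α_nonneg n) hα).sum_le_tsum _
        fun k _ => pow_nonneg (G.α_nonneg n) k
    have h4 : 0 ≤ (G.γ n * D + |G.c n|) * ‖x‖ := mul_nonneg
      (add_nonneg (mul_nonneg (G.γ_nonneg n) hD0) (abs_nonneg _)) (norm_nonneg _)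
    nlinarith [mul_le_mul_of_nonneg_right h3 h4]

variable (G) in
theorem exists_zCost_bound : ∃ C : ℝ, 0 ≤ C ∧ ∀ x ∈ G.box, G.zCost x ≤ C * ‖x‖ := by
  obtain ⟨L, hL0, hL⟩ := exists_stage_lipschitz G
  refine ⟨L, hL0, fun x hx => (zCost_le_stage hx zero_mem_flows).trans ?_⟩
  have := (abs_le.1 (hL x hx 0 zero_mem_box 0 zero_mem_flows 0 zero_mem_flows)).2
  rw [stage_zero_zero] at this
  simpa using this

theorem val_le_of_stall {C : ℝ} (hC : ∀ x ∈ G.box, |G.terminal x| ≤ C) {S : ℝ}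
    (hS : ∀ x ∈ G.box, ∀ N : ℕ,
      ∑ k ∈ Finset.range N, G.stage (G.traj x 0 k) 0 ≤ N * G.zCost x + S * ‖x‖)
    (N : ℕ) {x : V → ℝ} (hx : x ∈ G.box) : G.val N x ≤ N * G.zCost x + S * ‖x‖ + C := by
  refine (isPlan_zero hx N).val_le.trans ?_
  have h1 := hS x hx N
  have h2 := (abs_le.1 (hC _ ((isPlan_zero hx N).2 N le_rfl))).2
  simp only [cost, Pi.zero_apply]; linarith

end Net

/-! ### Asymptotics of the optimal value near the origin. -/

namespace Net

variable {V E : Type} [Fintype V] [Fintype E] [DecidableEq V] {G : Net V E}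

variable (G) in
/-- The limit of the optimal values at the origin. -/
noncomputable def bias : ℝ := ⨅ m, G.val m 0

theorem bias_le (m : ℕ) : G.bias ≤ G.val m 0 := by
  obtain ⟨C, -, hC⟩ := exists_terminal_bound G
  exact ciInf_le ⟨-C, by rintro _ ⟨m, rfl⟩; exact val_ge hC m zero_mem_box⟩ m

variable (G) in
theorem exists_val_zero_le {ε : ℝ} (hε : 0 < ε) : ∃ m, G.val m 0 ≤ G.bias + ε := by
  obtain ⟨m, hm⟩ := exists_lt_of_ciInf_lt (show ⨅ m, G.val m 0 < G.bias + ε from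
    lt_add_of_pos_right _ hε)
  exact ⟨m, hm.le⟩

variable (G) in
-- An explicit plan. One small flow realizes the least permanent cost `rho x`, the stock then decays
-- without flow, and the last `m` stages imitate a plan from the origin that nearly attains the
-- bias. The first flow is small because a small `rho x` forces small targets at the nodes without
-- leakage.
theorem val_le_of_small {ε : ℝ} (hε : 0 < ε) : ∃ r > 0, ∃ n₀ : ℕ, ∀ x ∈ G.box, ‖x‖ ≤ r →
    ∀ n ≥ n₀, G.val n x ≤ n * G.rho x + G.bias + ε := by
  obtain ⟨m, hm⟩ := exists_val_zero_le G (show 0 < ε / 3 by positivity)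
  obtain ⟨C₁, hC₁0, hC₁⟩ := exists_small_reach G
  obtain ⟨Cz, hCz0, hCz⟩ := exists_zCost_bound G
  obtain ⟨K, hK0, hK, -⟩ := exists_step_bound G
  obtain ⟨S, hS0, hS⟩ := exists_stall_bound G
  obtain ⟨Ls, hLs0, hLs⟩ := exists_stage_lipschitz G
  obtain ⟨L, hL0, hL⟩ := exists_val_lipschitz G m
  obtain ⟨κ, hκ0, hκf, hκx⟩ := exists_feasible_radius G
  -- Every quantity that has to be small is of the form `X * d` with `X ≤ A`, so that one choice of
  -- `d` serves all of them.
  set A : ℝ := 1 + 2 * C₁ + (1 + 2 * K * C₁) + Ls * (1 + 2 * C₁) + (S + L) * (1 + 2 * K * C₁)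
    with hA
  have a1 : 0 ≤ K * C₁ := by positivity
  have a2 : 0 ≤ Ls * (1 + 2 * C₁) := by positivity
  have a3 : 0 ≤ (S + L) * (1 + 2 * K * C₁) := by positivity
  have hA0 : 0 < A := by rw [hA]; nlinarith
  set d : ℝ := min κ (ε / 3) / A with hd
  have hd0 : 0 < d := by rw [hd]; positivity
  have hAd : A * d = min κ (ε / 3) := by rw [hd]; field_simp
  have key : ∀ X, X ≤ A → X * d ≤ κ ∧ X * d ≤ ε / 3 := fun X hX => by
    have := mul_le_mul_of_nonneg_right hX hd0.le
    rw [hAd] at this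
    exact ⟨this.trans (min_le_left _ _), this.trans (min_le_right _ _)⟩
  obtain ⟨η, hη0, hη⟩ := exists_small_of_nodeCost G hd0
  refine ⟨min d (η / (Cz + 1)), by positivity, m + 1, fun x hx hxr n hn => ?_⟩
  have hxd : ‖x‖ ≤ d := hxr.trans (min_le_left _ _)
  obtain ⟨f₀, hf₀, hrho, -⟩ := exists_rho_min hx
  have hrη : G.rho x ≤ η := by
    refine (rho_le_zCost hx).trans ((hCz x hx).trans ?_)
    have h1 : ‖x‖ * (Cz + 1) ≤ η := (le_div_iff₀ (by positivity)).1 (hxr.trans (min_le_right _ _))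
    nlinarith [norm_nonneg x]
  obtain ⟨f, hf, hfe, hfn⟩ := hC₁ x f₀ d hf₀ (fun n hn =>
    hη n _ ((hf₀.2 n).1 (Or.inl hn)) ((hf₀.2 n).2 (Or.inl hn))
      ((zCost_step_ge hf₀ hn).2.trans (hrho ▸ hrη))) hd0.le
  have hfn' : ‖f‖ ≤ 2 * C₁ * d := hfn.trans (by
    rw [mul_comm 2, mul_assoc]; exact mul_le_mul_of_nonneg_left (by linarith) hC₁0)
  have hy := hK x f
  set y := G.step x f with hyd
  have hyn : ‖y‖ ≤ (1 + 2 * K * C₁) * d := by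
    linarith [mul_le_mul_of_nonneg_left hfn' hK0]
  have hff : f ∈ G.flows := hκf f hf.1 (hfn'.trans (key _ (by rw [hA]; linarith)).1)
  have hyκ : ‖y‖ ≤ κ := hyn.trans (key _ (by rw [hA]; linarith)).1
  have hyb : y ∈ G.box := hκx y fun n => ⟨fun hn => ⟨(hf.2 n).1 (Or.inl hn), (hf.2 n).2 (Or.inl hn)⟩,
    fun hn => hn ▸ (hf.2 n).1 (Or.inr hn), fun hn => hn ▸ (hf.2 n).2 (Or.inr hn),
    fun _ => (abs_apply_le_norm y n).trans hyκ⟩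
  have hzy : G.zCost y = G.rho x := by rw [hrho]; exact zCost_congr hfe
  obtain ⟨j, rfl⟩ := Nat.exists_eq_add_of_le' hn
  have e1 : G.val (j + (m + 1)) x ≤ G.stage x f + G.val (j + m) y := val_succ_le hx hff hyb (j + m)
  -- The stock decays for `j` stages; the remaining `m` stages are compared with the origin, using
  -- the Lipschitz constant of horizon `m`.
  have e2 := (isPlan_zero hyb j).val_add_le m
  have e3 := hS y hyb j
  have hyj := (isPlan_zero hyb j).2 j le_rfl
  have e4 := hL 0 zero_mem_box _ hyj
  rw [zero_sub, norm_neg] at e4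
  have e5 : L * ‖G.traj y 0 j‖ ≤ L * ‖y‖ := mul_le_mul_of_nonneg_left (norm_traj_zero_le j) hL0
  have e6 := (abs_le.1 (hLs x hx 0 zero_mem_box f hff 0 zero_mem_flows)).2
  rw [stage_zero_zero, sub_zero, sub_zero, sub_zero] at e6
  have e7 : Ls * (‖x‖ + ‖f‖) ≤ ε / 3 := by
    refine le_trans ?_ (key (Ls * (1 + 2 * C₁)) (by rw [hA]; linarith)).2
    rw [mul_assoc]
    exact mul_le_mul_of_nonneg_left (by linarith) hLs0
  have e8 : (S + L) * ‖y‖ ≤ ε / 3 := by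
    refine le_trans ?_ (key ((S + L) * (1 + 2 * K * C₁)) (by rw [hA]; linarith)).2
    rw [mul_assoc]
    exact mul_le_mul_of_nonneg_left hyn (add_nonneg hS0 hL0)
  have e9 : (j : ℝ) * G.rho x ≤ ((j + (m + 1) : ℕ) : ℝ) * G.rho x :=
    mul_le_mul_of_nonneg_right (by push_cast; linarith [(Nat.cast_nonneg m : (0 : ℝ) ≤ m)])
      (rho_nonneg hx)
  simp only [Pi.zero_apply] at e2
  rw [hzy] at e3
  linarith

variable (G) in
-- However long the plan whose flows were added up to `F`, a flow of size proportional to the two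
-- end points has the same effect at the nodes that matter in the long run.
theorem exists_small_dom : ∃ C : ℝ, 0 ≤ C ∧ ∀ (x a : V → ℝ) (F : E → ℝ), G.Gates F →
    G.Dom (G.step x F) a → ∃ f, G.Gates f ∧ G.Dom (G.step x f) a ∧ ‖f‖ ≤ C * (‖x‖ + ‖a‖) := by
  obtain ⟨C, hC0, hC⟩ := exists_repair G
  refine ⟨C, hC0, fun x a F hF hd => ?_⟩
  have hαx : ∀ n, |G.α n * x n| ≤ ‖x‖ := fun n => by
    rw [abs_mul, abs_of_nonneg (G.α_nonneg n)]
    exact (mul_le_of_le_one_left (abs_nonneg _) (G.α_le_one n)).trans (abs_apply_le_norm x n)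
  have ha := abs_apply_le_norm a
  obtain ⟨g, hg, hgd⟩ := hC (fun n => G.α n = 1 ∨ G.lo n = 0) (fun n => G.α n = 1 ∨ G.hi n = 0)
    (fun e => G.fl e = 0) (fun e => G.fu e = 0)
    (fun n => a n - G.α n * x n) (fun n => a n - G.α n * x n)
    0 0 0 (‖x‖ + ‖a‖) (by positivity)
    (fun n _ => by
      have h1 := abs_le.1 (hαx n)
      have h2 := abs_le.1 (ha n)
      simp only [map_zero, Pi.zero_apply, mul_zero, zero_add]
      linarith)
    (fun n _ => by
      have h1 := abs_le.1 (hαx n)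
      have h2 := abs_le.1 (ha n)
      simp only [map_zero, Pi.zero_apply, mul_zero]
      linarith)
    (fun e _ => by simp; positivity) (fun e _ => by simp; positivity)
    ⟨F, fun n hn => by
      obtain ⟨h1, h2, -⟩ := hd n
      simp only [step] at h1 h2
      rcases hn with hn | hn
      · linarith [h1 hn]
      · linarith [h2 hn], fun n hn => by
      obtain ⟨h1, -, h2⟩ := hd n
      simp only [step] at h1 h2
      rcases hn with hn | hn
      · linarith [h1 hn]
      · linarith [h2 hn], hF.1, hF.2⟩
  refine ⟨g, ⟨hg.p, hg.q⟩, fun n => ⟨fun hn => ?_, fun hn => ?_, fun hn => ?_⟩, by simpa using hgd⟩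
  · have h1 := hg.lb n (Or.inl hn)
    have h2 := hg.ub n (Or.inl hn)
    simp only [step]; linarith
  · have h1 := hg.lb n (Or.inr hn)
    simp only [step]; linarith
  · have h1 := hg.ub n (Or.inr hn)
    simp only [step]; linarith

/-- Averaging over the `m` stages `N - 2 * m ≤ k < N - m`: the cheapest of them costs at most `R /
m`. -/
theorem exists_cheap_stage {l : ℕ → ℝ} {N m : ℕ} {R : ℝ} (hl : ∀ k < N, 0 ≤ l k)
    (hR : ∑ k ∈ Finset.range N, l k ≤ R) (hm : 0 < m) (hN : 2 * m ≤ N) :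
    ∃ k m', N = k + m' ∧ m ≤ m' ∧ m' ≤ 2 * m ∧ N - 2 * m ≤ k ∧ m * l k ≤ R := by
  by_contra! hcon
  have h1 : ∑ k ∈ Finset.Ico (N - 2 * m) (N - m), l k ≤ R := by
    refine le_trans (Finset.sum_le_sum_of_subset_of_nonneg ?_ ?_) hR
    · intro k hk
      simp only [Finset.mem_Ico, Finset.mem_range] at hk ⊢
      omega
    · intro k hk _; exact hl k (Finset.mem_range.1 hk)
  have h2 : ∑ k ∈ Finset.Ico (N - 2 * m) (N - m), R <
      ∑ k ∈ Finset.Ico (N - 2 * m) (N - m), m * l k := by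
    refine Finset.sum_lt_sum_of_nonempty ⟨N - 2 * m, by simp; omega⟩ fun k hk => ?_
    simp only [Finset.mem_Ico] at hk
    exact hcon k (N - k) (by omega) (by omega) (by omega) (by omega)
  rw [← Finset.mul_sum, Finset.sum_const, Nat.card_Ico, nsmul_eq_mul,
    show N - m - (N - 2 * m) = m by omega] at h2
  have hm' : (0 : ℝ) < m := by exact_mod_cast hm
  nlinarith

variable (G) in
/-- States reachable at negligible resource cost from the origin do not beat the bias. -/
theorem bias_le_val_of_dom {ε R : ℝ} (hε : 0 < ε) (hR : 0 ≤ R) : ∃ m₁ : ℕ, ∀ m ≥ m₁, ∃ r > 0,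
    ∀ m', m' ≤ 2 * m → ∀ (x a : V → ℝ) (F : E → ℝ), ‖x‖ ≤ r → a ∈ G.box → G.Gates F →
      G.Dom (G.step x F) a → m * ∑ n, G.nodeCost n (a n) ≤ R → G.bias - ε ≤ G.val m' a := by
  obtain ⟨C₁, hC₁0, hC₁⟩ := exists_small_dom G
  obtain ⟨C₂, hC₂0, hC₂⟩ := exists_repair G
  obtain ⟨K, hK0, hK, hKb⟩ := exists_step_bound G
  obtain ⟨S, hS0, hS⟩ := exists_stall_bound G
  obtain ⟨Ls, hLs0, hLs⟩ := exists_stage_lipschitz G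
  obtain ⟨κ, hκ0, hκf, hκx⟩ := exists_feasible_radius G
  obtain ⟨Ct, hCt0, hCt⟩ := exists_terminal_bound G
  obtain ⟨D, hD0, hD, -⟩ := exists_radius G
  choose L hL0 hL using exists_val_lipschitz G
  set U : ℝ := 2 * R + S * D + Ct with hU
  have hU0 : 0 ≤ U := by positivity
  -- `σ` is the weight of the auxiliary stock in a convex combination below. Since `U + Ct` bounds
  -- the possible gain in value at that stock, its contribution is at most `ε / 3`.
  set σ : ℝ := min (1 / 2) (ε / 3 / (U + Ct + 1)) with hσ
  have hσ0 : 0 < σ := by positivity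
  have hσ1 : σ ≤ 1 / 2 := min_le_left _ _
  have hσU : σ * (U + Ct) ≤ ε / 3 := by
    have h1 : σ * (U + Ct + 1) ≤ ε / 3 := (le_div_iff₀ (by positivity)).1 (min_le_right _ _)
    nlinarith
  set T : ℝ := 2 * C₁ + C₂ with hT
  have hT0 : 0 ≤ T := by positivity
  set A : ℝ := 1 + (1 + K) * T + Ls * T + (1 + (2 + 2 * K * C₁) / σ) with hA
  have a1 : 0 ≤ (1 + K) * T := by positivity
  have a2 : 0 ≤ Ls * T := by positivity
  have a3 : 0 ≤ (2 + 2 * K * C₁) / σ := by positivity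
  have hA0 : 0 < A := by positivity
  set d : ℝ := min κ (ε / 3) / A with hd
  have hd0 : 0 < d := by rw [hd]; positivity
  have hAd : A * d = min κ (ε / 3) := by rw [hd]; field_simp
  have key : ∀ X, X ≤ A → X * d ≤ κ ∧ X * d ≤ ε / 3 := fun X hX => by
    have := mul_le_mul_of_nonneg_right hX hd0.le
    rw [hAd] at this
    exact ⟨this.trans (min_le_left _ _), this.trans (min_le_right _ _)⟩
  obtain ⟨η, hη0, hη⟩ := exists_small_of_nodeCost G hd0
  obtain ⟨m₁, hm₁⟩ := exists_nat_ge (R / η + 1)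
  refine ⟨m₁, fun m hm => ?_⟩
  set Lm : ℝ := ∑ i ∈ Finset.range (2 * m + 1), L i with hLm
  have hLm0 : 0 ≤ Lm := Finset.sum_nonneg fun i _ => hL0 i
  refine ⟨min d (ε / 3 / (Lm * (1 + K * C₂) + 1)), by positivity,
    fun m' hm' x a F hxr ha hF hdom hcost => ?_⟩
  have hxd : ‖x‖ ≤ d := hxr.trans (min_le_left _ _)
  have hmR : R / η + 1 ≤ m := hm₁.trans (by exact_mod_cast hm)
  have hm0 : (0 : ℝ) < m := lt_of_lt_of_le (by positivity) hmR
  have hsum : ∑ n, G.nodeCost n (a n) ≤ η := by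
    have h1 : R / η ≤ m := by linarith
    rw [div_le_iff₀ hη0] at h1
    by_contra! hcon
    nlinarith [mul_lt_mul_of_pos_left hcon hm0]
  have had : ‖a‖ ≤ d := (pi_norm_le_iff_of_nonneg hd0.le).2 fun n =>
    hη n _ (ha.1 n) (ha.2 n) ((Finset.single_le_sum (f := fun n => G.nodeCost n (a n))
      (fun n _ => nodeCost_nonneg ha n) (Finset.mem_univ n)).trans hsum)
  obtain ⟨f, hfg, hfd, hfn⟩ := hC₁ x a F hF hdom
  have hfn' : ‖f‖ ≤ 2 * C₁ * d := hfn.trans (by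
    rw [mul_comm 2, mul_assoc]; exact mul_le_mul_of_nonneg_left (by linarith) hC₁0)
  set w := G.step x f with hw
  have hwn : ‖w‖ ≤ d + 2 * K * C₁ * d := by
    have := hK x f
    linarith [mul_le_mul_of_nonneg_left hfn' hK0]
  have hwa : ‖w - a‖ ≤ (2 + 2 * K * C₁) * d := (norm_sub_le _ _).trans (by linarith)
  have hwaσ : σ⁻¹ * ‖w - a‖ ≤ (2 + 2 * K * C₁) / σ * d := by
    rw [div_eq_inv_mul, mul_assoc]
    exact mul_le_mul_of_nonneg_left hwa (by positivity)
  have hsmall : ‖a‖ + σ⁻¹ * ‖w - a‖ ≤ κ := by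
    refine le_trans ?_ (key (1 + (2 + 2 * K * C₁) / σ) (by rw [hA]; linarith)).1
    linarith
  have hσinv : 1 ≤ σ⁻¹ := (one_le_inv₀ hσ0).2 (by linarith)
  have hwκ : ‖w‖ ≤ κ := by
    have h1 : ‖w‖ ≤ ‖a‖ + ‖w - a‖ := by
      have := norm_add_le a (w - a)
      rwa [add_sub_cancel] at this
    linarith [mul_le_mul_of_nonneg_right hσinv (norm_nonneg (w - a))]
  have hwbox : w ∈ G.box := hκx w fun n => ⟨fun hn => by
      rw [(hfd n).1 hn]; exact ⟨ha.1 n, ha.2 n⟩,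
    fun hn => (hn ▸ ha.1 n : (0 : ℝ) ≤ a n).trans ((hfd n).2.1 hn),
    fun hn => ((hfd n).2.2 hn).trans (hn ▸ ha.2 n : a n ≤ 0),
    fun _ => (abs_apply_le_norm w n).trans hwκ⟩
  -- The segment from `a` through `w` is prolonged by the factor `σ⁻¹`. It stays in the box because
  -- `w - a` vanishes at nodes without leakage and points inwards at the vanishing capacities;
  -- elsewhere smallness suffices. Hence `w` is a convex combination of `a` and this point, whose
  -- value is bounded because its permanent cost is that of `a`.
  have hbbox : a + σ⁻¹ • (w - a) ∈ G.box := hκx _ fun n => ⟨fun hn => by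
      have : w n = a n := (hfd n).1 hn
      simpa [this] using (⟨ha.1 n, ha.2 n⟩ : G.lo n ≤ a n ∧ a n ≤ G.hi n),
    fun hn => by
      have h1 : a n ≤ w n := (hfd n).2.1 hn
      have h2 : 0 ≤ a n := hn ▸ ha.1 n
      simp only [Pi.add_apply, Pi.smul_apply, Pi.sub_apply, smul_eq_mul]
      exact add_nonneg h2 (mul_nonneg (by positivity) (by linarith)),
    fun hn => by
      have h1 : w n ≤ a n := (hfd n).2.2 hn
      have h2 : a n ≤ 0 := hn ▸ ha.2 n
      simp only [Pi.add_apply, Pi.smul_apply, Pi.sub_apply, smul_eq_mul]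
      exact add_nonpos h2 (mul_nonpos_of_nonneg_of_nonpos (by positivity) (by linarith)),
    fun _ => by
      refine (abs_apply_le_norm _ n).trans ((norm_add_le _ _).trans ?_)
      rw [norm_smul, Real.norm_of_nonneg (by positivity)]
      exact hsmall⟩
  -- a nearby flow that is feasible from the origin
  obtain ⟨f', hf', hff'⟩ := hC₂ (fun n => G.α n = 1 ∨ G.lo n = 0) (fun n => G.α n = 1 ∨ G.hi n = 0)
    (fun e => G.fl e = 0) (fun e => G.fu e = 0) G.lo G.hi 0 0 f ‖x‖ (norm_nonneg _)
    (fun n hn => by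
      have h1 : |G.α n * x n| ≤ ‖x‖ := by
        rw [abs_mul, abs_of_nonneg (G.α_nonneg n)]
        exact (mul_le_of_le_one_left (abs_nonneg _) (G.α_le_one n)).trans (abs_apply_le_norm x n)
      have h2 : G.lo n ≤ w n := hwbox.1 n
      have h3 : w n = G.α n * x n + G.β n * G.inflow f n := rfl
      linarith [(abs_le.1 h1).2])
    (fun n hn => by
      have h1 : |G.α n * x n| ≤ ‖x‖ := by
        rw [abs_mul, abs_of_nonneg (G.α_nonneg n)]
        exact (mul_le_of_le_one_left (abs_nonneg _) (G.α_le_one n)).trans (abs_apply_le_norm x n)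
      have h2 : w n ≤ G.hi n := hwbox.2 n
      have h3 : w n = G.α n * x n + G.β n * G.inflow f n := rfl
      linarith [(abs_le.1 h1).1])
    (fun e he => by have := hfg.1 e he; simp; linarith [norm_nonneg x])
    (fun e he => by have := hfg.2 e he; simp; linarith [norm_nonneg x])
    ⟨0, fun n _ => by simpa using G.lo_nonpos n, fun n _ => by simpa using G.hi_nonneg n,
      fun _ _ => le_rfl, fun _ _ => le_rfl⟩
  have hf'g : G.Gates f' := ⟨hf'.p, hf'.q⟩
  have hf'n : ‖f'‖ ≤ T * d := by
    have h1 : ‖f'‖ ≤ ‖f‖ + ‖f' - f‖ := by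
      have := norm_add_le f (f' - f)
      rwa [add_sub_cancel] at this
    linarith [mul_le_mul_of_nonneg_left hxd hC₂0]
  have hf'κ : (1 + K) * ‖f'‖ ≤ κ := by
    refine le_trans ?_ (key ((1 + K) * T) (by rw [hA]; linarith)).1
    rw [mul_assoc]
    exact mul_le_mul_of_nonneg_left hf'n (by positivity)
  have hf'f : f' ∈ G.flows := hκf f' hf'g (by linarith [mul_nonneg hK0 (norm_nonneg f')])
  set y := G.step 0 f' with hy
  have hyb : ∀ n, y n = G.β n * G.inflow f' n := fun n => by simp [hy, step]
  have hyn : ‖y‖ ≤ κ := by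
    have := hK 0 f'
    rw [norm_zero, zero_add] at this
    linarith [norm_nonneg f']
  have hybox : y ∈ G.box := hκx y fun n => by
    rw [hyb]
    exact ⟨fun hn => ⟨hf'.lb n (Or.inl hn), hf'.ub n (Or.inl hn)⟩,
      fun hn => hn ▸ hf'.lb n (Or.inr hn), fun hn => hn ▸ hf'.ub n (Or.inr hn),
      fun _ => hyb n ▸ (abs_apply_le_norm y n).trans hyn⟩
  have hyw : ‖w - y‖ ≤ (1 + K * C₂) * ‖x‖ := by
    rw [hw, hy, step_sub, sub_zero]
    refine (hK _ _).trans ?_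
    rw [norm_sub_rev]
    linarith [mul_le_mul_of_nonneg_left hff' hK0]
  -- The stock `y`, close to `w`, is reached from the origin in one cheap stage, which compares `val
  -- m' w` with the value at the origin and hence with the bias.
  have e1 := val_succ_le zero_mem_box hf'f hybox m'
  have e2 := bias_le (G := G) (m' + 1)
  have e3 := hL m' w hwbox y hybox
  have e4 : L m' ≤ Lm := Finset.single_le_sum (f := L) (fun i _ => hL0 i)
    (Finset.mem_range.2 (by omega))
  have e5 : L m' * ‖w - y‖ ≤ ε / 3 := by
    have h1 : ‖x‖ * (Lm * (1 + K * C₂) + 1) ≤ ε / 3 :=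
      (le_div_iff₀ (by positivity)).1 (hxr.trans (min_le_right _ _))
    calc L m' * ‖w - y‖ ≤ Lm * ((1 + K * C₂) * ‖x‖) := mul_le_mul e4 hyw (norm_nonneg _) hLm0
      _ ≤ ε / 3 := by linarith [norm_nonneg x]
  have e6 := (abs_le.1 (hLs 0 zero_mem_box 0 zero_mem_box f' hf'f 0 zero_mem_flows)).2
  rw [stage_zero_zero, sub_zero, sub_zero, sub_zero, norm_zero, zero_add] at e6
  have e7 : Ls * ‖f'‖ ≤ ε / 3 := by
    refine le_trans ?_ (key (Ls * T) (by rw [hA]; linarith)).2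
    rw [mul_assoc]
    exact mul_le_mul_of_nonneg_left hf'n hLs0
  have e8 := val_add_smul_le (p := 1 - σ) (q := σ) (by linarith) hσ0.le (by ring) m' ha hbbox
  have e9 : (1 - σ) • a + σ • (a + σ⁻¹ • (w - a)) = w := by
    rw [smul_add, smul_smul, mul_inv_cancel₀ hσ0.ne', one_smul, sub_smul, one_smul]; abel
  rw [e9] at e8
  have e10 := val_le_of_stall hCt hS m' hbbox
  have e11 : G.zCost (a + σ⁻¹ • (w - a)) = G.zCost a := zCost_congr fun n hn => by
    have : w n = a n := (hfd n).1 hn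
    simp [this]
  have e12 : G.zCost a ≤ ∑ n, G.nodeCost n (a n) := by
    refine Finset.sum_le_sum fun n _ => ?_
    split_ifs
    · exact le_rfl
    · exact nodeCost_nonneg ha n
  have e13 : (m' : ℝ) * G.zCost a ≤ 2 * R := by
    have h1 : (m' : ℝ) ≤ 2 * m := by exact_mod_cast hm'
    have h2 : 0 ≤ ∑ n, G.nodeCost n (a n) := Finset.sum_nonneg fun n _ => nodeCost_nonneg ha n
    calc (m' : ℝ) * G.zCost a ≤ m' * ∑ n, G.nodeCost n (a n) :=
          mul_le_mul_of_nonneg_left e12 (Nat.cast_nonneg _)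
      _ ≤ 2 * m * ∑ n, G.nodeCost n (a n) := mul_le_mul_of_nonneg_right h1 h2
      _ ≤ 2 * R := by linarith
  have e14 : S * ‖a + σ⁻¹ • (w - a)‖ ≤ S * D := mul_le_mul_of_nonneg_left (hD _ hbbox) hS0
  rw [e11] at e10
  have e15 := val_ge hCt m' ha
  have e16 : G.val m' (a + σ⁻¹ • (w - a)) - G.val m' a ≤ U + Ct := by linarith
  linarith [mul_le_mul_of_nonneg_left e16 hσ0.le]

variable (G) in
-- An optimal plan passes, with between `m` and `2 * m` stages left, through a stock of negligible
-- cost. Until then it pays at least `rho x` per stage, and the rest costs at least the bias by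
-- `bias_le_val_of_dom`. The radius is chosen so that `m * rho x` is negligible, which accounts for
-- the stages left.
theorem le_val_of_small {ε : ℝ} (hε : 0 < ε) : ∃ r > 0, ∃ n₀ : ℕ, ∀ x ∈ G.box, ‖x‖ ≤ r →
    ∀ n ≥ n₀, n * G.rho x + G.bias - ε ≤ G.val n x := by
  obtain ⟨r₁, hr₁, n₁, h₁⟩ := val_le_of_small G one_pos
  obtain ⟨Ct, hCt0, hCt⟩ := exists_terminal_bound G
  obtain ⟨Cz, hCz0, hCz⟩ := exists_zCost_bound G
  set R : ℝ := |G.bias| + 1 + Ct with hR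
  have hR0 : 0 ≤ R := by positivity
  obtain ⟨m₁, hm₁⟩ := bias_le_val_of_dom G (show 0 < ε / 2 by positivity)
    (show 0 ≤ R + 1 by positivity)
  set m : ℕ := max m₁ (max n₁ 1) with hm
  obtain ⟨r₂, hr₂, h₂⟩ := hm₁ m (le_max_left _ _)
  have hm1 : 1 ≤ m := (le_max_right _ _).trans (le_max_right _ _)
  have hmn : n₁ ≤ m := (le_max_left _ _).trans (le_max_right _ _)
  have hm0 : (0 : ℝ) < m := by exact_mod_cast hm1
  refine ⟨min (min r₁ r₂) (min 1 (ε / 4) / (m * (Cz + 1))), by positivity, 2 * m + 1,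
    fun x hx hxr n hn => ?_⟩
  have hxr₁ := hxr.trans ((min_le_left _ _).trans (min_le_left _ _))
  have hxr₂ := hxr.trans ((min_le_left _ _).trans (min_le_right _ _))
  have hmrho : m * G.rho x ≤ min 1 (ε / 4) := by
    have h3 := hxr.trans (min_le_right _ _)
    rw [le_div_iff₀ (by positivity)] at h3
    have h4 := (rho_le_zCost hx).trans (hCz x hx)
    linarith [norm_nonneg x, mul_le_mul_of_nonneg_left h4 hm0.le, mul_nonneg hm0.le (norm_nonneg x)]
  obtain ⟨f, hf⟩ := exists_isOpt hx n
  have hup := h₁ x hx hxr₁ n (by omega)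
  have hsum : ∑ k ∈ Finset.range n, (G.stage (G.traj x f k) (f k) - G.rho x) ≤ R := by
    rw [Finset.sum_sub_distrib, Finset.sum_const, Finset.card_range, nsmul_eq_mul]
    have h3 := hf.2
    have h4 := (abs_le.1 (hCt _ (hf.1.2 n le_rfl))).1
    simp only [cost] at h3
    linarith [le_abs_self G.bias]
  obtain ⟨k, m', rfl, hmm', hm'2, hk, hle⟩ := exists_cheap_stage
    (fun k hk => sub_nonneg.2 (hf.1.rho_le_stage hk.le)) hsum (by omega) (by omega : 2 * m ≤ n)
  obtain ⟨k, rfl⟩ : ∃ j, k = j + 1 := ⟨k - 1, by omega⟩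
  have hpl : G.IsPlan (k + 1) x f := hf.1.mono (by omega)
  obtain ⟨F, hF, hdom⟩ := hpl.exists_dom
  have ha := hpl.2 _ le_rfl
  have hnode : ∑ n, G.nodeCost n (G.traj x f (k + 1) n) ≤
      G.stage (G.traj x f (k + 1)) (f (k + 1)) := by
    have : 0 ≤ ∑ e, G.edgeCost e (f (k + 1) e) :=
      Finset.sum_nonneg fun e _ => edgeCost_nonneg (hf.1.1 _) e
    simp only [stage]; linarith
  have h3 := h₂ m' hm'2 x _ F hxr₂ ha hF hdom (by
    have := mul_le_mul_of_nonneg_left hnode hm0.le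
    have h5 := hmrho.trans (min_le_left _ _)
    linarith)
  have h4 := hf.val_eq
  have h5 : ∑ j ∈ Finset.range (k + 1), G.rho x ≤
      ∑ j ∈ Finset.range (k + 1), G.stage (G.traj x f j) (f j) :=
    Finset.sum_le_sum fun j hj => hf.1.rho_le_stage (by have := Finset.mem_range.1 hj; omega)
  rw [Finset.sum_const, Finset.card_range, nsmul_eq_mul] at h5
  have h6 : (m' : ℝ) * G.rho x ≤ 2 * m * G.rho x :=
    mul_le_mul_of_nonneg_right (by exact_mod_cast hm'2) (rho_nonneg hx)
  have h7 := hmrho.trans (min_le_right _ _)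
  push_cast at h5 ⊢
  linarith

variable (G) in
/-- An optimal plan of bounded excess cost visits, at a bounded distance from the end, a stage
where it can be prolonged by a stage of negligible cost. -/
theorem exists_good_stage (R : ℝ) {ε : ℝ} (hε : 0 < ε) : ∃ ρ₀ > 0, ∃ M : ℕ, ∀ N > M, ∀ x ∈ G.box,
    ∀ f, G.IsOpt N x f → G.rho x ≤ ρ₀ → G.val N x - N * G.rho x ≤ R →
    ∃ K m, N = K + m ∧ 1 ≤ K ∧ m ≤ M ∧
      ∑ j ∈ Finset.range K, (G.stage (G.traj x f j) (f j) - G.rho x) ≤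
        G.val N x - N * G.rho x - G.bias + ε ∧
      G.val (m + 1) (G.traj x f K) ≤ G.val m (G.traj x f K) + ε := by
  obtain ⟨r₁, hr₁, n₁, h₁⟩ := val_le_of_small G (show 0 < ε / 4 by positivity)
  obtain ⟨r₂, hr₂, n₂, h₂⟩ := le_val_of_small G (show 0 < ε / 4 by positivity)
  obtain ⟨Ct, hCt0, hCt⟩ := exists_terminal_bound G
  obtain ⟨η, hη0, hη⟩ := exists_small_of_nodeCost G (lt_min hr₁ hr₂)
  obtain ⟨m₁, hm₁⟩ := exists_nat_ge ((|R| + Ct + 1) / min η (ε / 2))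
  set m : ℕ := max m₁ (max (max n₁ n₂) 1) with hm
  have hm1 : 1 ≤ m := (le_max_right _ _).trans (le_max_right _ _)
  have hmn₁ : n₁ ≤ m := (le_max_left _ _).trans ((le_max_left _ _).trans (le_max_right _ _))
  have hmn₂ : n₂ ≤ m := (le_max_right _ _).trans ((le_max_left _ _).trans (le_max_right _ _))
  have hm0 : (0 : ℝ) < m := by exact_mod_cast hm1
  have hmη : |R| + Ct + 1 ≤ m * min η (ε / 2) :=
    (div_le_iff₀ (by positivity)).1 (hm₁.trans (by exact_mod_cast le_max_left _ _))
  refine ⟨1 / m, by positivity, 2 * m, fun N hN x hx f hf hrho hR => ?_⟩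
  have hmrho : m * G.rho x ≤ 1 := by
    rw [le_div_iff₀ hm0] at hrho; linarith
  have hsum : ∑ k ∈ Finset.range N, (G.stage (G.traj x f k) (f k) - G.rho x) ≤ |R| + Ct := by
    rw [Finset.sum_sub_distrib, Finset.sum_const, Finset.card_range, nsmul_eq_mul]
    have h3 := hf.2
    have h4 := (abs_le.1 (hCt _ (hf.1.2 N le_rfl))).1
    simp only [cost] at h3
    linarith [le_abs_self R]
  obtain ⟨k, m', rfl, hmm', hm'2, hk, hle⟩ := exists_cheap_stage
    (fun k hk => sub_nonneg.2 (hf.1.rho_le_stage hk.le)) hsum (by omega) hN.le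
  have hpl : G.IsPlan k x f := hf.1.mono (by omega)
  have ha := hpl.2 _ le_rfl
  have hst : G.stage (G.traj x f k) (f k) ≤ min η (ε / 2) := by
    by_contra! hcon
    nlinarith [mul_lt_mul_of_pos_left hcon hm0]
  have hnode : ∑ n, G.nodeCost n (G.traj x f k n) ≤ G.stage (G.traj x f k) (f k) := by
    have : 0 ≤ ∑ e, G.edgeCost e (f k e) :=
      Finset.sum_nonneg fun e _ => edgeCost_nonneg (hf.1.1 _) e
    simp only [stage]; linarith
  have hsm : ‖G.traj x f k‖ ≤ min r₁ r₂ :=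
    (pi_norm_le_iff_of_nonneg (lt_min hr₁ hr₂).le).2 fun n => hη n _ (ha.1 n) (ha.2 n)
      ((Finset.single_le_sum (f := fun n => G.nodeCost n (G.traj x f k n))
        (fun n _ => nodeCost_nonneg ha n) (Finset.mem_univ n)).trans
        (hnode.trans (hst.trans (min_le_left _ _))))
  -- At a small stock both one-sided estimates hold. Comparing horizons `m' + 1` and `m'` leaves one
  -- additional `rho` of that stock, at most `ε / 2`, and two errors `ε / 4`.
  have e1 := h₁ _ ha (hsm.trans (min_le_left _ _)) (m' + 1) (by omega)
  have e2 := h₂ _ ha (hsm.trans (min_le_right _ _)) m' (by omega)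
  have e3 := hpl.rho_le_traj
  have e4 := ((rho_le_zCost ha).trans (zCost_le_stage ha (hf.1.1 k))).trans
    (hst.trans (min_le_right _ _))
  refine ⟨k, m', rfl, by omega, hm'2, ?_, ?_⟩
  · rw [Finset.sum_sub_distrib, Finset.sum_const, Finset.card_range, nsmul_eq_mul]
    have h4 := hf.val_eq
    have e5 := mul_le_mul_of_nonneg_left e3 (Nat.cast_nonneg m' : (0 : ℝ) ≤ m')
    push_cast
    linarith
  · push_cast at e1; linarith

end Net

/-! ### Prices along optimal plans. -/

namespace Net

variable {V E : Type} [Fintype V] [Fintype E] [DecidableEq V] {G : Net V E}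

theorem coordinate_min {ι : Type} [Fintype ι] {a b x : ι → ℝ} {φ : ι → ℝ → ℝ}
    (hx : x ∈ Set.Icc a b) (h : ∀ y ∈ Set.Icc a b, ∑ i, φ i (x i) ≤ ∑ i, φ i (y i)) (i : ι) (t : ℝ)
    (h1 : a i ≤ t) (h2 : t ≤ b i) : φ i (x i) ≤ φ i t := by
  classical
  have h3 := h (Function.update x i t) ⟨fun j => ?_, fun j => ?_⟩
  · rw [← Finset.add_sum_erase _ _ (Finset.mem_univ i),
      ← Finset.add_sum_erase _ (fun j => φ j (Function.update x i t j)) (Finset.mem_univ i)] at h3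
    have h4 : ∑ j ∈ Finset.univ.erase i, φ j (Function.update x i t j) =
        ∑ j ∈ Finset.univ.erase i, φ j (x j) := by
      refine Finset.sum_congr rfl fun j hj => ?_
      rw [Function.update_of_ne (Finset.ne_of_mem_erase hj)]
    rw [h4, Function.update_self] at h3
    linarith
  · by_cases hj : j = i
    · subst hj; simpa using h1
    · simpa [hj] using hx.1 j
  · by_cases hj : j = i
    · subst hj; simpa using h2
    · simpa [hj] using hx.2 j

variable (G) in
def edgeSum (f : E → ℝ) : ℝ := ∑ e, G.edgeCost e (f e)

theorem edgeSum_add_smul_le {p q : ℝ} (hp : 0 ≤ p) (hq : 0 ≤ q) (hpq : p + q = 1)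
    (f g : E → ℝ) : G.edgeSum (p • f + q • g) ≤ p * G.edgeSum f + q * G.edgeSum g := by
  simp only [edgeSum]
  rw [Finset.mul_sum, Finset.mul_sum, ← Finset.sum_add_distrib]
  exact Finset.sum_le_sum fun e _ => convexOn_quadratic _ _ (G.ρ_nonneg e) _ _ _ _ hp hq hpq

/-- The defect of the dynamics, as a linear map. -/
def defect (G : Net V E) : ((V → ℝ) × (E → ℝ) × (V → ℝ)) →ₗ[ℝ] (V → ℝ) where
  toFun z := G.step z.1 z.2.1 - z.2.2
  map_add' z w := by
    simp only [Prod.fst_add, Prod.snd_add, step_add]; abel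
  map_smul' r z := by
    ext n; simp [step]; ring

variable (G) in
/-- Bounded multipliers for the dynamics of one stage. -/
theorem exists_stage_multiplier (m : ℕ) : ∃ C : ℝ, 0 ≤ C ∧ ∀ (D : Set (V → ℝ)) (ψ : (V → ℝ) → ℝ)
    (x₀ : V → ℝ) (f₀ : E → ℝ), D ⊆ G.box → ConvexOn ℝ D ψ → x₀ ∈ D → f₀ ∈ G.flows →
    G.step x₀ f₀ ∈ G.box →
    (∀ x ∈ D, ∀ f ∈ G.flows, G.step x f ∈ G.box → ψ x₀ + G.edgeSum f₀ + G.val m (G.step x₀ f₀) ≤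
      ψ x + G.edgeSum f + G.val m (G.step x f)) →
    ∃ μ : V → ℝ, (∀ n, |μ n| ≤ C) ∧ ∀ x ∈ D, ∀ f ∈ G.flows, ∀ y ∈ G.box,
      ψ x₀ + G.edgeSum f₀ + G.val m (G.step x₀ f₀) ≤
        ψ x + G.edgeSum f + G.val m y + ∑ n, μ n * (y n - G.step x f n) := by
  classical
  obtain ⟨L, hL0, hL⟩ := exists_val_lipschitz G m
  obtain ⟨C, hC0, hC⟩ := exists_flow_repair G
  obtain ⟨S, hS0, hS⟩ := exists_stage_lipschitz G
  obtain ⟨K, hK0, hK, -⟩ := exists_step_bound G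
  -- The weight of an exact penalty: a defect of the dynamics is removed by repairing the flow, with
  -- edge cost `S * C`, and by adjusting the end stock, with value `L * (1 + K * C)`. The starting
  -- stock is not moved, so `W` depends neither on `D` nor on `ψ`.
  set W : ℝ := S * C + L * (1 + K * C) with hW
  have hW0 : 0 ≤ W := by positivity
  refine ⟨W, hW0, fun D ψ x₀ f₀ hD hψ hx₀ hf₀ hy₀ hmin => ?_⟩
  set M := ψ x₀ + G.edgeSum f₀ + G.val m (G.step x₀ f₀) with hM
  have hφ : ConvexOn ℝ (D ×ˢ G.flows ×ˢ G.box)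
      (fun z : (V → ℝ) × (E → ℝ) × (V → ℝ) => ψ z.1 + G.edgeSum z.2.1 + G.val m z.2.2) := by
    refine ⟨hψ.1.prod (convex_flows.prod convex_box), ?_⟩
    rintro ⟨x, f, y⟩ ⟨hx, hf, hy⟩ ⟨x', f', y'⟩ ⟨hx', hf', hy'⟩ p q hp hq hpq
    have h1 := hψ.2 hx hx' hp hq hpq
    have h2 := edgeSum_add_smul_le (G := G) hp hq hpq f f'
    have h3 := val_add_smul_le hp hq hpq m hy hy'
    simp only [Prod.smul_mk, Prod.mk_add_mk, smul_eq_mul] at h1 h2 h3 ⊢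
    linarith
  have hWc : ConvexOn ℝ Set.univ fun h : V → ℝ => W * ‖h‖ := by
    have := (convexOn_norm (E := V → ℝ) convex_univ).smul hW0
    simpa using this
  have hpen : ∀ z ∈ D ×ˢ G.flows ×ˢ G.box, M ≤
      ψ z.1 + G.edgeSum z.2.1 + G.val m z.2.2 + W * ‖G.defect z - 0‖ := by
    rintro ⟨x, f, y⟩ ⟨hx, hf, hy⟩
    obtain ⟨g, hg, hyg, hgd⟩ := hC x (hD hx) f hf y hy
    have h1 := hmin x hx g hg hyg
    have h2 := (abs_le.1 (hS x (hD hx) x (hD hx) g hg f hf)).2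
    have h3 : G.stage x g - G.stage x f = G.edgeSum g - G.edgeSum f := by
      simp only [stage, edgeSum]; ring
    rw [h3, sub_self, norm_zero, zero_add] at h2
    have h4 := hL y hy _ hyg
    have h5 : ‖y - G.step x g‖ ≤ ‖G.step x f - y‖ + K * ‖g - f‖ := by
      have e : y - G.step x g = -(G.step x f - y) - G.step 0 (g - f) := by
        rw [← sub_self x, ← step_sub]; abel
      rw [e]
      refine (norm_sub_le _ _).trans ?_
      rw [norm_neg]
      have := hK 0 (g - f)
      rw [norm_zero, zero_add] at this
      linarith
    have h6 := mul_le_mul_of_nonneg_left hgd hS0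
    have h7 := mul_le_mul_of_nonneg_left (h5.trans (add_le_add_right
      (mul_le_mul_of_nonneg_left hgd hK0) _)) hL0
    have h8 : ‖G.defect (x, f, y) - 0‖ = ‖G.step x f - y‖ := by rw [sub_zero]; rfl
    rw [h8, hW]
    simp only
    linarith
  have hne : (D ×ˢ G.flows ×ˢ G.box).Nonempty := ⟨(x₀, f₀, G.step x₀ f₀), hx₀, hf₀, hy₀⟩
  obtain ⟨l, hl⟩ := exists_multiplier hne hφ G.defect 0 hWc
    (by fun_prop) M hpen
  -- The multiplier inherits the bound of the penalty, by inserting the minimizer itself, which has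
  -- no defect.
  have hlW : ∀ h, l h ≤ W * ‖h‖ := fun h => by
    have h1 := hl (x₀, f₀, G.step x₀ f₀) ⟨hx₀, hf₀, hy₀⟩ h
    have h2 : G.defect (x₀, f₀, G.step x₀ f₀) = 0 := sub_self _
    rw [h2, sub_zero, zero_sub, map_neg] at h1
    simp only at h1
    linarith
  have hlsum : ∀ h : V → ℝ, l h = ∑ n, h n * l (Pi.single n 1) := fun h => by
    conv_lhs => rw [← Finset.univ_sum_single h]
    rw [map_sum]
    refine Finset.sum_congr rfl fun n _ => ?_
    have : Pi.single n (h n) = h n • (Pi.single n 1 : V → ℝ) := by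
      rw [← Pi.single_smul]; simp
    rw [this, map_smul, smul_eq_mul]
  refine ⟨fun n => -l (Pi.single n 1), fun n => ?_, fun x hx f hf y hy => ?_⟩
  · rw [abs_neg, abs_le]
    have h0 : ‖(Pi.single n 1 : V → ℝ)‖ ≤ 1 := by
      refine (pi_norm_le_iff_of_nonneg zero_le_one).2 fun j => ?_
      by_cases hj : j = n
      · subst hj; simp
      · simp [Pi.single_eq_of_ne hj]
    have h1 := hlW (Pi.single n 1)
    have h2 := hlW (-Pi.single n 1)
    rw [map_neg, norm_neg] at h2
    constructor <;> nlinarith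
  · have h1 := hl (x, f, y) ⟨hx, hf, hy⟩ 0
    rw [norm_zero, mul_zero, add_zero, sub_zero, sub_zero, hlsum] at h1
    refine h1.trans (le_of_eq ?_)
    congr 1
    refine Finset.sum_congr rfl fun n _ => ?_
    simp only [defect, LinearMap.coe_mk, AddHom.coe_mk, Pi.sub_apply]
    ring

theorem sum_mul_step (μ x : V → ℝ) (f : E → ℝ) : ∑ n, μ n * G.step x f n =
    ∑ n, μ n * (G.α n * x n) +
      ∑ e, f e * (G.β (G.head e) * μ (G.head e) - G.β (G.tail e) * μ (G.tail e)) := by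
  rw [← sum_mul_inflow (G := G) (fun n => G.β n * μ n), ← Finset.sum_add_distrib]
  refine Finset.sum_congr rfl fun n _ => ?_
  simp only [step]; ring

variable (G) in
/-- Prices along an optimal plan: the flows and the stocks minimize their costs coordinatewise,
and the prices are bounded in terms of the remaining horizon. -/
theorem exists_prices : ∃ C : ℕ → ℝ, (∀ m, 0 ≤ C m) ∧ ∀ (N : ℕ) (x : V → ℝ) (f : ℕ → E → ℝ),
    G.IsOpt N x f → ∃ μ : ℕ → V → ℝ,
      (∀ k < N, ∀ n, |μ (k + 1) n| ≤ C (N - (k + 1))) ∧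
      (∀ k < N, ∀ e t, G.fl e ≤ t → t ≤ G.fu e →
        G.edgeCost e (f k e) - f k e * (G.β (G.head e) * μ (k + 1) (G.head e) -
          G.β (G.tail e) * μ (k + 1) (G.tail e)) ≤
        G.edgeCost e t - t * (G.β (G.head e) * μ (k + 1) (G.head e) -
          G.β (G.tail e) * μ (k + 1) (G.tail e))) ∧
      ∀ k < N, 1 ≤ k → ∀ n t, G.lo n ≤ t → t ≤ G.hi n →
        G.nodeCost n (G.traj x f k n) + (μ k n - G.α n * μ (k + 1) n) * G.traj x f k n ≤
          G.nodeCost n t + (μ k n - G.α n * μ (k + 1) n) * t := by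
  choose C hC0 hC using exists_stage_multiplier G
  refine ⟨C, hC0, fun N x f hf => ?_⟩
  set X := G.traj x f with hX
  have hXb : ∀ k ≤ N, X k ∈ G.box := hf.1.2
  have hval : ∀ k < N, G.val (N - k) (X k) =
      G.stage (X k) (f k) + G.val (N - (k + 1)) (X (k + 1)) := fun k hk => by
    obtain ⟨m, rfl⟩ : ∃ m, N = k + (m + 1) := ⟨N - (k + 1), by omega⟩
    have h := hf.tail.val_succ
    rw [show k + (m + 1) - k = m + 1 by omega, show k + (m + 1) - (k + 1) = m by omega]
    exact h
  -- The initial stock is prescribed, so at time `0` only the flow varies; the optimality of the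
  -- stocks is available from time `1` on.
  let Dk : ℕ → Set (V → ℝ) := fun k => if k = 0 then {x} else G.box
  have hDk : ∀ k, Dk k ⊆ G.box := fun k => by
    simp only [Dk]; split_ifs
    · intro y hy; rw [Set.mem_singleton_iff.1 hy]; exact hf.1.start
    · exact subset_rfl
  have hDc : ∀ k, Convex ℝ (Dk k) := fun k => by
    simp only [Dk]; split_ifs
    · exact convex_singleton _
    · exact convex_box
  have hXD : ∀ k ≤ N, X k ∈ Dk k := fun k hk => by
    simp only [Dk]; split_ifs with h
    · subst h; rfl
    · exact hXb k hk
  -- The prices are constructed forwards in time: `μ k` makes the stock `X k` optimal for the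
  -- remaining value plus a linear term, and the multiplier of stage `k` passes this property on.
  -- Its size depends only on the number of stages that remain.
  let Inv : ℕ → (V → ℝ) → Prop := fun k μ => ∀ y ∈ Dk k,
    G.val (N - k) (X k) + ∑ n, μ n * X k n ≤ G.val (N - k) y + ∑ n, μ n * y n
  let Opt : ℕ → (V → ℝ) → (V → ℝ) → Prop := fun k μ ν => (∀ n, |ν n| ≤ C (N - (k + 1))) ∧
    ∀ y ∈ Dk k, ∀ g ∈ G.flows,
      ∑ n, G.nodeCost n (X k n) + ∑ n, μ n * X k n + G.edgeSum (f k) -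
        ∑ n, ν n * G.step (X k) (f k) n ≤
      ∑ n, G.nodeCost n (y n) + ∑ n, μ n * y n + G.edgeSum g - ∑ n, ν n * G.step y g n
  have hstep : ∀ k < N, ∀ μ, Inv k μ → ∃ ν, Inv (k + 1) ν ∧ Opt k μ ν := by
    intro k hk μ hμ
    have hψ : ConvexOn ℝ (Dk k) fun y => ∑ n, G.nodeCost n (y n) + ∑ n, μ n * y n := by
      refine ⟨hDc k, fun y _ z _ p q hp hq hpq => ?_⟩
      simp only [smul_eq_mul, mul_add, Finset.mul_sum, ← Finset.sum_add_distrib]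
      refine Finset.sum_le_sum fun n _ => ?_
      have := convexOn_quadratic (G.γ n) (G.c n + μ n) (G.γ_nonneg n) (y n) (z n) p q hp hq hpq
      simp only [nodeCost, Pi.add_apply, Pi.smul_apply, smul_eq_mul]
      linarith
    obtain ⟨ν, hν, hmin⟩ := hC (N - (k + 1)) (Dk k) _ (X k) (f k) (hDk k) hψ (hXD k hk.le)
      (hf.1.1 k) (hXb (k + 1) hk) (by
        intro y hy g hg hyg
        have h1 := hμ y hy
        have h2 := val_succ_le (hDk k hy) hg hyg (N - (k + 1))
        rw [show N - (k + 1) + 1 = N - k by omega] at h2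
        have h3 := hval k hk
        have h4 : X (k + 1) = G.step (X k) (f k) := rfl
        rw [h4] at h3
        simp only [stage] at h2 h3
        simp only [edgeSum]
        linarith)
    refine ⟨ν, fun y hy => ?_, hν, fun y hy g hg => ?_⟩
    · have h1 := hmin (X k) (hXD k hk.le) (f k) (hf.1.1 k) y (hDk _ hy)
      have h4 : X (k + 1) = G.step (X k) (f k) := rfl
      simp only [mul_sub, Finset.sum_sub_distrib] at h1
      rw [h4]
      linarith
    · have h1 := hmin y hy g hg _ (hXb (k + 1) hk)
      have h4 : X (k + 1) = G.step (X k) (f k) := rfl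
      rw [h4] at h1
      simp only [mul_sub, Finset.sum_sub_distrib] at h1
      linarith
  have hseq : ∀ j ≤ N, ∃ μ : ℕ → V → ℝ, Inv j (μ j) ∧ ∀ k < j, Opt k (μ k) (μ (k + 1)) := by
    intro j
    induction j with
    | zero =>
      refine fun _ => ⟨0, fun y hy => ?_, fun k hk => absurd hk (Nat.not_lt_zero _)⟩
      have : y = x := by simpa [Dk] using hy
      rw [this]; exact le_rfl
    | succ j ih =>
      intro hj
      obtain ⟨μ, h1, h2⟩ := ih (by omega)
      obtain ⟨ν, h3, h4⟩ := hstep j hj _ h1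
      refine ⟨Function.update μ (j + 1) ν, by rwa [Function.update_self], fun k hk => ?_⟩
      rw [Function.update_of_ne (show k ≠ j + 1 by omega)]
      rcases Nat.lt_succ_iff_lt_or_eq.1 hk with h | rfl
      · rw [Function.update_of_ne (show k + 1 ≠ j + 1 by omega)]
        exact h2 k h
      · rwa [Function.update_self]
  obtain ⟨μ, -, hμ⟩ := hseq N le_rfl
  refine ⟨μ, fun k hk => (hμ k hk).1, fun k hk e t h1 h2 => ?_, fun k hk hk1 n t h1 h2 => ?_⟩
  · refine coordinate_min (φ := fun e t => G.edgeCost e t - t * (G.β (G.head e) * μ (k + 1) (G.head e) -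
      G.β (G.tail e) * μ (k + 1) (G.tail e))) (hf.1.1 k) (fun g hg => ?_) e t h1 h2
    have h3 := (hμ k hk).2 (X k) (hXD k hk.le) g hg
    rw [sum_mul_step, sum_mul_step] at h3
    simp only [Finset.sum_sub_distrib]
    simp only [edgeSum] at h3
    linarith
  · refine coordinate_min (φ := fun n t => G.nodeCost n t +
      (μ k n - G.α n * μ (k + 1) n) * t) (hXb k hk.le) (fun y hy => ?_) n t h1 h2
    have hyD : y ∈ Dk k := by
      simp only [Dk]
      rw [if_neg (by omega)]
      exact hy
    have h3 := (hμ k hk).2 y hyD (f k) (hf.1.1 k)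
    rw [sum_mul_step, sum_mul_step] at h3
    have h4 : ∀ z : V → ℝ, ∑ n, (G.nodeCost n (z n) + (μ k n - G.α n * μ (k + 1) n) * z n) =
        ∑ n, G.nodeCost n (z n) + ∑ n, μ k n * z n - ∑ n, μ (k + 1) n * (G.α n * z n) := fun z => by
      rw [← Finset.sum_add_distrib, ← Finset.sum_sub_distrib]
      exact Finset.sum_congr rfl fun n _ => by ring
    rw [h4, h4]
    linarith

end Net

/-! ### Prices, closed sets and the monotonicity of shortages. -/

namespace Net

variable {V E : Type} [Fintype V] [Fintype E] [DecidableEq V] {G : Net V E}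

variable (G) in
/-- A trajectory near the origin together with prices `p` supporting it.  The prices are bounded
in terms of the number of remaining stages. -/
structure PriceSystem (K : ℕ) (L r : ℝ) (C : ℕ → ℝ) (x : ℕ → V → ℝ) (f : ℕ → E → ℝ)
    (p : ℕ → V → ℝ) : Prop where
  step : ∀ k < K, x (k + 1) = G.step (x k) (f k)
  box : ∀ k ≤ K, x k ∈ G.box
  flows : ∀ k < K, f k ∈ G.flows
  small : ∀ k < K, ∀ n, |x k n| ≤ r
  flow_sign : ∀ k < K, ∀ e, 0 ≤ f k e * (p (k + 1) (G.head e) - p (k + 1) (G.tail e))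
  gate_up : ∀ k < K, ∀ e, L < p (k + 1) (G.head e) - p (k + 1) (G.tail e) → G.fu e = 0
  gate_down : ∀ k < K, ∀ e, p (k + 1) (G.head e) - p (k + 1) (G.tail e) < -L → G.fl e = 0
  price_lt : ∀ k < K, 1 ≤ k → ∀ n, x k n < G.hi n →
    -(G.β n * (2 * G.γ n * x k n + G.c n)) ≤ p k n - G.α n * p (k + 1) n
  price_gt : ∀ k < K, 1 ≤ k → ∀ n, G.lo n < x k n →
    p k n - G.α n * p (k + 1) n ≤ -(G.β n * (2 * G.γ n * x k n + G.c n))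
  price_zero : ∀ k ≤ K, 1 ≤ k → ∀ n, G.β n = 0 → p k n = 0
  bound : ∀ k ≤ K, 1 ≤ k → ∀ n, |p k n| ≤ C (K - k)

variable (G) in
/-- Nodes whose content can only decrease by leakage. -/
def Retains (n : V) : Prop := 0 < G.β n ∧ (G.α n = 1 ∨ G.lo n = 0)

variable (G) in
/-- Sets of retaining nodes that no admissible flow enters. -/
def Closed (S : Finset V) : Prop := (∀ n ∈ S, G.Retains n) ∧
  ∀ e, (G.tail e ∉ S → G.head e ∈ S → G.fu e = 0) ∧ (G.tail e ∈ S → G.head e ∉ S → G.fl e = 0)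

variable (G) in
-- The stock left after one leakage, in units of inflow: for `0 < G.β n`, the next stock is `G.β n`
-- times the content plus the inflow.
noncomputable def content (n : V) (t : ℝ) : ℝ := G.α n * t / G.β n

variable (G) in
/-- The content at which the marginal cost of a shortage is `h`. -/
noncomputable def target (h : ℝ) (n : V) : ℝ :=
  if G.α n = 1 then max (G.lo n) (min (G.hi n) (-(h / G.β n + G.c n) / (2 * G.γ n))) / G.β n else 0

variable (G) in
noncomputable def gap (h : ℝ) (n : V) (t : ℝ) : ℝ := G.target h n - G.content n t

variable (G) in
noncomputable def shortage (h : ℝ) (S : Finset V) (x : V → ℝ) : ℝ := ∑ n ∈ S, G.gap h n (x n)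

theorem sum_inflow_nonneg {S : Finset V} {f : E → ℝ}
    (h_in : ∀ e, G.tail e ∉ S → G.head e ∈ S → 0 ≤ f e)
    (h_out : ∀ e, G.tail e ∈ S → G.head e ∉ S → f e ≤ 0) : 0 ≤ ∑ n ∈ S, G.inflow f n := by
  have h := sum_mul_inflow (G := G) (fun n => if n ∈ S then 1 else 0) f
  simp only [ite_mul, one_mul, zero_mul, Finset.sum_ite_mem, Finset.univ_inter] at h
  rw [h]
  refine Finset.sum_nonneg fun e _ => ?_
  by_cases h1 : G.head e ∈ S <;> by_cases h2 : G.tail e ∈ S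
  · simp [h1, h2]
  · simpa [h1, h2] using h_in e h2 h1
  · simpa [h1, h2] using h_out e h2 h1
  · simp [h1, h2]

theorem sum_inflow_nonpos {S : Finset V} {f : E → ℝ}
    (h_in : ∀ e, G.tail e ∉ S → G.head e ∈ S → f e ≤ 0)
    (h_out : ∀ e, G.tail e ∈ S → G.head e ∉ S → 0 ≤ f e) : ∑ n ∈ S, G.inflow f n ≤ 0 := by
  have h := sum_inflow_nonneg (G := G) (S := S) (f := -f)
    (fun e h1 h2 => neg_nonneg.2 (h_in e h1 h2)) (fun e h1 h2 => neg_nonpos.2 (h_out e h1 h2))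
  rw [map_neg] at h
  simpa using h

theorem down_induction {P : ℕ → Prop} {K : ℕ} (hK : 1 ≤ K → P K)
    (h : ∀ k, 1 ≤ k → k < K → P (k + 1) → P k) : ∀ k, 1 ≤ k → k ≤ K → P k := by
  have key : ∀ j k, k + j = K → 1 ≤ k → P k := by
    intro j
    induction j with
    | zero => intro k hk h1; rw [add_zero] at hk; subst hk; exact hK h1
    | succ j ih => intro k hk h1; exact h k h1 (by omega) (ih (k + 1) (by omega) (by omega))
  exact fun k h1 h2 => key (K - k) k (by omega) h1

/-- Pigeonhole: there is one more strip of width `c` than there are nodes, and the strips are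
disjoint. -/
theorem exists_free_level (p : V → ℝ) (a : ℝ) {c : ℝ} (hc : 0 < c) : ∃ j : ℕ, 1 ≤ j ∧
    j ≤ Fintype.card V + 1 ∧ ∀ n, p n ≤ a + (j - 1) * c ∨ a + j * c < p n := by
  by_contra! hcon
  have hex : ∀ j : ℕ, ∃ n, j ∈ Finset.Icc 1 (Fintype.card V + 1) →
      a + (j - 1) * c < p n ∧ p n ≤ a + j * c := by
    intro j
    by_cases hj : 1 ≤ j ∧ j ≤ Fintype.card V + 1
    · obtain ⟨n, h1, h2⟩ := hcon j hj.1 hj.2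
      exact ⟨n, fun _ => ⟨h1, h2⟩⟩
    · obtain ⟨n, -, -⟩ := hcon 1 le_rfl (by omega)
      exact ⟨n, fun h => absurd (Finset.mem_Icc.1 h) hj⟩
  choose n hn using hex
  obtain ⟨i, hi, j, hj, hij, he⟩ := Finset.exists_ne_map_eq_of_card_lt_of_maps_to
    (s := Finset.Icc 1 (Fintype.card V + 1)) (t := Finset.univ) (f := n) (by simp) (by simp)
  have key : ∀ i j : ℕ, i ∈ Finset.Icc 1 (Fintype.card V + 1) →
      j ∈ Finset.Icc 1 (Fintype.card V + 1) → n i = n j → ¬ i < j := by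
    intro i j hi hj he hlt
    have h1 := (hn i hi).2
    have h2 := (hn j hj).1
    rw [he] at h1
    have h3 : (i : ℝ) + 1 ≤ j := by exact_mod_cast hlt
    nlinarith
  rcases lt_or_gt_of_ne hij with h | h
  · exact key i j hi hj he h
  · exact key j i hj hi he.symm h

/-- The levels are more than `2 * C` apart, so each price is within `C` of at most one of them. -/
theorem card_bad_levels {ι : Type} [DecidableEq ι] (p : V → ℝ) (t : ι → ℝ) (s : Finset ι) (C : ℝ)
    (hsep : ∀ i ∈ s, ∀ j ∈ s, i ≠ j → 2 * C < |t i - t j|) :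
    ∃ b ⊆ s, b.card ≤ Fintype.card V ∧ ∀ i ∈ s, i ∉ b → ∀ n, p n ≤ t i - C ∨ t i + C < p n := by
  classical
  refine ⟨s.filter fun i => ∃ n, ¬ (p n ≤ t i - C ∨ t i + C < p n), Finset.filter_subset _ _, ?_, ?_⟩
  · by_contra hcon
    rw [not_le] at hcon
    set b := s.filter fun i => ∃ n, ¬ (p n ≤ t i - C ∨ t i + C < p n) with hb
    have hbn : ∀ i ∈ b, ∃ n, ¬ (p n ≤ t i - C ∨ t i + C < p n) := fun i hi =>
      (Finset.mem_filter.1 hi).2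
    have hV : Nonempty V := by
      obtain ⟨i, hi⟩ := Finset.card_pos.1 (lt_of_le_of_lt (Nat.zero_le _) hcon)
      obtain ⟨n, -⟩ := hbn i hi
      exact ⟨n⟩
    have hex : ∀ i, ∃ n, i ∈ b → ¬ (p n ≤ t i - C ∨ t i + C < p n) := fun i => by
      by_cases hi : i ∈ b
      · obtain ⟨n, hn⟩ := hbn i hi
        exact ⟨n, fun _ => hn⟩
      · exact ⟨Classical.arbitrary V, fun h => absurd h hi⟩
    choose n hn using hex
    obtain ⟨i, hi, j, hj, hij, he⟩ := Finset.exists_ne_map_eq_of_card_lt_of_maps_to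
      (s := b) (t := Finset.univ) (f := n) (by simpa using hcon) (by simp)
    have h1 := hn i hi
    have h2 := hn j hj
    push Not at h1 h2
    rw [he] at h1
    have h3 := hsep i (Finset.mem_filter.1 hi).1 j (Finset.mem_filter.1 hj).1 hij
    have h4 : |t i - t j| ≤ 2 * C := abs_le.2 ⟨by linarith, by linarith⟩
    linarith
  · intro i hi hib n
    by_contra hcon
    exact hib (Finset.mem_filter.2 ⟨hi, n, hcon⟩)

section

variable {K : ℕ} {L r κ B Θ : ℝ} {C : ℕ → ℝ} {x : ℕ → V → ℝ} {f : ℕ → E → ℝ} {p : ℕ → V → ℝ}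

/-- At a level avoided by the prices, the nodes above the level form a set that no admissible flow
enters. -/
theorem PriceSystem.gates_of_level (hp : G.PriceSystem K L r C x f p) {k : ℕ} (hk : k < K)
    {t : ℝ} (ht : ∀ n, p (k + 1) n ≤ t - L ∨ t < p (k + 1) n) (e : E) :
    (p (k + 1) (G.tail e) ≤ t → t < p (k + 1) (G.head e) → G.fu e = 0) ∧
      (t < p (k + 1) (G.tail e) → p (k + 1) (G.head e) ≤ t → G.fl e = 0) := by
  refine ⟨fun h1 h2 => hp.gate_up k hk e ?_, fun h1 h2 => hp.gate_down k hk e ?_⟩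
  · rcases ht (G.tail e) with h | h <;> linarith
  · rcases ht (G.head e) with h | h <;> linarith

/-- A node with `β n = 0` has price `0`. Any other node that does not retain leaks and is away from
its lower capacity, so its price obeys `p k ≤ α * p (k + 1) + B`. Backwards in time this contraction
preserves the bound `Θ`. -/
theorem PriceSystem.le_of_not_retains (hp : G.PriceSystem K L r C x f p)
    (hκ : ∀ n, G.lo n = 0 ∨ κ ≤ -G.lo n) (hr : r < κ)
    (hB : ∀ n t, G.lo n ≤ t → t ≤ G.hi n → |G.β n * (2 * G.γ n * t + G.c n)| ≤ B)
    (hΘ0 : 0 ≤ Θ) (hCΘ : C 0 ≤ Θ) (hΘ : ∀ n, G.α n ≠ 1 → B ≤ (1 - G.α n) * Θ) {n : V}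
    (hn : ¬ G.Retains n) : ∀ k, 1 ≤ k → k ≤ K → p k n ≤ Θ := by
  have hβ0 := G.β_nonneg n
  rcases hβ0.eq_or_lt with hβ | hβ
  · intro k h1 h2
    rw [hp.price_zero k h2 h1 n hβ.symm]; exact hΘ0
  · have hα : G.α n ≠ 1 := fun h => hn ⟨hβ, Or.inl h⟩
    have hlo : G.lo n ≠ 0 := fun h => hn ⟨hβ, Or.inr h⟩
    refine down_induction (fun h1 => ?_) fun k h1 h2 ih => ?_
    · have := (abs_le.1 (hp.bound K le_rfl h1 n)).2
      rw [Nat.sub_self] at this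
      exact this.trans hCΘ
    · have hb := hp.box k h2.le
      have h3 := (hκ n).resolve_left hlo
      have h4 := hp.price_gt k h2 h1 n (by linarith [(abs_le.1 (hp.small k h2 n)).1])
      have h5 := (abs_le.1 (hB n _ (hb.1 n) (hb.2 n))).1
      have h6 := mul_le_mul_of_nonneg_left ih (G.α_nonneg n)
      linarith [hΘ n hα]

theorem PriceSystem.price_le_mul (hp : G.PriceSystem K L r C x f p) {k : ℕ} (h1 : 1 ≤ k)
    (h2 : k < K) {i : V} (hlo : G.lo i = 0) (hx : 0 < x k i) : p k i ≤ G.α i * p (k + 1) i := by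
  have hhi : 0 < G.hi i := hx.trans_le ((hp.box k h2.le).2 i)
  have hc : 0 ≤ G.c i := by
    by_contra! hneg
    have := G.c_hi i
    nlinarith
  have hmarg : 0 ≤ G.β i * (2 * G.γ i * x k i + G.c i) := mul_nonneg (G.β_nonneg i)
    (add_nonneg (mul_nonneg (mul_nonneg zero_le_two (G.γ_nonneg i)) hx.le) hc)
  have := hp.price_gt k h2 h1 i (hlo ▸ hx)
  linarith

/-- A leaky node whose price is high is empty. -/
theorem PriceSystem.le_of_pos (hp : G.PriceSystem K L r C x f p)
    (hκ : ∀ n, G.lo n = 0 ∨ κ ≤ -G.lo n) (hr : r < κ) (hL : 0 < L)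
    (hB : ∀ n t, G.lo n ≤ t → t ≤ G.hi n → |G.β n * (2 * G.γ n * t + G.c n)| ≤ B)
    (hΘ0 : 0 ≤ Θ) (hCΘ : C 0 ≤ Θ)
    (hΘ : ∀ n, G.α n ≠ 1 → B + (Fintype.card V + 1) * L ≤ (1 - G.α n) * Θ) :
    ∀ k, 1 ≤ k → k ≤ K → ∀ i, 0 < G.β i → G.lo i = 0 → G.α i ≠ 1 → 0 < x k i → p k i ≤ Θ := by
  have hΘ' : ∀ n, G.α n ≠ 1 → B ≤ (1 - G.α n) * Θ := fun n hn => by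
    have : 0 ≤ ((Fintype.card V : ℝ) + 1) * L := by positivity
    linarith [hΘ n hn]
  refine down_induction (fun h1 i _ _ _ _ => ?_) fun k h1 h2 ih i hβ hlo hα hx => ?_
  · have := (abs_le.1 (hp.bound K le_rfl h1 i)).2
    rw [Nat.sub_self] at this
    exact this.trans hCΘ
  by_contra! hgt
  have hbk := hp.box k h2.le
  have hbk1 := hp.box (k + 1) h2
  have hα1 : 0 < 1 - G.α i := sub_pos.2 (lt_of_le_of_ne (G.α_le_one i) hα)
  have hpi := hp.price_le_mul h1 h2 hlo hx
  have hα0 : 0 < G.α i := by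
    rcases (G.α_nonneg i).eq_or_lt with h | h
    · rw [← h] at hpi; linarith
    · exact h
  have hpi1 : p k i ≤ p (k + 1) i := by
    have h3 : 0 ≤ p (k + 1) i := by
      by_contra! hneg
      nlinarith
    exact hpi.trans (mul_le_of_le_one_left h3 (G.α_le_one i))
  have hx1 : x (k + 1) i = 0 := by
    refine le_antisymm ?_ (hlo ▸ hbk1.1 i)
    by_contra! hpos
    linarith [ih i hβ hlo hα hpos]
  have hFi : G.inflow (f k) i < 0 := by
    have h3 : x (k + 1) i = G.α i * x k i + G.β i * G.inflow (f k) i := by rw [hp.step k h2]; rfl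
    have h4 : 0 < G.α i * x k i := mul_pos hα0 hx
    by_contra! hcon
    nlinarith [mul_nonneg hβ.le hcon]
  have hjump : p k i + (Fintype.card V + 1) * L < p (k + 1) i - B := by
    have h3 : (1 - G.α i) * p k i ≤ (1 - G.α i) * p (k + 1) i :=
      mul_le_mul_of_nonneg_left hpi1 hα1.le
    have h4 := mul_lt_mul_of_pos_left hgt hα1
    linarith [hΘ i hα]
  -- The price of `i` jumps by more than `B + (card V + 1) * L`. This leaves room for a level `t`
  -- that lies above no price by less than `L`, and still more than `B` below the next price of `i`.
  obtain ⟨j, hj1, hj2, hfree⟩ := exists_free_level (p k) (p k i) hL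
  set t : ℝ := p k i + j * L with ht
  have hti : p k i ≤ t := by rw [ht]; have : 0 ≤ (j : ℝ) * L := by positivity
                             linarith
  have htB : t < p (k + 1) i - B := by
    have h3 : (j : ℝ) * L ≤ (Fintype.card V + 1) * L :=
      mul_le_mul_of_nonneg_right (by exact_mod_cast hj2) hL.le
    linarith
  obtain ⟨k, rfl⟩ : ∃ m, k = m + 1 := ⟨k - 1, by omega⟩
  have hgate := hp.gates_of_level (k := k) (by omega) (t := t) (fun n => by
    rcases hfree n with h | h
    · left; rw [ht]; linarith
    · exact Or.inr h)
  -- The nodes that are cheap now and, at the next time, at least as expensive as `i`. Flows cannot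
  -- leave this set: the sign condition deals with nodes of lower next price, the gates at level `t`
  -- with nodes that are expensive now. As `i` sends stock out, some `m` of this set receives stock.
  -- If `m` does not leak, its price rises by at most `B`; if it leaks, it is filled at a high
  -- price, against the induction hypothesis.
  let T : Finset V := Finset.univ.filter fun n => p (k + 1 + 1) i ≤ p (k + 1 + 1) n ∧ p (k + 1) n ≤ t
  have hT : ∀ n, n ∈ T ↔ p (k + 1 + 1) i ≤ p (k + 1 + 1) n ∧ p (k + 1) n ≤ t := fun n => by simp [T]
  have hfl := hp.flows (k + 1) h2
  have hsum : 0 ≤ ∑ n ∈ T, G.inflow (f (k + 1)) n := by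
    refine sum_inflow_nonneg (fun e he1 he2 => ?_) fun e he1 he2 => ?_
    · obtain ⟨h3, h4⟩ := (hT _).1 he2
      by_cases h5 : p (k + 1 + 1) i ≤ p (k + 1 + 1) (G.tail e)
      · have h6 : t < p (k + 1) (G.tail e) := by
          by_contra! h7; exact he1 ((hT _).2 ⟨h5, h7⟩)
        have h7 := hfl.1 e
        rwa [(hgate e).2 h6 h4] at h7
      · by_contra! h7
        have h8 := hp.flow_sign (k + 1) h2 e
        push Not at h5
        nlinarith
    · obtain ⟨h3, h4⟩ := (hT _).1 he1
      by_cases h5 : p (k + 1 + 1) i ≤ p (k + 1 + 1) (G.head e)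
      · have h6 : t < p (k + 1) (G.head e) := by
          by_contra! h7; exact he2 ((hT _).2 ⟨h5, h7⟩)
        have h7 := hfl.2 e
        rwa [(hgate e).1 h4 h6] at h7
      · by_contra! h7
        have h8 := hp.flow_sign (k + 1) h2 e
        push Not at h5
        nlinarith
  have hiT : i ∈ T := (hT i).2 ⟨le_rfl, hti⟩
  obtain ⟨m, hmT, hFm⟩ : ∃ m ∈ T, 0 < G.inflow (f (k + 1)) m := by
    by_contra! hcon
    have h3 : ∑ n ∈ T, G.inflow (f (k + 1)) n < ∑ n ∈ T, 0 :=
      Finset.sum_lt_sum hcon ⟨i, hiT, hFi⟩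
    rw [Finset.sum_const_zero] at h3
    linarith
  obtain ⟨hm1, hm2⟩ := (hT m).1 hmT
  have hret : G.Retains m := by
    by_contra hn
    have := hp.le_of_not_retains hκ hr hB hΘ0 hCΘ hΘ' hn (k + 1 + 1) (by omega) h2
    linarith
  have hstep : x (k + 1 + 1) m = G.α m * x (k + 1) m + G.β m * G.inflow (f (k + 1)) m := by
    rw [hp.step (k + 1) h2]; rfl
  have hβF : 0 < G.β m * G.inflow (f (k + 1)) m := mul_pos hret.1 hFm
  by_cases hαm : G.α m = 1
  · rw [hαm, one_mul] at hstep
    have h3 := hp.price_lt (k + 1) h2 h1 m (by linarith [hbk1.2 m])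
    rw [hαm, one_mul] at h3
    have h4 := (abs_le.1 (hB m _ (hbk.1 m) (hbk.2 m))).2
    linarith
  · have hlom := hret.2.resolve_left hαm
    have h3 : 0 ≤ x (k + 1) m := hlom ▸ hbk.1 m
    have h4 := ih m hret.1 hlom hαm (by
      have := mul_nonneg (G.α_nonneg m) h3
      linarith)
    linarith

theorem content_step_le {n : V} (hn : G.Retains n) {y : V → ℝ} {g : E → ℝ}
    (h : G.step y g ∈ G.box) :
    G.content n (G.step y g n) ≤ G.content n (y n) + G.inflow g n := by
  have hβ := hn.1
  have e : G.content n (y n) + G.inflow g n = G.step y g n / G.β n := by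
    simp only [content, Net.step]; field_simp
  rw [e, content]
  refine div_le_div_of_nonneg_right ?_ hβ.le
  rcases hn.2 with h1 | h1
  · rw [h1, one_mul]
  · exact mul_le_of_le_one_left (h1 ▸ h.1 n) (G.α_le_one n)

theorem content_step_eq {n : V} (hβ : 0 < G.β n) {y : V → ℝ} {g : E → ℝ}
    (h : G.α n = 1 ∨ G.step y g n = 0) :
    G.content n (G.step y g n) = G.content n (y n) + G.inflow g n := by
  have e : G.content n (y n) + G.inflow g n = G.step y g n / G.β n := by
    simp only [content, Net.step]; field_simp
  rw [e, content]
  rcases h with h | h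
  · rw [h, one_mul]
  · rw [h, mul_zero]

/-- Here `q` is the drop of the price over one stage, which balances the marginal cost of the stock.
A drop of at least `h` means a marginal cost of at most `-h / β n` off the lower capacity, hence a
stock at most the target. -/
theorem gap_nonneg_of_price {n : V} (hβ : 0 < G.β n) (hα : G.α n = 1) {t h q : ℝ}
    (h2 : t ≤ G.hi n)
    (hq : G.lo n < t → q ≤ -(G.β n * (2 * G.γ n * t + G.c n))) (hqh : h ≤ q) (h1 : G.lo n ≤ t) :
    0 ≤ G.gap h n t := by
  simp only [gap, target, content, hα, if_true, one_mul]
  rw [← sub_div]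
  refine div_nonneg (sub_nonneg.2 ?_) hβ.le
  rcases h1.eq_or_lt with h3 | h3
  · rw [← h3]; exact le_max_left _ _
  · refine le_trans (le_min h2 ?_) (le_max_right _ _)
    rcases G.γ_pos n with hγ | ⟨h4, h5⟩
    · rw [le_div_iff₀ (by positivity)]
      have h4 : h / G.β n ≤ -(2 * G.γ n * t + G.c n) := by
        rw [div_le_iff₀ hβ]
        linarith [hq h3]
      linarith
    · linarith

theorem gap_nonpos_of_price {n : V} (hβ : 0 < G.β n) (hα : G.α n = 1) {t h q : ℝ}
    (h1 : G.lo n ≤ t) (hq : t < G.hi n → -(G.β n * (2 * G.γ n * t + G.c n)) ≤ q) (hqh : q ≤ h)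
    (h2 : t ≤ G.hi n) : G.gap h n t ≤ 0 := by
  simp only [gap, target, content, hα, if_true, one_mul]
  rw [← sub_div]
  refine div_nonpos_of_nonpos_of_nonneg (sub_nonpos.2 (max_le h1 ?_)) hβ.le
  rcases h2.eq_or_lt with h3 | h3
  · rw [h3]; exact min_le_left _ _
  · refine (min_le_right _ _).trans ?_
    rcases G.γ_pos n with hγ | ⟨h4, h5⟩
    · rw [div_le_iff₀ (by positivity)]
      have h4 : -(2 * G.γ n * t + G.c n) ≤ h / G.β n := by
        rw [le_div_iff₀ hβ]
        linarith [hq h3]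
      linarith
    · linarith

theorem gap_nonpos_of_leaky {n : V} (hβ : 0 < G.β n) (hα : G.α n ≠ 1) {t : ℝ} (h : ℝ)
    (ht : 0 ≤ t) : G.gap h n t ≤ 0 := by
  simp only [gap, target, content, hα, if_false, zero_sub, neg_nonpos]
  exact div_nonneg (mul_nonneg (G.α_nonneg n) ht) hβ.le

theorem gap_eq_zero {n : V} (hα : G.α n ≠ 1) (h : ℝ) : G.gap h n 0 = 0 := by
  simp [gap, target, content, hα]

theorem PriceSystem.gap_nonneg (hp : G.PriceSystem K L r C x f p) {k : ℕ} (hk : k < K)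
    (hk1 : 1 ≤ k) {n : V} (hn : G.Retains n) {h : ℝ} (hlt : h < p k n - p (k + 1) n)
    (hW : G.α n ≠ 1 → x k n = 0) : 0 ≤ G.gap h n (x k n) := by
  have hb := hp.box k hk.le
  by_cases hα : G.α n = 1
  · refine gap_nonneg_of_price hn.1 hα (hb.2 n) (fun h3 => ?_) hlt.le (hb.1 n)
    have := hp.price_gt k hk hk1 n h3
    rwa [hα, one_mul] at this
  · rw [hW hα, gap_eq_zero hα]

theorem PriceSystem.gap_nonpos (hp : G.PriceSystem K L r C x f p) {k : ℕ} (hk : k < K)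
    (hk1 : 1 ≤ k) {n : V} (hn : G.Retains n) {h : ℝ} (hlt : p k n - p (k + 1) n ≤ h) :
    G.gap h n (x k n) ≤ 0 := by
  have hb := hp.box k hk.le
  by_cases hα : G.α n = 1
  · refine gap_nonpos_of_price hn.1 hα (hb.1 n) (fun h3 => ?_) hlt (hb.2 n)
    have := hp.price_lt k hk hk1 n h3
    rwa [hα, one_mul] at this
  · exact gap_nonpos_of_leaky hn.1 hα h ((hn.2.resolve_left hα) ▸ hb.1 n)

/-- The cheap part of a closed set holds at least its target. -/
theorem PriceSystem.sum_gap_cheap_nonpos (hp : G.PriceSystem K L r C x f p) {h t : ℝ}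
    (hh : 0 ≤ h)
    (hleak : ∀ k < K, 1 ≤ k → t + (K - (k + 1 : ℕ)) * h < 0 → ∀ n, G.lo n = 0 →
      G.α n ≠ 1 → 0 < x k n → p k n - p (k + 1) n ≤ h)
    {S : Finset V} (hS : G.Closed S) (ht : ∀ n, t < p K n) :
    ∀ k, 1 ≤ k → k ≤ K →
      ∑ n ∈ S with p k n ≤ t + (K - k) * h, G.gap h n (x k n) ≤ 0 := by
  refine down_induction (fun h1 => ?_) fun k h1 h2 ih => ?_
  · rw [Finset.filter_false_of_mem]
    · simp
    · intro n _
      have := ht n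
      rw [sub_self, zero_mul, add_zero]; linarith
  have hcast : t + ((K : ℝ) - (k + 1 : ℕ)) * h + h = t + (K - k) * h := by push_cast; ring
  rw [← hcast]
  set t' := t + ((K : ℝ) - (k + 1 : ℕ)) * h with ht'
  have hbk := hp.box k h2.le
  have hbk1 := hp.box (k + 1) h2
  -- Only nodes that cross the threshold change the sum. The price of such a node drops by more or
  -- by less than `h`, which fixes the sign of its gap. A leaky node that holds stock cannot have
  -- the larger drop: for `t' ≥ 0` by `price_le_mul`, near the end by `hleak`.
  have step1 : ∑ n ∈ S with p k n ≤ t' + h, G.gap h n (x k n) ≤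
      ∑ n ∈ S with p (k + 1) n ≤ t', G.gap h n (x k n) := by
    rw [Finset.sum_filter, Finset.sum_filter]
    refine Finset.sum_le_sum fun n hn => ?_
    have hret := hS.1 n hn
    split_ifs with h3 h4 h4
    · exact le_rfl
    · push Not at h4
      exact hp.gap_nonpos h2 h1 hret (by linarith)
    · push Not at h3
      refine hp.gap_nonneg h2 h1 hret (by linarith) fun hα => ?_
      by_contra hne
      have hlo := hret.2.resolve_left hα
      have hpos : 0 < x k n := lt_of_le_of_ne (hlo ▸ hbk.1 n) (Ne.symm hne)
      rcases lt_or_ge t' 0 with ht0 | ht0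
      · linarith [hleak k h2 h1 ht0 n hlo hα hpos]
      · have h5 := hp.price_le_mul h1 h2 hlo hpos
        have h6 := mul_le_mul_of_nonneg_left h4 (G.α_nonneg n)
        have h7 := mul_le_of_le_one_left ht0 (G.α_le_one n)
        linarith
    · exact le_rfl
  refine step1.trans (le_trans ?_ ih)
  set T := S.filter fun n => p (k + 1) n ≤ t' with hT
  have hTm : ∀ n, n ∈ T ↔ n ∈ S ∧ p (k + 1) n ≤ t' := fun n => by simp [hT]
  have hfl := hp.flows k h2
  have hin : ∑ n ∈ T, G.inflow (f k) n ≤ 0 := by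
    refine sum_inflow_nonpos (fun e he1 he2 => ?_) fun e he1 he2 => ?_
    · obtain ⟨h3, h4⟩ := (hTm _).1 he2
      by_cases h5 : G.tail e ∈ S
      · have h6 : t' < p (k + 1) (G.tail e) := by
          by_contra! h7; exact he1 ((hTm _).2 ⟨h5, h7⟩)
        by_contra! h7
        have h8 := hp.flow_sign k h2 e
        nlinarith
      · have h7 := hfl.2 e
        rwa [(hS.2 e).1 h5 h3] at h7
    · obtain ⟨h3, h4⟩ := (hTm _).1 he1
      by_cases h5 : G.head e ∈ S
      · have h6 : t' < p (k + 1) (G.head e) := by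
          by_contra! h7; exact he2 ((hTm _).2 ⟨h5, h7⟩)
        by_contra! h7
        have h8 := hp.flow_sign k h2 e
        nlinarith
      · have h7 := hfl.1 e
        rwa [(hS.2 e).2 h3 h5] at h7
  have hcont : ∑ n ∈ T, G.gap h n (x k n) ≤
      ∑ n ∈ T, (G.gap h n (x (k + 1) n) + G.inflow (f k) n) := by
    refine Finset.sum_le_sum fun n hn => ?_
    have h3 := hp.step k h2
    have h4 := content_step_le (hS.1 n ((hTm n).1 hn).1) (h3 ▸ hbk1)
    rw [← h3] at h4
    simp only [gap]; linarith
  rw [Finset.sum_add_distrib] at hcont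
  linarith

/-- The expensive nodes outside a closed set hold at most their target. -/
theorem PriceSystem.sum_gap_expensive_nonneg (hp : G.PriceSystem K L r C x f p) {h t : ℝ}
    (ht : ∀ n, p K n ≤ t) {S : Finset V} (hS : G.Closed S)
    (hexp : ∀ k < K, 1 ≤ k → ∀ n, t + (K - k) * h < p k n →
      G.Retains n ∧ (G.α n ≠ 1 → x k n = 0)) :
    ∀ k, 1 ≤ k → k ≤ K →
      0 ≤ ∑ n with n ∉ S ∧ t + (K - k) * h < p k n, G.gap h n (x k n) := by
  refine down_induction (fun h1 => ?_) fun k h1 h2 ih => ?_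
  · rw [Finset.filter_false_of_mem]
    · simp
    · rintro n - ⟨-, h3⟩
      have := ht n
      rw [sub_self, zero_mul, add_zero] at h3; linarith
  have hcast : t + ((K : ℝ) - (k + 1 : ℕ)) * h + h = t + (K - k) * h := by push_cast; ring
  have hexpk := hexp k h2 h1
  rw [← hcast] at hexpk ⊢
  have hexp1 : ∀ n, t + ((K : ℝ) - (k + 1 : ℕ)) * h < p (k + 1) n →
      G.Retains n ∧ (G.α n ≠ 1 → x (k + 1) n = 0) := by
    intro n hn
    rcases Nat.lt_or_ge (k + 1) K with h3 | h3
    · exact hexp (k + 1) h3 (by omega) n hn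
    · have h4 : k + 1 = K := by omega
      rw [h4, sub_self, zero_mul, add_zero] at hn
      linarith [ht n]
  set t' := t + ((K : ℝ) - (k + 1 : ℕ)) * h with ht'
  have hbk1 := hp.box (k + 1) h2
  -- The same exchange as in the cheap part, with the inequality reversed: a node newly above the
  -- threshold has nonnegative gap, a node that ceases to be above it nonpositive gap.
  have step1 : ∑ n with n ∉ S ∧ t' < p (k + 1) n, G.gap h n (x k n) ≤
      ∑ n with n ∉ S ∧ t' + h < p k n, G.gap h n (x k n) := by
    rw [Finset.sum_filter, Finset.sum_filter]
    refine Finset.sum_le_sum fun n _ => ?_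
    split_ifs with h3 h4 h4
    · exact le_rfl
    · have h5 : p k n ≤ t' + h := by
        by_contra! h6; exact h4 ⟨h3.1, h6⟩
      exact hp.gap_nonpos h2 h1 (hexp1 n h3.2).1 (by linarith [h3.2])
    · have h5 : p (k + 1) n ≤ t' := by
        by_contra! h6; exact h3 ⟨h4.1, h6⟩
      exact hp.gap_nonneg h2 h1 (hexpk n h4.2).1 (by linarith [h4.2]) (hexpk n h4.2).2
    · exact le_rfl
  refine le_trans ih (le_trans ?_ step1)
  set T := Finset.univ.filter fun n => n ∉ S ∧ t' < p (k + 1) n with hT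
  have hTm : ∀ n, n ∈ T ↔ n ∉ S ∧ t' < p (k + 1) n := fun n => by simp [hT]
  have hfl := hp.flows k h2
  have hin : 0 ≤ ∑ n ∈ T, G.inflow (f k) n := by
    refine sum_inflow_nonneg (fun e he1 he2 => ?_) fun e he1 he2 => ?_
    · obtain ⟨h3, h4⟩ := (hTm _).1 he2
      by_cases h5 : G.tail e ∈ S
      · have h7 := hfl.1 e
        rwa [(hS.2 e).2 h5 h3] at h7
      · have h6 : p (k + 1) (G.tail e) ≤ t' := by
          by_contra! h7; exact he1 ((hTm _).2 ⟨h5, h7⟩)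
        by_contra! h7
        have h8 := hp.flow_sign k h2 e
        nlinarith
    · obtain ⟨h3, h4⟩ := (hTm _).1 he1
      by_cases h5 : G.head e ∈ S
      · have h7 := hfl.2 e
        rwa [(hS.2 e).1 h3 h5] at h7
      · have h6 : p (k + 1) (G.head e) ≤ t' := by
          by_contra! h7; exact he2 ((hTm _).2 ⟨h5, h7⟩)
        by_contra! h7
        have h8 := hp.flow_sign k h2 e
        nlinarith
  have hcont : ∑ n ∈ T, (G.gap h n (x (k + 1) n) + G.inflow (f k) n) ≤
      ∑ n ∈ T, G.gap h n (x k n) := by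
    refine Finset.sum_le_sum fun n hn => ?_
    have h3 := hp.step k h2
    obtain ⟨h5, h6⟩ := hexp1 n ((hTm n).1 hn).2
    have h4 := content_step_eq (G := G) h5.1 (y := x k) (g := f k) (by
      rw [← h3]
      by_cases hα : G.α n = 1
      · exact Or.inl hα
      · exact Or.inr (h6 hα))
    rw [← h3] at h4
    simp only [gap]; linarith
  rw [Finset.sum_add_distrib] at hcont
  linarith

/-- At a level avoided by the first prices, the shortage does not grow in the first step. -/
theorem PriceSystem.exists_shortage_le (hp : G.PriceSystem K L r C x f p) (hK : 1 < K)
    (hκ : ∀ n, G.lo n = 0 ∨ κ ≤ -G.lo n) (hr : r < κ) (hL : 0 < L)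
    (hB : ∀ n t, G.lo n ≤ t → t ≤ G.hi n → |G.β n * (2 * G.γ n * t + G.c n)| ≤ B)
    (hΘ0 : 0 ≤ Θ) (hCΘ : C 0 < Θ) (hLΘ : L ≤ Θ)
    (hΘ : ∀ n, G.α n ≠ 1 → B + (Fintype.card V + 1) * L ≤ (1 - G.α n) * Θ) {h : ℝ} (hh : 0 ≤ h)
    (hleak : ∀ k < K, 1 ≤ k → -Θ + (K - (k + 1 : ℕ)) * h < 0 → ∀ n, G.lo n = 0 →
      G.α n ≠ 1 → 0 < x k n → p k n - p (k + 1) n ≤ h)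
    (hlevel : ∀ n, p 1 n ≤ (K - 1) * h - Θ ∨ (K - 1) * h + Θ < p 1 n)
    {S : Finset V} (hS : G.Closed S) :
    ∃ U, G.Closed U ∧ G.shortage h S (x 1) ≤ G.shortage h U (x 0) := by
  have hΘ' : ∀ n, G.α n ≠ 1 → B ≤ (1 - G.α n) * Θ := fun n hn => by
    have : 0 ≤ ((Fintype.card V : ℝ) + 1) * L := by positivity
    linarith [hΘ n hn]
  have hKh : 0 ≤ ((K : ℝ) - 1) * h :=
    mul_nonneg (by have : (1 : ℝ) < K := by exact_mod_cast hK
                   linarith) hh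
  have hhigh : ∀ k, 1 ≤ k → k ≤ K → ∀ n, Θ < p k n →
      G.Retains n ∧ (G.α n ≠ 1 → x k n = 0) := by
    intro k h1 h2 n hn
    have hret : G.Retains n := by
      by_contra hcon
      linarith [hp.le_of_not_retains hκ hr hB hΘ0 hCΘ.le hΘ' hcon k h1 h2]
    refine ⟨hret, fun hα => ?_⟩
    have hlo := hret.2.resolve_left hα
    refine le_antisymm ?_ (hlo ▸ (hp.box k h2).1 n)
    by_contra! hpos
    linarith [hp.le_of_pos hκ hr hL hB hΘ0 hCΘ.le hΘ k h1 h2 n hret.1 hlo hα hpos]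
  -- All nodes above the level. Since the level is avoided by a margin `Θ`, both thresholds, ending
  -- at `-Θ` and at `Θ`, separate the same nodes at time `1`.
  let U : Finset V := Finset.univ.filter fun n => ((K : ℝ) - 1) * h < p 1 n
  have hUm : ∀ n, n ∈ U ↔ ((K : ℝ) - 1) * h < p 1 n := fun n => by simp [U]
  have hUm' : ∀ n, n ∈ U ↔ Θ + ((K : ℝ) - (1 : ℕ)) * h < p 1 n := fun n => by
    rw [hUm]; push_cast
    constructor
    · intro h1; rcases hlevel n with h2 | h2 <;> linarith
    · intro h1; linarith
  have hUm'' : ∀ n, n ∉ U ↔ p 1 n ≤ -Θ + ((K : ℝ) - (1 : ℕ)) * h := fun n => by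
    rw [hUm]; push_cast
    constructor
    · intro h1; rcases hlevel n with h2 | h2 <;> linarith
    · intro h1; linarith
  have hUret : ∀ n ∈ U, G.Retains n ∧ (G.α n ≠ 1 → x 1 n = 0) := fun n hn =>
    hhigh 1 le_rfl hK.le n (by have := (hUm' n).1 hn; push_cast at this; linarith)
  have hgate := hp.gates_of_level (k := 0) (by omega) (t := ((K : ℝ) - 1) * h) (fun n => by
    rcases hlevel n with h2 | h2
    · left; simpa using h2.trans (by linarith)
    · right; simpa using lt_of_le_of_lt (by linarith) h2)
  have hU : G.Closed U := by
    refine ⟨fun n hn => (hUret n hn).1, fun e => ⟨fun h1 h2 => ?_, fun h1 h2 => ?_⟩⟩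
    · rw [hUm, not_lt] at h1
      exact (hgate e).1 h1 ((hUm _).1 h2)
    · rw [hUm, not_lt] at h2
      exact (hgate e).2 ((hUm _).1 h1) h2
  refine ⟨U, hU, ?_⟩
  have hKbound : ∀ n, |p K n| ≤ C 0 := fun n => by
    have := hp.bound K le_rfl hK.le n
    rwa [Nat.sub_self] at this
  have q1 := hp.sum_gap_cheap_nonpos hh hleak hS
    (fun n => by linarith [(abs_le.1 (hKbound n)).1]) 1 le_rfl hK.le
  have q2 := hp.sum_gap_expensive_nonneg (h := h) (t := Θ)
    (fun n => by linarith [(abs_le.1 (hKbound n)).2]) hS (fun k hk h1 n hn => by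
      have h3 : 0 ≤ ((K : ℝ) - k) * h :=
        mul_nonneg (by have : (k : ℝ) ≤ K := by exact_mod_cast hk.le
                       linarith) hh
      exact hhigh k h1 hk.le n (by linarith)) 1 le_rfl hK.le
  -- `S \ U` is the cheap part of `S` and contributes at most `0`; `U \ S` is the expensive part
  -- outside `S` and contributes at least `0`. So `U` is at least as short as `S`. The first flow
  -- feeds `U`, hence `U` was at least as short before.
  have e1 : G.shortage h S (x 1) ≤ G.shortage h U (x 1) := by
    have h1 : ∑ n ∈ S with p 1 n ≤ -Θ + ((K : ℝ) - (1 : ℕ)) * h, G.gap h n (x 1 n) =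
        ∑ n ∈ S \ U, G.gap h n (x 1 n) := by
      refine Finset.sum_congr ?_ fun _ _ => rfl
      ext n; rw [Finset.mem_filter, Finset.mem_sdiff, hUm'']
    have h2 : ∑ n with n ∉ S ∧ Θ + ((K : ℝ) - (1 : ℕ)) * h < p 1 n, G.gap h n (x 1 n) =
        ∑ n ∈ U \ S, G.gap h n (x 1 n) := by
      refine Finset.sum_congr ?_ fun _ _ => rfl
      ext n; rw [Finset.mem_filter, Finset.mem_sdiff, hUm']; simp [and_comm]
    have h3 := Finset.sum_inter_add_sum_sdiff S U fun n => G.gap h n (x 1 n)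
    have h4 := Finset.sum_inter_add_sum_sdiff U S fun n => G.gap h n (x 1 n)
    rw [Finset.inter_comm] at h4
    simp only [shortage]
    linarith
  refine e1.trans ?_
  have hin : 0 ≤ ∑ n ∈ U, G.inflow (f 0) n := by
    refine sum_inflow_nonneg (fun e he1 he2 => ?_) fun e he1 he2 => ?_
    · rw [hUm, not_lt] at he1
      rw [hUm] at he2
      by_contra! h7
      have h8 := hp.flow_sign 0 (by omega) e
      rw [zero_add] at h8
      nlinarith
    · rw [hUm] at he1
      rw [hUm, not_lt] at he2
      by_contra! h7
      have h8 := hp.flow_sign 0 (by omega) e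
      rw [zero_add] at h8
      nlinarith
  have hcont : ∑ n ∈ U, (G.gap h n (x 1 n) + G.inflow (f 0) n) ≤ ∑ n ∈ U, G.gap h n (x 0 n) := by
    refine Finset.sum_le_sum fun n hn => ?_
    have h3 : x 1 = G.step (x 0) (f 0) := hp.step 0 (by omega)
    obtain ⟨h5, h6⟩ := hUret n hn
    have h4 := content_step_eq (G := G) h5.1 (y := x 0) (g := f 0) (by
      rw [← h3]
      by_cases hα : G.α n = 1
      · exact Or.inl hα
      · exact Or.inr (h6 hα))
    rw [← h3] at h4
    simp only [gap]; linarith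
  rw [Finset.sum_add_distrib] at hcont
  simp only [shortage]
  linarith

end

end Net

/-! ### Sign reversal, deficits, and static multipliers. -/

namespace Net

variable {V E : Type} [Fintype V] [Fintype E] [DecidableEq V] {G : Net V E}

/-- The network with all stocks and flows reversed in sign. -/
def neg (G : Net V E) : Net V E where
  tail := G.tail
  head := G.head
  α := G.α
  β := G.β
  lo := -G.hi
  hi := -G.lo
  γ := G.γ
  c := -G.c
  τ := -G.τ
  fl := -G.fu
  fu := -G.fl
  ρ := G.ρ
  d := -G.d
  α_nonneg := G.α_nonneg
  α_le_one := G.α_le_one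
  β_nonneg := G.β_nonneg
  lo_nonpos n := by simpa using G.hi_nonneg n
  hi_nonneg n := by simpa using G.lo_nonpos n
  fl_nonpos n := by simpa using G.fu_nonneg n
  fu_nonneg n := by simpa using G.fl_nonpos n
  γ_nonneg := G.γ_nonneg
  ρ_nonneg := G.ρ_nonneg
  c_lo n := by simpa using G.c_hi n
  c_hi n := by simpa using G.c_lo n
  d_fl n := by simpa using G.d_fu n
  d_fu n := by simpa using G.d_fl n
  γ_pos n := by simpa [and_comm] using G.γ_pos n
  β_pos n h := by simpa [and_comm] using G.β_pos n h
  inj := G.inj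

theorem step_neg (x : V → ℝ) (f : E → ℝ) : G.neg.step (-x) (-f) = -G.step x f := by
  ext n
  have h : G.neg.inflow = G.inflow := rfl
  simp only [step, h, map_neg, Pi.neg_apply]
  simp only [neg]; ring

theorem neg_mem_box {x : V → ℝ} (hx : x ∈ G.box) : -x ∈ G.neg.box :=
  ⟨fun n => neg_le_neg (hx.2 n), fun n => neg_le_neg (hx.1 n)⟩

theorem neg_mem_flows {f : E → ℝ} (hf : f ∈ G.flows) : -f ∈ G.neg.flows :=
  ⟨fun n => neg_le_neg (hf.2 n), fun n => neg_le_neg (hf.1 n)⟩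

section

variable {K : ℕ} {L r κ B Θ : ℝ} {C : ℕ → ℝ} {x : ℕ → V → ℝ} {f : ℕ → E → ℝ} {p : ℕ → V → ℝ}

theorem PriceSystem.neg (hp : G.PriceSystem K L r C x f p) :
    G.neg.PriceSystem K L r C (fun k => -x k) (fun k => -f k) fun k => -p k where
  step k hk := by rw [step_neg, hp.step k hk]
  box k hk := neg_mem_box (hp.box k hk)
  flows k hk := neg_mem_flows (hp.flows k hk)
  small k hk n := by simpa using hp.small k hk n
  flow_sign k hk e := by
    have := hp.flow_sign k hk e
    simp only [Pi.neg_apply]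
    simp only [Net.neg]
    linarith
  gate_up k hk e h := by
    have := hp.gate_down k hk e (by simp only [Pi.neg_apply] at h; simp only [Net.neg] at h; linarith)
    simp [Net.neg, this]
  gate_down k hk e h := by
    have := hp.gate_up k hk e (by simp only [Pi.neg_apply] at h; simp only [Net.neg] at h; linarith)
    simp [Net.neg, this]
  price_lt k hk h1 n h := by
    have := hp.price_gt k hk h1 n (by simp only [Net.neg, Pi.neg_apply] at h; linarith)
    simp only [Pi.neg_apply]
    simp only [Net.neg, Pi.neg_apply]
    linarith
  price_gt k hk h1 n h := by
    have := hp.price_lt k hk h1 n (by simp only [Net.neg, Pi.neg_apply] at h; linarith)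
    simp only [Pi.neg_apply]
    simp only [Net.neg, Pi.neg_apply]
    linarith
  price_zero k hk h1 n h := by simpa using hp.price_zero k hk h1 n h
  bound k hk h1 n := by simpa using hp.bound k hk h1 n

theorem PriceSystem.restrict (hp : G.PriceSystem K L r C x f p) (j : ℕ) :
    G.PriceSystem (K - j) L r (fun i => C (i + (K - (K - j)))) x f p where
  step k hk := hp.step k (by omega)
  box k hk := hp.box k (by omega)
  flows k hk := hp.flows k (by omega)
  small k hk := hp.small k (by omega)
  flow_sign k hk := hp.flow_sign k (by omega)
  gate_up k hk := hp.gate_up k (by omega)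
  gate_down k hk := hp.gate_down k (by omega)
  price_lt k hk := hp.price_lt k (by omega)
  price_gt k hk := hp.price_gt k (by omega)
  price_zero k hk := hp.price_zero k (by omega)
  bound k hk h1 n := by
    have := hp.bound k (by omega) h1 n
    rwa [show K - k = K - j - k + (K - (K - j)) by omega] at this

/-- The price of a leaky node holding stock rises slowly. -/
theorem PriceSystem.price_sub_le (hp : G.PriceSystem K L r C x f p)
    (hκ : ∀ n, G.hi n = 0 ∨ κ ≤ G.hi n) (hr : r < κ) {h r' : ℝ} {j : ℕ} (hC0 : 0 ≤ C 0)
    {n : V} (hrh : 2 * G.β n * G.γ n * r' ≤ h / 2)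
    (hj : ∀ i ≥ j, G.α n ^ i * C 0 ≤ h / 2) {k : ℕ} (hk : k + 1 + j ≤ K)
    (hk1 : 1 ≤ k) (hsmall : ∀ i, k ≤ i → i < K → x i n ≤ r') (hlo : G.lo n = 0) (hα : G.α n ≠ 1)
    (hx : 0 < x k n) :
    p k n - p (k + 1) n ≤ h := by
  have hα1 : 0 < 1 - G.α n := sub_pos.2 (lt_of_le_of_ne (G.α_le_one n) hα)
  have hβ := G.β_nonneg n
  have hhi : G.hi n ≠ 0 := by
    have := (hp.box k (by omega)).2 n
    intro h0; rw [h0] at this; linarith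
  have hhi' := (hκ n).resolve_left hhi
  set b := G.β n * (2 * G.γ n * r' + G.c n) with hb
  -- The recursion `p i ≥ α * p (i + 1) - b`, unrolled from the end: its fixed point is `-b / (1 -
  -- α)`, and the error of the final price is damped by `α ^ (K - i)`.
  have hlow : ∀ i, k ≤ i → i ≤ K → -(b / (1 - G.α n)) - G.α n ^ (K - i) * C 0 ≤ p i n := by
    have hb0 : 0 ≤ b := by
      have hr0 : 0 ≤ r' := hx.le.trans (hsmall k le_rfl (by omega))
      have hc : 0 ≤ G.c n := by
        by_contra! hneg
        have := G.c_hi n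
        have := G.hi_nonneg n
        have : 0 < G.hi n := lt_of_le_of_ne this (Ne.symm hhi)
        nlinarith
      have := G.γ_nonneg n
      positivity
    have hK : -(b / (1 - G.α n)) - G.α n ^ (K - K) * C 0 ≤ p K n := by
      have h3 := (abs_le.1 (hp.bound K le_rfl (by omega) n)).1
      rw [Nat.sub_self] at h3 ⊢
      have : 0 ≤ b / (1 - G.α n) := div_nonneg hb0 hα1.le
      linarith
    refine fun i hki hiK => ?_
    obtain ⟨m, rfl⟩ := Nat.exists_eq_add_of_le hki
    have key : ∀ l i, i + l = K → k ≤ i →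
        -(b / (1 - G.α n)) - G.α n ^ (K - i) * C 0 ≤ p i n := by
      intro l
      induction l with
      | zero => intro i h1 _; rw [add_zero] at h1; subst h1; exact hK
      | succ l ih =>
      intro i h1 hki
      have h2 : i < K := by omega
      replace ih := ih (i + 1) (by omega) (by omega)
      have h3 := (abs_le.1 (hp.small i h2 n)).2
      have h4 := hp.price_lt i h2 (by omega) n (by linarith)
      have h5 : G.β n * (2 * G.γ n * x i n + G.c n) ≤ b := by
        refine mul_le_mul_of_nonneg_left ?_ hβ
        have := mul_le_mul_of_nonneg_left (hsmall i hki h2) (mul_nonneg zero_le_two (G.γ_nonneg n))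
        linarith
      have h6 := mul_le_mul_of_nonneg_left ih (G.α_nonneg n)
      rw [show K - i = K - (i + 1) + 1 by omega, pow_succ]
      have h7 : b / (1 - G.α n) = b + G.α n * (b / (1 - G.α n)) := by field_simp; ring
      rw [h7]
      linarith
    exact key (K - (k + m)) (k + m) (by omega) hki
  have h1 := hp.price_gt k (by omega) hk1 n (hlo ▸ hx)
  have h2 := mul_le_mul_of_nonneg_left (hlow (k + 1) (by omega) (by omega)) hα1.le
  have h3 : (1 - G.α n) * (-(b / (1 - G.α n)) - G.α n ^ (K - (k + 1)) * C 0) =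
      -b - (1 - G.α n) * (G.α n ^ (K - (k + 1)) * C 0) := by field_simp
  rw [h3] at h2
  have h4 := hj (K - (k + 1)) (by omega)
  have h5 : (1 - G.α n) * (G.α n ^ (K - (k + 1)) * C 0) ≤ G.α n ^ (K - (k + 1)) * C 0 :=
    mul_le_of_le_one_left (mul_nonneg (pow_nonneg (G.α_nonneg n) _) hC0)
      (by linarith [G.α_nonneg n])
  have h6 : 0 ≤ G.β n * (2 * G.γ n * x k n) :=
    mul_nonneg hβ (mul_nonneg (mul_nonneg zero_le_two (G.γ_nonneg n)) hx.le)
  rw [hb] at h2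
  linarith

end

theorem closed_empty : G.Closed ∅ := ⟨by simp, by simp⟩

open Classical in
variable (G) in
noncomputable def closedSets : Finset (Finset V) := Finset.univ.filter G.Closed

theorem mem_closedSets {S : Finset V} : S ∈ G.closedSets ↔ G.Closed S := by simp [closedSets]

variable (G) in
/-- The largest shortage of a closed set at marginal cost `h`. -/
noncomputable def deficit (h : ℝ) (x : V → ℝ) : ℝ :=
  G.closedSets.sup' ⟨∅, mem_closedSets.2 closed_empty⟩ fun S => G.shortage h S x

variable (G) in
/-- The total loss of content of the closed sets. -/
noncomputable def loss (x : V → ℝ) : ℝ := -∑ S ∈ G.closedSets, ∑ n ∈ S, G.content n (x n)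

theorem shortage_le_deficit {S : Finset V} (hS : G.Closed S) (h : ℝ) (x : V → ℝ) :
    G.shortage h S x ≤ G.deficit h x :=
  Finset.le_sup' (fun S => G.shortage h S x) (mem_closedSets.2 hS)

theorem deficit_nonneg (h : ℝ) (x : V → ℝ) : 0 ≤ G.deficit h x := by
  have := shortage_le_deficit (G := G) closed_empty h x
  simpa [shortage] using this

theorem sum_content_step_le {S : Finset V} (hS : G.Closed S) {y : V → ℝ} {g : E → ℝ}
    (hg : g ∈ G.flows) (h : G.step y g ∈ G.box) :
    ∑ n ∈ S, G.content n (G.step y g n) ≤ ∑ n ∈ S, G.content n (y n) := by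
  have h1 : ∑ n ∈ S, G.content n (G.step y g n) ≤
      ∑ n ∈ S, (G.content n (y n) + G.inflow g n) :=
    Finset.sum_le_sum fun n hn => content_step_le (hS.1 n hn) h
  rw [Finset.sum_add_distrib] at h1
  have h2 : ∑ n ∈ S, G.inflow g n ≤ 0 := by
    refine sum_inflow_nonpos (fun e he1 he2 => ?_) fun e he1 he2 => ?_
    · have := hg.2 e; rwa [(hS.2 e).1 he1 he2] at this
    · have := hg.1 e; rwa [(hS.2 e).2 he1 he2] at this
  linarith

theorem loss_le_loss_step {y : V → ℝ} {g : E → ℝ} (hg : g ∈ G.flows) (h : G.step y g ∈ G.box) :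
    G.loss y ≤ G.loss (G.step y g) := by
  refine neg_le_neg (Finset.sum_le_sum fun S hS => ?_)
  exact sum_content_step_le (mem_closedSets.1 hS) hg h

/-- The crude bound used at bad levels. The content of each closed set can only decrease, so the
loss of one of them is at most the total loss over all of them. -/
theorem deficit_step_le (h : ℝ) {y : V → ℝ} {g : E → ℝ} (hg : g ∈ G.flows)
    (hb : G.step y g ∈ G.box) :
    G.deficit h (G.step y g) ≤ G.deficit h y + (G.loss (G.step y g) - G.loss y) := by
  refine Finset.sup'_le _ _ fun S hS => ?_
  have h1 := shortage_le_deficit (mem_closedSets.1 hS) h y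
  have h2 : ∑ n ∈ S, G.content n (y n) - ∑ n ∈ S, G.content n (G.step y g n) ≤
      ∑ S ∈ G.closedSets, (∑ n ∈ S, G.content n (y n) - ∑ n ∈ S, G.content n (G.step y g n)) :=
    Finset.single_le_sum
      (f := fun S => ∑ n ∈ S, G.content n (y n) - ∑ n ∈ S, G.content n (G.step y g n))
      (fun T hT => sub_nonneg.2 (sum_content_step_le (mem_closedSets.1 hT) hg hb)) hS
  rw [Finset.sum_sub_distrib] at h2
  have h3 : G.shortage h S (G.step y g) = G.shortage h S y +
      (∑ n ∈ S, G.content n (y n) - ∑ n ∈ S, G.content n (G.step y g n)) := by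
    simp only [shortage, gap, Finset.sum_sub_distrib]; ring
  simp only [loss]
  linarith

/-- The static resource problem: multipliers at a minimizer. -/
theorem exists_static_prices {x : V → ℝ} (hx : x ∈ G.box) {f : E → ℝ} (hf : G.Reach x f)
    (hmin : ∀ g, G.Reach x g → G.zCost (G.step x f) ≤ G.zCost (G.step x g)) :
    ∃ μ : V → ℝ, ∀ g, G.Gates g → ∀ y : V → ℝ,
      (∀ n, (G.α n = 1 ∨ G.lo n = 0 → G.lo n ≤ y n) ∧ (G.α n = 1 ∨ G.hi n = 0 → y n ≤ G.hi n)) →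
      G.zCost (G.step x f) ≤ G.zCost y + ∑ n, μ n * (y n - G.step x g n) := by
  classical
  obtain ⟨C, hC0, hC⟩ := exists_repair G
  obtain ⟨K, hK0, hK, -⟩ := exists_step_bound G
  obtain ⟨D, hD0, hD⟩ : ∃ D : ℝ, 0 ≤ D ∧ ∀ n t, G.lo n ≤ t → t ≤ G.hi n → |t| ≤ D := by
    refine ⟨∑ n, (|G.lo n| + |G.hi n|), Finset.sum_nonneg fun _ _ => by positivity,
      fun n t h1 h2 => ?_⟩
    refine le_trans ?_ (Finset.single_le_sum (f := fun n => |G.lo n| + |G.hi n|)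
      (fun m _ => by positivity) (Finset.mem_univ n))
    rw [abs_le]
    constructor <;> linarith [neg_abs_le (G.lo n), le_abs_self (G.hi n), abs_nonneg (G.lo n),
      abs_nonneg (G.hi n)]
  set L : ℝ := ∑ n, (2 * |G.γ n| * D + |G.c n|) with hL
  have hL0 : 0 ≤ L := Finset.sum_nonneg fun _ _ => by positivity
  let Y : Set (V → ℝ) := {y | ∀ n, (G.α n = 1 ∨ G.lo n = 0 → G.lo n ≤ y n) ∧
    (G.α n = 1 ∨ G.hi n = 0 → y n ≤ G.hi n)}
  have hYc : Convex ℝ Y := by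
    intro y hy z hz p q hp hq hpq n
    simp only [Pi.add_apply, Pi.smul_apply, smul_eq_mul]
    refine ⟨fun hn => ?_, fun hn => ?_⟩
    · have h1 := mul_le_mul_of_nonneg_left ((hy n).1 hn) hp
      have h2 := mul_le_mul_of_nonneg_left ((hz n).1 hn) hq
      have h3 : G.lo n = p * G.lo n + q * G.lo n := by rw [← add_mul, hpq, one_mul]
      linarith
    · have h1 := mul_le_mul_of_nonneg_left ((hy n).2 hn) hp
      have h2 := mul_le_mul_of_nonneg_left ((hz n).2 hn) hq
      have h3 : G.hi n = p * G.hi n + q * G.hi n := by rw [← add_mul, hpq, one_mul]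
      linarith
  have hGc : Convex ℝ {g : E → ℝ | G.Gates g} := by
    intro g hg h hh p q hp hq _
    exact ⟨fun e he => add_nonneg (mul_nonneg hp (hg.1 e he)) (mul_nonneg hq (hh.1 e he)),
      fun e he => add_nonpos (mul_nonpos_of_nonneg_of_nonpos hp (hg.2 e he))
        (mul_nonpos_of_nonneg_of_nonpos hq (hh.2 e he))⟩
  have hzlip : ∀ y ∈ Y, ∀ z ∈ Y, G.zCost y ≤ G.zCost z + L * ‖y - z‖ := by
    intro y hy z hz
    rw [zCost, zCost, hL, Finset.sum_mul, ← Finset.sum_add_distrib]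
    refine Finset.sum_le_sum fun n _ => ?_
    split_ifs with hn
    · have h1 := (abs_le.1 (quadratic_sub_le (a := G.γ n) (b := G.c n)
        (hD n (y n) ((hy n).1 (Or.inl hn)) ((hy n).2 (Or.inl hn)))
        (hD n (z n) ((hz n).1 (Or.inl hn)) ((hz n).2 (Or.inl hn))))).2
      have h2 := mul_le_mul_of_nonneg_left (abs_apply_le_norm (y - z) n)
        (show 0 ≤ 2 * |G.γ n| * D + |G.c n| by positivity)
      simp only [Pi.sub_apply] at h2
      simp only [nodeCost]; linarith
    · positivity
  have hφ : ConvexOn ℝ ({g : E → ℝ | G.Gates g} ×ˢ Y)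
      (fun z : (E → ℝ) × (V → ℝ) => G.zCost z.2) := by
    refine ⟨hGc.prod hYc, fun z _ w _ p q hp hq hpq => ?_⟩
    simp only [zCost, Prod.snd_add, Prod.smul_snd, smul_eq_mul, Finset.mul_sum,
      ← Finset.sum_add_distrib]
    refine Finset.sum_le_sum fun n _ => ?_
    split_ifs
    · exact convexOn_quadratic _ _ (G.γ_nonneg n) _ _ _ _ hp hq hpq
    · simp
  set W : ℝ := L * (1 + K * C) with hW
  have hW0 : 0 ≤ W := by positivity
  have hWc : ConvexOn ℝ Set.univ fun h : V → ℝ => W * ‖h‖ := by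
    have := (convexOn_norm (E := V → ℝ) convex_univ).smul hW0
    simpa using this
  let A : ((E → ℝ) × (V → ℝ)) →ₗ[ℝ] (V → ℝ) :=
    { toFun := fun z => G.step 0 z.1 - z.2
      map_add' := fun z w => by
        have := step_add (G := G) 0 0 z.1 w.1
        rw [add_zero] at this
        simp only [Prod.fst_add, Prod.snd_add, this]; abel
      map_smul' := fun r z => by ext n; simp [step]; ring }
  have hA : ∀ z, A z - (-(G.step x 0)) = G.step x z.1 - z.2 := fun z => by
    ext n; simp [A, step]; ring
  have hne : ({g : E → ℝ | G.Gates g} ×ˢ Y).Nonempty := ⟨(f, G.step x f), hf.1, hf.2⟩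
  have h0Y : G.Reach x 0 := reach_zero hx
  obtain ⟨l, hl⟩ := exists_multiplier hne hφ A (-(G.step x 0)) hWc (by fun_prop)
    (G.zCost (G.step x f)) (by
      rintro ⟨g, y⟩ ⟨hg, hy⟩
      rw [hA]
      simp only
      have hd : ∀ n, |G.step x g n - y n| ≤ ‖G.step x g - y‖ := fun n =>
        abs_apply_le_norm (G.step x g - y) n
      obtain ⟨g', hg', hgd⟩ := hC (fun n => G.α n = 1 ∨ G.lo n = 0)
        (fun n => G.α n = 1 ∨ G.hi n = 0) (fun e => G.fl e = 0) (fun e => G.fu e = 0)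
        (fun n => G.lo n - G.α n * x n) (fun n => G.hi n - G.α n * x n) 0 0 g
        ‖G.step x g - y‖ (norm_nonneg _)
        (fun n hn => by
          have h1 := (abs_le.1 (hd n)).1
          have h2 := (hy n).1 hn
          simp only [step] at h1 ⊢; linarith)
        (fun n hn => by
          have h1 := (abs_le.1 (hd n)).2
          have h2 := (hy n).2 hn
          simp only [step] at h1 ⊢; linarith)
        (fun e he => by have := hg.1 e he; simp; positivity)
        (fun e he => by have := hg.2 e he; simp; linarith [norm_nonneg (G.step x g - y)])
        ⟨0, fun n hn => by have := (h0Y.2 n).1 hn; simp [step] at this; simpa using this,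
          fun n hn => by have := (h0Y.2 n).2 hn; simp [step] at this; simpa using this,
          fun _ _ => le_rfl, fun _ _ => le_rfl⟩
      have hR : G.Reach x g' := ⟨⟨hg'.p, hg'.q⟩, fun n =>
        ⟨fun hn => by have := hg'.lb n hn; simp only [step]; linarith,
          fun hn => by have := hg'.ub n hn; simp only [step]; linarith⟩⟩
      have h1 := hmin g' hR
      have h2 := hzlip _ hR.2 y hy
      have h3 : ‖G.step x g' - y‖ ≤ (1 + K * C) * ‖G.step x g - y‖ := by
        have e : G.step x g' - y = (G.step x g - y) + G.step 0 (g' - g) := by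
          rw [← sub_self x, ← step_sub]; abel
        rw [e]
        refine (norm_add_le _ _).trans ?_
        have h4 := hK 0 (g' - g)
        rw [norm_zero, zero_add] at h4
        linarith [mul_le_mul_of_nonneg_left hgd hK0]
      have h4 := mul_le_mul_of_nonneg_left h3 hL0
      rw [hW, mul_assoc]
      linarith)
  have hlsum : ∀ h : V → ℝ, l h = ∑ n, h n * l (Pi.single n 1) := fun h => by
    conv_lhs => rw [← Finset.univ_sum_single h]
    rw [map_sum]
    refine Finset.sum_congr rfl fun n _ => ?_
    have : Pi.single n (h n) = h n • (Pi.single n 1 : V → ℝ) := by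
      rw [← Pi.single_smul]; simp
    rw [this, map_smul, smul_eq_mul]
  refine ⟨fun n => -l (Pi.single n 1), fun g hg y hy => ?_⟩
  have h1 := hl (g, y) ⟨hg, hy⟩ 0
  rw [norm_zero, mul_zero, add_zero, hA, sub_zero, hlsum] at h1
  refine h1.trans (le_of_eq ?_)
  congr 1
  refine Finset.sum_congr rfl fun n _ => ?_
  simp only [Pi.sub_apply]
  ring

end Net

/-! ### The permanent cost is controlled by deficits. -/

namespace Net

variable {V E : Type} [Fintype V] [Fintype E] [DecidableEq V] {G : Net V E}

/-- A minimizer has `φ'(x) ≥ 0` unless it is the right end point. -/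
theorem marginal_nonneg {a b x hi : ℝ} (ha : 0 ≤ a) (hx : x < hi)
    (h : ∀ t, x ≤ t → t ≤ hi → a * x ^ 2 + b * x ≤ a * t ^ 2 + b * t) : 0 ≤ 2 * a * x + b := by
  by_contra! hneg
  set q := -(2 * a * x + b) with hq
  have hq0 : 0 < q := by linarith
  set δ := min (hi - x) (q / (2 * (a + 1))) with hδ
  have hδ0 : 0 < δ := lt_min (by linarith) (by positivity)
  have h1 := h (x + δ) (by linarith) (by linarith [min_le_left (hi - x) (q / (2 * (a + 1)))])
  have h2 : δ * (2 * (a + 1)) ≤ q := (le_div_iff₀ (by positivity)).1 (min_le_right _ _)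
  have h3 : a * (x + δ) ^ 2 + b * (x + δ) = a * x ^ 2 + b * x + δ * (a * δ - q) := by
    rw [hq]; ring
  rw [h3] at h1
  have h4 : 0 ≤ a * δ - q := by
    by_contra! h5
    nlinarith
  nlinarith [mul_nonneg ha hδ0.le]

theorem marginal_nonpos {a b x lo : ℝ} (ha : 0 ≤ a) (hx : lo < x)
    (h : ∀ t, lo ≤ t → t ≤ x → a * x ^ 2 + b * x ≤ a * t ^ 2 + b * t) : 2 * a * x + b ≤ 0 := by
  have := marginal_nonneg (b := -b) (x := -x) (hi := -lo) ha (by linarith) fun t h1 h2 => by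
    have := h (-t) (by linarith) (by linarith)
    linarith
  linarith

/-- A minimum-cut argument. Let `p` be the prices of the static problem at a minimizing total flow.
If `p n ≤ h`, optimality leaves no gap at `n`. Otherwise the nodes with price above `h` form a
closed set across whose boundary nothing flows, so its shortage is unchanged by the optimal flow.
After that flow all its gaps are nonnegative, hence each is at most the shortage. -/
theorem gap_le_deficit {x : V → ℝ} (hx : x ∈ G.box) {f : E → ℝ} (hf : G.Reach x f)
    (hmin : ∀ g, G.Reach x g → G.zCost (G.step x f) ≤ G.zCost (G.step x g)) {h : ℝ} (hh : 0 < h)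
    {n : V} (hα : G.α n = 1) (hβ : 0 < G.β n) : G.gap h n (G.step x f n) ≤ G.deficit h x := by
  classical
  obtain ⟨μ, hμ⟩ := exists_static_prices hx hf hmin
  set y := G.step x f with hy
  set p : V → ℝ := fun n => G.β n * μ n with hp
  have hedge : ∀ e t, (G.fl e = 0 → 0 ≤ t) → (G.fu e = 0 → t ≤ 0) →
      t * (p (G.head e) - p (G.tail e)) ≤ f e * (p (G.head e) - p (G.tail e)) := by
    intro e t h1 h2
    have h3 := hμ (Function.update f e t) ⟨fun e' he' => ?_, fun e' he' => ?_⟩ y hf.2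
    · simp only [mul_sub, Finset.sum_sub_distrib, hy, sum_mul_step] at h3
      have h4 : ∑ e', Function.update f e t e' * (p (G.head e') - p (G.tail e')) -
          ∑ e', f e' * (p (G.head e') - p (G.tail e')) =
          (t - f e) * (p (G.head e) - p (G.tail e)) := by
        rw [← Finset.sum_sub_distrib, Finset.sum_eq_single e]
        · rw [Function.update_self]; ring
        · intro e' _ he'; rw [Function.update_of_ne he']; ring
        · simp
      simp only [hp, mul_sub, Finset.sum_sub_distrib] at h4 ⊢
      linarith
    · by_cases h : e' = e
      · subst h; rw [Function.update_self]; exact h1 he'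
      · rw [Function.update_of_ne h]; exact hf.1.1 e' he'
    · by_cases h : e' = e
      · subst h; rw [Function.update_self]; exact h2 he'
      · rw [Function.update_of_ne h]; exact hf.1.2 e' he'
  have hup : ∀ e, 0 < p (G.head e) - p (G.tail e) → G.fu e = 0 := by
    intro e h1
    by_contra h2
    have := hedge e (f e + 1) (fun h3 => by linarith [hf.1.1 e h3]) fun h3 => absurd h3 h2
    linarith
  have hdown : ∀ e, p (G.head e) - p (G.tail e) < 0 → G.fl e = 0 := by
    intro e h1
    by_contra h2
    have := hedge e (f e - 1) (fun h3 => absurd h3 h2) fun h3 => by linarith [hf.1.2 e h3]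
    linarith
  -- Complementary slackness: the flows range over a cone, so `f e` may be scaled to `0` and to `2 *
  -- f e`.
  have hzero : ∀ e, p (G.head e) - p (G.tail e) ≠ 0 → f e = 0 := by
    intro e h1
    have h2 := hedge e 0 (fun _ => le_rfl) fun _ => le_rfl
    have h3 := hedge e (2 * f e) (fun h3 => by linarith [hf.1.1 e h3])
      fun h3 => by linarith [hf.1.2 e h3]
    have h4 : f e * (p (G.head e) - p (G.tail e)) = 0 := by linarith
    exact (mul_eq_zero.1 h4).resolve_right h1
  have hnode : ∀ m t, (G.α m = 1 ∨ G.lo m = 0 → G.lo m ≤ t) →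
      (G.α m = 1 ∨ G.hi m = 0 → t ≤ G.hi m) →
      (if G.α m = 1 then G.nodeCost m (y m) else 0) + μ m * y m ≤
        (if G.α m = 1 then G.nodeCost m t else 0) + μ m * t := by
    intro m t h1 h2
    have h3 := hμ f hf.1 (Function.update y m t) fun m' => by
      by_cases h : m' = m
      · subst h; rw [Function.update_self]; exact ⟨h1, h2⟩
      · rw [Function.update_of_ne h]; exact hf.2 m'
    have h4 : ∑ m', μ m' * (Function.update y m t m' - G.step x f m') = μ m * (t - y m) := by
      rw [Finset.sum_eq_single m]
      · rw [Function.update_self]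
      · intro m' _ hm'; rw [Function.update_of_ne hm', hy, sub_self, mul_zero]
      · simp
    have h5 : G.zCost (Function.update y m t) - G.zCost y =
        (if G.α m = 1 then G.nodeCost m t else 0) -
          (if G.α m = 1 then G.nodeCost m (y m) else 0) := by
      simp only [zCost]
      rw [← Finset.sum_sub_distrib, Finset.sum_eq_single m]
      · rw [Function.update_self]
      · intro m' _ hm'; rw [Function.update_of_ne hm', sub_self]
      · simp
    linarith
  have hprice : ∀ m, G.α m = 1 → 0 < G.β m →
      (G.lo m < y m → p m ≤ -(G.β m * (2 * G.γ m * y m + G.c m))) ∧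
      (y m < G.hi m → -(G.β m * (2 * G.γ m * y m + G.c m)) ≤ p m) := by
    intro m hαm hβm
    have h0 : ∀ t, G.lo m ≤ t → t ≤ G.hi m →
        G.γ m * y m ^ 2 + (G.c m + μ m) * y m ≤ G.γ m * t ^ 2 + (G.c m + μ m) * t := by
      intro t h1 h2
      have := hnode m t (fun _ => h1) fun _ => h2
      rw [if_pos hαm, if_pos hαm] at this
      simp only [nodeCost] at this
      linarith
    have hlo := (hf.2 m).1 (Or.inl hαm)
    have hhi := (hf.2 m).2 (Or.inl hαm)
    refine ⟨fun h1 => ?_, fun h1 => ?_⟩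
    · have h2 := marginal_nonpos (G.γ_nonneg m) h1 fun t h3 h4 => h0 t h3 (h4.trans hhi)
      have h3 := mul_nonpos_of_nonneg_of_nonpos hβm.le h2
      simp only [hp]; linarith
    · have h2 := marginal_nonneg (G.γ_nonneg m) h1 fun t h3 h4 => h0 t (hlo.trans h3) h4
      have h3 := mul_nonneg hβm.le h2
      simp only [hp]; linarith
  have hgapn : p n ≤ h → G.gap h n (y n) ≤ G.deficit h x := fun hn =>
    (gap_nonpos_of_price hβ hα ((hf.2 n).1 (Or.inl hα)) (hprice n hα hβ).2 hn
      ((hf.2 n).2 (Or.inl hα))).trans (deficit_nonneg h x)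
  rcases le_or_gt (p n) h with hn | hn
  · exact hgapn hn
  let S : Finset V := Finset.univ.filter fun m => h < p m
  have hSm : ∀ m, m ∈ S ↔ h < p m := fun m => by simp [S]
  have hret : ∀ m ∈ S, G.Retains m ∧ (G.α m ≠ 1 → y m = 0) := by
    intro m hm
    have h1 := hh.trans ((hSm m).1 hm)
    have hβm : 0 < G.β m := by
      refine lt_of_le_of_ne (G.β_nonneg m) fun h2 => ?_
      simp only [hp, ← h2, zero_mul] at h1
      exact lt_irrefl _ h1
    have hμm : 0 < μ m := by
      by_contra! h2
      have := mul_nonpos_of_nonneg_of_nonpos hβm.le h2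
      simp only [hp] at h1; linarith
    have hret : G.Retains m := by
      by_contra hcon
      have hα' : G.α m ≠ 1 := fun h2 => hcon ⟨hβm, Or.inl h2⟩
      have hlo' : G.lo m ≠ 0 := fun h2 => hcon ⟨hβm, Or.inr h2⟩
      have := hnode m (y m - 1) (fun h2 => absurd h2 (by simp [hα', hlo']))
        fun h2 => by linarith [(hf.2 m).2 h2]
      rw [if_neg hα', if_neg hα'] at this
      linarith
    refine ⟨hret, fun hα' => ?_⟩
    have hlo' := hret.2.resolve_left hα'
    have h2 : 0 ≤ y m := hlo' ▸ (hf.2 m).1 (Or.inr hlo')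
    have := hnode m 0 (fun _ => hlo'.le) fun _ => G.hi_nonneg m
    rw [if_neg hα', if_neg hα'] at this
    by_contra hne
    have h3 : 0 < y m := lt_of_le_of_ne h2 (Ne.symm hne)
    nlinarith
  have hS : G.Closed S := by
    refine ⟨fun m hm => (hret m hm).1, fun e => ⟨fun h1 h2 => ?_, fun h1 h2 => ?_⟩⟩
    · rw [hSm, not_lt] at h1
      rw [hSm] at h2
      exact hup e (by linarith)
    · rw [hSm, not_lt] at h2
      rw [hSm] at h1
      exact hdown e (by linarith)
  -- Every edge of the boundary joins different prices and therefore carries no flow.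
  have hin : ∑ m ∈ S, G.inflow f m = 0 := by
    have hcross : ∀ e, (G.tail e ∈ S ∧ G.head e ∉ S ∨ G.tail e ∉ S ∧ G.head e ∈ S) → f e = 0 := by
      rintro e (⟨h1, h2⟩ | ⟨h1, h2⟩)
      · rw [hSm] at h1
        rw [hSm, not_lt] at h2
        exact hzero e (by linarith)
      · rw [hSm] at h2
        rw [hSm, not_lt] at h1
        exact hzero e (by linarith)
    refine le_antisymm (sum_inflow_nonpos (fun e h1 h2 => (hcross e (Or.inr ⟨h1, h2⟩)).le)
      fun e h1 h2 => (hcross e (Or.inl ⟨h1, h2⟩)).ge) (sum_inflow_nonneg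
      (fun e h1 h2 => (hcross e (Or.inr ⟨h1, h2⟩)).ge)
      fun e h1 h2 => (hcross e (Or.inl ⟨h1, h2⟩)).le)
  have hsum : G.shortage h S x = ∑ m ∈ S, G.gap h m (y m) := by
    have h1 : ∑ m ∈ S, G.gap h m (y m) = ∑ m ∈ S, (G.gap h m (x m) - G.inflow f m) := by
      refine Finset.sum_congr rfl fun m hm => ?_
      obtain ⟨h2, h3⟩ := hret m hm
      have h4 := content_step_eq (G := G) h2.1 (y := x) (g := f) (by
        by_cases hα : G.α m = 1
        · exact Or.inl hα
        · exact Or.inr (h3 hα))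
      simp only [gap, hy, h4]; ring
    rw [h1, Finset.sum_sub_distrib, hin, sub_zero]; rfl
  refine le_trans ?_ (shortage_le_deficit hS h x)
  rw [hsum]
  refine Finset.single_le_sum (f := fun m => G.gap h m (y m)) (fun m hm => ?_) ((hSm n).2 hn)
  obtain ⟨h2, h3⟩ := hret m hm
  by_cases hαm : G.α m = 1
  · exact gap_nonneg_of_price h2.1 hαm ((hf.2 m).2 (Or.inl hαm)) (hprice m hαm h2.1).1
      ((hSm m).1 hm).le ((hf.2 m).1 (Or.inl hαm))
  · show 0 ≤ G.gap h m (y m)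
    rw [h3 hαm, gap_eq_zero hαm]

theorem target_nonpos {h : ℝ} (hh : 0 ≤ h) (n : V) : G.target h n ≤ 0 := by
  simp only [target]
  split_ifs with hα
  · refine div_nonpos_of_nonpos_of_nonneg (max_le (G.lo_nonpos n) ?_) (G.β_nonneg n)
    rcases le_or_gt 0 (G.c n) with hc | hc
    · refine (min_le_right _ _).trans (div_nonpos_of_nonpos_of_nonneg ?_ ?_)
      · have := div_nonneg hh (G.β_nonneg n)
        linarith
      · linarith [G.γ_nonneg n]
    · refine (min_le_left _ _).trans ?_
      by_contra! hpos
      nlinarith [G.c_hi n]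
  · exact le_rfl

variable (G) in
theorem exists_target_bound : ∃ C : ℝ, 0 ≤ C ∧ ∀ h, 0 ≤ h → ∀ n, -(C * h) ≤ G.target h n * G.β n := by
  refine ⟨∑ n, 1 / (2 * G.γ n * G.β n), Finset.sum_nonneg fun n _ => ?_, fun h hh n => ?_⟩
  · have := G.γ_nonneg n
    have := G.β_nonneg n
    positivity
  have h0 : ∀ n, 0 ≤ 1 / (2 * G.γ n * G.β n) := fun n => by
    have := G.γ_nonneg n
    have := G.β_nonneg n
    positivity
  have h1 := Finset.single_le_sum (f := fun n => 1 / (2 * G.γ n * G.β n)) (fun m _ => h0 m)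
    (Finset.mem_univ n)
  refine le_trans (neg_le_neg (mul_le_mul_of_nonneg_right h1 hh)) ?_
  have h2 : -(1 / (2 * G.γ n * G.β n) * h) ≤ 0 := neg_nonpos.2 (mul_nonneg (h0 n) hh)
  rcases (G.β_nonneg n).eq_or_lt with hβ | hβ
  · rw [← hβ] at h2 ⊢; rw [mul_zero (G.target h n)]; exact h2
  simp only [target]
  split_ifs with hα
  · rw [div_mul_cancel₀ _ hβ.ne']
    rcases le_or_gt (G.c n) 0 with hc | hc
    · refine le_trans (le_min (h2.trans (G.hi_nonneg n)) ?_) (le_max_right _ _)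
      rcases (G.γ_nonneg n).eq_or_lt with hγ | hγ
      · rw [← hγ]; simp
      · rw [le_div_iff₀ (by positivity)]
        have : -(1 / (2 * G.γ n * G.β n) * h) * (2 * G.γ n) = -(h / G.β n) := by field_simp
        rw [this]; linarith
    · refine le_trans ?_ (le_max_left _ _)
      have : G.lo n = 0 := by
        refine le_antisymm (G.lo_nonpos n) ?_
        by_contra! hneg
        nlinarith [G.c_lo n]
      rw [this]; exact h2
  · rw [zero_mul]; exact h2

theorem reach_neg {x : V → ℝ} {f : E → ℝ} : G.neg.Reach (-x) (-f) ↔ G.Reach x f := by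
  have key : ∀ {G : Net V E} {x : V → ℝ} {f : E → ℝ}, G.Reach x f → G.neg.Reach (-x) (-f) := by
    intro G x f h
    refine ⟨⟨fun e he => ?_, fun e he => ?_⟩, fun n => ⟨fun hn => ?_, fun hn => ?_⟩⟩
    · have := h.1.2 e (by simpa [neg] using he)
      simpa using this
    · have := h.1.1 e (by simpa [neg] using he)
      simpa using this
    · have := (h.2 n).2 (by simpa [neg] using hn)
      rw [step_neg]
      simpa [neg] using this
    · have := (h.2 n).1 (by simpa [neg] using hn)
      rw [step_neg]
      simpa [neg] using this
  refine ⟨fun h => ?_, key⟩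
  have h1 := key h
  have h2 : G.neg.neg = G := by
    cases G; simp [neg]
  rwa [neg_neg, neg_neg, h2] at h1

theorem zCost_neg (y : V → ℝ) : G.neg.zCost (-y) = G.zCost y := by
  refine Finset.sum_congr rfl fun n _ => ?_
  have h : G.neg.α = G.α := rfl
  rw [h]
  split_ifs
  · simp [nodeCost, neg]
  · rfl

variable (G) in
/-- The resource value is controlled by the deficits. -/
theorem exists_rho_le_deficit : ∃ C : ℝ, 0 ≤ C ∧ ∀ x ∈ G.box, ∀ h₁ h₂ : ℝ, 0 < h₁ → 0 < h₂ →
    G.rho x ≤ C * (h₁ + h₂ + G.deficit h₁ x + G.neg.deficit h₂ (-x)) := by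
  obtain ⟨C₁, hC₁0, hC₁⟩ := exists_target_bound G
  obtain ⟨C₂, hC₂0, hC₂⟩ := exists_target_bound G.neg
  obtain ⟨D, hD0, hD⟩ : ∃ D : ℝ, 0 ≤ D ∧ ∀ n t, G.lo n ≤ t → t ≤ G.hi n → |t| ≤ D := by
    refine ⟨∑ n, (|G.lo n| + |G.hi n|), Finset.sum_nonneg fun _ _ => by positivity,
      fun n t h1 h2 => ?_⟩
    refine le_trans ?_ (Finset.single_le_sum (f := fun n => |G.lo n| + |G.hi n|)
      (fun m _ => by positivity) (Finset.mem_univ n))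
    rw [abs_le]
    constructor <;> linarith [neg_abs_le (G.lo n), le_abs_self (G.hi n), abs_nonneg (G.lo n),
      abs_nonneg (G.hi n)]
  set B : ℝ := C₁ + C₂ + ∑ n, G.β n with hB
  have hβB : ∀ n, G.β n ≤ ∑ n, G.β n := fun n =>
    Finset.single_le_sum (fun m _ => G.β_nonneg m) (Finset.mem_univ n)
  have hβs : 0 ≤ ∑ n, G.β n := Finset.sum_nonneg fun m _ => G.β_nonneg m
  have hB0 : 0 ≤ B := by positivity
  refine ⟨(∑ n, (G.γ n * D + |G.c n|)) * B, mul_nonneg (Finset.sum_nonneg fun n _ =>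
    add_nonneg (mul_nonneg (G.γ_nonneg n) hD0) (abs_nonneg _)) hB0, fun x hx h₁ h₂ hh₁ hh₂ => ?_⟩
  obtain ⟨f, hf, hrho, hmin⟩ := exists_rho_min hx
  have hfneg : G.neg.Reach (-x) (-f) := reach_neg.2 hf
  have hminneg : ∀ g, G.neg.Reach (-x) g →
      G.neg.zCost (G.neg.step (-x) (-f)) ≤ G.neg.zCost (G.neg.step (-x) g) := by
    intro g hg
    have hg' : G.Reach x (-g) := reach_neg.1 (by rwa [neg_neg])
    have e : G.neg.step (-x) g = -G.step x (-g) := by rw [← step_neg, neg_neg]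
    rw [step_neg, e, zCost_neg, zCost_neg]
    exact hmin _ hg'
  set H := h₁ + h₂ + G.deficit h₁ x + G.neg.deficit h₂ (-x) with hH
  have hd1 := deficit_nonneg (G := G) h₁ x
  have hd2 := deficit_nonneg (G := G.neg) h₂ (-x)
  have hH0 : 0 ≤ H := by positivity
  have hy : ∀ n, G.α n = 1 → |G.step x f n| ≤ B * H := by
    intro n hα
    rcases G.β_pos n hα with hβ | ⟨hlo, hhi⟩
    · have g1 := gap_le_deficit hx hf hmin hh₁ hα hβ
      have g2 := gap_le_deficit (G := G.neg) (neg_mem_box hx) hfneg hminneg hh₂ (n := n) hα hβ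
      rw [step_neg] at g2
      simp only [gap, content] at g1 g2
      have a1 : G.neg.α n = 1 := hα
      have a2 : G.neg.β n = G.β n := rfl
      rw [hα, one_mul] at g1
      rw [a1, one_mul, a2, Pi.neg_apply] at g2
      have t1 := hC₁ h₁ hh₁.le n
      have t2 := hC₂ h₂ hh₂.le n
      rw [a2] at t2
      have m1 := mul_le_mul_of_nonneg_right g1 hβ.le
      have m2 := mul_le_mul_of_nonneg_right g2 hβ.le
      rw [sub_mul, div_mul_cancel₀ _ hβ.ne'] at m1 m2
      have b1 : C₁ * h₁ ≤ C₁ * H := mul_le_mul_of_nonneg_left (by rw [hH]; linarith) hC₁0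
      have b2 : C₂ * h₂ ≤ C₂ * H := mul_le_mul_of_nonneg_left (by rw [hH]; linarith) hC₂0
      have b3 : G.deficit h₁ x * G.β n ≤ (∑ n, G.β n) * H := by
        rw [mul_comm]
        exact mul_le_mul (hβB n) (by rw [hH]; linarith) hd1 hβs
      have b4 : G.neg.deficit h₂ (-x) * G.β n ≤ (∑ n, G.β n) * H := by
        rw [mul_comm]
        exact mul_le_mul (hβB n) (by rw [hH]; linarith) hd2 hβs
      have b5 : 0 ≤ C₁ * H := by positivity
      have b6 : 0 ≤ C₂ * H := by positivity
      rw [abs_le, hB]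
      constructor <;> linarith
    · have h1 := (hf.2 n).1 (Or.inl hα)
      have h2 := (hf.2 n).2 (Or.inl hα)
      have : G.step x f n = 0 := by linarith
      rw [this, abs_zero]; positivity
  rw [hrho, zCost, mul_assoc, Finset.sum_mul]
  refine Finset.sum_le_sum fun n _ => ?_
  have hcoef : 0 ≤ G.γ n * D + |G.c n| := add_nonneg (mul_nonneg (G.γ_nonneg n) hD0) (abs_nonneg _)
  split_ifs with hα
  · have h1 := hy n hα
    have h2 := hD n _ ((hf.2 n).1 (Or.inl hα)) ((hf.2 n).2 (Or.inl hα))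
    calc G.nodeCost n (G.step x f n) ≤ (G.γ n * D + |G.c n|) * |G.step x f n| := by
          have h3 : G.step x f n ^ 2 ≤ D * |G.step x f n| := by
            rw [← sq_abs, pow_two]; exact mul_le_mul_of_nonneg_right h2 (abs_nonneg _)
          have h4 : G.c n * G.step x f n ≤ |G.c n| * |G.step x f n| := by
            rw [← abs_mul]; exact le_abs_self _
          simp only [nodeCost]
          linarith [mul_le_mul_of_nonneg_left h3 (G.γ_nonneg n)]
      _ ≤ _ := mul_le_mul_of_nonneg_left h1 hcoef
  · positivity

end Net

/-! ### Deficits over many separated levels. -/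

namespace Net

variable {V E : Type} [Fintype V] [Fintype E] [DecidableEq V] {G : Net V E}

variable (G) in
/-- Optimal plans that stay near the origin are supported by prices. -/
theorem exists_priceSystem : ∃ L : ℝ, 0 < L ∧ ∃ C : ℕ → ℝ, (∀ m, 0 ≤ C m) ∧
    ∀ (N : ℕ) (x : V → ℝ) (f : ℕ → E → ℝ), G.IsOpt N x f → ∀ K ≤ N, ∀ r κ : ℝ, r < κ →
      (∀ e, G.fl e = 0 ∨ κ ≤ -G.fl e) → (∀ e, G.fu e = 0 ∨ κ ≤ G.fu e) →
      (∀ k < K, ∀ n, |G.traj x f k n| ≤ r) → (∀ k < K, ∀ e, |f k e| ≤ r) →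
      ∃ p, G.PriceSystem K L r (fun i => C (i + (N - K))) (G.traj x f) f p := by
  obtain ⟨C, hC0, hC⟩ := exists_prices G
  -- `L` exceeds every marginal edge cost. A larger price difference would drive the flow to its
  -- capacity, which is impossible for a small flow unless that capacity vanishes.
  set L : ℝ := 1 + ∑ e, (2 * G.ρ e * (G.fu e - G.fl e) + |G.d e|) with hL
  have hterm : ∀ e, 0 ≤ 2 * G.ρ e * (G.fu e - G.fl e) + |G.d e| := fun e =>
    add_nonneg (mul_nonneg (mul_nonneg zero_le_two (G.ρ_nonneg e))
      (by linarith [G.fu_nonneg e, G.fl_nonpos e])) (abs_nonneg _)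
  have hLe : ∀ e, 2 * G.ρ e * (G.fu e - G.fl e) + |G.d e| < L := fun e => by
    have := Finset.single_le_sum (f := fun e => 2 * G.ρ e * (G.fu e - G.fl e) + |G.d e|)
      (fun e _ => hterm e) (Finset.mem_univ e)
    linarith
  refine ⟨L, by have := Finset.sum_nonneg fun e (_ : e ∈ Finset.univ) => hterm e
                linarith, fun m => (∑ n, G.β n) * C m,
    fun m => mul_nonneg (Finset.sum_nonneg fun n _ => G.β_nonneg n) (hC0 m),
    fun N x f hf K hK r κ hr hκl hκu hx hfl => ?_⟩
  obtain ⟨μ, hμ, he, hn⟩ := hC N x f hf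
  refine ⟨fun k n => G.β n * μ k n, ?_⟩
  have hslope : ∀ k < K, ∀ e, G.ρ e * f k e ≤ G.ρ e * G.fu e ∧ G.ρ e * G.fl e ≤ G.ρ e * f k e :=
    fun k hk e => ⟨mul_le_mul_of_nonneg_left ((hf.1.1 k).2 e) (G.ρ_nonneg e),
      mul_le_mul_of_nonneg_left ((hf.1.1 k).1 e) (G.ρ_nonneg e)⟩
  have hρ1 : ∀ e, G.ρ e * G.fl e ≤ 0 := fun e =>
    mul_nonpos_of_nonneg_of_nonpos (G.ρ_nonneg e) (G.fl_nonpos e)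
  have hρ2 : ∀ e, 0 ≤ G.ρ e * G.fu e := fun e => mul_nonneg (G.ρ_nonneg e) (G.fu_nonneg e)
  refine ⟨fun k _ => rfl, fun k hk => hf.1.2 k (by omega), fun k _ => hf.1.1 k, hx,
    fun k hk e => ?_, fun k hk e h => ?_, fun k hk e h => ?_, fun k hk h1 n h => ?_,
    fun k hk h1 n h => ?_, fun k _ _ n h => ?_, fun k hk h1 n => ?_⟩
  · have h1 := he k (by omega) e 0 (G.fl_nonpos e) (G.fu_nonneg e)
    have h2 := edgeCost_nonneg (hf.1.1 k) e
    simp only [edgeCost] at h1 h2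
    linarith
  · by_contra hne
    have h2 := (hκu e).resolve_left hne
    have h3 := marginal_nonneg (G.ρ_nonneg e) (x := f k e) (hi := G.fu e)
      (b := G.d e - (G.β (G.head e) * μ (k + 1) (G.head e) -
          G.β (G.tail e) * μ (k + 1) (G.tail e)))
      (by linarith [(abs_le.1 (hfl k hk e)).2]) (fun t h3 h4 => by
        have := he k (by omega) e t (((hf.1.1 k).1 e).trans h3) h4
        simp only [edgeCost] at this; linarith)
    linarith [hLe e, (hslope k hk e).1, hρ1 e, le_abs_self (G.d e)]
  · by_contra hne
    have h2 := (hκl e).resolve_left hne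
    have h3 := marginal_nonpos (G.ρ_nonneg e) (x := f k e) (lo := G.fl e)
      (b := G.d e - (G.β (G.head e) * μ (k + 1) (G.head e) -
          G.β (G.tail e) * μ (k + 1) (G.tail e)))
      (by linarith [(abs_le.1 (hfl k hk e)).1]) (fun t h3 h4 => by
        have := he k (by omega) e t h3 (h4.trans ((hf.1.1 k).2 e))
        simp only [edgeCost] at this; linarith)
    linarith [hLe e, (hslope k hk e).2, hρ2 e, neg_abs_le (G.d e)]
  · have hb := hf.1.2 k (by omega)
    have h3 := marginal_nonneg (G.γ_nonneg n) (x := G.traj x f k n) (hi := G.hi n)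
      (b := G.c n + (μ k n - G.α n * μ (k + 1) n)) h (fun t h3 h4 => by
        have := hn k (by omega) h1 n t ((hb.1 n).trans h3) h4
        simp only [nodeCost] at this; linarith)
    have := mul_nonneg (G.β_nonneg n) h3
    linarith
  · have hb := hf.1.2 k (by omega)
    have h3 := marginal_nonpos (G.γ_nonneg n) (x := G.traj x f k n) (lo := G.lo n)
      (b := G.c n + (μ k n - G.α n * μ (k + 1) n)) h (fun t h3 h4 => by
        have := hn k (by omega) h1 n t h3 (h4.trans (hb.2 n))
        simp only [nodeCost] at this; linarith)
    have := mul_nonpos_of_nonneg_of_nonpos (G.β_nonneg n) h3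
    linarith
  · simp only [h, zero_mul]
  · obtain ⟨k, rfl⟩ : ∃ j, k = j + 1 := ⟨k - 1, by omega⟩
    have h2 := hμ k (by omega) n
    rw [show K - (k + 1) + (N - K) = N - (k + 1) by omega, abs_mul,
      abs_of_nonneg (G.β_nonneg n)]
    exact mul_le_mul (Finset.single_le_sum (fun m _ => G.β_nonneg m) (Finset.mem_univ n)) h2
      (abs_nonneg _) (Finset.sum_nonneg fun n _ => G.β_nonneg n)

section

variable {K : ℕ} {L r κ B Θ : ℝ} {C : ℕ → ℝ} {x : ℕ → V → ℝ} {f : ℕ → E → ℝ} {p : ℕ → V → ℝ}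

/-- Over well separated levels, the deficits grow in total by at most the loss of content. -/
theorem PriceSystem.sum_deficit_step_le (hp : G.PriceSystem K L r C x f p) (hK : 1 < K)
    (hκ : ∀ n, G.lo n = 0 ∨ κ ≤ -G.lo n) (hr : r < κ) (hL : 0 < L)
    (hB : ∀ n t, G.lo n ≤ t → t ≤ G.hi n → |G.β n * (2 * G.γ n * t + G.c n)| ≤ B)
    (hΘ0 : 0 ≤ Θ) (hCΘ : C 0 < Θ) (hLΘ : L ≤ Θ)
    (hΘ : ∀ n, G.α n ≠ 1 → B + (Fintype.card V + 1) * L ≤ (1 - G.α n) * Θ)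
    {s : Finset ℕ} {h : ℕ → ℝ} (hh : ∀ i ∈ s, 0 ≤ h i)
    (hleak : ∀ i ∈ s, ∀ k < K, 1 ≤ k → -Θ + (K - (k + 1 : ℕ)) * h i < 0 → ∀ n, G.lo n = 0 →
      G.α n ≠ 1 → 0 < x k n → p k n - p (k + 1) n ≤ h i)
    (hsep : ∀ i ∈ s, ∀ j ∈ s, i ≠ j → 2 * Θ < (K - 1) * |h i - h j|) :
    ∑ i ∈ s, G.deficit (h i) (x 1) ≤ ∑ i ∈ s, G.deficit (h i) (x 0) +
      Fintype.card V * (G.loss (x 1) - G.loss (x 0)) := by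
  have hK1 : (0 : ℝ) ≤ K - 1 := by
    have : (1 : ℝ) < K := by exact_mod_cast hK
    linarith
  have hx1 : x 1 = G.step (x 0) (f 0) := hp.step 0 (by omega)
  have hb1 := hp.box 1 hK.le
  have hf0 := hp.flows 0 (by omega)
  rw [hx1] at hb1
  have hΔ := loss_le_loss_step hf0 hb1
  rw [← hx1] at hΔ
  -- At most `card V` levels are bad. There the deficit may grow by the loss of content; at all the
  -- others it does not grow.
  obtain ⟨b, hbs, hbc, hb⟩ := card_bad_levels (p 1) (fun i => (K - 1) * h i) s Θ
    (fun i hi j hj hij => by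
      rw [← mul_sub, abs_mul, abs_of_nonneg hK1]; exact hsep i hi j hj hij)
  have key : ∑ i ∈ s, (G.deficit (h i) (x 1) - G.deficit (h i) (x 0)) ≤
      ∑ i ∈ s, if i ∈ b then G.loss (x 1) - G.loss (x 0) else 0 := by
    refine Finset.sum_le_sum fun i hi => ?_
    split_ifs with hib
    · have := deficit_step_le (h i) hf0 (by rw [← hx1]; exact hp.box 1 hK.le)
      rw [← hx1] at this
      linarith
    · rw [sub_nonpos]
      refine Finset.sup'_le _ _ fun S hS => ?_
      obtain ⟨U, hU, h1⟩ := hp.exists_shortage_le hK hκ hr hL hB hΘ0 hCΘ hLΘ hΘ (hh i hi)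
        (hleak i hi) (hb i hi hib) (mem_closedSets.1 hS)
      exact h1.trans (shortage_le_deficit hU _ _)
  rw [Finset.sum_sub_distrib, ← Finset.sum_filter, Finset.filter_mem_eq_inter,
    Finset.inter_eq_right.2 hbs, Finset.sum_const, nsmul_eq_mul] at key
  have : (b.card : ℝ) * (G.loss (x 1) - G.loss (x 0)) ≤
      Fintype.card V * (G.loss (x 1) - G.loss (x 0)) :=
    mul_le_mul_of_nonneg_right (by exact_mod_cast hbc) (by linarith)
  linarith

end

variable (G) in
open Classical in
noncomputable def leakyCost (x : V → ℝ) : ℝ := ∑ n with G.α n ≠ 1, G.nodeCost n (x n)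

theorem leakyCost_nonneg {x : V → ℝ} (hx : x ∈ G.box) : 0 ≤ G.leakyCost x :=
  Finset.sum_nonneg fun n _ => nodeCost_nonneg hx n

theorem nodeCost_le_leakyCost {x : V → ℝ} (hx : x ∈ G.box) {n : V} (hn : G.α n ≠ 1) :
    G.nodeCost n (x n) ≤ G.leakyCost x := by
  classical
  exact Finset.single_le_sum (f := fun n => G.nodeCost n (x n)) (fun m _ => nodeCost_nonneg hx m)
    (by simp [hn])

theorem exists_marginal_bound (G : Net V E) : ∃ B : ℝ, ∀ n t, G.lo n ≤ t → t ≤ G.hi n →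
    |G.β n * (2 * G.γ n * t + G.c n)| ≤ B := by
  have h0 : ∀ n, 0 ≤ G.β n * (2 * G.γ n * (G.hi n - G.lo n) + |G.c n|) := fun n =>
    mul_nonneg (G.β_nonneg n) (add_nonneg (mul_nonneg (mul_nonneg zero_le_two (G.γ_nonneg n))
      (by linarith [G.lo_nonpos n, G.hi_nonneg n])) (abs_nonneg _))
  refine ⟨∑ n, G.β n * (2 * G.γ n * (G.hi n - G.lo n) + |G.c n|), fun n t h1 h2 => ?_⟩
  refine le_trans ?_ (Finset.single_le_sum
    (f := fun n => G.β n * (2 * G.γ n * (G.hi n - G.lo n) + |G.c n|))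
    (fun n _ => h0 n) (Finset.mem_univ n))
  rw [abs_mul, abs_of_nonneg (G.β_nonneg n)]
  refine mul_le_mul_of_nonneg_left ?_ (G.β_nonneg n)
  have h3 := G.γ_nonneg n
  refine (abs_add_le _ _).trans ?_
  rw [abs_mul, abs_of_nonneg (mul_nonneg zero_le_two h3)]
  have : |t| ≤ G.hi n - G.lo n := abs_le.2
    ⟨by linarith [G.hi_nonneg n], by linarith [G.lo_nonpos n]⟩
  linarith [mul_le_mul_of_nonneg_left this (mul_nonneg zero_le_two h3)]

theorem exists_leak_threshold (G : Net V E) (W : ℝ) (hW : 0 ≤ W) : ∃ Θ : ℝ, 0 ≤ Θ ∧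
    ∀ Θ' ≥ Θ, ∀ n, G.α n ≠ 1 → W ≤ (1 - G.α n) * Θ' := by
  have h0 : ∀ n, 0 ≤ W * (1 - G.α n)⁻¹ := fun n =>
    mul_nonneg hW (inv_nonneg.2 (by linarith [G.α_le_one n]))
  refine ⟨∑ n, W * (1 - G.α n)⁻¹, Finset.sum_nonneg fun n _ => h0 n, fun Θ' hΘ n hn => ?_⟩
  have h1 : 0 < 1 - G.α n := sub_pos.2 (lt_of_le_of_ne (G.α_le_one n) hn)
  have h2 := (Finset.single_le_sum (fun n _ => h0 n) (Finset.mem_univ n)).trans hΘ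
  have h3 := mul_le_mul_of_nonneg_left h2 h1.le
  rwa [mul_comm W, mul_inv_cancel_left₀ h1.ne'] at h3

theorem exists_leak_decay (G : Net V E) (C : ℝ) {ε : ℝ} (hε : 0 < ε) :
    ∃ j : ℕ, ∀ n, G.α n ≠ 1 → ∀ i ≥ j, G.α n ^ i * C ≤ ε := by
  have h : ∀ n, ∀ᶠ i : ℕ in atTop, G.α n ≠ 1 → G.α n ^ i * C ≤ ε := fun n => by
    by_cases hn : G.α n = 1
    · simp [hn]
    · have h1 := (tendsto_pow_atTop_nhds_zero_of_lt_one (G.α_nonneg n)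
        (lt_of_le_of_ne (G.α_le_one n) hn)).mul_const C
      rw [zero_mul] at h1
      filter_upwards [h1.eventually (ge_mem_nhds hε)] with i hi _ using hi
  obtain ⟨j, hj⟩ := eventually_atTop.1 (eventually_all.2 h)
  exact ⟨j, fun n hn i hi => hj i hi n hn⟩

variable (G) in
/-- The deficits over well separated levels are nearly monotone along supported trajectories of
bounded leaky cost. -/
theorem exists_sum_deficit_step_le (C : ℕ → ℝ) (hC : ∀ m, 0 ≤ C m) {L r κ R h₁ : ℝ} (hL : 0 < L)
    (hκl : ∀ n, G.lo n = 0 ∨ κ ≤ -G.lo n) (hκu : ∀ n, G.hi n = 0 ∨ κ ≤ G.hi n) (hr : r < κ)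
    (hh₁ : 0 < h₁) : ∃ (D : ℕ) (Λ : ℝ), ∀ K x f p, D + 2 ≤ K → G.PriceSystem K L r C x f p →
      ∑ k ∈ Finset.range K, G.leakyCost (x k) ≤ R → ∀ (s : Finset ℕ) (h : ℕ → ℝ),
      (∀ i ∈ s, h₁ ≤ h i) →
      (∀ i ∈ s, ∀ j ∈ s, i ≠ j → Λ < ((K - D - 1 : ℕ) : ℝ) * |h i - h j|) →
      ∑ i ∈ s, G.deficit (h i) (x 1) ≤ ∑ i ∈ s, G.deficit (h i) (x 0) +
        Fintype.card V * (G.loss (x 1) - G.loss (x 0)) := by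
  obtain ⟨B, hB⟩ := exists_marginal_bound G
  obtain ⟨Θ₀, hΘ₀0, hΘ₀⟩ := exists_leak_threshold G (|B| + (Fintype.card V + 1) * L) (by positivity)
  set r' : ℝ := h₁ / (4 * (∑ n, G.β n * G.γ n + 1)) with hr'
  have hβγ : ∀ n, 0 ≤ G.β n * G.γ n := fun n => mul_nonneg (G.β_nonneg n) (G.γ_nonneg n)
  have hsum0 : 0 ≤ ∑ n, G.β n * G.γ n := Finset.sum_nonneg fun n _ => hβγ n
  have hr'0 : 0 < r' := by positivity
  have hrh : ∀ n, 2 * G.β n * G.γ n * r' ≤ h₁ / 2 := fun n => by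
    have h1 := Finset.single_le_sum (fun n _ => hβγ n) (Finset.mem_univ n)
    have h2 : r' * (4 * (∑ n, G.β n * G.γ n + 1)) = h₁ := by rw [hr']; field_simp
    have h3 := mul_le_mul_of_nonneg_right h1 hr'0.le
    linarith
  obtain ⟨η, hη0, hη⟩ := exists_small_of_nodeCost G hr'0
  -- Near the end of the horizon the leaky stocks have to be small for the price estimates. Fewer
  -- than `m` stages can have leaky cost above `η` when the total is below `m * η`, so induction on
  -- `m` may discard the end of the horizon whenever such a stage occurs in the last window.
  have key : ∀ m D₀ : ℕ, ∃ (D : ℕ) (Λ : ℝ), D₀ ≤ D ∧ ∀ K x f p, D + 2 ≤ K →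
      G.PriceSystem K L r C x f p →
      ∑ k ∈ Finset.range (K - D₀), G.leakyCost (x k) < m * η → ∀ (s : Finset ℕ) (h : ℕ → ℝ),
      (∀ i ∈ s, h₁ ≤ h i) →
      (∀ i ∈ s, ∀ j ∈ s, i ≠ j → Λ < ((K - D - 1 : ℕ) : ℝ) * |h i - h j|) →
      ∑ i ∈ s, G.deficit (h i) (x 1) ≤ ∑ i ∈ s, G.deficit (h i) (x 0) +
        Fintype.card V * (G.loss (x 1) - G.loss (x 0)) := by
    intro m
    induction m with
    | zero =>
      refine fun D₀ => ⟨D₀, 0, le_rfl, fun K x f p hK hp hlt => ?_⟩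
      have : 0 ≤ ∑ k ∈ Finset.range (K - D₀), G.leakyCost (x k) := Finset.sum_nonneg fun k hk =>
        leakyCost_nonneg (hp.box k (by have := Finset.mem_range.1 hk; omega))
      simp only [Nat.cast_zero, zero_mul] at hlt
      linarith
    | succ m ih =>
      intro D₀
      obtain ⟨j, hj⟩ := exists_leak_decay G (C D₀) (half_pos hh₁)
      set Θ : ℝ := Θ₀ + C (D₀ + j) + 1 + L with hΘdef
      have hCj := hC (D₀ + j)
      -- The threshold that starts at `-Θ` becomes nonnegative within `q` stages from the end,
      -- because its slope is at least `h₁`; only there is the condition on leaky nodes needed.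
      obtain ⟨q, hq⟩ := exists_nat_ge (Θ / h₁)
      rw [div_le_iff₀ hh₁] at hq
      obtain ⟨D, Λ, hD, ih⟩ := ih (D₀ + j + q + 1)
      refine ⟨D, max Λ (2 * Θ), by omega, fun K x f p hK hp hlt s h hhs hsep => ?_⟩
      -- The window has three pieces: `j` stages for the final prices to be damped, `q` stages for
      -- the threshold to reach zero, and one more for the index shift.
      by_cases hwin : ∃ k, K - (D₀ + j + q + 1) ≤ k ∧ k < K - D₀ ∧ η < G.leakyCost (x k)
      · obtain ⟨k, hk1, hk2, hk3⟩ := hwin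
        refine ih K x f p hK hp ?_ s h hhs fun i hi j hj hij =>
          lt_of_le_of_lt (le_max_left _ _) (hsep i hi j hj hij)
        have h1 : ∑ i ∈ insert k (Finset.range (K - (D₀ + j + q + 1))), G.leakyCost (x i) ≤
            ∑ i ∈ Finset.range (K - D₀), G.leakyCost (x i) := by
          refine Finset.sum_le_sum_of_subset_of_nonneg (fun i hi => ?_) fun i hi _ =>
            leakyCost_nonneg (hp.box i (by have := Finset.mem_range.1 hi; omega))
          rcases Finset.mem_insert.1 hi with rfl | hi
          · exact Finset.mem_range.2 hk2
          · have := Finset.mem_range.1 hi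
            exact Finset.mem_range.2 (by omega)
        rw [Finset.sum_insert (by simp; omega)] at h1
        push_cast at hlt
        linarith
      · push Not at hwin
        have hp₀ := hp.restrict D₀
        have hp₁ := hp₀.restrict j
        rw [show K - D₀ - j = K - (D₀ + j) by omega] at hp₁
        refine hp₁.sum_deficit_step_le (κ := κ) (B := |B|) (Θ := Θ) (by omega) hκl hr hL
          (fun n t h1 h2 => (hB n t h1 h2).trans (le_abs_self B)) (by positivity) ?_ ?_
          (hΘ₀ Θ (by linarith)) (fun i hi => hh₁.le.trans (hhs i hi)) ?_ ?_
        · rw [show 0 + (K - D₀ - (K - (D₀ + j))) + (K - (K - D₀)) = D₀ + j by omega]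
          linarith
        · linarith
        · intro a ha k hk hk1 hneg n hlo hα hpos
          refine le_trans (hp₀.price_sub_le (h := h₁) (r' := r') (j := j) hκu hr (hC _) (hrh n)
            (fun i hi => ?_) (k := k) (by omega) hk1 (fun i hki hiK => ?_) hlo hα hpos) (hhs a ha)
          · rw [show 0 + (K - (K - D₀)) = D₀ by omega]
            exact hj n hα i hi
          · have hb := hp.box i (by omega)
            refine (le_abs_self _).trans (hη n _ (hb.1 n) (hb.2 n)
              ((nodeCost_le_leakyCost hb hα).trans (hwin i ?_ hiK)))
            by_contra! hlt'
            have h1 : (q : ℝ) ≤ (K - (D₀ + j) : ℕ) - (k + 1 : ℕ) := by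
              have : q + (k + 1) ≤ K - (D₀ + j) := by omega
              have : ((q + (k + 1) : ℕ) : ℝ) ≤ (K - (D₀ + j) : ℕ) := by exact_mod_cast this
              push_cast at this ⊢
              linarith
            have h2 := mul_le_mul h1 (hhs a ha) hh₁.le (le_trans (Nat.cast_nonneg q) h1)
            linarith
        · intro i hi i' hi' hne
          refine lt_of_lt_of_le (lt_of_le_of_lt (le_max_right _ _) (hsep i hi i' hi' hne))
            (mul_le_mul_of_nonneg_right ?_ (abs_nonneg _))
          have : K - D - 1 + 1 ≤ K - (D₀ + j) := by omega
          have : ((K - D - 1 + 1 : ℕ) : ℝ) ≤ (K - (D₀ + j) : ℕ) := by exact_mod_cast this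
          push_cast at this ⊢
          linarith
  obtain ⟨m, hm⟩ := exists_nat_gt (R / η)
  rw [div_lt_iff₀ hη0] at hm
  obtain ⟨D, Λ, -, hD⟩ := key m 0
  exact ⟨D, Λ, fun K x f p hK hp hR => hD K x f p hK hp (lt_of_le_of_lt (by simpa using hR) hm)⟩

end Net

/-! ### The closed loop and its potential. -/

namespace Net

variable {V E : Type} [Fintype V] [Fintype E] [DecidableEq V] {G : Net V E}

theorem nodeCost_le_sum {x : V → ℝ} (hx : x ∈ G.box) (n : V) :
    G.nodeCost n (x n) ≤ ∑ n, G.nodeCost n (x n) :=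
  Finset.single_le_sum (f := fun n => G.nodeCost n (x n)) (fun m _ => nodeCost_nonneg hx m)
    (Finset.mem_univ n)

theorem sum_nodeCost_le_stage {x : V → ℝ} {f : E → ℝ} (hf : f ∈ G.flows) :
    ∑ n, G.nodeCost n (x n) ≤ G.stage x f :=
  le_add_of_nonneg_right (Finset.sum_nonneg fun e _ => edgeCost_nonneg hf e)

variable (G) in
theorem exists_small_of_sum_nodeCost {ε : ℝ} (hε : 0 < ε) : ∃ η > 0, ∀ x ∈ G.box,
    ∑ n, G.nodeCost n (x n) ≤ η → ‖x‖ ≤ ε := by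
  obtain ⟨η, hη0, hη⟩ := exists_small_of_nodeCost G hε
  refine ⟨η, hη0, fun x hx h => (pi_norm_le_iff_of_nonneg hε.le).2 fun n => ?_⟩
  exact hη n _ (hx.1 n) (hx.2 n) ((nodeCost_le_sum hx n).trans h)

variable (G) in
-- The map from a flow to its components of positive quadratic cost and its scaled inflows is
-- injective, hence bounded below. The components are controlled by the stage cost, the inflows by
-- the smallness of the stocks before and after the step.
theorem exists_small_flow {ε : ℝ} (hε : 0 < ε) : ∃ η > 0, ∀ (x : V → ℝ) (f : E → ℝ), f ∈ G.flows →
    G.step x f ∈ G.box → x ∈ G.box →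
    G.stage x f ≤ η → ∑ n, G.nodeCost n (G.step x f n) ≤ η → ‖f‖ ≤ ε := by
  classical
  let T : (E → ℝ) →ₗ[ℝ] (E → ℝ) × (V → ℝ) :=
    { toFun := fun f => (fun e => if 0 < G.ρ e then f e else 0, fun n => G.β n * G.inflow f n)
      map_add' := fun f g => by
        ext i
        · simp only [Pi.add_apply, Prod.fst_add]; split_ifs <;> simp
        · simp [mul_add]
      map_smul' := fun r f => by
        ext i
        · simp [Pi.smul_apply]
        · simp; ring }
  have hker : LinearMap.ker T = ⊥ := by
    refine (LinearMap.ker_eq_bot').2 fun f hf => G.inj f (fun e he => ?_) fun n => ?_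
    · have := congrFun (congrArg Prod.fst hf) e
      simpa [T, he] using this
    · exact congrFun (congrArg Prod.snd hf) n
  obtain ⟨K, -, hK⟩ := T.exists_antilipschitzWith hker
  set δ : ℝ := ε / (K + 1) with hδ
  have hδ0 : 0 < δ := by positivity
  obtain ⟨η₁, hη₁0, hη₁⟩ := exists_small_of_sum_nodeCost G (half_pos hδ0)
  obtain ⟨κ, hκ0, hκ⟩ := exists_pos_le_finite (fun e => if 0 < G.ρ e then G.ρ e else 1) (by
    intro e; split_ifs with h
    · exact h
    · exact one_pos)
  refine ⟨min η₁ (κ * δ ^ 2), lt_min hη₁0 (by positivity), fun x f hf hy hx h1 h2 => ?_⟩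
  have hx' := hη₁ x hx ((sum_nodeCost_le_stage hf).trans (h1.trans (min_le_left _ _)))
  have hy' := hη₁ _ hy (h2.trans (min_le_left _ _))
  have hT : ‖T f‖ ≤ δ := by
    refine norm_prod_le_iff.2 ⟨?_, ?_⟩
    · refine (pi_norm_le_iff_of_nonneg hδ0.le).2 fun e => ?_
      simp only [T, LinearMap.coe_mk, AddHom.coe_mk, Real.norm_eq_abs]
      split_ifs with he
      · have h3 := hκ e
        rw [if_pos he] at h3
        have h4 : G.edgeCost e (f e) ≤ G.stage x f :=
          (Finset.single_le_sum (f := fun e => G.edgeCost e (f e))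
            (fun e _ => edgeCost_nonneg hf e) (Finset.mem_univ e)).trans
            (le_add_of_nonneg_left (Finset.sum_nonneg fun n _ => nodeCost_nonneg hx n))
        have h5 := edgeCost_ge hf e
        have h6 := mul_le_mul_of_nonneg_right h3 (sq_nonneg (f e))
        have h7 : κ * f e ^ 2 ≤ κ * δ ^ 2 := by linarith [h1.trans (min_le_right _ _)]
        exact abs_le_of_sq_le_sq (le_of_mul_le_mul_left h7 hκ0) hδ0.le |> fun h =>
          abs_le.2 (abs_le.1 h)
      · simpa using hδ0.le
    · refine (pi_norm_le_iff_of_nonneg hδ0.le).2 fun n => ?_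
      have h3 := (abs_apply_le_norm (G.step x f) n).trans hy'
      have h4 := (abs_apply_le_norm x n).trans hx'
      have h5 : |G.α n * x n| ≤ |x n| := by
        rw [abs_mul, abs_of_nonneg (G.α_nonneg n)]
        exact mul_le_of_le_one_left (abs_nonneg _) (G.α_le_one n)
      have h6 : T f = (_, fun n => G.β n * G.inflow f n) := rfl
      rw [h6]
      simp only [step] at h3
      rw [Real.norm_eq_abs, abs_le]
      constructor <;> linarith [abs_le.1 h3, abs_le.1 (h5.trans h4)]
  have h3 := hK.le_mul_dist f 0
  rw [map_zero, dist_zero_right, dist_zero_right] at h3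
  have h4 : (K : ℝ) * ‖T f‖ ≤ K * δ := mul_le_mul_of_nonneg_left hT K.2
  have h5 : (K + 1 : ℝ) * δ = ε := by rw [hδ]; field_simp
  linarith

variable (G) in
/-- The closed loop under receding-horizon control. -/
def IsLoop (N : ℕ) (x : ℕ → V → ℝ) : Prop :=
  x 0 ∈ G.box ∧ ∀ t, ∃ f, G.IsOpt N (x t) f ∧ x (t + 1) = G.step (x t) (f 0)

theorem IsLoop.tail {N : ℕ} {x : ℕ → V → ℝ} (h : G.IsLoop N x) (t : ℕ) :
    G.IsLoop N fun i => x (t + i) := by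
  refine ⟨?_, fun i => h.2 (t + i)⟩
  obtain ⟨f, hf, -⟩ := h.2 t
  exact hf.1.start

theorem IsLoop.mem_box {N : ℕ} {x : ℕ → V → ℝ} (h : G.IsLoop N x) (t : ℕ) : x t ∈ G.box :=
  (h.tail t).1

/-- Inserting a stage where the value grows little. -/
theorem IsOpt.val_step_le {K m : ℕ} {x : V → ℝ} {f : ℕ → E → ℝ} {ε : ℝ}
    (h : G.IsOpt (K + m) x f) (hK : 1 ≤ K)
    (hε : G.val (m + 1) (G.traj x f K) ≤ G.val m (G.traj x f K) + ε) :
    G.val (K + m) (G.step x (f 0)) ≤ G.val (K + m) x - G.stage x (f 0) + ε := by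
  obtain ⟨k, rfl⟩ : ∃ k, K = 1 + k := ⟨K - 1, by omega⟩
  have h1 := h.val_eq
  have h2 : G.IsPlan k (G.step x (f 0)) fun i => f (1 + i) := by
    have := (h.1.mono (show 1 + k ≤ 1 + k + m by omega)).tail
    simpa [traj] using this
  have h3 := h2.val_add_le (m + 1)
  have h4 : G.traj (G.step x (f 0)) (fun i => f (1 + i)) k = G.traj x f (1 + k) := by
    rw [traj_add]; rfl
  rw [h4, show k + (m + 1) = 1 + k + m by ring] at h3
  rw [Finset.sum_range_add] at h1
  have h5 : ∀ j, G.stage (G.traj (G.step x (f 0)) (fun i => f (1 + i)) j) (f (1 + j)) =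
      G.stage (G.traj x f (1 + j)) (f (1 + j)) := fun j => by rw [traj_add x f 1]; rfl
  simp only [h5] at h3
  simp only [Finset.sum_range_one] at h1
  have h6 : G.traj x f 0 = x := rfl
  rw [h6] at h1
  linarith

theorem PriceSystem.mono {K : ℕ} {L r : ℝ} {C C' : ℕ → ℝ} {x : ℕ → V → ℝ} {f : ℕ → E → ℝ}
    {p : ℕ → V → ℝ} (hp : G.PriceSystem K L r C x f p) (h : ∀ i, C i ≤ C' i) :
    G.PriceSystem K L r C' x f p :=
  { hp with bound := fun k hk h1 n => (hp.bound k hk h1 n).trans (h _) }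

theorem leakyCost_neg (x : V → ℝ) : G.neg.leakyCost (-x) = G.leakyCost x := by
  have h : G.neg.α = G.α := rfl
  simp only [leakyCost, h]
  exact Finset.sum_congr rfl fun n _ => by simp [nodeCost, neg]

theorem leakyCost_add_rho_le {x : V → ℝ} {f : E → ℝ} (hx : x ∈ G.box) (hf : f ∈ G.flows) :
    G.leakyCost x + G.rho x ≤ G.stage x f := by
  have h1 := rho_le_zCost hx
  have h2 := sum_nodeCost_le_stage (x := x) hf
  have h3 : G.leakyCost x + G.zCost x = ∑ n, G.nodeCost n (x n) := by
    rw [leakyCost, zCost, Finset.sum_filter, ← Finset.sum_add_distrib]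
    refine Finset.sum_congr rfl fun n _ => ?_
    by_cases h : G.α n = 1 <;> simp [h]
  linarith

variable (G) in
theorem exists_deficit_le : ∃ C : ℝ, 0 ≤ C ∧ ∀ (x : V → ℝ) (h : ℝ), 0 ≤ h →
    G.deficit h x ≤ C * ‖x‖ := by
  have h0 : ∀ n, 0 ≤ G.α n / G.β n := fun n => div_nonneg (G.α_nonneg n) (G.β_nonneg n)
  refine ⟨∑ n, G.α n / G.β n, Finset.sum_nonneg fun n _ => h0 n, fun x h hh => ?_⟩
  refine Finset.sup'_le _ _ fun S _ => ?_
  have h1 : G.shortage h S x ≤ ∑ n ∈ S, G.α n / G.β n * ‖x‖ := by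
    refine Finset.sum_le_sum fun n _ => ?_
    have h2 := target_nonpos (G := G) hh n
    have h3 := mul_le_mul_of_nonneg_left ((neg_le_abs _).trans (abs_apply_le_norm x n)) (h0 n)
    have h4 : G.content n (x n) = G.α n / G.β n * x n := by simp only [content]; ring
    rw [gap, h4]
    linarith
  refine h1.trans ?_
  rw [← Finset.sum_mul]
  refine mul_le_mul_of_nonneg_right ?_ (norm_nonneg _)
  exact Finset.sum_le_sum_of_subset_of_nonneg (Finset.subset_univ S) fun n _ _ => h0 n

variable (G) in
theorem exists_loss_bound : ∃ W : ℝ, 0 ≤ W ∧ ∀ x ∈ G.box, |G.loss x| ≤ W := by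
  have hc : Continuous G.loss := by
    unfold loss content
    fun_prop
  obtain ⟨W, hW⟩ := (isCompact_Icc (a := G.lo) (b := G.hi)).exists_bound_of_continuousOn
    hc.continuousOn
  exact ⟨max W 0, le_max_right _ _, fun x hx => (hW x hx).trans (le_max_left _ _)⟩

variable (G) in
/-- The total deficit over the levels `h i`, corrected by the loss of content. -/
noncomputable def potential (h : ℕ → ℝ) (J : ℕ) (x : V → ℝ) : ℝ :=
  (∑ i ∈ Finset.range J, G.deficit (h i) x + ∑ i ∈ Finset.range J, G.neg.deficit (h i) (-x)) -
    Fintype.card V * (G.loss x + G.neg.loss (-x))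

/-- The deficits of the network account for shortages, those of its reversal for surpluses.
Subtracting `card V` times the losses absorbs the growth at the bad levels of each family, and what
remains is monotone. -/
theorem exists_potential_step_le (G : Net V E) (C : ℕ → ℝ) (hC : ∀ m, 0 ≤ C m)
    {L r κ R h₁ : ℝ} (hL : 0 < L)
    (hκl : ∀ n, G.lo n = 0 ∨ κ ≤ -G.lo n) (hκu : ∀ n, G.hi n = 0 ∨ κ ≤ G.hi n) (hr : r < κ)
    (hh₁ : 0 < h₁) : ∃ (D : ℕ) (Λ : ℝ), 0 ≤ Λ ∧ ∀ K x f p, D + 2 ≤ K →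
      G.PriceSystem K L r C x f p →
      ∑ k ∈ Finset.range K, G.leakyCost (x k) ≤ R → ∀ (J : ℕ) (h : ℕ → ℝ),
      (∀ i, h₁ ≤ h i) →
      (∀ i j, i ≠ j → Λ < ((K - D - 1 : ℕ) : ℝ) * |h i - h j|) →
      G.potential h J (x 1) ≤ G.potential h J (x 0) := by
  obtain ⟨D₁, Λ₁, H₁⟩ := exists_sum_deficit_step_le G C hC (R := R) hL hκl hκu hr hh₁
  obtain ⟨D₂, Λ₂, H₂⟩ := exists_sum_deficit_step_le G.neg C hC (R := R) hL
    (fun n => by simpa [neg] using hκu n) (fun n => by simpa [neg] using hκl n) hr hh₁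
  refine ⟨max D₁ D₂, max (max Λ₁ Λ₂) 0, le_max_right _ _,
    fun K x f p hK hp hR J h hh hsep => ?_⟩
  have hcast : ∀ D ≤ max D₁ D₂, ((K - max D₁ D₂ - 1 : ℕ) : ℝ) ≤ ((K - D - 1 : ℕ) : ℝ) :=
    fun D hD => by exact_mod_cast (by omega : K - max D₁ D₂ - 1 ≤ K - D - 1)
  have h1 := H₁ K x f p (by omega) hp hR (Finset.range J) h (fun i _ => hh i)
    (fun i _ j _ hij => lt_of_lt_of_le
      (lt_of_le_of_lt ((le_max_left _ _).trans (le_max_left _ _)) (hsep i j hij))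
      (mul_le_mul_of_nonneg_right (hcast _ (le_max_left _ _)) (abs_nonneg _)))
  have h2 := H₂ K _ _ _ (by omega) hp.neg (by simpa only [leakyCost_neg] using hR)
    (Finset.range J) h (fun i _ => hh i)
    (fun i _ j _ hij => lt_of_lt_of_le
      (lt_of_le_of_lt ((le_max_right _ _).trans (le_max_left _ _)) (hsep i j hij))
      (mul_le_mul_of_nonneg_right (hcast _ (le_max_right _ _)) (abs_nonneg _)))
  simp only [potential]
  linarith

end Net

/-! ### Stability and attraction of the closed loop. -/

namespace Net

variable {V E : Type} [Fintype V] [Fintype E] [DecidableEq V] {G : Net V E}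

variable (G) in
/-- The potential bounds the resource value. -/
theorem exists_rho_le_potential : ∃ C : ℝ, 0 ≤ C ∧ ∃ W : ℝ, 0 ≤ W ∧ ∀ x ∈ G.box,
    (∀ (h : ℕ → ℝ) (J : ℕ), (∀ i, 0 ≤ h i) → G.potential h J x ≤ J * (C * ‖x‖) + W) ∧
    ∀ (h : ℕ → ℝ) (J : ℕ) (h₀ : ℝ), (∀ i, 0 < h i) → (∀ i < J, h i ≤ h₀) →
      J * G.rho x ≤ C * (J * h₀ + G.potential h J x + W) := by
  obtain ⟨C₁, hC₁0, hC₁⟩ := exists_rho_le_deficit G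
  obtain ⟨C₂, hC₂0, hC₂⟩ := exists_deficit_le G
  obtain ⟨C₃, hC₃0, hC₃⟩ := exists_deficit_le G.neg
  obtain ⟨W₁, hW₁0, hW₁⟩ := exists_loss_bound G
  obtain ⟨W₂, hW₂0, hW₂⟩ := exists_loss_bound G.neg
  have hcard : (0 : ℝ) ≤ Fintype.card V := Nat.cast_nonneg _
  refine ⟨2 * C₁ + C₂ + C₃, by positivity, Fintype.card V * (W₁ + W₂), by positivity,
    fun x hx => ?_⟩
  have hl : |(Fintype.card V : ℝ) * (G.loss x + G.neg.loss (-x))| ≤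
      Fintype.card V * (W₁ + W₂) := by
    rw [abs_mul, abs_of_nonneg hcard]
    exact mul_le_mul_of_nonneg_left ((abs_add_le _ _).trans
      (add_le_add (hW₁ x hx) (hW₂ _ (neg_mem_box hx)))) hcard
  refine ⟨fun h J hh => ?_, fun h J h₀ hh hh₀ => ?_⟩
  · have h1 : ∑ i ∈ Finset.range J, G.deficit (h i) x ≤ ∑ i ∈ Finset.range J, C₂ * ‖x‖ :=
      Finset.sum_le_sum fun i _ => hC₂ x (h i) (hh i)
    have h2 : ∑ i ∈ Finset.range J, G.neg.deficit (h i) (-x) ≤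
        ∑ i ∈ Finset.range J, C₃ * ‖x‖ :=
      Finset.sum_le_sum fun i _ => by simpa using hC₃ (-x) (h i) (hh i)
    simp only [Finset.sum_const, Finset.card_range, nsmul_eq_mul] at h1 h2
    have h3 : 0 ≤ (J : ℝ) * (2 * C₁ * ‖x‖) := by positivity
    simp only [potential]
    linarith [(abs_le.1 hl).1]
  · have h1 : ∑ i ∈ Finset.range J, G.rho x ≤ ∑ i ∈ Finset.range J,
        C₁ * (2 * h₀ + (G.deficit (h i) x + G.neg.deficit (h i) (-x))) :=
      Finset.sum_le_sum fun i hi => by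
        have h2 := hC₁ x hx (h i) (h i) (hh i) (hh i)
        have h3 := mul_le_mul_of_nonneg_left (hh₀ i (Finset.mem_range.1 hi)) hC₁0
        linarith
    rw [← Finset.mul_sum, Finset.sum_add_distrib, Finset.sum_add_distrib] at h1
    simp only [Finset.sum_const, Finset.card_range, nsmul_eq_mul] at h1
    have h2 : 0 ≤ ∑ i ∈ Finset.range J, G.deficit (h i) x := Finset.sum_nonneg fun i _ =>
      deficit_nonneg _ _
    have h3 : 0 ≤ ∑ i ∈ Finset.range J, G.neg.deficit (h i) (-x) := Finset.sum_nonneg fun i _ =>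
      deficit_nonneg _ _
    have h4 : 0 ≤ (J : ℝ) * h₀ := by
      rcases Nat.eq_zero_or_pos J with rfl | hJ
      · simp
      · exact mul_nonneg (Nat.cast_nonneg _) ((hh 0).le.trans (hh₀ 0 hJ))
    simp only [potential]
    set Q := ∑ i ∈ Finset.range J, G.deficit (h i) x +
      ∑ i ∈ Finset.range J, G.neg.deficit (h i) (-x) with hQ
    have h5 : 0 ≤ Fintype.card V * (W₁ + W₂) - (Fintype.card V : ℝ) * (G.loss x + G.neg.loss (-x)) := by
      linarith [(abs_le.1 hl).2]
    have h6 : 0 ≤ C₁ * Q := mul_nonneg hC₁0 (by linarith)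
    have h7 := mul_nonneg (show 0 ≤ 2 * C₁ + C₂ + C₃ by positivity) h5
    have h8 : 0 ≤ (C₂ + C₃) * (J * h₀ + Q) := mul_nonneg (by positivity) (by linarith)
    linarith

variable (G) in
/-- The origin is stable under receding-horizon control with long horizons. -/
theorem loop_stable {ε : ℝ} (hε : 0 < ε) : ∃ δ > 0, ∃ N₀ : ℕ, ∀ N ≥ N₀, ∀ x, G.IsLoop N x →
    ‖x 0‖ ≤ δ → ∀ t, ‖x t‖ ≤ ε := by
  obtain ⟨κ, hκ0, hκlo, hκhi, hκfl, hκfu⟩ := exists_capacity_radius G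
  obtain ⟨L, hL0, C, hC0, hC⟩ := exists_priceSystem G
  obtain ⟨Cst, hCst0, W, hW0, hpot⟩ := exists_rho_le_potential G
  set ε' : ℝ := min ε (κ / 2) with hε'
  have hε'0 : 0 < ε' := lt_min hε (by positivity)
  have hε'κ : ε' < κ := lt_of_le_of_lt (min_le_right _ _) (by linarith)
  obtain ⟨ηa, hηa0, hηa⟩ := exists_small_of_sum_nodeCost G hε'0
  obtain ⟨ηb, hηb0, hηb⟩ := exists_small_flow G hε'0
  set η : ℝ := min ηa ηb with hη
  have hη0 : 0 < η := lt_min hηa0 hηb0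
  set s : ℝ := η / 4 with hs
  have hs0 : 0 < s := by positivity
  obtain ⟨r₁, hr₁0, n₁, hub⟩ := val_le_of_small G (half_pos hs0)
  obtain ⟨η₁, hη₁0, hη₁⟩ := exists_small_of_sum_nodeCost G hr₁0
  -- `e₀` is the error of inserting a stage; a stage cheaper than `e₀` forces the stock into the
  -- ball of radius `r₁`, where the upper bound on the value applies.
  set e₀ : ℝ := min (s / 2) η₁ with he₀
  have he₀0 : 0 < e₀ := lt_min (by positivity) hη₁0
  obtain ⟨ρ₀, hρ₀0, M, hgood⟩ := exists_good_stage G (G.bias + s) he₀0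
  set ρa : ℝ := min ρ₀ (η / 4) with hρa
  have hρa0 : 0 < ρa := lt_min hρ₀0 (by positivity)
  set h₀ : ℝ := ρa / (4 * (Cst + 1)) with hh₀
  have hh₀0 : 0 < h₀ := by positivity
  have hh₀' : Cst * h₀ ≤ ρa / 4 := by
    have : h₀ * (4 * (Cst + 1)) = ρa := by rw [hh₀]; field_simp
    linarith
  -- With `J` levels the bounded loss terms contribute at most a quarter of `ρa` to `rho`; the
  -- height `h₀` of the levels and the initial distance `δ` contribute a quarter each.
  obtain ⟨J, hJ⟩ := exists_nat_gt (8 * Cst * W / ρa)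
  rw [div_lt_iff₀ hρa0] at hJ
  have hJ0 : (0 : ℝ) < J := by
    have : 0 ≤ 8 * Cst * W := by positivity
    by_contra! hneg
    have := mul_nonpos_of_nonpos_of_nonneg hneg hρa0.le
    linarith
  set δ : ℝ := min r₁ (ρa / (4 * (Cst * Cst + 1))) with hδ
  have hδ0 : 0 < δ := lt_min hr₁0 (by positivity)
  have hδ' : Cst * (Cst * δ) ≤ ρa / 4 := by
    have h1 : ρa / (4 * (Cst * Cst + 1)) * (4 * (Cst * Cst + 1)) = ρa := by field_simp
    have h2 := mul_le_mul_of_nonneg_left (min_le_right r₁ (ρa / (4 * (Cst * Cst + 1))))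
      (mul_nonneg hCst0 hCst0)
    rw [← hδ] at h2
    have : 0 < ρa / (4 * (Cst * Cst + 1)) := by positivity
    linarith
  -- At most `M + 1` stages follow the end of the price system, and the sum over `j` majorizes the
  -- price bounds for all these cases.
  obtain ⟨D, Λ, hΛ0, htrap⟩ := exists_potential_step_le G
    (fun i => ∑ j ∈ Finset.range (M + 2), C (i + j))
    (fun i => Finset.sum_nonneg fun j _ => hC0 _) (R := 2 * s) hL0 hκlo hκhi hε'κ (half_pos hh₀0)
  -- Equally spaced levels between `h₀ / 2` and `h₀`. Their spacing is fixed, so long horizons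
  -- separate the price thresholds as far as required.
  let h : ℕ → ℝ := fun i => h₀ / 2 + h₀ / 2 * (i / J)
  have hh1 : ∀ i, h₀ / 2 ≤ h i := fun i => le_add_of_nonneg_right (by positivity)
  have hh2 : ∀ i < J, h i ≤ h₀ := fun i hi => by
    have : (i : ℝ) / J ≤ 1 := (div_le_one hJ0).2 (by exact_mod_cast hi.le)
    have := mul_le_mul_of_nonneg_left this (half_pos hh₀0).le
    simp only [h]; linarith
  have hhsep : ∀ i j : ℕ, i ≠ j → h₀ / (2 * J) ≤ |h i - h j| := fun i j hij => by
    have h1 : h i - h j = h₀ / (2 * J) * ((i : ℝ) - j) := by simp only [h]; field_simp; ring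
    have h2 : (1 : ℝ) ≤ |(i : ℝ) - j| := by
      have h3 : (1 : ℤ) ≤ |(i : ℤ) - j| := Int.one_le_abs (by omega)
      exact_mod_cast h3
    have h3 : 0 < h₀ / (2 * J) := by positivity
    rw [h1, abs_mul, abs_of_pos h3]
    exact le_mul_of_one_le_right h3.le h2
  obtain ⟨q, hq⟩ := exists_nat_gt (Λ * (2 * J) / h₀)
  rw [div_lt_iff₀ hh₀0] at hq
  refine ⟨δ, hδ0, max n₁ (M + D + q + 5), fun N hN x hx hx0 => ?_⟩
  have hNn₁ : n₁ ≤ N := (le_max_left _ _).trans hN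
  have hNM : M + D + q + 5 ≤ N := (le_max_right _ _).trans hN
  have hx0b := hx.mem_box 0
  have hrho : ∀ t, G.potential h J (x t) ≤ G.potential h J (x 0) → G.rho (x t) ≤ ρa := by
    intro t ht
    have h1 := (hpot _ hx0b).1 h J fun i => (half_pos hh₀0).le.trans (hh1 i)
    have h2 := (hpot _ (hx.mem_box t)).2 h J h₀
      (fun i => (half_pos hh₀0).trans_le (hh1 i)) hh2
    have h3 : Cst * (J * h₀ + G.potential h J (x t) + W) ≤
        Cst * (J * h₀ + (J * (Cst * δ) + W) + W) := by
      refine mul_le_mul_of_nonneg_left ?_ hCst0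
      have := mul_le_mul_of_nonneg_left (mul_le_mul_of_nonneg_left hx0 hCst0) hJ0.le
      linarith
    have h4 := mul_le_mul_of_nonneg_left hh₀' hJ0.le
    have h5 := mul_le_mul_of_nonneg_left hδ' hJ0.le
    refine le_of_mul_le_mul_left ?_ hJ0
    linarith [mul_pos hJ0 hρa0]
  -- The two invariants support each other. A small potential keeps `rho` small, so the optimal plan
  -- has small stage costs and its stocks and flows stay where only the gates matter; this supplies
  -- the prices that make the potential nonincreasing. The bound on the excess value is preserved by
  -- inserting a cheap stage.
  have hmain : ∀ t, (G.val N (x t) - N * G.rho (x t) ≤ G.bias + s ∧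
      G.potential h J (x t) ≤ G.potential h J (x 0)) → ‖x t‖ ≤ ε' ∧
      (G.val N (x (t + 1)) - N * G.rho (x (t + 1)) ≤ G.bias + s ∧
        G.potential h J (x (t + 1)) ≤ G.potential h J (x 0)) := by
    rintro t ⟨hval, hpt⟩
    have hρt := hrho t hpt
    obtain ⟨f, hf, hxt⟩ := hx.2 t
    obtain ⟨K, m, hKm, hK1, hmM, hsum, hins⟩ := hgood N (by omega) (x t) (hx.mem_box t) f hf
      (hρt.trans (min_le_left _ _)) hval
    have hbox : ∀ j ≤ N, G.traj (x t) f j ∈ G.box := hf.1.2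
    have hexc : ∀ j < K, 0 ≤ G.stage (G.traj (x t) f j) (f j) - G.rho (x t) := fun j hj =>
      sub_nonneg.2 (hf.1.rho_le_stage (by omega))
    have hsum' : ∑ j ∈ Finset.range K, (G.stage (G.traj (x t) f j) (f j) - G.rho (x t)) ≤
        2 * s := by
      have := min_le_left (s / 2) η₁
      linarith
    have hstage : ∀ j < K, G.stage (G.traj (x t) f j) (f j) ≤ η := fun j hj => by
      have h1 := Finset.single_le_sum
        (f := fun j => G.stage (G.traj (x t) f j) (f j) - G.rho (x t))
        (fun j hj => hexc j (Finset.mem_range.1 hj)) (Finset.mem_range.2 hj)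
      have h2 := min_le_right ρ₀ (η / 4)
      linarith
    have hnode : ∀ j < K, ∑ n, G.nodeCost n (G.traj (x t) f j n) ≤ η := fun j hj =>
      (sum_nodeCost_le_stage (hf.1.1 j)).trans (hstage j hj)
    have hsmall : ∀ j < K, ‖G.traj (x t) f j‖ ≤ ε' := fun j hj =>
      hηa _ (hbox j (by omega)) ((hnode j hj).trans (min_le_left _ _))
    have hflow : ∀ j < K - 1, ‖f j‖ ≤ ε' := fun j hj =>
      hηb _ _ (hf.1.1 j) (hbox (j + 1) (by omega)) (hbox j (by omega))
        ((hstage j (by omega)).trans (min_le_right _ _))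
        ((hnode (j + 1) (by omega)).trans (min_le_right _ _))
    have hρ1 : G.rho (x t) ≤ G.rho (x (t + 1)) := by
      rw [hxt]
      exact (hf.1.mono (show 1 ≤ N by omega)).rho_le_traj
    refine ⟨hsmall 0 (by omega), ?_, ?_⟩
    · have hf' := hf
      rw [hKm] at hf'
      have h1 := hf'.val_step_le hK1 hins
      rw [← hKm, ← hxt] at h1
      have hN0 : (0 : ℝ) ≤ N := Nat.cast_nonneg N
      have h2 := mul_le_mul_of_nonneg_left hρ1 hN0
      -- Either the stage pays for the inserted one, or the stock is so small that the excess over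
      -- the bias is at most `s / 2` before the step.
      rcases le_or_gt e₀ (G.stage (x t) (f 0)) with h3 | h3
      · linarith
      · have h4 := hη₁ (x t) (hx.mem_box t)
          ((sum_nodeCost_le_stage (hf.1.1 0)).trans (h3.le.trans (min_le_right _ _)))
        have h5 := hub (x t) (hx.mem_box t) h4 N hNn₁
        have h6 := stage_nonneg (hx.mem_box t) (hf.1.1 0)
        have := min_le_left (s / 2) η₁
        linarith
    -- Only `K - 1` stages, because bounding a flow requires the cost of the stock after it.
    · obtain ⟨p, hp⟩ := hC N (x t) f hf (K - 1) (by omega) ε' κ hε'κ hκfl hκfu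
        (fun k hk n => (abs_apply_le_norm _ n).trans (hsmall k (by omega)))
        (fun k hk e => by
          have := norm_le_pi_norm (f k) e
          exact this.trans (hflow k hk))
      have hp' := hp.mono (C' := fun i => ∑ j ∈ Finset.range (M + 2), C (i + j)) fun i =>
        Finset.single_le_sum (f := fun j => C (i + j)) (fun j _ => hC0 _)
          (Finset.mem_range.2 (by omega))
      have h1 := htrap (K - 1) _ _ _ (by omega) hp' ?_ J h hh1 fun i j hij => ?_
      · refine le_trans ?_ (h1.trans hpt)
        rw [hxt]; exact le_rfl
      · refine le_trans (Finset.sum_le_sum fun k hk => ?_) (le_trans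
          (Finset.sum_le_sum_of_subset_of_nonneg (Finset.range_subset_range.2 (by omega :
            K - 1 ≤ K)) fun j hj _ => hexc j (Finset.mem_range.1 hj)) hsum')
        have hk' := Finset.mem_range.1 hk
        have h1 := leakyCost_add_rho_le (hbox k (by omega)) (hf.1.1 k)
        have h2 := (hf.1.mono (show k ≤ N by omega)).rho_le_traj
        linarith
      · have h1 : (q : ℝ) ≤ ((K - 1 - D - 1 : ℕ) : ℝ) := by exact_mod_cast (by omega)
        have h2 := mul_le_mul h1 (hhsep i j hij) (by positivity) (Nat.cast_nonneg _)
        refine lt_of_lt_of_le ?_ h2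
        rw [← mul_div_assoc, lt_div_iff₀ (by positivity)]
        exact hq
  have hinv : ∀ t, G.val N (x t) - N * G.rho (x t) ≤ G.bias + s ∧
      G.potential h J (x t) ≤ G.potential h J (x 0) := by
    intro t
    induction t with
    | zero =>
      refine ⟨?_, le_rfl⟩
      have := hub (x 0) hx0b (hx0.trans (min_le_left _ _)) N hNn₁
      linarith
    | succ t ih => exact (hmain t ih).2
  exact fun t => ((hmain t (hinv t)).1).trans (min_le_left _ _)

variable (G) in
/-- Loops of bounded value come close to the origin within a uniform time. -/
theorem loop_visits {δ : ℝ} (hδ : 0 < δ) (R : ℝ) : ∃ T N₀ : ℕ, ∀ N ≥ N₀, ∀ x, G.IsLoop N x →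
    G.val N (x 0) ≤ R → ∃ t ≤ T, ‖x t‖ ≤ δ := by
  obtain ⟨η, hη0, hη⟩ := exists_small_of_sum_nodeCost G hδ
  obtain ⟨Ct, hCt0, hCt⟩ := exists_terminal_bound G
  obtain ⟨ρ₀, hρ₀0, M, hgood⟩ := exists_good_stage G R (half_pos hη0)
  obtain ⟨q, hq⟩ := exists_nat_gt ((R + Ct) / ρ₀)
  rw [div_lt_iff₀ hρ₀0] at hq
  obtain ⟨T, hT⟩ := exists_nat_gt ((R + Ct) / (η / 2))
  rw [div_lt_iff₀ (half_pos hη0)] at hT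
  refine ⟨T, M + q + 1, fun N hN x hx hR => ?_⟩
  by_contra! hcon
  have hlow : ∀ t, N * G.rho (x t) - Ct ≤ G.val N (x t) := fun t =>
    mul_rho_le_val hCt N (hx.mem_box t)
  have hρ0 : ∀ t, 0 ≤ G.rho (x t) := fun t => rho_nonneg (hx.mem_box t)
  have hqN : (q : ℝ) ≤ N := by exact_mod_cast (by omega)
  have hN0 : (0 : ℝ) < N := by exact_mod_cast (by omega)
  have hdec : ∀ t ≤ T + 1, G.val N (x t) ≤ R - t * (η / 2) := by
    intro t
    induction t with
    | zero => intro _; simpa using hR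
    | succ t ih =>
      intro ht
      replace ih := ih (by omega)
      have h0 : 0 ≤ (t : ℝ) * (η / 2) := by positivity
      obtain ⟨f, hf, hxt⟩ := hx.2 t
      have hNρ : 0 ≤ N * G.rho (x t) := mul_nonneg hN0.le (hρ0 t)
      -- A bounded value forces `rho` to be at most of order `1 / N`, so for long horizons it is
      -- below `ρ₀`. Far from the origin each step then lowers the value by at least `η / 2`.
      obtain ⟨K, m, hKm, hK1, hmM, -, hins⟩ := hgood N (by omega) (x t) (hx.mem_box t) f hf (by
          refine le_of_mul_le_mul_left ?_ hN0
          have := hlow t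
          have := mul_le_mul_of_nonneg_right hqN hρ₀0.le
          linarith) (by linarith)
      have hf' := hf
      rw [hKm] at hf'
      have h1 := hf'.val_step_le hK1 hins
      rw [← hKm, ← hxt] at h1
      have h2 : η < G.stage (x t) (f 0) := by
        by_contra! h3
        have := hη (x t) (hx.mem_box t) ((sum_nodeCost_le_stage (hf.1.1 0)).trans h3)
        linarith [hcon t (by omega)]
      push_cast
      linarith
  have h1 := hdec (T + 1) le_rfl
  have h2 := hlow (T + 1)
  have h3 := mul_nonneg hN0.le (hρ0 (T + 1))
  push_cast at h1
  linarith

variable (G) in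
/-- Loops of bounded initial value are practically attracted to the origin, uniformly. -/
theorem loop_attracted {ε : ℝ} (hε : 0 < ε) (R : ℝ) : ∃ T N₀ : ℕ, ∀ N ≥ N₀, ∀ x, G.IsLoop N x →
    G.val N (x 0) ≤ R → ∀ t ≥ T, ‖x t‖ ≤ ε := by
  obtain ⟨δ, hδ0, N₁, h1⟩ := loop_stable G hε
  obtain ⟨T, N₂, h2⟩ := loop_visits G hδ0 R
  refine ⟨T, max N₁ N₂, fun N hN x hx hR t ht => ?_⟩
  obtain ⟨i, hi, hxi⟩ := h2 N ((le_max_right _ _).trans hN) x hx hR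
  have := h1 N ((le_max_left _ _).trans hN) _ (hx.tail i) hxi (t - i)
  rwa [show i + (t - i) = t by omega] at this

end Net

/-! ### Ingredients for a uniform value bound: replenishing, emptying and draining. -/

namespace Net

variable {V E : Type} [Fintype V] [Fintype E] [DecidableEq V] {G : Net V E}

variable (G) in
/-- A constant flow that can be maintained forever. -/
def Sustains (w : E → ℝ) : Prop := G.Gates w ∧ ∀ n,
  (G.α n = 1 ∨ G.lo n = 0 → 0 ≤ G.β n * G.inflow w n) ∧
    (G.α n = 1 ∨ G.hi n = 0 → G.β n * G.inflow w n ≤ 0)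

variable (G) in
/-- Leaky one-sided nodes whose stock cannot be replenished forever. -/
def Fleeting (n : V) : Prop := G.α n ≠ 1 ∧ ∀ w, G.Sustains w → G.β n * G.inflow w n = 0

theorem Sustains.smul {w : E → ℝ} (h : G.Sustains w) {r : ℝ} (hr : 0 ≤ r) :
    G.Sustains (r • w) := by
  have e : ∀ n, G.β n * G.inflow (r • w) n = r * (G.β n * G.inflow w n) := fun n => by
    rw [map_smul]; simp; ring
  refine ⟨⟨fun e he => mul_nonneg hr (h.1.1 e he), fun e he =>
    mul_nonpos_of_nonneg_of_nonpos hr (h.1.2 e he)⟩, fun n => ?_⟩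
  rw [e]
  exact ⟨fun hn => mul_nonneg hr ((h.2 n).1 hn), fun hn =>
    mul_nonpos_of_nonneg_of_nonpos hr ((h.2 n).2 hn)⟩

theorem Sustains.sum {ι : Type} {s : Finset ι} {w : ι → E → ℝ} (h : ∀ i ∈ s, G.Sustains (w i)) :
    G.Sustains (∑ i ∈ s, w i) := by
  have e : ∀ n, G.β n * G.inflow (∑ i ∈ s, w i) n = ∑ i ∈ s, G.β n * G.inflow (w i) n :=
    fun n => by rw [map_sum, Finset.sum_apply, Finset.mul_sum]
  refine ⟨⟨fun e he => ?_, fun e he => ?_⟩, fun n => ?_⟩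
  · rw [Finset.sum_apply]; exact Finset.sum_nonneg fun i hi => (h i hi).1.1 e he
  · rw [Finset.sum_apply]; exact Finset.sum_nonpos fun i hi => (h i hi).1.2 e he
  · rw [e]
    exact ⟨fun hn => Finset.sum_nonneg fun i hi => ((h i hi).2 n).1 hn,
      fun hn => Finset.sum_nonpos fun i hi => ((h i hi).2 n).2 hn⟩

variable (G) in
/-- One flow replenishes all one-sided leaky nodes that are not fleeting. -/
theorem exists_replenishing : ∃ w, G.Sustains w ∧ ∃ θ > 0, ∀ n, G.α n ≠ 1 → ¬ G.Fleeting n →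
    (G.lo n = 0 → θ ≤ G.β n * G.inflow w n) ∧ (G.hi n = 0 → G.β n * G.inflow w n ≤ -θ) := by
  classical
  have h0 : G.Sustains 0 := ⟨gates_of_mem_flows zero_mem_flows, fun n => by simp⟩
  have hex : ∀ n, ∃ w, G.Sustains w ∧ (G.α n ≠ 1 → ¬ G.Fleeting n →
      G.β n * G.inflow w n ≠ 0) := fun n => by
    by_cases hn : G.α n ≠ 1 ∧ ¬ G.Fleeting n
    · obtain ⟨w, hw, hne⟩ : ∃ w, G.Sustains w ∧ G.β n * G.inflow w n ≠ 0 := by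
        by_contra! hcon
        exact hn.2 ⟨hn.1, hcon⟩
      exact ⟨w, hw, fun _ _ => hne⟩
    · exact ⟨0, h0, fun h1 h2 => absurd ⟨h1, h2⟩ hn⟩
  choose w hw hne using hex
  have hsum : ∀ n, G.β n * G.inflow (∑ m, w m) n = ∑ m, G.β n * G.inflow (w m) n :=
    fun n => by rw [map_sum, Finset.sum_apply, Finset.mul_sum]
  have hsus : G.Sustains (∑ m, w m) := Sustains.sum fun i _ => hw i
  have hlo : ∀ n, G.α n ≠ 1 → ¬ G.Fleeting n → G.lo n = 0 →
      0 < G.β n * G.inflow (∑ m, w m) n := fun n h1 h2 h3 => by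
    rw [hsum]
    exact Finset.sum_pos' (fun m _ => ((hw m).2 n).1 (Or.inr h3))
      ⟨n, Finset.mem_univ n, lt_of_le_of_ne (((hw n).2 n).1 (Or.inr h3)) (hne n h1 h2).symm⟩
  have hhi : ∀ n, G.α n ≠ 1 → ¬ G.Fleeting n → G.hi n = 0 →
      G.β n * G.inflow (∑ m, w m) n < 0 := fun n h1 h2 h3 => by
    rw [hsum]
    exact Finset.sum_neg' (fun m _ => ((hw m).2 n).2 (Or.inr h3))
      ⟨n, Finset.mem_univ n, lt_of_le_of_ne (((hw n).2 n).2 (Or.inr h3)) (hne n h1 h2)⟩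
  obtain ⟨θ, hθ0, hθ⟩ := exists_pos_le_finite
    (fun n => if G.β n * G.inflow (∑ m, w m) n = 0 then 1 else |G.β n * G.inflow (∑ m, w m) n|) (by
      intro n; split_ifs with h
      · exact one_pos
      · exact abs_pos.2 h)
  refine ⟨_, hsus, θ, hθ0, fun n h1 h2 => ⟨fun h3 => ?_, fun h3 => ?_⟩⟩
  · have h4 := hlo n h1 h2 h3
    have h5 := hθ n
    rwa [if_neg h4.ne', abs_of_pos h4] at h5
  · have h4 := hhi n h1 h2 h3
    have h5 := hθ n
    rw [if_neg h4.ne, abs_of_neg h4] at h5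
    linarith

/-- Balance of a trajectory. -/
theorem traj_sub_add_sum (x : V → ℝ) (f : ℕ → E → ℝ) (T : ℕ) (n : V) :
    G.traj x f T n - x n + (1 - G.α n) * ∑ k ∈ Finset.range T, G.traj x f k n =
      G.β n * G.inflow (∑ k ∈ Finset.range T, f k) n := by
  induction T with
  | zero => simp [traj]
  | succ T ih =>
    rw [Finset.sum_range_succ, Finset.sum_range_succ, map_add, Pi.add_apply, mul_add (G.β n), ← ih]
    have : G.traj x f (T + 1) n = G.α n * G.traj x f T n + G.β n * G.inflow (f T) n := rfl
    rw [this]; ring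

variable (G) in
/-- Fleeting nodes are nearly empty after a uniform time. -/
theorem exists_fleeting_small {ε : ℝ} (hε : 0 < ε) : ∃ m : ℕ, ∀ x f, G.IsPlan m x f →
    ∃ k < m, ∀ n, G.Fleeting n → G.lo n = 0 ∨ G.hi n = 0 → |G.traj x f k n| ≤ ε := by
  classical
  obtain ⟨C, hC0, hC⟩ := exists_repair G
  obtain ⟨D, hD0, hDx, -⟩ := exists_radius G
  obtain ⟨K, hK0, -, hK⟩ := exists_step_bound G
  set B : ℝ := ∑ n, (2 * D + K * (C * (2 * D))) * (1 - G.α n)⁻¹ with hB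
  obtain ⟨m, hm⟩ := exists_nat_gt (B / ε)
  rw [div_lt_iff₀ hε] at hm
  refine ⟨m, fun x f hf => ?_⟩
  by_contra! hcon
  let s : Finset V := Finset.univ.filter fun n => G.Fleeting n ∧ (G.lo n = 0 ∨ G.hi n = 0)
  have hdiff : ∀ n, |G.traj x f m n - x n| ≤ 2 * D := fun n => by
    have h1 := (abs_apply_le_norm _ n).trans (hDx _ (hf.2 m le_rfl))
    have h2 := (abs_apply_le_norm _ n).trans (hDx _ hf.start)
    exact (abs_sub _ _).trans (by linarith)
  -- The total flow over `m` stages violates the conditions for being sustainable by at most `2 *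
  -- D`, whatever `m` is, so it is within a fixed distance of a sustainable flow. The latter does
  -- not feed the fleeting nodes; their summed stocks are therefore bounded independently of `m`,
  -- and some stage has them small.
  obtain ⟨w, hw, hwd⟩ := hC (fun n => G.α n = 1 ∨ G.lo n = 0) (fun n => G.α n = 1 ∨ G.hi n = 0)
    (fun e => G.fl e = 0) (fun e => G.fu e = 0) 0 0 0 0 (∑ k ∈ Finset.range m, f k) (2 * D)
    (by positivity)
    (fun n hn => by
      rw [← traj_sub_add_sum]
      have h1 := (abs_le.1 (hdiff n)).1
      have h2 : 0 ≤ (1 - G.α n) * ∑ k ∈ Finset.range m, G.traj x f k n := by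
        rcases hn with hn | hn
        · simp [hn]
        · refine mul_nonneg (by linarith [G.α_le_one n]) (Finset.sum_nonneg fun k hk => ?_)
          have := (hf.2 k (Finset.mem_range.1 hk).le).1 n
          rwa [hn] at this
      simp only [Pi.zero_apply]; linarith)
    (fun n hn => by
      rw [← traj_sub_add_sum]
      have h1 := (abs_le.1 (hdiff n)).2
      have h2 : (1 - G.α n) * ∑ k ∈ Finset.range m, G.traj x f k n ≤ 0 := by
        rcases hn with hn | hn
        · simp [hn]
        · refine mul_nonpos_of_nonneg_of_nonpos (by linarith [G.α_le_one n])
            (Finset.sum_nonpos fun k hk => ?_)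
          have := (hf.2 k (Finset.mem_range.1 hk).le).2 n
          rwa [hn] at this
      simp only [Pi.zero_apply]; linarith)
    (fun e he => by
      have : 0 ≤ (∑ k ∈ Finset.range m, f k) e := by
        rw [Finset.sum_apply]
        exact Finset.sum_nonneg fun k _ => (gates_of_mem_flows (hf.1 k)).1 e he
      simp only [Pi.zero_apply]; linarith)
    (fun e he => by
      have : (∑ k ∈ Finset.range m, f k) e ≤ 0 := by
        rw [Finset.sum_apply]
        exact Finset.sum_nonpos fun k _ => (gates_of_mem_flows (hf.1 k)).2 e he
      simp only [Pi.zero_apply]; linarith)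
    ⟨0, fun n _ => by simp, fun n _ => by simp, fun e _ => by simp, fun e _ => by simp⟩
  have hsus : G.Sustains w := ⟨⟨hw.p, hw.q⟩, fun n => ⟨hw.lb n, hw.ub n⟩⟩
  have hn : ∀ n ∈ s, ∑ k ∈ Finset.range m, |G.traj x f k n| ≤
      (2 * D + K * (C * (2 * D))) * (1 - G.α n)⁻¹ := by
    intro n hns
    obtain ⟨hfl, hside⟩ := (Finset.mem_filter.1 hns).2
    have hα : 0 < 1 - G.α n := sub_pos.2 (lt_of_le_of_ne (G.α_le_one n) hfl.1)
    rw [← div_eq_mul_inv, le_div_iff₀ hα, mul_comm]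
    have h1 : |(1 - G.α n) * ∑ k ∈ Finset.range m, G.traj x f k n| ≤
        2 * D + K * (C * (2 * D)) := by
      have h2 := traj_sub_add_sum (G := G) x f m n
      have h3 := (hK (w - ∑ k ∈ Finset.range m, f k) n).trans (mul_le_mul_of_nonneg_left hwd hK0)
      rw [map_sub, Pi.sub_apply, mul_sub, hfl.2 w hsus] at h3
      have h4 := hdiff n
      rw [abs_le] at h3 h4 ⊢
      constructor <;> linarith
    rw [abs_mul, abs_of_pos hα] at h1
    refine le_trans (le_of_eq ?_) h1
    congr 1
    rcases hside with h | h
    · have h5 : ∀ k ∈ Finset.range m, 0 ≤ G.traj x f k n := fun k hk => by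
        have := (hf.2 k (Finset.mem_range.1 hk).le).1 n
        rwa [h] at this
      rw [abs_of_nonneg (Finset.sum_nonneg h5)]
      exact Finset.sum_congr rfl fun k hk => abs_of_nonneg (h5 k hk)
    · have h5 : ∀ k ∈ Finset.range m, G.traj x f k n ≤ 0 := fun k hk => by
        have := (hf.2 k (Finset.mem_range.1 hk).le).2 n
        rwa [h] at this
      rw [abs_of_nonpos (Finset.sum_nonpos h5), ← Finset.sum_neg_distrib]
      exact Finset.sum_congr rfl fun k hk => abs_of_nonpos (h5 k hk)
  have htot : ∑ k ∈ Finset.range m, ∑ n ∈ s, |G.traj x f k n| ≤ B := by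
    rw [Finset.sum_comm]
    refine (Finset.sum_le_sum hn).trans (Finset.sum_le_sum_of_subset_of_nonneg
      (Finset.subset_univ s) fun n _ _ => ?_)
    have := inv_nonneg.2 (show 0 ≤ 1 - G.α n by linarith [G.α_le_one n])
    positivity
  have hbig : ∑ k ∈ Finset.range m, ε ≤ ∑ k ∈ Finset.range m, ∑ n ∈ s, |G.traj x f k n| := by
    refine Finset.sum_le_sum fun k hk => ?_
    obtain ⟨n, h1, h2, h3⟩ := hcon k (Finset.mem_range.1 hk)
    exact h3.le.trans (Finset.single_le_sum (f := fun n => |G.traj x f k n|)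
      (fun _ _ => abs_nonneg _) (Finset.mem_filter.2 ⟨Finset.mem_univ n, h1, h2⟩))
  simp at hbig
  linarith

variable (G) in
/-- From a stock that can be driven to the origin, a bounded total flow empties the nodes without
leakage. -/
theorem exists_emptying_flow : ∃ C : ℝ, 0 ≤ C ∧ ∀ x f, (∀ N, G.IsPlan N x f) →
    Tendsto (G.traj x f) atTop (𝓝 0) →
    ∃ g, G.Reach x g ∧ (∀ n, G.α n = 1 → G.step x g n = 0) ∧ ‖g‖ ≤ C := by
  classical
  obtain ⟨C, hC0, hC⟩ := exists_small_reach G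
  obtain ⟨D, hD0, hDx, -⟩ := exists_radius G
  refine ⟨C * (D + 1), by positivity, fun x f hf hlim => ?_⟩
  let φ : (E → ℝ) → ℝ := fun g => ∑ n, if G.α n = 1 then |G.step x g n| else 0
  let Y : Set (E → ℝ) := {g | G.Reach x g} ∩ Metric.closedBall 0 (C * (D + 1))
  have hstep : ∀ n, Continuous fun g : E → ℝ => G.step x g n := fun n => by
    have h : Continuous fun g : E → ℝ => G.inflow g n :=
      (continuous_apply n).comp (continuous_inflow (G := G))
    simp only [step]
    fun_prop
  have hφ : Continuous φ := by
    refine continuous_finsetSum _ fun n _ => ?_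
    split_ifs
    · exact (hstep n).abs
    · exact continuous_const
  have hYc : IsCompact Y := by
    refine (isCompact_closedBall _ _).inter_left ?_
    simp only [Reach, Gates, Set.ofPred_and, Set.ofPred_forall]
    refine IsClosed.inter (IsClosed.inter ?_ ?_) (isClosed_iInter fun n => IsClosed.inter ?_ ?_)
    · exact isClosed_iInter fun e => isClosed_iInter fun _ =>
        isClosed_le continuous_const (continuous_apply e)
    · exact isClosed_iInter fun e => isClosed_iInter fun _ =>
        isClosed_le (continuous_apply e) continuous_const
    · exact isClosed_iInter fun _ => isClosed_le continuous_const (hstep n)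
    · exact isClosed_iInter fun _ => isClosed_le (hstep n) continuous_const
  -- A plan that ends within `δ` of the origin may be arbitrarily long, but the flow that replaces
  -- its total lies in the fixed compact set `Y`. Minimizing over `Y` produces an exact emptying
  -- flow.
  have happ : ∀ δ : ℝ, 0 < δ → δ ≤ 1 → ∃ g ∈ Y, φ g ≤ Fintype.card V * δ := by
    intro δ hδ hδ1
    obtain ⟨T, hT⟩ := (Metric.tendsto_atTop.1 hlim) δ hδ
    have hT' : ‖G.traj x f (T + 1)‖ ≤ δ := by
      have := hT (T + 1) (by omega)
      rw [dist_zero_right] at this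
      exact this.le
    obtain ⟨F, hF, hd⟩ := (hf (T + 1)).exists_dom
    have hb := (hf (T + 1)).2 _ le_rfl
    have hz : ∀ n, G.α n = 1 → |G.step x F n| ≤ δ := fun n hn => by
      rw [(hd n).1 hn]; exact (abs_apply_le_norm _ n).trans hT'
    obtain ⟨g, hg, hge, hgn⟩ := hC x F δ (Reach.of_dom hF hb hd) hz hδ.le
    refine ⟨g, ⟨hg, ?_⟩, ?_⟩
    · rw [mem_closedBall_zero_iff]
      exact hgn.trans (mul_le_mul_of_nonneg_left
        (add_le_add (hDx _ (hf 0).start) hδ1) hC0)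
    · refine (Finset.sum_le_card_nsmul _ _ δ fun n _ => ?_).trans (le_of_eq ?_)
      · split_ifs with hn
        · rw [hge n hn]; exact hz n hn
        · exact hδ.le
      · rw [Finset.card_univ, nsmul_eq_mul]
  obtain ⟨g₁, hg₁, -⟩ := happ 1 one_pos le_rfl
  obtain ⟨g, hg, hmin⟩ := hYc.exists_isMinOn ⟨g₁, hg₁⟩ hφ.continuousOn
  have hφ0 : φ g ≤ 0 := by
    refine le_of_forall_pos_le_add fun ε hε => ?_
    obtain ⟨g', hg', h1⟩ := happ (min 1 (ε / (Fintype.card V + 1))) (by positivity)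
      (min_le_left _ _)
    have h2 : (Fintype.card V : ℝ) * min 1 (ε / (Fintype.card V + 1)) ≤ ε := by
      refine (mul_le_mul_of_nonneg_left (min_le_right _ _) (Nat.cast_nonneg _)).trans ?_
      rw [← mul_div_assoc, div_le_iff₀ (by positivity)]
      nlinarith
    have h3 := hmin hg'
    simp only [Set.mem_ofPred_eq] at h3
    linarith
  refine ⟨g, hg.1, fun n hn => ?_, mem_closedBall_zero_iff.1 hg.2⟩
  have h1 : (if G.α n = 1 then |G.step x g n| else 0) ≤ φ g :=
    Finset.single_le_sum (f := fun n => if G.α n = 1 then |G.step x g n| else 0)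
      (fun n _ => by split_ifs <;> positivity) (Finset.mem_univ n)
  rw [if_pos hn] at h1
  exact abs_nonpos_iff.1 (h1.trans hφ0)

variable (G) in
/-- Small flows keep the leaky two-sided nodes admissible. -/
theorem exists_slow_radius : ∃ κ > 0, (∀ f, G.Gates f → ‖f‖ ≤ κ → f ∈ G.flows) ∧
    ∀ x ∈ G.box, ∀ f, ‖f‖ ≤ κ →
      (∀ n, (G.α n = 1 → G.lo n ≤ G.step x f n ∧ G.step x f n ≤ G.hi n) ∧
        (G.α n ≠ 1 → (G.lo n = 0 → 0 ≤ G.step x f n) ∧ (G.hi n = 0 → G.step x f n ≤ 0))) →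
      G.step x f ∈ G.box := by
  classical
  obtain ⟨κ₁, hκ₁0, hκ₁, -⟩ := exists_feasible_radius G
  obtain ⟨κ₂, hκ₂0, hlo, hhi, -, -⟩ := exists_capacity_radius G
  obtain ⟨K, hK0, -, hK⟩ := exists_step_bound G
  obtain ⟨a, ha0, ha⟩ := exists_pos_le_finite (fun n => if G.α n = 1 then 1 else 1 - G.α n) (by
    intro n; split_ifs with h
    · exact one_pos
    · exact sub_pos.2 (lt_of_le_of_ne (G.α_le_one n) h))
  refine ⟨min κ₁ (a * κ₂ / (K + 1)), by positivity,
    fun f hf h => hκ₁ f hf (h.trans (min_le_left _ _)), fun x hx f hf h => ?_⟩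
  have hb : ∀ n, |G.β n * G.inflow f n| ≤ a * κ₂ := fun n => by
    refine (hK f n).trans ?_
    have h1 := mul_le_mul_of_nonneg_left (hf.trans (min_le_right _ _)) hK0
    have h2 : a * κ₂ / (K + 1) * (K + 1) = a * κ₂ := by field_simp
    have h3 : 0 < a * κ₂ / (K + 1) := by positivity
    linarith
  refine ⟨fun n => ?_, fun n => ?_⟩
  · by_cases hα : G.α n = 1
    · exact ((h n).1 hα).1
    · rcases hlo n with h1 | h1
      · rw [h1]; exact ((h n).2 hα).1 h1
      · have h2 := ha n
        rw [if_neg hα] at h2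
        have h3 := mul_le_mul h2 h1 hκ₂0.le (ha0.le.trans h2)
        have h4 := mul_le_mul_of_nonneg_left (hx.1 n) (G.α_nonneg n)
        have h5 := (abs_le.1 (hb n)).1
        simp only [step]; linarith
  · by_cases hα : G.α n = 1
    · exact ((h n).1 hα).2
    · rcases hhi n with h1 | h1
      · rw [h1]; exact ((h n).2 hα).2 h1
      · have h2 := ha n
        rw [if_neg hα] at h2
        have h3 := mul_le_mul h2 h1 hκ₂0.le (ha0.le.trans h2)
        have h4 := mul_le_mul_of_nonneg_left (hx.2 n) (G.α_nonneg n)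
        have h5 := (abs_le.1 (hb n)).2
        simp only [step]; linarith

end Net

/-! ### The uniform bound on the values. -/

namespace Net

variable {V E : Type} [Fintype V] [Fintype E] [DecidableEq V] {G : Net V E}

variable (G) in
/-- When the fleeting nodes are nearly empty, a small first flow makes the rest of an emptying flow
harmless to them. -/
theorem exists_fleeting_drain : ∃ C : ℝ, 0 ≤ C ∧ ∀ (x : V → ℝ) (g : E → ℝ) (ε : ℝ), x ∈ G.box →
    G.Reach x g → (∀ n, G.α n = 1 → G.step x g n = 0) →
    (∀ n, G.Fleeting n → G.lo n = 0 ∨ G.hi n = 0 → |x n| ≤ ε) → 0 ≤ ε →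
    ∃ w, ‖w‖ ≤ C * ε ∧ G.Gates w ∧ G.Gates (g - w) ∧
      (∀ n, (G.α n = 1 → G.lo n ≤ G.step x w n ∧ G.step x w n ≤ G.hi n) ∧
        (G.α n ≠ 1 → (G.lo n = 0 → 0 ≤ G.step x w n) ∧ (G.hi n = 0 → G.step x w n ≤ 0))) ∧
      ∀ n, G.Fleeting n → (G.lo n = 0 → 0 ≤ G.β n * G.inflow (g - w) n) ∧
        (G.hi n = 0 → G.β n * G.inflow (g - w) n ≤ 0) := by
  classical
  obtain ⟨C, hC0, hC⟩ := exists_repair G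
  refine ⟨C, hC0, fun x g ε hx hg hz hfl hε => ?_⟩
  have hαx : ∀ n, |G.α n * x n| ≤ |x n| := fun n => by
    rw [abs_mul, abs_of_nonneg (G.α_nonneg n)]
    exact mul_le_of_le_one_left (abs_nonneg _) (G.α_le_one n)
  have hst := (isPlan_zero hx 1).2 1 le_rfl
  have hst' : ∀ n, G.lo n ≤ G.α n * x n ∧ G.α n * x n ≤ G.hi n := fun n => by
    have h1 := hst.1 n
    have h2 := hst.2 n
    rw [traj_zero, pow_one] at h1 h2
    exact ⟨h1, h2⟩
  have hg0 : ∀ n, (G.lo n = 0 → 0 ≤ G.α n * x n + G.β n * G.inflow g n) ∧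
      (G.hi n = 0 → G.α n * x n + G.β n * G.inflow g n ≤ 0) := fun n =>
    ⟨fun h => by have := (hg.2 n).1 (Or.inr h); rwa [h] at this,
      fun h => by have := (hg.2 n).2 (Or.inr h); rwa [h] at this⟩
  have hz' : ∀ n, G.α n = 1 → G.α n * x n + G.β n * G.inflow g n = 0 := hz
  let lb : V → ℝ := fun n => if G.α n = 1 ∨ G.lo n = 0 then G.lo n - G.α n * x n
    else G.β n * G.inflow g n
  let ub : V → ℝ := fun n => if G.α n = 1 ∨ G.hi n = 0 then G.hi n - G.α n * x n
    else G.β n * G.inflow g n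
  -- Conditions on `w`: it has an admissible first step, it takes over the part of `g` that draws on
  -- the stock of fleeting nodes, and on one-sided edges it lies between `0` and `g`. The flow `g`
  -- satisfies them all, and the zero flow violates them by at most `ε`, so a solution of size
  -- proportional to `ε` exists.
  obtain ⟨w, hw, hwd⟩ := hC
    (fun n => G.α n = 1 ∨ G.lo n = 0 ∨ (G.hi n = 0 ∧ G.Fleeting n))
    (fun n => G.α n = 1 ∨ G.hi n = 0 ∨ (G.lo n = 0 ∧ G.Fleeting n))
    (fun e => G.fl e = 0 ∨ G.fu e = 0) (fun e => G.fl e = 0 ∨ G.fu e = 0) lb ub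
    (fun e => if G.fl e = 0 then 0 else g e) (fun e => if G.fu e = 0 then 0 else g e) 0 ε hε
    (fun n hn => by
      simp only [lb, map_zero, Pi.zero_apply, mul_zero, zero_add]
      split_ifs with h
      · linarith [(hst' n).1]
      · push Not at h
        obtain ⟨h1, h2⟩ := (hn.resolve_left h.1).resolve_left h.2
        linarith [(hg0 n).2 h1, (abs_le.1 ((hαx n).trans (hfl n h2 (Or.inr h1)))).1])
    (fun n hn => by
      simp only [ub, map_zero, Pi.zero_apply, mul_zero]
      split_ifs with h
      · linarith [(hst' n).2]
      · push Not at h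
        obtain ⟨h1, h2⟩ := (hn.resolve_left h.1).resolve_left h.2
        linarith [(hg0 n).1 h1, (abs_le.1 ((hαx n).trans (hfl n h2 (Or.inl h1)))).2])
    (fun e he => by
      simp only [Pi.zero_apply, zero_add]
      split_ifs with h
      · exact hε
      · exact (hg.1.2 e (he.resolve_left h)).trans hε)
    (fun e he => by
      simp only [Pi.zero_apply]
      split_ifs with h
      · linarith
      · linarith [hg.1.1 e (he.resolve_right h)])
    ⟨g, fun n hn => by
        simp only [lb]
        split_ifs with h
        · rcases h with h | h
          · linarith [hz' n h, G.lo_nonpos n]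
          · linarith [(hg0 n).1 h]
        · exact le_rfl,
      fun n hn => by
        simp only [ub]
        split_ifs with h
        · rcases h with h | h
          · linarith [hz' n h, G.hi_nonneg n]
          · linarith [(hg0 n).2 h]
        · exact le_rfl,
      fun e he => by
        split_ifs with h
        · exact hg.1.1 e h
        · exact le_rfl,
      fun e he => by
        split_ifs with h
        · exact hg.1.2 e h
        · exact le_rfl⟩
  rw [sub_zero] at hwd
  have hwp : ∀ e, G.fl e = 0 → 0 ≤ w e := fun e he => by simpa [he] using hw.p e (Or.inl he)
  have hwq : ∀ e, G.fu e = 0 → w e ≤ 0 := fun e he => by simpa [he] using hw.q e (Or.inr he)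
  refine ⟨w, hwd, ⟨hwp, hwq⟩, ⟨fun e he => ?_, fun e he => ?_⟩, fun n => ⟨fun hα => ?_, fun hα =>
    ⟨fun h => ?_, fun h => ?_⟩⟩, fun n hn => ?_⟩
  · have h1 := hw.q e (Or.inl he)
    split_ifs at h1 with h
    · have := hg.1.1 e he
      simp only [Pi.sub_apply]; linarith
    · simpa using h1
  · have h1 := hw.p e (Or.inr he)
    split_ifs at h1 with h
    · have := hg.1.2 e he
      simp only [Pi.sub_apply]; linarith
    · simpa using h1
  · have h1 := hw.lb n (Or.inl hα)
    have h2 := hw.ub n (Or.inl hα)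
    simp only [lb, ub, hα, true_or, if_true] at h1 h2
    simp only [step, hα]
    constructor <;> linarith
  · have h1 := hw.lb n (Or.inr (Or.inl h))
    simp only [lb, h, or_true, if_true] at h1
    simp only [step]; linarith
  · have h1 := hw.ub n (Or.inr (Or.inl h))
    simp only [ub, h, or_true, if_true] at h1
    simp only [step]; linarith
  · rw [map_sub, Pi.sub_apply, mul_sub]
    refine ⟨fun h => ?_, fun h => ?_⟩
    · have h1 := hw.ub n (Or.inr (Or.inr ⟨h, hn⟩))
      simp only [ub] at h1
      split_ifs at h1 with h2
      · have h3 := h2.resolve_left hn.1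
        have h4 := (hg0 n).1 h
        linarith
      · linarith
    · have h1 := hw.lb n (Or.inr (Or.inr ⟨h, hn⟩))
      simp only [lb] at h1
      split_ifs at h1 with h2
      · have h3 := h2.resolve_left hn.1
        have h4 := (hg0 n).2 h
        linarith
      · linarith

theorem traj_const_of_no_leak {x : V → ℝ} {u : E → ℝ} {n : V} (hα : G.α n = 1) (j : ℕ) :
    G.traj x (fun _ => u) j n = x n + j * (G.β n * G.inflow u n) := by
  induction j with
  | zero => simp [traj]
  | succ j ih =>
    have : G.traj x (fun _ => u) (j + 1) n =
      G.α n * G.traj x (fun _ => u) j n + G.β n * G.inflow u n := rfl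
    rw [this, hα, ih]; push_cast; ring

variable (G) in
/-- The optimal values are bounded uniformly over the stocks that can be driven to the origin. -/
theorem exists_val_bound : ∃ (R : ℝ) (N₁ : ℕ), ∀ x f, (∀ N, G.IsPlan N x f) →
    Tendsto (G.traj x f) atTop (𝓝 0) → ∀ N ≥ N₁, G.val N x ≤ R := by
  classical
  obtain ⟨C₁, hC₁0, hdrain⟩ := exists_fleeting_drain G
  obtain ⟨C₂, hC₂0, hempty⟩ := exists_emptying_flow G
  obtain ⟨κ, hκ0, hκf, hκx⟩ := exists_slow_radius G
  obtain ⟨D, hD0, hDx, hDf⟩ := exists_radius G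
  obtain ⟨K, hK0, -, hK⟩ := exists_step_bound G
  obtain ⟨S, hS0, hS⟩ := exists_stall_bound G
  obtain ⟨Ls, hLs0, hLs⟩ := exists_stage_lipschitz G
  obtain ⟨Ct, hCt0, hCt⟩ := exists_terminal_bound G
  obtain ⟨ws, hws, θ, hθ0, hθ⟩ := exists_replenishing G
  have hstage : ∀ x ∈ G.box, ∀ f ∈ G.flows, G.stage x f ≤ Ls * (D + D) := fun x hx f hf => by
    have h1 := (abs_le.1 (hLs x hx 0 zero_mem_box f hf 0 zero_mem_flows)).2
    rw [stage_zero_zero, sub_zero, sub_zero, sub_zero] at h1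
    exact h1.trans (mul_le_mul_of_nonneg_left (add_le_add (hDx x hx) (hDf f hf)) hLs0)
  set P : ℝ := Ls * (D + D) with hP
  have hP0 : 0 ≤ P := by positivity
  set ε : ℝ := κ / (C₁ + 1) with hε
  have hε0 : 0 < ε := by positivity
  have hCε : C₁ * ε ≤ κ := by
    have : ε * (C₁ + 1) = κ := by rw [hε]; field_simp
    linarith
  obtain ⟨m, hm⟩ := exists_fleeting_small G hε0
  set a : ℝ := κ / (2 * (‖ws‖ + 1)) with ha
  have ha0 : 0 < a := by positivity
  have haws : a * ‖ws‖ ≤ κ / 2 := by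
    have h1 : a * (2 * (‖ws‖ + 1)) = κ := by rw [ha]; field_simp
    linarith
  -- The number of stages over which the emptying flow is spread: it makes each share an admissible
  -- flow together with the replenishing one, and makes its effect on a node at most `a * θ`.
  obtain ⟨q, hq⟩ := exists_nat_gt ((C₂ + κ) / (κ / 2) + K * (C₂ + κ) / (a * θ))
  have hq0 : (0 : ℝ) < q := lt_of_le_of_lt (by positivity) hq
  have hq1 : (C₂ + κ) / q ≤ κ / 2 := by
    rw [div_le_iff₀ hq0, mul_comm, ← div_le_iff₀ (by positivity)]
    have : 0 ≤ K * (C₂ + κ) / (a * θ) := by positivity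
    linarith
  have hq2 : K * (C₂ + κ) / q ≤ a * θ := by
    rw [div_le_iff₀ hq0, mul_comm (a * θ), ← div_le_iff₀ (by positivity)]
    have : 0 ≤ (C₂ + κ) / (κ / 2) := by positivity
    linarith
  refine ⟨m * P + (P + (q * P + (S * D + Ct))), m + (1 + q), fun x f hf hlim N hN => ?_⟩
  obtain ⟨k, hkm, hk⟩ := hm x f (hf m)
  set z := G.traj x f k with hz
  have hzb : z ∈ G.box := (hf k).2 k le_rfl
  obtain ⟨g, hg, hgz, hgn⟩ := hempty z (fun i => f (k + i)) (fun N => (hf (k + N)).tail) (by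
    have h1 := hlim.comp (tendsto_add_atTop_nat k)
    refine h1.congr fun i => ?_
    simp only [Function.comp, hz]
    rw [add_comm i k, traj_add])
  obtain ⟨w, hwn, hw, hgw, hwz, hwf⟩ := hdrain z g ε hzb hg hgz hk hε0.le
  have hwκ : ‖w‖ ≤ κ := hwn.trans hCε
  set y := G.step z w with hy
  have hyb : y ∈ G.box := hκx z hzb w hwκ hwz
  have hwfl := hκf w hw hwκ
  -- The replenishing flow outweighs the share of the emptying flow at one-sided leaky nodes that
  -- are not fleeting. It changes nothing at fleeting nodes and at nodes without leakage, so after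
  -- `q` stages the latter are exactly empty.
  set u : E → ℝ := (q : ℝ)⁻¹ • (g - w) + a • ws with hu
  have hgwn : ‖g - w‖ ≤ C₂ + κ := (norm_sub_le _ _).trans (add_le_add hgn hwκ)
  have hun : ‖u‖ ≤ κ := by
    refine (norm_add_le _ _).trans ?_
    rw [norm_smul, norm_smul, Real.norm_of_nonneg (inv_nonneg.2 hq0.le),
      Real.norm_of_nonneg ha0.le, inv_mul_eq_div]
    have := (div_le_div_of_nonneg_right hgwn hq0.le).trans hq1
    linarith
  have huin : ∀ n, G.β n * G.inflow u n =
      (q : ℝ)⁻¹ * (G.β n * G.inflow (g - w) n) + a * (G.β n * G.inflow ws n) := fun n => by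
    rw [hu, map_add, map_smul, map_smul]; simp; ring
  have hug : G.Gates u := Gates.add
    ⟨fun e he => mul_nonneg (inv_nonneg.2 hq0.le) (hgw.1 e he),
      fun e he => mul_nonpos_of_nonneg_of_nonpos (inv_nonneg.2 hq0.le) (hgw.2 e he)⟩
    ((hws.smul ha0.le).1)
  have hufl := hκf u hug hun
  have hbd : ∀ n, |(q : ℝ)⁻¹ * (G.β n * G.inflow (g - w) n)| ≤ a * θ := fun n => by
    rw [abs_mul, abs_of_nonneg (inv_nonneg.2 hq0.le), inv_mul_eq_div]
    exact (div_le_div_of_nonneg_right ((hK _ n).trans (mul_le_mul_of_nonneg_left hgwn hK0))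
      hq0.le).trans hq2
  have hside : ∀ n, G.α n ≠ 1 → (G.lo n = 0 → 0 ≤ G.β n * G.inflow u n) ∧
      (G.hi n = 0 → G.β n * G.inflow u n ≤ 0) := by
    intro n hα
    rw [huin]
    by_cases hfl : G.Fleeting n
    · rw [hfl.2 ws hws, mul_zero, add_zero]
      exact ⟨fun h => mul_nonneg (inv_nonneg.2 hq0.le) ((hwf n hfl).1 h),
        fun h => mul_nonpos_of_nonneg_of_nonpos (inv_nonneg.2 hq0.le) ((hwf n hfl).2 h)⟩
    · have h1 := abs_le.1 (hbd n)
      refine ⟨fun h => ?_, fun h => ?_⟩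
      · have := mul_le_mul_of_nonneg_left ((hθ n hα hfl).1 h) ha0.le
        linarith
      · have := mul_le_mul_of_nonneg_left ((hθ n hα hfl).2 h) ha0.le
        linarith
  have hZu : ∀ n, G.α n = 1 → G.β n * G.inflow u n = -((q : ℝ)⁻¹ * y n) := by
    intro n hα
    have h1 : G.β n * G.inflow ws n = 0 :=
      le_antisymm ((hws.2 n).2 (Or.inl hα)) ((hws.2 n).1 (Or.inl hα))
    have h2 := hgz n hα
    rw [huin, h1, mul_zero, add_zero, map_sub, Pi.sub_apply, mul_sub]
    simp only [step] at h2
    have h3 : y n = G.α n * z n + G.β n * G.inflow w n := rfl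
    rw [h3, ← mul_neg]
    congr 1
    linarith
  have hconst : ∀ j, j ≤ q → G.traj y (fun _ => u) j ∈ G.box := by
    intro j
    induction j with
    | zero => intro _; exact hyb
    | succ j ih =>
      intro hj
      replace ih := ih (by omega)
      refine hκx _ ih u hun fun n => ⟨fun hα => ?_, fun hα => ⟨fun h => ?_, fun h => ?_⟩⟩
      · have h1 : G.step (G.traj y (fun _ => u) j) u n = G.traj y (fun _ => u) (j + 1) n := rfl
        rw [h1, traj_const_of_no_leak hα, hZu n hα]
        have h2 : ((j + 1 : ℕ) : ℝ) * (q : ℝ)⁻¹ ≤ 1 := by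
          rw [← div_eq_mul_inv, div_le_one hq0]; exact_mod_cast hj
        have h3 : 0 ≤ ((j + 1 : ℕ) : ℝ) * (q : ℝ)⁻¹ := by positivity
        have h4 := smul_mem_box hyb (a := fun _ => 1 - ((j + 1 : ℕ) : ℝ) * (q : ℝ)⁻¹)
          (fun _ => by linarith) (fun _ => by linarith)
        have h5 := h4.1 n
        have h6 := h4.2 n
        simp only at h5 h6
        constructor <;> linarith
      · have h1 := ih.1 n
        rw [h] at h1
        exact add_nonneg (mul_nonneg (G.α_nonneg n) h1) ((hside n hα).1 h)
      · have h1 := ih.2 n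
        rw [h] at h1
        exact add_nonpos (mul_nonpos_of_nonneg_of_nonpos (G.α_nonneg n) h1) ((hside n hα).2 h)
  have hplan : G.IsPlan q y fun _ => u := ⟨fun _ => hufl, hconst⟩
  have hend := hconst q le_rfl
  have hzc : G.zCost (G.traj y (fun _ => u) q) = 0 := by
    refine Finset.sum_eq_zero fun n _ => ?_
    split_ifs with hα
    · rw [traj_const_of_no_leak hα, hZu n hα]
      have : y n + (q : ℝ) * -((q : ℝ)⁻¹ * y n) = 0 := by field_simp; ring
      rw [this]; simp [nodeCost]
    · rfl
  obtain ⟨i, rfl⟩ : ∃ i, N = k + (1 + (q + i)) := ⟨N - (k + (1 + q)), by omega⟩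
  have hsum : ∀ (n : ℕ) (x : V → ℝ) (f : ℕ → E → ℝ), G.IsPlan n x f →
      ∑ j ∈ Finset.range n, G.stage (G.traj x f j) (f j) ≤ n * P := fun n x f h => by
    refine (Finset.sum_le_card_nsmul _ _ P fun j hj =>
      hstage _ (h.2 j (Finset.mem_range.1 hj).le) _ (h.1 j)).trans (le_of_eq ?_)
    rw [Finset.card_range, nsmul_eq_mul]
  have h1 := (hf k).val_add_le (1 + (q + i))
  have h2 := val_succ_le hzb hwfl hyb (q + i)
  have h3 := hplan.val_add_le i
  have h4 := val_le_of_stall hCt hS i hend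
  rw [hzc, mul_zero, zero_add] at h4
  have h5 := hsum k x f (hf k)
  have h6 := hsum q y _ hplan
  have h7 := mul_le_mul_of_nonneg_left (hDx _ hend) hS0
  have h8 : (k : ℝ) * P ≤ m * P :=
    mul_le_mul_of_nonneg_right (by exact_mod_cast hkm.le) hP0
  have h9 := hstage z hzb w hwfl
  rw [add_comm (q + i) 1] at h2
  linarith

end Net

/-! ### Multipliers of a steady state. -/

namespace Net

variable {V E : Type} [Fintype V] [Fintype E] [DecidableEq V] {G : Net V E}

/-- The change of stock during one stage, as a linear map. -/
def drift (G : Net V E) : ((V → ℝ) × (E → ℝ)) →ₗ[ℝ] (V → ℝ) where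
  toFun z := G.step z.1 z.2 - z.1
  map_add' z w := by
    simp only [Prod.fst_add, Prod.snd_add, step_add]; abel
  map_smul' r z := by
    ext n; simp [step]; ring

variable (G) in
/-- Multipliers for a linear cost that is minimal at the origin among the stationary points. -/
theorem exists_static_multiplier (a : V → ℝ) (b : E → ℝ)
    (h : ∀ x ∈ G.box, ∀ f ∈ G.flows, G.step x f = x → 0 ≤ ∑ n, a n * x n + ∑ e, b e * f e) :
    ∃ μ : V → ℝ,
      (∀ n, 0 ≤ (a n + (G.α n - 1) * μ n) * G.lo n ∧ 0 ≤ (a n + (G.α n - 1) * μ n) * G.hi n) ∧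
      ∀ e, 0 ≤ (b e + (G.β (G.head e) * μ (G.head e) - G.β (G.tail e) * μ (G.tail e))) * G.fl e ∧
        0 ≤ (b e + (G.β (G.head e) * μ (G.head e) - G.β (G.tail e) * μ (G.tail e))) * G.fu e := by
  classical
  let φ : ((V → ℝ) × (E → ℝ)) →ₗ[ℝ] ℝ :=
    { toFun := fun z => ∑ n, a n * z.1 n + ∑ e, b e * z.2 e
      map_add' := fun z w => by simp [mul_add, Finset.sum_add_distrib]; ring
      map_smul' := fun r z => by
        simp only [Prod.smul_fst, Prod.smul_snd, Pi.smul_apply, smul_eq_mul, RingHom.id_apply,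
          mul_add, Finset.mul_sum]
        congr 1 <;> exact Finset.sum_congr rfl fun _ _ => by ring }
  obtain ⟨L, hL0, hL⟩ := φ.toContinuousLinearMap.bound
  let p : (V ⊕ V) ⊕ (E ⊕ E) → ((V → ℝ) × (E → ℝ)) →ₗ[ℝ] ℝ := Sum.elim
    (Sum.elim (fun n => LinearMap.proj n ∘ₗ LinearMap.fst ℝ _ _)
      fun n => -(LinearMap.proj n ∘ₗ LinearMap.fst ℝ _ _))
    (Sum.elim (fun e => LinearMap.proj e ∘ₗ LinearMap.snd ℝ _ _)
      fun e => -(LinearMap.proj e ∘ₗ LinearMap.snd ℝ _ _))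
  let q : V → ((V → ℝ) × (E → ℝ)) →ₗ[ℝ] ℝ := fun n => LinearMap.proj n ∘ₗ G.drift
  obtain ⟨C, hC0, hC⟩ := hoffman p q
  set W : ℝ := L * C with hW
  have hW0 : 0 ≤ W := by positivity
  have hWc : ConvexOn ℝ Set.univ fun h : V → ℝ => W * ‖h‖ := by
    have := (convexOn_norm (E := V → ℝ) convex_univ).smul hW0
    simpa using this
  have h00 : G.step 0 0 = 0 := step_zero_zero
  have hpen : ∀ z ∈ G.box ×ˢ G.flows, 0 ≤ φ z + W * ‖G.drift z - 0‖ := by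
    rintro z ⟨hz1, hz2⟩
    rw [sub_zero]
    -- A pair is moved to a stationary admissible one at a distance proportional to its drift; the
    -- cost is nonnegative there, so the drift is an exact penalty.
    obtain ⟨w, hw1, hw2, hwd⟩ := hC (Sum.elim (Sum.elim G.hi (-G.lo)) (Sum.elim G.fu (-G.fl))) 0 z
      ‖G.drift z‖ (norm_nonneg _) (by
        have := norm_nonneg (G.drift z)
        rintro ((n | n) | (e | e))
        · have := hz1.2 n; simp [p]; linarith
        · have := hz1.1 n; simp [p]; linarith
        · have := hz2.2 e; simp [p]; linarith
        · have := hz2.1 e; simp [p]; linarith)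
      (fun n => by
        have := abs_apply_le_norm (G.drift z) n
        simpa [q] using this)
      ⟨0, by
        rintro ((n | n) | (e | e))
        · simpa [p] using G.hi_nonneg n
        · simpa [p] using G.lo_nonpos n
        · simpa [p] using G.fu_nonneg e
        · simpa [p] using G.fl_nonpos e, fun n => by simp [q]⟩
    have h1 : w.1 ∈ G.box := ⟨fun n => by have := hw1 (.inl (.inr n)); simp [p] at this; exact this,
      fun n => hw1 (.inl (.inl n))⟩
    have h2 : w.2 ∈ G.flows := ⟨fun n => by have := hw1 (.inr (.inr n)); simp [p] at this; exact this,
      fun n => hw1 (.inr (.inl n))⟩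
    have h3 : G.step w.1 w.2 = w.1 := by
      ext n
      have := hw2 n
      simp only [q, LinearMap.comp_apply, drift, LinearMap.coe_mk, AddHom.coe_mk,
        LinearMap.proj_apply, Pi.sub_apply, Pi.zero_apply] at this
      linarith
    have h4 : 0 ≤ φ w := h _ h1 _ h2 h3
    have h5 : φ z = φ w - φ (w - z) := by rw [map_sub]; ring
    have h6 := (abs_le.1 (hL (w - z))).2
    have h7 := mul_le_mul_of_nonneg_left hwd hL0.le
    have h8 : φ.toContinuousLinearMap (w - z) = φ (w - z) := rfl
    rw [h8] at h6
    rw [h5, hW, mul_assoc]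
    linarith
  have hφc : ConvexOn ℝ (G.box ×ˢ G.flows) φ := φ.convexOn (convex_box.prod convex_flows)
  obtain ⟨l, hl⟩ := exists_multiplier (s := G.box ×ˢ G.flows) ⟨(0, 0), zero_mem_box, zero_mem_flows⟩
    hφc G.drift 0 hWc (by fun_prop) 0 hpen
  set μ : V → ℝ := fun n => l (Pi.single n 1) with hμ
  have hlsum : ∀ h : V → ℝ, l h = ∑ n, μ n * h n := fun h => by
    conv_lhs => rw [← Finset.univ_sum_single h]
    rw [map_sum]
    refine Finset.sum_congr rfl fun n _ => ?_
    have : Pi.single n (h n) = h n • (Pi.single n 1 : V → ℝ) := by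
      rw [← Pi.single_smul]; simp
    rw [this, map_smul, smul_eq_mul, mul_comm]
  have key : ∀ x ∈ G.box, ∀ f ∈ G.flows, 0 ≤ ∑ n, (a n + (G.α n - 1) * μ n) * x n +
      ∑ e, (b e + (G.β (G.head e) * μ (G.head e) - G.β (G.tail e) * μ (G.tail e))) * f e := by
    intro x hx f hf
    have h1 := hl (x, f) ⟨hx, hf⟩ 0
    have h2 : G.drift (x, f) - 0 - 0 = G.step x f - x := by simp [drift]
    rw [norm_zero, mul_zero, add_zero, h2, hlsum] at h1
    refine h1.trans (le_of_eq ?_)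
    simp only [Pi.sub_apply, mul_sub, Finset.sum_sub_distrib, sum_mul_step]
    simp only [φ, LinearMap.coe_mk, AddHom.coe_mk, add_mul, sub_mul, Finset.sum_add_distrib,
      Finset.sum_sub_distrib, one_mul]
    have e1 : ∑ n, G.α n * μ n * x n = ∑ n, μ n * (G.α n * x n) :=
      Finset.sum_congr rfl fun _ _ => by ring
    have e2 : ∀ i : E → V, ∑ e, f e * (G.β (i e) * μ (i e)) = ∑ e, G.β (i e) * μ (i e) * f e :=
      fun i => Finset.sum_congr rfl fun _ _ => by ring
    simp only [e1, e2]
    ring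
  have hnode : ∀ n t, G.lo n ≤ t → t ≤ G.hi n → 0 ≤ (a n + (G.α n - 1) * μ n) * t := by
    intro n t h1 h2
    have := key (Pi.single n t) ⟨fun m => ?_, fun m => ?_⟩ 0 zero_mem_flows
    · simpa [Pi.single_apply] using this
    · by_cases hm : m = n
      · subst hm; simpa using h1
      · simpa [Pi.single_apply, hm] using G.lo_nonpos m
    · by_cases hm : m = n
      · subst hm; simpa using h2
      · simpa [Pi.single_apply, hm] using G.hi_nonneg m
  have hedge : ∀ e t, G.fl e ≤ t → t ≤ G.fu e →
      0 ≤ (b e + (G.β (G.head e) * μ (G.head e) - G.β (G.tail e) * μ (G.tail e))) * t := by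
    intro n t h1 h2
    have := key 0 zero_mem_box (Pi.single n t) ⟨fun m => ?_, fun m => ?_⟩
    · simpa [Pi.single_apply] using this
    · by_cases hm : m = n
      · subst hm; simpa using h1
      · simpa [Pi.single_apply, hm] using G.fl_nonpos m
    · by_cases hm : m = n
      · subst hm; simpa using h2
      · simpa [Pi.single_apply, hm] using G.fu_nonneg m
  refine ⟨μ, fun n => ⟨hnode n _ le_rfl ((G.lo_nonpos n).trans (G.hi_nonneg n)),
    hnode n _ ((G.lo_nonpos n).trans (G.hi_nonneg n)) le_rfl⟩, fun e =>
    ⟨hedge e _ le_rfl ((G.fl_nonpos e).trans (G.fu_nonneg e)),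
      hedge e _ ((G.fl_nonpos e).trans (G.fu_nonneg e)) le_rfl⟩⟩

end Net

/-! ### Potential games -/

namespace Grid

variable {M : ℕ} (G : Grid M)

/-- Linear part of the load. -/
def loadSlope (u : PInput) : ℝ := u.1 + u.2

theorem load_add (v : Fin M) (u d : PInput) : G.load v (u + d) = G.load v u + loadSlope d := by
  simp [load, loadSlope]; ring

theorem aggregateLoad_add (u d : Fin M → PInput) :
    G.aggregateLoad (u + d) = G.aggregateLoad u + ∑ v, loadSlope (d v) := by
  simp only [aggregateLoad, Pi.add_apply, load_add, Finset.sum_add_distrib]; ring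

theorem aggregateLoad_update (v : Fin M) (u : Fin M → PInput) (y : PInput) :
    G.aggregateLoad (Function.update u v y) =
      G.aggregateLoad u + (G.load v y - G.load v (u v)) := by
  simp only [aggregateLoad]
  rw [← Finset.add_sum_erase _ _ (Finset.mem_univ v),
    ← Finset.add_sum_erase _ (fun w => G.load w (u w)) (Finset.mem_univ v), Function.update_self]
  have : ∑ w ∈ Finset.univ.erase v, G.load w (Function.update u v y w) =
      ∑ w ∈ Finset.univ.erase v, G.load w (u w) :=
    Finset.sum_congr rfl fun w hw => by rw [Function.update_of_ne (Finset.ne_of_mem_erase hw)]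
  rw [this]; ring

/-- Potential of one stage when the price rate of the aggregate load is `r`. -/
noncomputable def potential (r : ℝ) (x : Fin M → PState) (u : Fin M → PInput) : ℝ :=
  ∑ v, (G.γ₁ v * (x v).1 ^ 2 + G.γ₂ v * (x v).2 ^ 2 + r / 2 * G.load v (u v) ^ 2 +
    G.ρ₂ v * G.load v (u v)) + r / 2 * G.aggregateLoad u ^ 2

/-- Derivative of the potential at `(x, u)` in the direction `(y, d)`. -/
noncomputable def slope (r : ℝ) (x : Fin M → PState) (u : Fin M → PInput) (y : Fin M → PState)
    (d : Fin M → PInput) : ℝ :=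
  ∑ v, (2 * G.γ₁ v * (x v).1 * (y v).1 + 2 * G.γ₂ v * (x v).2 * (y v).2 +
    (r * G.aggregateLoad u + G.ρ₂ v + r * G.load v (u v)) * loadSlope (d v))

/-- Second-order part of the potential. -/
noncomputable def curvature (r : ℝ) (y : Fin M → PState) (d : Fin M → PInput) : ℝ :=
  ∑ v, (G.γ₁ v * (y v).1 ^ 2 + G.γ₂ v * (y v).2 ^ 2 + r / 2 * loadSlope (d v) ^ 2) +
    r / 2 * (∑ v, loadSlope (d v)) ^ 2

theorem potential_add (r t : ℝ) (x y : Fin M → PState) (u d : Fin M → PInput) :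
    G.potential r (x + t • y) (u + t • d) =
      G.potential r x u + t * G.slope r x u y d + t ^ 2 * G.curvature r y d := by
  have h : ∀ v, loadSlope (t • d v) = t * loadSlope (d v) := fun v => by
    simp [loadSlope]; ring
  simp only [potential, slope, curvature, aggregateLoad_add, Pi.add_apply, Pi.smul_apply, load_add,
    h, ← Finset.mul_sum, Prod.fst_add, Prod.snd_add, Prod.smul_fst, Prod.smul_snd, smul_eq_mul]
  have e : ∑ v, (2 * G.γ₁ v * (x v).1 * (y v).1 + 2 * G.γ₂ v * (x v).2 * (y v).2 +
      (r * G.aggregateLoad u + G.ρ₂ v + r * G.load v (u v)) * loadSlope (d v)) =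
      ∑ v, (2 * G.γ₁ v * (x v).1 * (y v).1 + 2 * G.γ₂ v * (x v).2 * (y v).2 +
      (G.ρ₂ v + r * G.load v (u v)) * loadSlope (d v)) +
      r * G.aggregateLoad u * ∑ v, loadSlope (d v) := by
    rw [Finset.mul_sum, ← Finset.sum_add_distrib]
    exact Finset.sum_congr rfl fun v _ => by ring
  rw [e]
  have e2 : ∑ v, (G.γ₁ v * ((x v).1 + t * (y v).1) ^ 2 + G.γ₂ v * ((x v).2 + t * (y v).2) ^ 2 +
      r / 2 * (G.load v (u v) + t * loadSlope (d v)) ^ 2 +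
      G.ρ₂ v * (G.load v (u v) + t * loadSlope (d v))) =
      ∑ v, (G.γ₁ v * (x v).1 ^ 2 + G.γ₂ v * (x v).2 ^ 2 + r / 2 * G.load v (u v) ^ 2 +
        G.ρ₂ v * G.load v (u v)) +
      t * ∑ v, (2 * G.γ₁ v * (x v).1 * (y v).1 + 2 * G.γ₂ v * (x v).2 * (y v).2 +
        (G.ρ₂ v + r * G.load v (u v)) * loadSlope (d v)) +
      t ^ 2 * ∑ v, (G.γ₁ v * (y v).1 ^ 2 + G.γ₂ v * (y v).2 ^ 2 +
        r / 2 * loadSlope (d v) ^ 2) := by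
    rw [Finset.mul_sum, Finset.mul_sum, ← Finset.sum_add_distrib, ← Finset.sum_add_distrib]
    exact Finset.sum_congr rfl fun v _ => by ring
  rw [e2]; ring

theorem potential_add' (r : ℝ) (x y : Fin M → PState) (u d : Fin M → PInput) :
    G.potential r (x + y) (u + d) =
      G.potential r x u + G.slope r x u y d + G.curvature r y d := by
  have := G.potential_add r 1 x y u d
  simpa using this

theorem curvature_nonneg {r : ℝ} (hr : 0 ≤ r) (y : Fin M → PState) (d : Fin M → PInput) :
    0 ≤ G.curvature r y d := by
  refine add_nonneg (Finset.sum_nonneg fun v _ => ?_) (by positivity)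
  have h1 := G.γ₁_pos v
  have h2 := G.γ₂_pos v
  positivity

/-- The curvature sees states and loads only: consumption and charging can be exchanged at constant
load, and the inputs have to be recovered from the dynamics. -/
theorem eq_zero_of_curvature {r : ℝ} (hr : 0 < r) {y : Fin M → PState} {d : Fin M → PInput}
    (h : G.curvature r y d ≤ 0) : y = 0 ∧ ∀ v, loadSlope (d v) = 0 := by
  have h0 : ∀ v ∈ Finset.univ, 0 ≤ G.γ₁ v * (y v).1 ^ 2 + G.γ₂ v * (y v).2 ^ 2 +
      r / 2 * loadSlope (d v) ^ 2 := fun v _ => by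
    have h1 := G.γ₁_pos v
    have h2 := G.γ₂_pos v
    positivity
  have h1 : ∀ v, G.γ₁ v * (y v).1 ^ 2 + G.γ₂ v * (y v).2 ^ 2 +
      r / 2 * loadSlope (d v) ^ 2 ≤ 0 := fun v => by
    refine (Finset.single_le_sum h0 (Finset.mem_univ v)).trans ?_
    have : 0 ≤ r / 2 * (∑ v, loadSlope (d v)) ^ 2 := by positivity
    simp only [curvature] at h
    linarith
  have h2 : ∀ v, (y v).1 = 0 ∧ (y v).2 = 0 ∧ loadSlope (d v) = 0 := fun v => by
    have a1 := G.γ₁_pos v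
    have a2 := G.γ₂_pos v
    have b1 : 0 ≤ G.γ₁ v * (y v).1 ^ 2 := by positivity
    have b2 : 0 ≤ G.γ₂ v * (y v).2 ^ 2 := by positivity
    have b3 : 0 ≤ r / 2 * loadSlope (d v) ^ 2 := by positivity
    have c := h1 v
    refine ⟨?_, ?_, ?_⟩
    · have : G.γ₁ v * (y v).1 ^ 2 = 0 := by linarith
      simpa [a1.ne'] using this
    · have : G.γ₂ v * (y v).2 ^ 2 = 0 := by linarith
      simpa [a2.ne'] using this
    · have : r / 2 * loadSlope (d v) ^ 2 = 0 := by linarith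
      simpa [hr.ne'] using this
  exact ⟨funext fun v => Prod.ext (h2 v).1 (h2 v).2.1, fun v => (h2 v).2.2⟩

end Grid

/-- The derivative of a function that is quadratic along a line. -/
theorem fderiv_apply_of_quadratic {E : Type} [NormedAddCommGroup E] [NormedSpace ℝ E] {f : E → ℝ}
    {x d : E} (hf : DifferentiableAt ℝ f x) {b c : ℝ}
    (h : ∀ t : ℝ, f (x + t • d) = f x + t * b + t ^ 2 * c) : fderiv ℝ f x d = b := by
  have h1 : HasDerivAt (fun t : ℝ => x + t • d) d 0 := by
    simpa using ((hasDerivAt_id (0 : ℝ)).smul_const d).const_add x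
  have h2 : HasFDerivAt f (fderiv ℝ f x) (x + (0 : ℝ) • d) := by simpa using hf.hasFDerivAt
  have h3 := h2.comp_hasDerivAt (0 : ℝ) h1
  have h4 : HasDerivAt (fun t : ℝ => f x + t * b + t ^ 2 * c) b 0 := by
    have e1 := ((hasDerivAt_id (0 : ℝ)).mul_const b).const_add (f x)
    have e2 := ((hasDerivAt_id (0 : ℝ)).pow 2).mul_const c
    have e3 := e1.add e2
    simp only [id, Nat.cast_ofNat, Nat.add_one_sub_one, mul_one, one_mul] at e3
    refine (HasDerivAt.congr_deriv e3 (by simp)).congr_of_eventuallyEq (Eventually.of_forall fun t => ?_)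
    simp
  have h5 : (f ∘ fun t : ℝ => x + t • d) = fun t : ℝ => f x + t * b + t ^ 2 * c := funext h
  rw [h5] at h3
  exact h3.unique h4

theorem nonneg_of_quadratic {a b : ℝ} (h : ∀ t : ℝ, 0 < t → t ≤ 1 → 0 ≤ t * a + t ^ 2 * b) :
    0 ≤ a := by
  by_contra! ha
  set t : ℝ := min 1 (-a / (2 * (|b| + 1))) with ht
  have hd : 0 < -a / (2 * (|b| + 1)) := div_pos (by linarith) (by positivity)
  have ht0 : 0 < t := lt_min one_pos hd
  have h1 := h t ht0 (min_le_left _ _)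
  have h2 : t * (2 * (|b| + 1)) ≤ -a := (le_div_iff₀ (by positivity)).1 (min_le_right _ _)
  have h3 : 0 ≤ t * (a + t * b) := by linarith
  have h4 := nonneg_of_mul_nonneg_right h3 ht0
  have h5 := mul_le_mul_of_nonneg_left (le_abs_self b) ht0.le
  linarith

/-! ### Variational equilibria as minimizers of a potential. -/

namespace Grid

variable {M : ℕ} (G : Grid M) {E ι : Type} [NormedAddCommGroup E] [NormedSpace ℝ E] [Fintype ι]

/-- Sum of the stage costs of one player over the stages `ι`. -/
noncomputable def sumCost (X : ι → E →L[ℝ] PState) (U : ι → E →L[ℝ] PInput) (v : Fin M)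
    (z : Fin M → E) : ℝ :=
  ∑ k, G.stageCost v (X k (z v)) fun w => U k (z w)

noncomputable def sumPotential (r : ℝ) (X : ι → E →L[ℝ] PState) (U : ι → E →L[ℝ] PInput)
    (z : Fin M → E) : ℝ :=
  ∑ k, G.potential r (fun v => X k (z v)) fun v => U k (z v)

/-- A player's own load enters the price as well, so its marginal price is `r * (L + l) + ρ₂`. With
a common rate `r` this is also the derivative of the potential in that player's strategy. -/
theorem fderiv_sumCost {r : ℝ} (hr : ∀ v, G.ρ₁ v = r) (X : ι → E →L[ℝ] PState)
    (U : ι → E →L[ℝ] PInput) (v : Fin M) (z : Fin M → E) (d : E) :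
    fderiv ℝ (fun y : E => G.sumCost X U v (Function.update z v y)) (z v) d =
      ∑ k, (2 * G.γ₁ v * (X k (z v)).1 * (X k d).1 + 2 * G.γ₂ v * (X k (z v)).2 * (X k d).2 +
        (r * G.aggregateLoad (fun w => U k (z w)) + G.ρ₂ v + r * G.load v (U k (z v))) *
          loadSlope (U k d)) := by
  have hU : ∀ k (y : E), (fun w => U k (Function.update z v y w)) =
      Function.update (fun w => U k (z w)) v (U k y) := fun k y => by
    ext w
    all_goals
      by_cases hw : w = v
      · subst hw; simp
      · simp [Function.update_of_ne hw]
  have hcost : ∀ y : E, G.sumCost X U v (Function.update z v y) =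
      ∑ k, ((r * (G.aggregateLoad (fun w => U k (z w)) +
        (G.load v (U k y) - G.load v (U k (z v)))) + G.ρ₂ v) * G.load v (U k y) +
          G.γ₁ v * (X k y).1 ^ 2 + G.γ₂ v * (X k y).2 ^ 2) := fun y => by
    refine Finset.sum_congr rfl fun k _ => ?_
    rw [stageCost, hU, aggregateLoad_update, Function.update_self, hr]
  simp only [hcost]
  refine fderiv_apply_of_quadratic (c := ∑ k, (r * loadSlope (U k d) ^ 2 +
    G.γ₁ v * (X k d).1 ^ 2 + G.γ₂ v * (X k d).2 ^ 2)) ?_ fun t => ?_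
  · simp only [load]
    fun_prop
  · rw [Finset.mul_sum, Finset.mul_sum, ← Finset.sum_add_distrib, ← Finset.sum_add_distrib]
    refine Finset.sum_congr rfl fun k _ => ?_
    simp only [map_add, map_smul, load_add, Prod.fst_add, Prod.snd_add, Prod.smul_fst,
      Prod.smul_snd, smul_eq_mul]
    have : loadSlope (t • U k d) = t * loadSlope (U k d) := by simp [loadSlope]; ring
    rw [this]; ring

theorem sumPotential_add (r t : ℝ) (X : ι → E →L[ℝ] PState) (U : ι → E →L[ℝ] PInput)
    (z d : Fin M → E) : G.sumPotential r X U (z + t • d) = G.sumPotential r X U z +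
      t * ∑ k, G.slope r (fun v => X k (z v)) (fun v => U k (z v)) (fun v => X k (d v))
        (fun v => U k (d v)) +
      t ^ 2 * ∑ k, G.curvature r (fun v => X k (d v)) fun v => U k (d v) := by
  rw [Finset.mul_sum, Finset.mul_sum]
  simp only [sumPotential]
  rw [← Finset.sum_add_distrib, ← Finset.sum_add_distrib]
  refine Finset.sum_congr rfl fun k _ => ?_
  rw [← potential_add]
  congr 1 <;>
  · funext v
    simp

/-- The potential is quadratic along lines, so its increment is slope plus curvature, and the
variational inequality says that the slope is nonnegative. Conversely, the slope is the limit of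
difference quotients along shrinking segments in the convex set `Z`. -/
theorem mem_variationalEquilibria_iff {r : ℝ} (hr : ∀ v, G.ρ₁ v = r) (hr0 : 0 ≤ r)
    (X : ι → E →L[ℝ] PState) (U : ι → E →L[ℝ] PInput) {Z : Set (Fin M → E)} (hZ : Convex ℝ Z)
    (z : Fin M → E) : z ∈ variationalEquilibria (G.sumCost X U) Z ↔
      z ∈ Z ∧ ∀ z' ∈ Z, G.sumPotential r X U z +
        ∑ k, G.curvature r (fun v => X k (z' v - z v)) (fun v => U k (z' v - z v)) ≤
          G.sumPotential r X U z' := by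
  have hslope : ∀ z' : Fin M → E,
      ∑ v, fderiv ℝ (fun y : E => G.sumCost X U v (Function.update z v y)) (z v) (z' v - z v) =
      ∑ k, G.slope r (fun v => X k (z v)) (fun v => U k (z v)) (fun v => X k ((z' - z) v))
        (fun v => U k ((z' - z) v)) := fun z' => by
    simp only [fderiv_sumCost G hr, slope]
    rw [Finset.sum_comm]
    rfl
  have hexp : ∀ (z' : Fin M → E) (t : ℝ), G.sumPotential r X U (z + t • (z' - z)) = _ :=
    fun z' t => G.sumPotential_add r t X U z (z' - z)
  refine and_congr_right fun hz => ⟨fun h z' hz' => ?_, fun h z' hz' => ?_⟩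
  · have h1 := h z' hz'
    have h2 := hexp z' 1
    rw [hslope] at h1
    rw [one_smul, add_sub_cancel, one_pow, one_mul, one_mul] at h2
    rw [h2]
    simp only [Pi.sub_apply] at h1 ⊢
    linarith
  · rw [hslope]
    refine nonneg_of_quadratic (b := ∑ k, G.curvature r (fun v => X k ((z' - z) v))
      fun v => U k ((z' - z) v)) fun t ht ht1 => ?_
    have hw : z + t • (z' - z) ∈ Z := by
      have := hZ hz hz' (sub_nonneg.2 ht1) ht.le (by ring)
      convert this using 1
      rw [smul_sub, sub_smul, one_smul]; abel
    have h1 := h _ hw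
    rw [hexp z' t] at h1
    have h2 : 0 ≤ ∑ k, G.curvature r (fun v => X k ((z + t • (z' - z)) v - z v))
        fun v => U k ((z + t • (z' - z)) v - z v) :=
      Finset.sum_nonneg fun k _ => G.curvature_nonneg hr0 _ _
    linarith

end Grid

/-! ### Existence and uniqueness of equilibria. -/

namespace Grid

variable {M : ℕ} {G : Grid M}

theorem mem_inputs {u : Fin M → PInput} : u ∈ G.inputs ↔
    ∀ v, u v ∈ G.agentInputs v ∧ G.LMin ≤ G.aggregateLoad u ∧ G.aggregateLoad u ≤ G.LMax := by
  simp only [inputs, coupling, Set.mem_ofPred_eq, Set.mem_inter_iff, Function.update_eq_self]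

theorem load_combo (v : Fin M) {p q : ℝ} (h : p + q = 1) (u w : PInput) :
    G.load v (p • u + q • w) = p * G.load v u + q * G.load v w := by
  have : q = 1 - p := by linarith
  subst this
  simp [load]; ring

theorem aggregateLoad_combo {p q : ℝ} (h : p + q = 1) (u w : Fin M → PInput) :
    G.aggregateLoad (p • u + q • w) = p * G.aggregateLoad u + q * G.aggregateLoad w := by
  simp only [aggregateLoad, Pi.add_apply, Pi.smul_apply, load_combo _ h, Finset.sum_add_distrib,
    ← Finset.mul_sum]
  have : q = 1 - p := by linarith
  subst this
  ring

theorem combo_mem_Icc {a b p q s t : ℝ} (hp : 0 ≤ p) (hq : 0 ≤ q) (h : p + q = 1)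
    (hs : a ≤ s ∧ s ≤ b) (ht : a ≤ t ∧ t ≤ b) : a ≤ p * s + q * t ∧ p * s + q * t ≤ b :=
  convex_Icc a b hs ht hp hq h

theorem convex_states : Convex ℝ G.states := by
  intro x hx y hy p q hp hq hpq v
  obtain ⟨h1, h2, h3, h4⟩ := hx v
  obtain ⟨h5, h6, h7, h8⟩ := hy v
  have e1 := combo_mem_Icc hp hq hpq ⟨h1, h2⟩ ⟨h5, h6⟩
  have e2 := combo_mem_Icc hp hq hpq ⟨h3, h4⟩ ⟨h7, h8⟩
  exact ⟨e1.1, e1.2, e2.1, e2.2⟩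

theorem convex_inputs : Convex ℝ G.inputs := by
  intro x hx y hy p q hp hq hpq
  rw [mem_inputs] at hx hy ⊢
  intro v
  obtain ⟨⟨h1, h2, h3, h4, h5, h6⟩, h7⟩ := hx v
  obtain ⟨⟨g1, g2, g3, g4, g5, g6⟩, g7⟩ := hy v
  have e1 := combo_mem_Icc hp hq hpq ⟨h1, h2⟩ ⟨g1, g2⟩
  have e2 := combo_mem_Icc hp hq hpq ⟨h3, h4⟩ ⟨g3, g4⟩
  have e3 := combo_mem_Icc hp hq hpq ⟨h5, h6⟩ ⟨g5, g6⟩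
  have e4 := combo_mem_Icc hp hq hpq h7 g7
  rw [aggregateLoad_combo hpq]
  have e5 : G.β v * ((p • x + q • y) v).2 = p * (G.β v * (x v).2) + q * (G.β v * (y v).2) := by
    simp; ring
  refine ⟨⟨?_, ?_, e2.1, e2.2, ?_, ?_⟩, e4⟩
  · rw [e5]; exact e1.1
  · rw [e5]; exact e1.2
  · simp only [Pi.add_apply, Pi.smul_apply, load_combo v hpq]; exact e3.1
  · simp only [Pi.add_apply, Pi.smul_apply, load_combo v hpq]; exact e3.2

theorem step_combo {p q : ℝ} (h : p + q = 1) (x y : Fin M → PState) (u w : Fin M → PInput) :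
    G.step (p • x + q • y) (p • u + q • w) = p • G.step x u + q • G.step y w := by
  have : q = 1 - p := by linarith
  subst this
  funext v
  ext <;> simp [step, stepAgent] <;> ring

theorem mem_steadySet {z : Fin M → PInput × PState} : z ∈ G.steadySet ↔
    (fun v => (z v).2) ∈ G.states ∧
      G.step (fun v => (z v).2) (fun v => (z v).1) = (fun v => (z v).2) ∧
      (fun v => (z v).1) ∈ G.inputs := by
  constructor
  · exact fun h => ⟨fun v => (h v).1, funext fun v => (h v).2.1.symm, fun v => (h v).2.2⟩
  · exact fun h v => ⟨h.1 v, (congrFun h.2.1 v).symm, h.2.2 v⟩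

theorem convex_steadySet : Convex ℝ G.steadySet := by
  intro x hx y hy p q hp hq hpq
  rw [mem_steadySet] at hx hy ⊢
  refine ⟨convex_states hx.1 hy.1 hp hq hpq, ?_, convex_inputs hx.2.2 hy.2.2 hp hq hpq⟩
  have := step_combo (G := G) hpq (fun v => (x v).2) (fun v => (y v).2) (fun v => (x v).1)
    fun v => (y v).1
  rw [hx.2.1, hy.2.1] at this
  exact this

theorem mem_actionSet {N : ℕ} {x₀ : Fin M → PState} {z : Fin M → Plan N} :
    z ∈ G.actionSet N x₀ ↔
      (∀ k : Fin N, (fun v => (z v).2 k.succ) =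
        G.step (fun v => (z v).2 k.castSucc) fun v => (z v).1 k) ∧
      (∀ k : Fin N, (fun v => (z v).1 k) ∈ G.inputs) ∧
      (∀ k, (fun v => (z v).2 k) ∈ G.states) ∧ (fun v => (z v).2 0) = x₀ := by
  constructor
  · exact fun h => ⟨fun k => funext fun v => (h v).1 k, fun k v => (h v).2.1 k,
      fun k v => (h v).2.2.1 k, funext fun v => (h v).2.2.2⟩
  · exact fun h v => ⟨fun k => congrFun (h.1 k) v, fun k => h.2.1 k v, fun k => h.2.2.1 k v,
      congrFun h.2.2.2 v⟩

theorem convex_actionSet (N : ℕ) (x₀ : Fin M → PState) : Convex ℝ (G.actionSet N x₀) := by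
  intro x hx y hy p q hp hq hpq
  rw [mem_actionSet] at hx hy ⊢
  refine ⟨fun k => ?_, fun k => convex_inputs (hx.2.1 k) (hy.2.1 k) hp hq hpq,
    fun k => convex_states (hx.2.2.1 k) (hy.2.2.1 k) hp hq hpq, ?_⟩
  · have := step_combo (G := G) hpq (fun v => (x v).2 k.castSucc) (fun v => (y v).2 k.castSucc)
      (fun v => (x v).1 k) fun v => (y v).1 k
    rw [← hx.1 k, ← hy.1 k] at this
    exact this.symm
  · have h : (fun v => ((p • x + q • y) v).2 0) =
        p • (fun v => (x v).2 0) + q • fun v => (y v).2 0 := rfl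
    rw [h, hx.2.2.2, hy.2.2.2, ← add_smul, hpq, one_smul]

theorem steadyCost_eq : G.steadyCost = G.sumCost (ι := Unit)
    (fun _ => ContinuousLinearMap.snd ℝ PInput PState)
    (fun _ => ContinuousLinearMap.fst ℝ PInput PState) := by
  funext v z
  simp [steadyCost, sumCost]

theorem horizonCost_eq (N : ℕ) : G.horizonCost N = G.sumCost (ι := Fin N)
    (fun k => (ContinuousLinearMap.proj k.castSucc).comp (ContinuousLinearMap.snd ℝ
      (Fin N → PInput) (Fin (N + 1) → PState)))
    (fun k => (ContinuousLinearMap.proj k).comp (ContinuousLinearMap.fst ℝ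
      (Fin N → PInput) (Fin (N + 1) → PState))) := rfl

theorem isSteadyVGNE_iff {r : ℝ} (hr : ∀ v, G.ρ₁ v = r) (hr0 : 0 ≤ r) {x : Fin M → PState}
    {u : Fin M → PInput} : G.IsSteadyVGNE x u ↔ (x ∈ G.states ∧ G.step x u = x ∧ u ∈ G.inputs) ∧
      ∀ y w, y ∈ G.states → G.step y w = y → w ∈ G.inputs →
        G.potential r x u + G.curvature r (y - x) (w - u) ≤ G.potential r y w := by
  rw [IsSteadyVGNE, steadyCost_eq, mem_variationalEquilibria_iff G hr hr0 _ _ convex_steadySet,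
    mem_steadySet]
  refine and_congr_right fun _ => ⟨fun h y w h1 h2 h3 => ?_, fun h z' hz' => ?_⟩
  · have := h (fun v => (w v, y v)) (mem_steadySet.2 ⟨h1, h2, h3⟩)
    simp only [sumPotential, Finset.univ_unique, Finset.sum_singleton] at this
    exact this
  · rw [mem_steadySet] at hz'
    have := h _ _ hz'.1 hz'.2.1 hz'.2.2
    simp only [sumPotential, Finset.univ_unique, Finset.sum_singleton]
    exact this

theorem mem_gameSolutions_iff {r : ℝ} (hr : ∀ v, G.ρ₁ v = r) (hr0 : 0 ≤ r) {N : ℕ}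
    {x₀ : Fin M → PState} {z : Fin M → Plan N} : z ∈ G.gameSolutions N x₀ ↔
      z ∈ G.actionSet N x₀ ∧ ∀ z' ∈ G.actionSet N x₀,
        ∑ k : Fin N, G.potential r (fun v => (z v).2 k.castSucc) (fun v => (z v).1 k) +
        ∑ k : Fin N, G.curvature r (fun v => (z' v).2 k.castSucc - (z v).2 k.castSucc)
          (fun v => (z' v).1 k - (z v).1 k) ≤
        ∑ k : Fin N, G.potential r (fun v => (z' v).2 k.castSucc) (fun v => (z' v).1 k) := by
  rw [gameSolutions, horizonCost_eq, mem_variationalEquilibria_iff G hr hr0 _ _ (convex_actionSet N x₀)]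
  rfl

/-- Among convexly many candidates, a minimizer of the potential is a strong minimizer. -/
theorem gameSolutions_of_minimal {r : ℝ} (hr : ∀ v, G.ρ₁ v = r) (hr0 : 0 ≤ r) {N : ℕ}
    {x₀ : Fin M → PState} {z : Fin M → Plan N} (hz : z ∈ G.actionSet N x₀)
    (hmin : ∀ z' ∈ G.actionSet N x₀,
      ∑ k : Fin N, G.potential r (fun v => (z v).2 k.castSucc) (fun v => (z v).1 k) ≤
        ∑ k : Fin N, G.potential r (fun v => (z' v).2 k.castSucc) (fun v => (z' v).1 k)) :
    z ∈ G.gameSolutions N x₀ := by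
  rw [mem_gameSolutions_iff hr hr0]
  refine ⟨hz, fun z' hz' => ?_⟩
  have hslope : 0 ≤ ∑ k : Fin N, G.slope r (fun v => (z v).2 k.castSucc) (fun v => (z v).1 k)
      (fun v => (z' v).2 k.castSucc - (z v).2 k.castSucc) (fun v => (z' v).1 k - (z v).1 k) := by
    refine nonneg_of_quadratic (b := ∑ k : Fin N, G.curvature r
      (fun v => (z' v).2 k.castSucc - (z v).2 k.castSucc) (fun v => (z' v).1 k - (z v).1 k))
      fun t ht ht1 => ?_
    have hw : z + t • (z' - z) ∈ G.actionSet N x₀ := by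
      have := convex_actionSet N x₀ hz hz' (sub_nonneg.2 ht1) ht.le (by ring)
      convert this using 1
      rw [smul_sub, sub_smul, one_smul]; abel
    have h1 := hmin _ hw
    have h2 : ∀ k : Fin N, G.potential r (fun v => ((z + t • (z' - z)) v).2 k.castSucc)
        (fun v => ((z + t • (z' - z)) v).1 k) = _ := fun k =>
      G.potential_add r t (fun v => (z v).2 k.castSucc)
        (fun v => (z' v).2 k.castSucc - (z v).2 k.castSucc) (fun v => (z v).1 k)
        (fun v => (z' v).1 k - (z v).1 k)
    simp only [h2, Finset.sum_add_distrib, ← Finset.mul_sum] at h1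
    linarith
  have h2 : ∀ k : Fin N, G.potential r (fun v => (z' v).2 k.castSucc) (fun v => (z' v).1 k) =
      G.potential r (fun v => (z v).2 k.castSucc) (fun v => (z v).1 k) +
      G.slope r (fun v => (z v).2 k.castSucc) (fun v => (z v).1 k)
        (fun v => (z' v).2 k.castSucc - (z v).2 k.castSucc) (fun v => (z' v).1 k - (z v).1 k) +
      G.curvature r (fun v => (z' v).2 k.castSucc - (z v).2 k.castSucc)
        (fun v => (z' v).1 k - (z v).1 k) := fun k => by
    rw [← G.potential_add']
    congr 1
    · funext v; simp
    · funext v; simp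
  simp only [h2, Finset.sum_add_distrib]
  linarith

/-- Charging is bounded through the load and the consumption: the limits on `β v * s` say nothing
when `β v = 0`. -/
theorem isCompact_steadySet : IsCompact G.steadySet := by
  have hl : ∀ v, Continuous fun z : Fin M → PInput × PState => G.load v (z v).1 := fun v => by
    simp only [load]; fun_prop
  have hL : Continuous fun z : Fin M → PInput × PState => G.aggregateLoad fun v => (z v).1 := by
    simp only [aggregateLoad]
    exact (continuous_finsetSum _ fun v _ => hl v).add continuous_const
  let K : Set (Fin M → PInput × PState) := Set.univ.pi fun v =>
    (Set.Icc (G.eMin v) (G.eMax v) ×ˢ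
      Set.Icc (G.g v - G.eMax v) (G.lMax v + G.g v - G.eMin v)) ×ˢ
    (Set.Icc (G.ζMin v) (G.ζMax v) ×ˢ Set.Icc 0 (G.qMax v))
  have hK : IsCompact K := isCompact_univ_pi fun v =>
    (isCompact_Icc.prod isCompact_Icc).prod (isCompact_Icc.prod isCompact_Icc)
  refine hK.of_isClosed_subset ?_ fun z hz v _ => ?_
  · have : G.steadySet = {z | ∀ v, ((G.ζMin v ≤ (z v).2.1 ∧ (z v).2.1 ≤ G.ζMax v) ∧
        (0 ≤ (z v).2.2 ∧ (z v).2.2 ≤ G.qMax v)) ∧ (z v).2 = G.stepAgent v (z v).2 (z v).1 ∧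
        ((G.sMin v ≤ G.β v * (z v).1.2 ∧ G.β v * (z v).1.2 ≤ G.sMax v) ∧
        (G.eMin v ≤ (z v).1.1 ∧ (z v).1.1 ≤ G.eMax v) ∧
        (0 ≤ G.load v (z v).1 ∧ G.load v (z v).1 ≤ G.lMax v)) ∧
        G.LMin ≤ G.aggregateLoad (fun v => (z v).1) ∧
          G.aggregateLoad (fun v => (z v).1) ≤ G.LMax} := by
      ext z
      simp only [steadySet, agentStates, agentInputs, coupling, Set.mem_ofPred_eq,
        Set.mem_inter_iff, Function.update_eq_self]
      refine forall_congr' fun v => ?_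
      tauto
    rw [this]
    simp only [Set.ofPred_forall, Set.ofPred_and]
    have hst : ∀ v, Continuous fun z : Fin M → PInput × PState =>
        G.stepAgent v (z v).2 (z v).1 := fun v => by
      simp only [stepAgent]; fun_prop
    refine isClosed_iInter fun v => ?_
    refine IsClosed.inter (IsClosed.inter (IsClosed.inter ?_ ?_) (IsClosed.inter ?_ ?_))
      (IsClosed.inter ?_ (IsClosed.inter (IsClosed.inter (IsClosed.inter ?_ ?_)
        (IsClosed.inter (IsClosed.inter ?_ ?_) (IsClosed.inter ?_ ?_))) (IsClosed.inter ?_ ?_)))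
    · exact isClosed_le (by fun_prop) (by fun_prop)
    · exact isClosed_le (by fun_prop) (by fun_prop)
    · exact isClosed_le (by fun_prop) (by fun_prop)
    · exact isClosed_le (by fun_prop) (by fun_prop)
    · exact isClosed_eq (by fun_prop) (hst v)
    · exact isClosed_le (by fun_prop) (by fun_prop)
    · exact isClosed_le (by fun_prop) (by fun_prop)
    · exact isClosed_le (by fun_prop) (by fun_prop)
    · exact isClosed_le (by fun_prop) (by fun_prop)
    · exact isClosed_le continuous_const (hl v)
    · exact isClosed_le (hl v) continuous_const
    · exact isClosed_le continuous_const hL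
    · exact isClosed_le hL continuous_const
  · obtain ⟨⟨h1, h2, h3, h4⟩, -, ⟨-, -, h5, h6, h7, h8⟩, -⟩ := hz v
    simp only [load] at h7 h8
    exact ⟨⟨⟨h5, h6⟩, by linarith, by linarith⟩, ⟨h1, h2⟩, h3, h4⟩

theorem exists_isSteadyVGNE {r : ℝ} (hr : ∀ v, G.ρ₁ v = r) (hr0 : 0 ≤ r)
    (h : G.steadySet.Nonempty) : ∃ x u, G.IsSteadyVGNE x u := by
  have hc : Continuous fun z : Fin M → PInput × PState =>
      G.potential r (fun v => (z v).2) fun v => (z v).1 := by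
    simp only [potential, aggregateLoad, load]
    fun_prop
  obtain ⟨z, hz, hmin⟩ := isCompact_steadySet.exists_isMinOn h hc.continuousOn
  refine ⟨fun v => (z v).2, fun v => (z v).1, (isSteadyVGNE_iff hr hr0).2
    ⟨mem_steadySet.1 hz, fun y w h1 h2 h3 => ?_⟩⟩
  set z' : Fin M → PInput × PState := fun v => (w v, y v) with hz'
  have hz's : z' ∈ G.steadySet := mem_steadySet.2 ⟨h1, h2, h3⟩
  have hslope : 0 ≤ G.slope r (fun v => (z v).2) (fun v => (z v).1)
      (y - fun v => (z v).2) (w - fun v => (z v).1) := by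
    refine nonneg_of_quadratic (b := G.curvature r (y - fun v => (z v).2)
      (w - fun v => (z v).1)) fun t ht ht1 => ?_
    have hw : z + t • (z' - z) ∈ G.steadySet := by
      have := convex_steadySet hz hz's (sub_nonneg.2 ht1) ht.le (by ring)
      convert this using 1
      rw [smul_sub, sub_smul, one_smul]; abel
    have h1 := hmin hw
    have h2 : G.potential r (fun v => ((z + t • (z' - z)) v).2)
        (fun v => ((z + t • (z' - z)) v).1) = _ :=
      G.potential_add r t (fun v => (z v).2) (y - fun v => (z v).2) (fun v => (z v).1)
        (w - fun v => (z v).1)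
    simp only [Set.mem_ofPred_eq] at h1
    rw [h2] at h1
    linarith
  have h4 := G.potential_add' r (fun v => (z v).2) (y - fun v => (z v).2) (fun v => (z v).1)
    (w - fun v => (z v).1)
  rw [add_sub_cancel, add_sub_cancel] at h4
  linarith

theorem eRef_of_step_eq {x : Fin M → PState} {u : Fin M → PInput} (h : G.step x u = x)
    (v : Fin M) : (u v).1 = G.eRef v := by
  have := congrArg Prod.fst (congrFun h v)
  simp only [step, stepAgent] at this
  linarith

/-- Adding the two strengthened minimality inequalities makes the curvature vanish, so states and
loads agree. In a steady state the consumption is the nominal one, and the load then determines the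
charging. -/
theorem IsSteadyVGNE.unique {r : ℝ} (hr : ∀ v, G.ρ₁ v = r) (hr0 : 0 < r) {x y : Fin M → PState}
    {u w : Fin M → PInput} (h : G.IsSteadyVGNE x u) (h' : G.IsSteadyVGNE y w) :
    y = x ∧ w = u := by
  rw [isSteadyVGNE_iff hr hr0.le] at h h'
  have h1 := h.2 y w h'.1.1 h'.1.2.1 h'.1.2.2
  have h2 := h'.2 x u h.1.1 h.1.2.1 h.1.2.2
  have h3 := G.curvature_nonneg hr0.le (x - y) (u - w)
  obtain ⟨h4, h5⟩ := G.eq_zero_of_curvature hr0 (y := y - x) (d := w - u) (by linarith)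
  refine ⟨sub_eq_zero.1 h4, funext fun v => ?_⟩
  have h6 := eRef_of_step_eq h.1.2.1 v
  have h7 := eRef_of_step_eq h'.1.2.1 v
  have h8 := h5 v
  simp only [loadSlope, Pi.sub_apply, Prod.fst_sub, Prod.snd_sub] at h8
  exact Prod.ext (h7.trans h6.symm) (by linarith)

/-- All solutions of the horizon game have the same first input. -/
theorem gameSolutions_unique {r : ℝ} (hr : ∀ v, G.ρ₁ v = r) (hr0 : 0 < r) {N : ℕ} (hN : 2 ≤ N)
    {x₀ : Fin M → PState} {z z' : Fin M → Plan N} (h : z ∈ G.gameSolutions N x₀)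
    (h' : z' ∈ G.gameSolutions N x₀) (v : Fin M) :
    (z v).1 ⟨0, by omega⟩ = (z' v).1 ⟨0, by omega⟩ := by
  rw [mem_gameSolutions_iff hr hr0.le] at h h'
  have h1 := h.2 z' h'.1
  have h2 := h'.2 z h.1
  have h3 : ∀ (z z' : Fin M → Plan N) (k : Fin N), 0 ≤ G.curvature r
      (fun v => (z' v).2 k.castSucc - (z v).2 k.castSucc) fun v => (z' v).1 k - (z v).1 k :=
    fun z z' k => G.curvature_nonneg hr0.le _ _
  have h4 : 0 ≤ ∑ k : Fin N, G.curvature r (fun v => (z v).2 k.castSucc - (z' v).2 k.castSucc)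
      fun v => (z v).1 k - (z' v).1 k := Finset.sum_nonneg fun k _ => h3 z' z k
  have h5 : ∀ k : Fin N, G.curvature r (fun v => (z' v).2 k.castSucc - (z v).2 k.castSucc)
      (fun v => (z' v).1 k - (z v).1 k) ≤ 0 := fun k => by
    have := Finset.single_le_sum (fun k _ => h3 z z' k) (Finset.mem_univ k)
    linarith
  -- With `N ≥ 2` the state at stage `1` is still penalized, hence common to both solutions. The
  -- energy-shift dynamics then give the first consumption, and the load gives the first charging.
  obtain ⟨h6, h7⟩ := G.eq_zero_of_curvature hr0 (h5 ⟨0, by omega⟩)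
  obtain ⟨h8, -⟩ := G.eq_zero_of_curvature hr0 (h5 ⟨1, by omega⟩)
  have h9 : (z' v).2 (⟨1, by omega⟩ : Fin N).castSucc = (z v).2 (⟨1, by omega⟩ : Fin N).castSucc :=
    sub_eq_zero.1 (congrFun h8 v)
  have h10 : (z' v).2 (⟨0, by omega⟩ : Fin N).castSucc = (z v).2 (⟨0, by omega⟩ : Fin N).castSucc :=
    sub_eq_zero.1 (congrFun h6 v)
  have h11 := congrArg Prod.fst ((h.1 v).1 ⟨0, by omega⟩)
  have h12 := congrArg Prod.fst ((h'.1 v).1 ⟨0, by omega⟩)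
  have e : (⟨0, by omega⟩ : Fin N).succ = (⟨1, by omega⟩ : Fin N).castSucc := rfl
  rw [e] at h11 h12
  simp only [stepAgent] at h11 h12
  have h13 := h7 v
  simp only [loadSlope, Prod.fst_sub, Prod.snd_sub] at h13
  rw [h9, h10, h11] at h12
  exact Prod.ext (by linarith) (by linarith)

end Grid

/-! ### A grid near a steady state, as a network -/

namespace Net

variable {V E : Type} [Fintype V] [Fintype E] [DecidableEq V]

/-- The same network with other linear costs. -/
def withCosts (G : Net V E) (c τ : V → ℝ) (d : E → ℝ)
    (hc : ∀ n, 0 ≤ c n * G.lo n ∧ 0 ≤ c n * G.hi n)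
    (hd : ∀ e, 0 ≤ d e * G.fl e ∧ 0 ≤ d e * G.fu e) : Net V E :=
  { G with
    c := c
    τ := τ
    d := d
    c_lo := fun n => (hc n).1
    c_hi := fun n => (hc n).2
    d_fl := fun e => (hd e).1
    d_fu := fun e => (hd e).2 }

variable {G : Net V E}

theorem traj_withCosts (c τ : V → ℝ) (d : E → ℝ) (hc hd) (x : V → ℝ) (f : ℕ → E → ℝ) (k : ℕ) :
    (G.withCosts c τ d hc hd).traj x f k = G.traj x f k := by
  induction k with
  | zero => rfl
  | succ k ih =>
    simp only [traj]
    rw [ih]; rfl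

/-- Rotation of the cost: each stage receives the change of `∑ n, μ n * x n` over that stage. The
sum telescopes, the terminal cost cancels its end, and only a term depending on the initial stock
remains, so the optimal plans are unaffected. -/
theorem cost_withCosts (a μ : V → ℝ) (b : E → ℝ) (hc hd) (N : ℕ) (x : V → ℝ) (f : ℕ → E → ℝ) :
    (G.withCosts (fun n => a n + (G.α n - 1) * μ n) (-μ)
      (fun e => b e + (G.β (G.head e) * μ (G.head e) - G.β (G.tail e) * μ (G.tail e)))
      hc hd).cost N x f =
    ∑ k ∈ Finset.range N, (∑ n, (G.γ n * G.traj x f k n ^ 2 + a n * G.traj x f k n) +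
      ∑ e, (G.ρ e * f k e ^ 2 + b e * f k e)) - ∑ n, μ n * x n := by
  have hstage : ∀ y g, (G.withCosts (fun n => a n + (G.α n - 1) * μ n) (-μ)
      (fun e => b e + (G.β (G.head e) * μ (G.head e) - G.β (G.tail e) * μ (G.tail e)))
      hc hd).stage y g = ∑ n, (G.γ n * y n ^ 2 + a n * y n) + ∑ e, (G.ρ e * g e ^ 2 + b e * g e) +
        (∑ n, μ n * G.step y g n - ∑ n, μ n * y n) := fun y g => by
    rw [sum_mul_step]
    have h1 : ∑ n, (G.γ n * y n ^ 2 + (a n + (G.α n - 1) * μ n) * y n) =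
        ∑ n, (G.γ n * y n ^ 2 + a n * y n) + (∑ n, μ n * (G.α n * y n) - ∑ n, μ n * y n) := by
      rw [← Finset.sum_sub_distrib, ← Finset.sum_add_distrib]
      exact Finset.sum_congr rfl fun _ _ => by ring
    have h2 : ∑ e, (G.ρ e * g e ^ 2 +
        (b e + (G.β (G.head e) * μ (G.head e) - G.β (G.tail e) * μ (G.tail e))) * g e) =
        ∑ e, (G.ρ e * g e ^ 2 + b e * g e) +
          ∑ e, g e * (G.β (G.head e) * μ (G.head e) - G.β (G.tail e) * μ (G.tail e)) := by
      rw [← Finset.sum_add_distrib]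
      exact Finset.sum_congr rfl fun _ _ => by ring
    have h3 : (G.withCosts (fun n => a n + (G.α n - 1) * μ n) (-μ)
      (fun e => b e + (G.β (G.head e) * μ (G.head e) - G.β (G.tail e) * μ (G.tail e)))
      hc hd).stage y g = ∑ n, (G.γ n * y n ^ 2 + (a n + (G.α n - 1) * μ n) * y n) +
        ∑ e, (G.ρ e * g e ^ 2 +
        (b e + (G.β (G.head e) * μ (G.head e) - G.β (G.tail e) * μ (G.tail e))) * g e) := rfl
    rw [h3, h1, h2]; ring
  have hterm : ∀ y, (G.withCosts (fun n => a n + (G.α n - 1) * μ n) (-μ)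
      (fun e => b e + (G.β (G.head e) * μ (G.head e) - G.β (G.tail e) * μ (G.tail e)))
      hc hd).terminal y = -∑ n, μ n * y n := fun y => by
    rw [← Finset.sum_neg_distrib]
    exact Finset.sum_congr rfl fun n _ => by
      show (-μ) n * y n = _
      simp
  rw [cost, hterm]
  simp only [hstage, traj_withCosts]
  rw [Finset.sum_add_distrib]
  have h : ∀ k, G.step (G.traj x f k) (f k) = G.traj x f (k + 1) := fun k => rfl
  simp only [h]
  rw [Finset.sum_range_sub (fun k => ∑ n, μ n * G.traj x f k n)]
  simp only [traj]
  ring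

end Net

/-- Nodes: the ground and the hub, then the bus, the deferrable load and the battery of each
prosumer. -/
abbrev Node (M : ℕ) := (Unit ⊕ Unit) ⊕ (Fin M ⊕ Fin M ⊕ Fin M)

/-- Links: the aggregate load, then the load, the consumption and the charging of each prosumer. -/
abbrev Link (M : ℕ) := Unit ⊕ (Fin M ⊕ Fin M ⊕ Fin M)

section NodesAndLinks

variable {M : ℕ}

def nodeFn {R : Type} (a b : R) (f g h : Fin M → R) : Node M → R :=
  Sum.elim (Sum.elim (fun _ => a) fun _ => b) (Sum.elim f (Sum.elim g h))

def linkFn {R : Type} (a : R) (f g h : Fin M → R) : Link M → R :=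
  Sum.elim (fun _ => a) (Sum.elim f (Sum.elim g h))

theorem forall_node {p : Node M → Prop} : (∀ n, p n) ↔ p (.inl (.inl ())) ∧ p (.inl (.inr ())) ∧
    ∀ v, p (.inr (.inl v)) ∧ p (.inr (.inr (.inl v))) ∧ p (.inr (.inr (.inr v))) := by
  refine ⟨fun h => ⟨h _, h _, fun v => ⟨h _, h _, h _⟩⟩, fun h => ?_⟩
  rintro ((_ | _) | (v | v | v))
  exacts [h.1, h.2.1, (h.2.2 v).1, (h.2.2 v).2.1, (h.2.2 v).2.2]

theorem forall_link {p : Link M → Prop} : (∀ e, p e) ↔ p (.inl ()) ∧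
    ∀ v, p (.inr (.inl v)) ∧ p (.inr (.inr (.inl v))) ∧ p (.inr (.inr (.inr v))) := by
  refine ⟨fun h => ⟨h _, fun v => ⟨h _, h _, h _⟩⟩, fun h => ?_⟩
  rintro (_ | (v | v | v))
  exacts [h.1, (h.2 v).1, (h.2 v).2.1, (h.2 v).2.2]

theorem sum_node (f : Node M → ℝ) : ∑ n, f n = f (.inl (.inl ())) + f (.inl (.inr ())) +
    ∑ v, (f (.inr (.inl v)) + f (.inr (.inr (.inl v))) + f (.inr (.inr (.inr v)))) := by
  simp [Fintype.sum_sum_type, Finset.sum_add_distrib]; ring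

theorem sum_link (f : Link M → ℝ) : ∑ n, f n = f (.inl ()) +
    ∑ v, (f (.inr (.inl v)) + f (.inr (.inr (.inl v))) + f (.inr (.inr (.inr v)))) := by
  simp [Fintype.sum_sum_type, Finset.sum_add_distrib]; ring

def linkTail : Link M → Node M :=
  linkFn (.inl (.inl ())) (fun _ => .inl (.inr ())) (fun v => .inr (.inl v)) fun v => .inr (.inl v)

def linkHead : Link M → Node M :=
  linkFn (.inl (.inr ())) (fun v => .inr (.inl v)) (fun v => .inr (.inr (.inl v)))
    fun v => .inr (.inr (.inr v))

def linkInflow (f : Link M → ℝ) (n : Node M) : ℝ :=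
  ∑ e, f e * ((if linkHead e = n then 1 else 0) - if linkTail e = n then 1 else 0)

theorem linkInflow_eq (f : Link M → ℝ) : linkInflow f = nodeFn (-f (.inl ()))
    (f (.inl ()) - ∑ v, f (.inr (.inl v)))
    (fun v => f (.inr (.inl v)) - f (.inr (.inr (.inl v))) - f (.inr (.inr (.inr v))))
    (fun v => f (.inr (.inr (.inl v)))) fun v => f (.inr (.inr (.inr v))) := by
  refine funext (forall_node.2 ⟨?_, ?_, fun v => ⟨?_, ?_, ?_⟩⟩) <;>
    simp [linkInflow, linkHead, linkTail, linkFn, nodeFn]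
  all_goals ring

/-- Stocks of the nodes that correspond to states of the prosumers. -/
def stock (y : Fin M → PState) : Node M → ℝ :=
  nodeFn 0 0 0 (fun v => (y v).1) fun v => (y v).2

/-- Flows in the links that correspond to inputs of the prosumers. -/
def linkFlow (d : Fin M → PInput) : Link M → ℝ :=
  linkFn (∑ v, Grid.loadSlope (d v)) (fun v => Grid.loadSlope (d v)) (fun v => (d v).1)
    fun v => (d v).2

def stockState (x : Node M → ℝ) : Fin M → PState :=
  fun v => (x (.inr (.inr (.inl v))), x (.inr (.inr (.inr v))))

def linkInput (f : Link M → ℝ) : Fin M → PInput :=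
  fun v => (f (.inr (.inr (.inl v))), f (.inr (.inr (.inr v))))

theorem stockState_stock (y : Fin M → PState) : stockState (stock y) = y := rfl

theorem linkInput_linkFlow (d : Fin M → PInput) : linkInput (linkFlow d) = d := rfl

end NodesAndLinks

namespace Grid

variable {M : ℕ} (G : Grid M)

structure IsSteady (x : Fin M → PState) (u : Fin M → PInput) : Prop where
  states : x ∈ G.states
  step_eq : G.step x u = x
  inputs : u ∈ G.inputs

variable {G} {xbar : Fin M → PState} {ubar : Fin M → PInput}

theorem IsSteady.agentStates (h : G.IsSteady xbar ubar) (v : Fin M) : G.ζMin v ≤ (xbar v).1 ∧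
    (xbar v).1 ≤ G.ζMax v ∧ 0 ≤ (xbar v).2 ∧ (xbar v).2 ≤ G.qMax v := h.states v

theorem IsSteady.agentInputs (h : G.IsSteady xbar ubar) (v : Fin M) :
    G.sMin v ≤ G.β v * (ubar v).2 ∧ G.β v * (ubar v).2 ≤ G.sMax v ∧
    G.eMin v ≤ (ubar v).1 ∧ (ubar v).1 ≤ G.eMax v ∧
    0 ≤ G.load v (ubar v) ∧ G.load v (ubar v) ≤ G.lMax v := (h.inputs v).1

open Classical in
/-- Deviations of a grid from a steady state. -/
noncomputable def devNet (h : G.IsSteady xbar ubar)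
    (hL : G.LMin ≤ G.aggregateLoad ubar ∧ G.aggregateLoad ubar ≤ G.LMax) {r : ℝ} (hr : 0 < r) :
    Net (Node M) (Link M) where
  tail := linkTail
  head := linkHead
  α := nodeFn 0 0 0 1 G.α
  -- The ground ignores its inflow and serves as a free source. Hub and buses have gain `1` and zero
  -- capacity, which enforces the balance of loads, consumption and charging.
  β := nodeFn 0 1 1 1 G.β
  -- A battery with `α = 1` and `β = 0` never changes. Its deviation is frozen at `0`, the only
  -- value compatible with convergence to the steady state.
  lo := nodeFn 0 0 0 (fun v => G.ζMin v - (xbar v).1)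
    fun v => if G.α v = 1 ∧ G.β v = 0 then 0 else -(xbar v).2
  hi := nodeFn 0 0 0 (fun v => G.ζMax v - (xbar v).1)
    fun v => if G.α v = 1 ∧ G.β v = 0 then 0 else G.qMax v - (xbar v).2
  γ := nodeFn 0 0 0 G.γ₁ G.γ₂
  c := 0
  τ := 0
  -- When `β v = 0` the charging has no limits of its own; the capacities inserted here already
  -- follow from those on load and consumption.
  fl := linkFn (G.LMin - G.aggregateLoad ubar) (fun v => -G.load v (ubar v))
    (fun v => G.eMin v - (ubar v).1)
    fun v => if G.β v = 0 then -(G.lMax v + (G.eMax v - G.eMin v))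
      else G.sMin v / G.β v - (ubar v).2
  fu := linkFn (G.LMax - G.aggregateLoad ubar) (fun v => G.lMax v - G.load v (ubar v))
    (fun v => G.eMax v - (ubar v).1)
    fun v => if G.β v = 0 then G.lMax v + (G.eMax v - G.eMin v)
      else G.sMax v / G.β v - (ubar v).2
  ρ := linkFn (r / 2) (fun _ => r / 2) 0 0
  d := 0
  α_nonneg := forall_node.2 ⟨le_rfl, le_rfl, fun v => ⟨le_rfl, zero_le_one, (G.α_mem v).1⟩⟩
  α_le_one := forall_node.2 ⟨zero_le_one, zero_le_one, fun v => ⟨zero_le_one, le_rfl,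
    (G.α_mem v).2⟩⟩
  β_nonneg := forall_node.2 ⟨le_rfl, zero_le_one, fun v => ⟨zero_le_one, zero_le_one,
    (G.β_mem v).1⟩⟩
  lo_nonpos := forall_node.2 ⟨le_rfl, le_rfl, fun v => ⟨le_rfl, by
    have := h.agentStates v
    simp only [nodeFn, Sum.elim_inr, Sum.elim_inl]; linarith, by
    have := h.agentStates v
    simp only [nodeFn, Sum.elim_inr]; split_ifs <;> linarith⟩⟩
  hi_nonneg := forall_node.2 ⟨le_rfl, le_rfl, fun v => ⟨le_rfl, by
    have := h.agentStates v
    simp only [nodeFn, Sum.elim_inr, Sum.elim_inl]; linarith, by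
    have := h.agentStates v
    simp only [nodeFn, Sum.elim_inr]; split_ifs <;> linarith⟩⟩
  fl_nonpos := forall_link.2 ⟨by
    simp only [linkFn, Sum.elim_inl]; linarith, fun v => by
    have := h.agentInputs v
    have he := G.eMin_lt_eMax v
    simp only [linkFn, Sum.elim_inr, Sum.elim_inl]
    refine ⟨by linarith, by linarith, ?_⟩
    split_ifs with hβ
    · linarith
    · have hβ' := lt_of_le_of_ne (G.β_mem v).1 (Ne.symm hβ)
      have := (div_le_iff₀' hβ').2 this.1
      linarith⟩
  fu_nonneg := forall_link.2 ⟨by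
    simp only [linkFn, Sum.elim_inl]; linarith, fun v => by
    have := h.agentInputs v
    have he := G.eMin_lt_eMax v
    simp only [linkFn, Sum.elim_inr, Sum.elim_inl]
    refine ⟨by linarith, by linarith, ?_⟩
    split_ifs with hβ
    · linarith
    · have hβ' := lt_of_le_of_ne (G.β_mem v).1 (Ne.symm hβ)
      have := (le_div_iff₀' hβ').2 this.2.1
      linarith⟩
  γ_nonneg := forall_node.2 ⟨le_rfl, le_rfl, fun v => ⟨le_rfl, (G.γ₁_pos v).le, (G.γ₂_pos v).le⟩⟩
  ρ_nonneg := forall_link.2 ⟨by simp only [linkFn, Sum.elim_inl]; linarith, fun v => ⟨by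
    simp only [linkFn, Sum.elim_inr, Sum.elim_inl]; linarith, le_rfl, le_rfl⟩⟩
  c_lo := fun _ => by simp
  c_hi := fun _ => by simp
  d_fl := fun _ => by simp
  d_fu := fun _ => by simp
  γ_pos := forall_node.2 ⟨.inr ⟨rfl, rfl⟩, .inr ⟨rfl, rfl⟩, fun v => ⟨.inr ⟨rfl, rfl⟩,
    .inl (G.γ₁_pos v), .inl (G.γ₂_pos v)⟩⟩
  β_pos := forall_node.2 ⟨fun h => absurd h (zero_ne_one' ℝ), fun h => absurd h (zero_ne_one' ℝ),
    fun v => ⟨fun h => absurd h (zero_ne_one' ℝ), fun _ => .inl one_pos, fun hα => by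
      simp only [nodeFn, Sum.elim_inr] at hα ⊢
      by_cases hβ : G.β v = 0
      · simp [hα, hβ]
      · exact .inl (lt_of_le_of_ne (G.β_mem v).1 (Ne.symm hβ))⟩⟩
  inj := fun f h1 h2 => by
    have h3 : ∀ n, nodeFn 0 1 1 1 G.β n * linkInflow f n = 0 := h2
    rw [linkInflow_eq, forall_node] at h3
    simp only [nodeFn, Sum.elim_inr, Sum.elim_inl, Pi.one_apply, one_mul] at h3
    rw [forall_link] at h1
    simp only [linkFn, Sum.elim_inr, Sum.elim_inl, Pi.zero_apply, lt_irrefl, false_imp_iff] at h1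
    have hr2 : 0 < r / 2 := by linarith
    refine funext (forall_link.2 ⟨h1.1 hr2, fun v => ?_⟩)
    have a1 := (h1.2 v).1 hr2
    have a2 := (h3.2.2 v).2.1
    have a3 := (h3.2.2 v).1
    exact ⟨a1, a2, by simp only [Pi.zero_apply]; linarith⟩

end Grid

/-! ### Dictionary between the grid and the network. -/

namespace Grid

variable {M : ℕ} {G : Grid M} {xbar : Fin M → PState} {ubar : Fin M → PInput}

theorem mem_inputs_iff [Nonempty (Fin M)] {u : Fin M → PInput} : u ∈ G.inputs ↔
    (∀ v, u v ∈ G.agentInputs v) ∧ G.LMin ≤ G.aggregateLoad u ∧ G.aggregateLoad u ≤ G.LMax := by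
  rw [mem_inputs, forall_and, forall_const]

variable (h : G.IsSteady xbar ubar)
  (hL : G.LMin ≤ G.aggregateLoad ubar ∧ G.aggregateLoad ubar ≤ G.LMax) {r : ℝ} (hr : 0 < r)


theorem devNet_step (y : Fin M → PState) (d : Fin M → PInput) :
    (devNet h hL hr).step (stock y) (linkFlow d) = stock (G.step (xbar + y) (ubar + d) - xbar) := by
  have e : (devNet h hL hr).step (stock y) (linkFlow d) = fun n =>
    nodeFn 0 0 0 1 G.α n * stock y n + nodeFn 0 1 1 1 G.β n * linkInflow (linkFlow d) n := rfl
  rw [e, linkInflow_eq]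
  refine funext (forall_node.2 ?_)
  simp only [stock, linkFlow, nodeFn, linkFn, Sum.elim_inl, Sum.elim_inr, Pi.zero_apply,
    Pi.one_apply]
  refine ⟨by ring, by ring, fun v => ⟨by simp only [loadSlope]; ring, ?_, ?_⟩⟩
  · have := eRef_of_step_eq h.step_eq v
    simp only [step, stepAgent, Pi.add_apply, Pi.sub_apply, Prod.fst_add, Prod.fst_sub]
    linarith
  · have := congrArg Prod.snd (congrFun h.step_eq v)
    simp only [step, stepAgent, Pi.add_apply, Pi.sub_apply, Prod.snd_add, Prod.snd_sub] at this ⊢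
    linarith

theorem linkFlow_mem_devNet_flows [Nonempty (Fin M)] {d : Fin M → PInput} :
    linkFlow d ∈ (devNet h hL hr).flows ↔ ubar + d ∈ G.inputs := by
  have e : linkFlow d ∈ (devNet h hL hr).flows ↔
    (∀ e, (devNet h hL hr).fl e ≤ linkFlow d e) ∧ ∀ e, linkFlow d e ≤ (devNet h hL hr).fu e :=
    Iff.rfl
  rw [e, ← forall_and, forall_link, mem_inputs_iff, and_comm, aggregateLoad_add]
  refine and_congr (forall_congr' fun v => ?_) ?_
  · have h1 := h.agentInputs v
    simp only [devNet, linkFlow, linkFn, Sum.elim_inl, Sum.elim_inr, Grid.agentInputs,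
      Set.mem_ofPred_eq, Pi.add_apply, load_add, Prod.fst_add, Prod.snd_add]
    by_cases hβ : G.β v = 0
    · simp only [hβ, if_true, zero_mul] at h1 ⊢
      simp only [loadSlope]
      constructor
      · rintro ⟨⟨h2, h3⟩, ⟨h4, h5⟩, h6, h7⟩
        exact ⟨h1.1, h1.2.1, by linarith, by linarith, by linarith, by linarith⟩
      · rintro ⟨h2, h3, h4, h5, h6, h7⟩
        exact ⟨⟨by linarith, by linarith⟩, ⟨by linarith, by linarith⟩, by linarith, by linarith⟩
    · have hβ' := lt_of_le_of_ne (G.β_mem v).1 (Ne.symm hβ)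
      simp only [hβ, if_false, sub_le_iff_le_add', le_sub_iff_add_le', div_le_iff₀' hβ',
        le_div_iff₀' hβ']
      constructor
      · rintro ⟨⟨h2, h3⟩, ⟨h4, h5⟩, h6, h7⟩
        exact ⟨h6, h7, h4, h5, by linarith, h3⟩
      · rintro ⟨h2, h3, h4, h5, h6, h7⟩
        exact ⟨⟨by linarith, h7⟩, ⟨h4, h5⟩, h2, h3⟩
  · simp only [devNet, linkFlow, linkFn, Sum.elim_inl]
    constructor <;> rintro ⟨h2, h3⟩ <;> exact ⟨by linarith, by linarith⟩

theorem stock_mem_devNet_box {y : Fin M → PState} : stock y ∈ (devNet h hL hr).box ↔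
    xbar + y ∈ G.states ∧ ∀ v, G.α v = 1 ∧ G.β v = 0 → (y v).2 = 0 := by
  have e : stock y ∈ (devNet h hL hr).box ↔
    (∀ e, (devNet h hL hr).lo e ≤ stock y e) ∧ ∀ e, stock y e ≤ (devNet h hL hr).hi e :=
    Iff.rfl
  have e2 : xbar + y ∈ G.states ↔ ∀ v, (xbar + y) v ∈ G.agentStates v := Iff.rfl
  rw [e, ← forall_and, forall_node, e2, ← forall_and]
  simp only [devNet, stock, nodeFn, Sum.elim_inl, Sum.elim_inr, le_refl, true_and, and_self,
    Pi.zero_apply, Grid.agentStates, Set.mem_ofPred_eq, Pi.add_apply, Prod.fst_add, Prod.snd_add]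
  refine forall_congr' fun v => ?_
  have h1 := h.agentStates v
  by_cases hv : G.α v = 1 ∧ G.β v = 0
  · simp only [hv, and_self, if_true, forall_const]
    constructor
    · rintro ⟨⟨h2, h3⟩, h4, h5⟩
      exact ⟨⟨by linarith, by linarith, by linarith, by linarith⟩, le_antisymm h5 h4⟩
    · rintro ⟨⟨h2, h3, h4, h5⟩, h6⟩
      exact ⟨⟨by linarith, by linarith⟩, h6.ge, h6.le⟩
  · simp only [hv, if_false, false_imp_iff, and_true]
    constructor
    · rintro ⟨⟨h2, h3⟩, h4, h5⟩
      exact ⟨by linarith, by linarith, by linarith, by linarith⟩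
    · rintro ⟨h2, h3, h4, h5⟩
      exact ⟨⟨by linarith, by linarith⟩, by linarith, by linarith⟩

theorem stock_stockState {x : Node M → ℝ} (hx : x ∈ (devNet h hL hr).box) :
    stock (stockState x) = x := by
  refine funext (forall_node.2 ⟨le_antisymm (hx.1 (.inl (.inl ()))) (hx.2 (.inl (.inl ()))),
    le_antisymm (hx.1 (.inl (.inr ()))) (hx.2 (.inl (.inr ()))), fun v =>
    ⟨le_antisymm (hx.1 (.inr (.inl v))) (hx.2 (.inr (.inl v))), rfl, rfl⟩⟩)

/-- Because hub and buses must stay empty after the step, the flows are balanced there, and the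
consumption and charging flows determine all the others. -/
theorem linkFlow_linkInput {x : Node M → ℝ} {f : Link M → ℝ}
    (hs : (devNet h hL hr).step x f ∈ (devNet h hL hr).box) : linkFlow (linkInput f) = f := by
  have e : (devNet h hL hr).step x f = fun n =>
    nodeFn 0 0 0 1 G.α n * x n + nodeFn 0 1 1 1 G.β n * linkInflow f n := rfl
  have h1 := le_antisymm (hs.1 (.inl (.inr ()))) (hs.2 (.inl (.inr ())))
  have h2 : ∀ v, _ := fun v => le_antisymm (hs.1 (.inr (.inl v))) (hs.2 (.inr (.inl v)))
  rw [e, linkInflow_eq] at h1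
  simp only [e, linkInflow_eq] at h2
  simp only [devNet, nodeFn, Sum.elim_inl, Sum.elim_inr, Pi.zero_apply, Pi.one_apply, zero_mul,
    zero_add, one_mul] at h1 h2
  have h3 : ∀ v, loadSlope (linkInput f v) = f (.inr (.inl v)) := fun v => by
    have := h2 v
    simp only [loadSlope, linkInput]
    linarith
  refine funext (forall_link.2 ⟨?_, fun v => ⟨h3 v, rfl, rfl⟩⟩)
  have h4 : linkFlow (linkInput f) (.inl ()) = ∑ v, loadSlope (linkInput f v) := rfl
  rw [h4, Finset.sum_congr rfl fun v _ => h3 v]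
  linarith

/-- Derivative of the potential at the steady state, with respect to the stocks. -/
def stockSlope (G : Grid M) (xbar : Fin M → PState) : Node M → ℝ :=
  nodeFn 0 0 0 (fun v => 2 * G.γ₁ v * (xbar v).1) fun v => 2 * G.γ₂ v * (xbar v).2

/-- Derivative of the potential at the steady state, with respect to the flows. -/
def flowSlope (G : Grid M) (r : ℝ) (ubar : Fin M → PInput) : Link M → ℝ :=
  linkFn (r * G.aggregateLoad ubar) (fun v => G.ρ₂ v + r * G.load v (ubar v)) 0 0

theorem sum_slope_eq (y : Fin M → PState) (d : Fin M → PInput) :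
    ∑ n, G.stockSlope xbar n * stock y n + ∑ e, G.flowSlope r ubar e * linkFlow d e =
      G.slope r xbar ubar y d := by
  simp only [sum_node, sum_link, stockSlope, flowSlope, stock, linkFlow, nodeFn, linkFn,
    Sum.elim_inl, Sum.elim_inr, Pi.zero_apply, slope, Finset.mul_sum]
  simp only [mul_zero, zero_add, zero_mul, add_zero]
  rw [← Finset.sum_add_distrib, ← Finset.sum_add_distrib]
  exact Finset.sum_congr rfl fun v _ => by ring

theorem sum_curvature_eq (y : Fin M → PState) (d : Fin M → PInput) :
    ∑ n, (devNet h hL hr).γ n * stock y n ^ 2 + ∑ e, (devNet h hL hr).ρ e * linkFlow d e ^ 2 =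
      G.curvature r y d := by
  simp only [sum_node, sum_link, devNet, stock, linkFlow, nodeFn, linkFn,
    Sum.elim_inl, Sum.elim_inr, Pi.zero_apply, curvature, Finset.sum_add_distrib]
  simp only [zero_mul, Finset.sum_const_zero, add_zero, zero_add]
  ring

theorem devNet_cost_eq (y : Fin M → PState) (d : Fin M → PInput) :
    ∑ n, ((devNet h hL hr).γ n * stock y n ^ 2 + G.stockSlope xbar n * stock y n) +
      ∑ e, ((devNet h hL hr).ρ e * linkFlow d e ^ 2 + G.flowSlope r ubar e * linkFlow d e) =
      G.potential r (xbar + y) (ubar + d) - G.potential r xbar ubar := by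
  rw [potential_add', ← sum_slope_eq, ← sum_curvature_eq h hL hr, Finset.sum_add_distrib,
    Finset.sum_add_distrib]
  ring

/-- Multipliers of a steady equilibrium. -/
theorem exists_steady_multiplier [Nonempty (Fin M)] (hρ : ∀ v, G.ρ₁ v = r)
    (hE : G.IsSteadyVGNE xbar ubar) : ∃ μ : Node M → ℝ,
      (∀ n, 0 ≤ (G.stockSlope xbar n + ((devNet h hL hr).α n - 1) * μ n) * (devNet h hL hr).lo n ∧
        0 ≤ (G.stockSlope xbar n + ((devNet h hL hr).α n - 1) * μ n) * (devNet h hL hr).hi n) ∧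
      ∀ e, 0 ≤ (G.flowSlope r ubar e + ((devNet h hL hr).β ((devNet h hL hr).head e) *
          μ ((devNet h hL hr).head e) - (devNet h hL hr).β ((devNet h hL hr).tail e) *
          μ ((devNet h hL hr).tail e))) * (devNet h hL hr).fl e ∧
        0 ≤ (G.flowSlope r ubar e + ((devNet h hL hr).β ((devNet h hL hr).head e) *
          μ ((devNet h hL hr).head e) - (devNet h hL hr).β ((devNet h hL hr).tail e) *
          μ ((devNet h hL hr).tail e))) * (devNet h hL hr).fu e := by
  refine (devNet h hL hr).exists_static_multiplier _ _ fun x hx f hf hs => ?_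
  have hs' : (devNet h hL hr).step x f ∈ (devNet h hL hr).box := by rwa [hs]
  obtain ⟨y, rfl⟩ : ∃ y, stock y = x := ⟨_, stock_stockState h hL hr hx⟩
  obtain ⟨d, rfl⟩ : ∃ d, linkFlow d = f := ⟨_, linkFlow_linkInput h hL hr hs'⟩
  rw [sum_slope_eq]
  rw [devNet_step] at hs
  have h1 := congrArg stockState hs
  rw [stockState_stock, stockState_stock, sub_eq_iff_eq_add'] at h1
  have h2 := ((isSteadyVGNE_iff hρ hr.le).1 hE).2 _ _
    ((stock_mem_devNet_box h hL hr).1 hx).1 h1 ((linkFlow_mem_devNet_flows h hL hr).1 hf)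
  rw [potential_add', add_sub_cancel_left, add_sub_cancel_left] at h2
  linarith

end Grid

/-! ### The rotated network and the feedback of the game. -/

namespace Grid

variable {M : ℕ} {G : Grid M} {xbar : Fin M → PState} {ubar : Fin M → PInput}
  (h : G.IsSteady xbar ubar)
  (hL : G.LMin ≤ G.aggregateLoad ubar ∧ G.aggregateLoad ubar ≤ G.LMax) {r : ℝ} (hr : 0 < r)

/-- The multipliers `μ` turn the derivative of the potential at the steady state into costs that
are minimal at the origin. -/
def IsSteadyMultiplier (μ : Node M → ℝ) : Prop :=
  (∀ n, 0 ≤ (G.stockSlope xbar n + ((devNet h hL hr).α n - 1) * μ n) * (devNet h hL hr).lo n ∧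
    0 ≤ (G.stockSlope xbar n + ((devNet h hL hr).α n - 1) * μ n) * (devNet h hL hr).hi n) ∧
  ∀ e, 0 ≤ (G.flowSlope r ubar e + ((devNet h hL hr).β ((devNet h hL hr).head e) *
      μ ((devNet h hL hr).head e) - (devNet h hL hr).β ((devNet h hL hr).tail e) *
      μ ((devNet h hL hr).tail e))) * (devNet h hL hr).fl e ∧
    0 ≤ (G.flowSlope r ubar e + ((devNet h hL hr).β ((devNet h hL hr).head e) *
      μ ((devNet h hL hr).head e) - (devNet h hL hr).β ((devNet h hL hr).tail e) *
      μ ((devNet h hL hr).tail e))) * (devNet h hL hr).fu e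

variable {h hL hr} {μ : Node M → ℝ}

/-- The network of deviations from the steady state, with costs that are minimal at the origin. -/
noncomputable def steadyNet {μ : Node M → ℝ} (hμ : IsSteadyMultiplier h hL hr μ) :
    Net (Node M) (Link M) :=
  (devNet h hL hr).withCosts _ (-μ) _ hμ.1 hμ.2

variable (hμ : IsSteadyMultiplier h hL hr μ)

theorem traj_steadyNet {X : ℕ → Fin M → PState} {U : ℕ → Fin M → PInput} {N : ℕ}
    (hX : ∀ k < N, X (k + 1) = G.step (X k) (U k)) {k : ℕ} (hk : k ≤ N) :
    (steadyNet hμ).traj (stock (X 0 - xbar)) (fun k => linkFlow (U k - ubar)) k =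
      stock (X k - xbar) := by
  rw [steadyNet, Net.traj_withCosts]
  induction k with
  | zero => rfl
  | succ k ih =>
    simp only [Net.traj]
    rw [ih (by omega), devNet_step, add_sub_cancel, add_sub_cancel, hX k (by omega)]

theorem stock_mem_box_of_traj {X : ℕ → Fin M → PState} {U : ℕ → Fin M → PInput} {N : ℕ}
    (hX : ∀ k < N, X (k + 1) = G.step (X k) (U k)) (hs : ∀ k ≤ N, X k ∈ G.states)
    (h0 : stock (X 0 - xbar) ∈ (steadyNet hμ).box) {k : ℕ} (hk : k ≤ N) :
    stock (X k - xbar) ∈ (steadyNet hμ).box := by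
  refine (stock_mem_devNet_box h hL hr).2 ⟨by rw [add_sub_cancel]; exact hs k hk, fun v hv => ?_⟩
  induction k with
  | zero => exact ((stock_mem_devNet_box h hL hr).1 h0).2 v hv
  | succ k ih =>
    rw [← ih (by omega), hX k (by omega)]
    simp [step, stepAgent, hv.1, hv.2]

theorem isPlan_steadyNet [Nonempty (Fin M)] {X : ℕ → Fin M → PState} {U : ℕ → Fin M → PInput}
    {N : ℕ} (hX : ∀ k < N, X (k + 1) = G.step (X k) (U k)) (hs : ∀ k ≤ N, X k ∈ G.states)
    (hU : ∀ k, U k ∈ G.inputs) (h0 : stock (X 0 - xbar) ∈ (steadyNet hμ).box) :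
    (steadyNet hμ).IsPlan N (stock (X 0 - xbar)) fun k => linkFlow (U k - ubar) := by
  refine ⟨fun k => (linkFlow_mem_devNet_flows h hL hr).2 ?_, fun k hk => ?_⟩
  · rw [add_sub_cancel]; exact hU k
  · rw [traj_steadyNet hμ hX hk]
    exact stock_mem_box_of_traj hμ hX hs h0 hk

theorem cost_steadyNet {X : ℕ → Fin M → PState} {U : ℕ → Fin M → PInput}
    {N : ℕ} (hX : ∀ k < N, X (k + 1) = G.step (X k) (U k)) :
    (steadyNet hμ).cost N (stock (X 0 - xbar)) (fun k => linkFlow (U k - ubar)) =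
      ∑ k ∈ Finset.range N, G.potential r (X k) (U k) - N * G.potential r xbar ubar -
        ∑ n, μ n * stock (X 0 - xbar) n := by
  have ht := fun k (hk : k ≤ N) => traj_steadyNet hμ hX hk
  simp only [steadyNet, Net.traj_withCosts] at ht
  rw [steadyNet, Net.cost_withCosts]
  congr 1
  have e : ∀ k ∈ Finset.range N, ∑ n, ((devNet h hL hr).γ n *
      (devNet h hL hr).traj (stock (X 0 - xbar)) (fun k => linkFlow (U k - ubar)) k n ^ 2 +
      G.stockSlope xbar n *
        (devNet h hL hr).traj (stock (X 0 - xbar)) (fun k => linkFlow (U k - ubar)) k n) +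
      ∑ e, ((devNet h hL hr).ρ e * linkFlow (U k - ubar) e ^ 2 +
        G.flowSlope r ubar e * linkFlow (U k - ubar) e) =
      G.potential r (X k) (U k) - G.potential r xbar ubar := fun k hk => by
    rw [ht k (Finset.mem_range.1 hk).le, devNet_cost_eq, add_sub_cancel, add_sub_cancel]
  rw [Finset.sum_congr rfl e, Finset.sum_sub_distrib, Finset.sum_const, Finset.card_range,
    nsmul_eq_mul]

theorem stock_stockState_traj {N : ℕ} {y : Node M → ℝ} {f : ℕ → Link M → ℝ}
    (hf : (steadyNet hμ).IsPlan N y f) {k : ℕ} (hk : k ≤ N) :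
    stock (stockState ((steadyNet hμ).traj y f k)) = (steadyNet hμ).traj y f k :=
  stock_stockState h hL hr (hf.2 k hk)

theorem linkFlow_linkInput_plan {N : ℕ} {y : Node M → ℝ} {f : ℕ → Link M → ℝ}
    (hf : (steadyNet hμ).IsPlan N y f) {k : ℕ} (hk : k < N) : linkFlow (linkInput (f k)) = f k :=
  linkFlow_linkInput h hL hr (x := (steadyNet hμ).traj y f k) (hf.2 (k + 1) hk)

theorem plan_states {N : ℕ} {y : Node M → ℝ} {f : ℕ → Link M → ℝ}
    (hf : (steadyNet hμ).IsPlan N y f) {k : ℕ} (hk : k ≤ N) :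
    xbar + stockState ((steadyNet hμ).traj y f k) ∈ G.states := by
  refine ((stock_mem_devNet_box h hL hr).1 ?_).1
  rw [stock_stockState_traj hμ hf hk]
  exact hf.2 k hk

theorem plan_inputs [Nonempty (Fin M)] {N : ℕ} {y : Node M → ℝ} {f : ℕ → Link M → ℝ}
    (hf : (steadyNet hμ).IsPlan N y f) {k : ℕ} (hk : k < N) :
    ubar + linkInput (f k) ∈ G.inputs := by
  refine (linkFlow_mem_devNet_flows h hL hr).1 ?_
  rw [linkFlow_linkInput_plan hμ hf hk]
  exact hf.1 k

theorem plan_step {N : ℕ} {y : Node M → ℝ} {f : ℕ → Link M → ℝ}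
    (hf : (steadyNet hμ).IsPlan N y f) {k : ℕ} (hk : k < N) :
    xbar + stockState ((steadyNet hμ).traj y f (k + 1)) =
      G.step (xbar + stockState ((steadyNet hμ).traj y f k)) (ubar + linkInput (f k)) := by
  have h1 : (steadyNet hμ).traj y f (k + 1) =
    (devNet h hL hr).step ((steadyNet hμ).traj y f k) (f k) := rfl
  rw [h1, ← stock_stockState_traj hμ hf hk.le, ← linkFlow_linkInput_plan hμ hf hk, devNet_step,
    stockState_stock, stockState_stock, linkInput_linkFlow, add_sub_cancel]

/-- The feedback of the game is the first step of an optimal plan of the network. -/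
theorem feedback_eq [Nonempty (Fin M)] (hρ : ∀ v, G.ρ₁ v = r) {N : ℕ} (hN : 2 ≤ N)
    {y : Node M → ℝ} {f : ℕ → Link M → ℝ} (hf : (steadyNet hμ).IsOpt N y f) :
    G.feedback N (xbar + stockState y) = {ubar + linkInput (f 0)} := by
  have hp := hf.1
  have hy : stock (stockState y) = y := stock_stockState_traj hμ hp (Nat.zero_le N)
  let z : Fin M → Plan N := fun v => (fun k => (ubar + linkInput (f k)) v,
    fun k => (xbar + stockState ((steadyNet hμ).traj y f k)) v)
  have hz : z ∈ G.actionSet N (xbar + stockState y) := mem_actionSet.2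
    ⟨fun k => plan_step hμ hp k.2, fun k => plan_inputs hμ hp k.2,
      fun k => plan_states hμ hp (Nat.lt_succ_iff.1 k.2), rfl⟩
  have hcost : ∀ z' ∈ G.actionSet N (xbar + stockState y), (steadyNet hμ).val N y ≤
      ∑ k : Fin N, G.potential r (fun v => (z' v).2 k.castSucc) (fun v => (z' v).1 k) -
        N * G.potential r xbar ubar - ∑ n, μ n * y n := fun z' hz' => by
    obtain ⟨h1, h2, h3, h4⟩ := mem_actionSet.1 hz'
    let X : ℕ → Fin M → PState := fun k =>
      if hk : k < N + 1 then fun v => (z' v).2 ⟨k, hk⟩ else xbar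
    -- Past the horizon the steady input serves as default, since a plan has admissible flows at all
    -- times.
    let U : ℕ → Fin M → PInput := fun k => if hk : k < N then fun v => (z' v).1 ⟨k, hk⟩ else ubar
    have eX : ∀ k (hk : k < N + 1), X k = fun v => (z' v).2 ⟨k, hk⟩ := fun k hk => dif_pos hk
    have eU : ∀ k (hk : k < N), U k = fun v => (z' v).1 ⟨k, hk⟩ := fun k hk => dif_pos hk
    have hX : ∀ k < N, X (k + 1) = G.step (X k) (U k) := fun k hk => by
      rw [eX _ (by omega), eX _ (by omega), eU _ hk]
      exact h1 ⟨k, hk⟩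
    have hs : ∀ k ≤ N, X k ∈ G.states := fun k hk => by
      rw [eX _ (by omega)]; exact h3 _
    have hU : ∀ k, U k ∈ G.inputs := fun k => by
      by_cases hk : k < N
      · rw [eU _ hk]; exact h2 _
      · simp only [U, hk, dif_neg, not_false_eq_true]; exact h.inputs
    have hX0 : stock (X 0 - xbar) = y := by
      rw [eX 0 (by omega)]
      have : (fun v => (z' v).2 ⟨0, by omega⟩) = xbar + stockState y := h4
      rw [this, add_sub_cancel_left, hy]
    have h0 : stock (X 0 - xbar) ∈ (steadyNet hμ).box := by
      rw [hX0]; exact hp.2 0 (Nat.zero_le N)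
    have h5 := (isPlan_steadyNet hμ hX hs hU h0).val_le
    rw [cost_steadyNet hμ hX, hX0, Finset.sum_range] at h5
    refine h5.trans (le_of_eq ?_)
    congr 2
    exact Finset.sum_congr rfl fun k _ => by
      rw [eX _ (by omega), eU _ k.2]; rfl
  have hval : (steadyNet hμ).val N y =
      ∑ k : Fin N, G.potential r (fun v => (z v).2 k.castSucc) (fun v => (z v).1 k) -
        N * G.potential r xbar ubar - ∑ n, μ n * y n := by
    let X : ℕ → Fin M → PState := fun k => xbar + stockState ((steadyNet hμ).traj y f k)
    let U : ℕ → Fin M → PInput := fun k => ubar + linkInput (f k)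
    have hX : ∀ k < N, X (k + 1) = G.step (X k) (U k) := fun k hk => plan_step hμ hp hk
    have h1 := cost_steadyNet hμ hX
    have hX0 : stock (X 0 - xbar) = y := by
      simp only [X, add_sub_cancel_left]; exact hy
    rw [hX0, Finset.sum_range] at h1
    rw [← hf.2]
    refine Eq.trans ?_ h1
    have h2 : ∀ k < N, linkFlow (U k - ubar) = f k := fun k hk => by
      simp only [U, add_sub_cancel_left]; exact linkFlow_linkInput_plan hμ hp hk
    simp only [Net.cost]
    have h3 : ∀ k ≤ N, (steadyNet hμ).traj y (fun k => linkFlow (U k - ubar)) k =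
      (steadyNet hμ).traj y f k := fun k hk => Net.traj_congr fun j hj => h2 j (by omega)
    rw [h3 N le_rfl]
    congr 1
    refine Finset.sum_congr rfl fun k hk => ?_
    rw [h3 k (Finset.mem_range.1 hk).le, h2 k (Finset.mem_range.1 hk)]
  have hsol : z ∈ G.gameSolutions N (xbar + stockState y) :=
    gameSolutions_of_minimal hρ hr.le hz fun z' hz' => by
      have := hcost z' hz'
      linarith
  refine Set.eq_singleton_iff_unique_mem.2 ⟨⟨by omega, z, hsol, rfl⟩, ?_⟩
  rintro _ ⟨h0, z', hz', rfl⟩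
  funext v
  exact gameSolutions_unique hρ hr hN hz' hsol v

end Grid

/-! ### Comparison of the Euclidean and the maximum norm. -/

section StackedNorm

variable {M : ℕ}

theorem stackedNorm_nonneg (y : Fin M → PState) : 0 ≤ stackedNorm y := Real.sqrt_nonneg _

theorem norm_stock_le (y : Fin M → PState) : ‖stock y‖ ≤ stackedNorm y := by
  have h0 := stackedNorm_nonneg y
  have h : ∀ v, (y v).1 ^ 2 + (y v).2 ^ 2 ≤ ∑ v, ((y v).1 ^ 2 + (y v).2 ^ 2) := fun v =>
    Finset.single_le_sum (f := fun v => (y v).1 ^ 2 + (y v).2 ^ 2) (fun v _ => by positivity)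
      (Finset.mem_univ v)
  refine (pi_norm_le_iff_of_nonneg h0).2 (forall_node.2 ⟨?_, ?_, fun v => ⟨?_, ?_, ?_⟩⟩)
  · simpa [stock, nodeFn] using h0
  · simpa [stock, nodeFn] using h0
  · simpa [stock, nodeFn] using h0
  · refine Real.abs_le_sqrt (le_trans ?_ (h v))
    simp only [stock, nodeFn, Sum.elim_inr, Sum.elim_inl]
    nlinarith [sq_nonneg (y v).2]
  · refine Real.abs_le_sqrt (le_trans ?_ (h v))
    simp only [stock, nodeFn, Sum.elim_inr]
    nlinarith [sq_nonneg (y v).1]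

theorem stackedNorm_stockState_le (x : Node M → ℝ) :
    stackedNorm (stockState x) ≤ (Real.sqrt (2 * M) + 1) * ‖x‖ := by
  have h : ∀ n, x n ^ 2 ≤ ‖x‖ ^ 2 := fun n => by
    rw [← sq_abs]
    exact pow_le_pow_left₀ (abs_nonneg _) (norm_le_pi_norm x n) 2
  have h1 : stackedNorm (stockState x) ≤ Real.sqrt (2 * M * ‖x‖ ^ 2) := by
    refine Real.sqrt_le_sqrt ?_
    have : ∑ v : Fin M, (‖x‖ ^ 2 + ‖x‖ ^ 2) = 2 * M * ‖x‖ ^ 2 := by simp; ring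
    rw [← this]
    exact Finset.sum_le_sum fun v _ => add_le_add (h _) (h _)
  rw [Real.sqrt_mul (by positivity), Real.sqrt_sq (norm_nonneg x)] at h1
  linarith [norm_nonneg x]

theorem continuous_stock : Continuous (stock : (Fin M → PState) → Node M → ℝ) := by
  refine continuous_pi (forall_node.2 ⟨?_, ?_, fun v => ⟨?_, ?_, ?_⟩⟩) <;>
    simp only [stock, nodeFn, Sum.elim_inr, Sum.elim_inl, Pi.zero_apply] <;> fun_prop

theorem stock_zero : stock (0 : Fin M → PState) = 0 :=
  funext (forall_node.2 ⟨rfl, rfl, fun _ => ⟨rfl, rfl, rfl⟩⟩)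

end StackedNorm

namespace Net

variable {V E : Type} [Fintype V] [Fintype E] [DecidableEq V] {G : Net V E}

/-- From every admissible stock there is a receding-horizon closed loop. -/
theorem exists_loop {N : ℕ} (hN : 1 ≤ N) {x₀ : V → ℝ} (h : x₀ ∈ G.box) :
    ∃ (x : ℕ → V → ℝ) (f : ℕ → ℕ → E → ℝ), x 0 = x₀ ∧
      ∀ t, G.IsOpt N (x t) (f t) ∧ x (t + 1) = G.step (x t) (f t 0) := by
  choose! F hF using fun (x : V → ℝ) (hx : x ∈ G.box) => exists_isOpt (G := G) hx N
  let x : ℕ → V → ℝ := fun t => Nat.rec x₀ (fun _ y => G.step y (F y 0)) t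
  have hx : ∀ t, x t ∈ G.box := fun t => by
    induction t with
    | zero => exact h
    | succ t ih => exact (hF _ ih).1.2 1 hN
  exact ⟨x, fun t => F (x t), rfl, fun t => ⟨hF _ (hx t), rfl⟩⟩

end Net

/-! ### Transfer of the network results to the grid. -/

namespace Grid

variable {M : ℕ} {G : Grid M} {xbar : Fin M → PState} {ubar : Fin M → PInput}

theorem IsSteady.mem_region (h : G.IsSteady xbar ubar) : xbar ∈ G.region xbar :=
  ⟨fun _ => xbar, fun _ => ubar, rfl, fun _ => h.step_eq.symm, fun _ => h.inputs,
    fun _ => h.states, tendsto_const_nhds⟩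

variable {h : G.IsSteady xbar ubar}
  {hL : G.LMin ≤ G.aggregateLoad ubar ∧ G.aggregateLoad ubar ≤ G.LMax} {r : ℝ} {hr : 0 < r}
  {μ : Node M → ℝ}

/-- A battery that can neither leak nor be charged keeps its state of charge, so convergence forces
it to start at its steady value. This places the initial deviation in the box with the frozen nodes.
-/
theorem exists_plan_of_mem_region [Nonempty (Fin M)] (hμ : IsSteadyMultiplier h hL hr μ)
    {x₀ : Fin M → PState} (hx : x₀ ∈ G.region xbar) : ∃ f, (∀ N, (steadyNet hμ).IsPlan N (stock (x₀ - xbar)) f) ∧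
      Tendsto ((steadyNet hμ).traj (stock (x₀ - xbar)) f) atTop (𝓝 0) := by
  obtain ⟨X, U, rfl, hX, hU, hs, hlim⟩ := hx
  have h0 : stock (X 0 - xbar) ∈ (steadyNet hμ).box := by
    refine (stock_mem_devNet_box h hL hr).2 ⟨by rw [add_sub_cancel]; exact hs 0, fun v hv => ?_⟩
    have hconst : ∀ k, (X k v).2 = (X 0 v).2 := fun k => by
      induction k with
      | zero => rfl
      | succ k ih => rw [hX]; simp [step, stepAgent, hv.1, hv.2, ih]
    have h1 : Tendsto (fun k => (X k v).2) atTop (𝓝 (xbar v).2) :=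
      (continuous_snd.tendsto _).comp ((continuous_apply v).tendsto _ |>.comp hlim)
    simp only [hconst] at h1
    have := tendsto_nhds_unique tendsto_const_nhds h1
    simp [this]
  refine ⟨fun k => linkFlow (U k - ubar), fun N => isPlan_steadyNet hμ (fun k _ => hX k)
    (fun k _ => hs k) hU h0, ?_⟩
  have h1 : (steadyNet hμ).traj (stock (X 0 - xbar)) (fun k => linkFlow (U k - ubar)) =
      fun k => stock (X k - xbar) :=
    funext fun k => traj_steadyNet hμ (N := k) (fun k _ => hX k) le_rfl
  rw [h1]
  have h2 : Tendsto (fun k => X k - xbar) atTop (𝓝 0) := by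
    simpa using hlim.sub_const xbar
  have h3 := (continuous_stock (M := M)).tendsto 0
  rw [stock_zero] at h3
  exact h3.comp h2

/-- The family fed into the comparison argument consists of the norms along closed loops whose
initial value is at most the uniform bound `R`. Stability, attraction and boundedness hold uniformly
on it, and for long horizons every start in the region belongs to it. -/
theorem practical_stability [Nonempty (Fin M)] (hμ : IsSteadyMultiplier h hL hr μ)
    (hρ : ∀ v, G.ρ₁ v = r) :
    ∃ (Nbar : ℕ) (η : ℝ → ℝ → ℝ) (γ : ℕ → ℝ),
      IsClassKL η ∧ (∀ N, 0 ≤ γ N) ∧ Tendsto γ atTop (𝓝 0) ∧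
      ∀ N, Nbar ≤ N → ∀ x₀ ∈ G.region xbar,
        ∃ (x : ℕ → Fin M → PState) (u : ℕ → Fin M → PInput),
          x 0 = x₀ ∧
          ∀ t : ℕ,
            G.feedback N (x t) = {u t} ∧
            x (t + 1) = G.step (x t) (u t) ∧
            x t ∈ G.states ∧ u t ∈ G.inputs ∧
            stackedNorm (x t - xbar) ≤ η (stackedNorm (x 0 - xbar)) t + γ N := by
  obtain ⟨R, N₁, hR⟩ := (steadyNet hμ).exists_val_bound
  obtain ⟨D, hD0, hD, -⟩ := Net.exists_radius (G := steadyNet hμ)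
  set C : ℝ := Real.sqrt (2 * M) + 1 with hC
  have hC0 : 0 < C := by positivity
  let fam : ℕ → Set (ℕ → ℝ) := fun N => {s | ∃ y, (steadyNet hμ).IsLoop N y ∧
    (steadyNet hμ).val N (y 0) ≤ R ∧ ∀ t, s t = stackedNorm (stockState (y t))}
  have hbox : ∀ {N y}, (steadyNet hμ).IsLoop N y → ∀ t, y t ∈ (steadyNet hμ).box :=
    fun hy t => hy.mem_box t
  obtain ⟨η, γ, hη, hγ, hγ0, hb⟩ := exists_isClassKL_bound (C * D) fam
    (fun N s ⟨y, _, _, hs⟩ t => by rw [hs]; exact stackedNorm_nonneg _)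
    (fun N s ⟨y, hy, _, hs⟩ t => by
      rw [hs]
      exact (stackedNorm_stockState_le _).trans
        (mul_le_mul_of_nonneg_left (hD _ (hbox hy t)) hC0.le))
    (fun ε hε => by
      obtain ⟨δ, hδ, N₀, hst⟩ := (steadyNet hμ).loop_stable (div_pos hε hC0)
      refine ⟨δ, hδ, N₀, fun N hN s ⟨y, hy, _, hs⟩ h0 t => ?_⟩
      have h1 : ‖y 0‖ ≤ δ := by
        rw [← stock_stockState h hL hr (hbox hy 0)]
        exact (norm_stock_le _).trans (hs 0 ▸ h0)
      rw [hs]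
      refine (stackedNorm_stockState_le _).trans ?_
      have := (le_div_iff₀' hC0).1 (hst N hN y hy h1 t)
      exact this)
    (fun ε hε => by
      obtain ⟨T, N₀, hat⟩ := (steadyNet hμ).loop_attracted (div_pos hε hC0) R
      refine ⟨T, N₀, fun N hN s ⟨y, hy, hv, hs⟩ t ht => ?_⟩
      rw [hs]
      refine (stackedNorm_stockState_le _).trans ?_
      exact (le_div_iff₀' hC0).1 (hat N hN y hy hv t ht))
  refine ⟨max 2 N₁, η, γ, hη, hγ, hγ0, fun N hN x₀ hx₀ => ?_⟩
  have hN2 : 2 ≤ N := (le_max_left _ _).trans hN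
  obtain ⟨g, hg, hglim⟩ := exists_plan_of_mem_region hμ hx₀
  have hbox0 : stock (x₀ - xbar) ∈ (steadyNet hμ).box := (hg 0).2 0 le_rfl
  obtain ⟨y, f, hy0, hy⟩ := Net.exists_loop (G := steadyNet hμ) (N := N) (by omega) hbox0
  have hloop : (steadyNet hμ).IsLoop N y :=
    ⟨hy0 ▸ hbox0, fun t => ⟨f t, hy t⟩⟩
  have hmem : (fun t => stackedNorm (stockState (y t))) ∈ fam N :=
    ⟨y, hloop, hy0 ▸ hR _ g hg hglim N ((le_max_right _ _).trans hN), fun _ => rfl⟩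
  refine ⟨fun t => xbar + stockState (y t), fun t => ubar + linkInput (f t 0), ?_, fun t =>
    ⟨feedback_eq hμ hρ hN2 (hy t).1, ?_, plan_states hμ (hy t).1.1 (Nat.zero_le N),
      plan_inputs hμ (hy t).1.1 (by omega), ?_⟩⟩
  · simp only [hy0, stockState_stock, add_sub_cancel]
  · have := plan_step hμ (hy t).1.1 (k := 0) (by omega)
    simp only [(hy t).2]
    exact this
  · simp only [add_sub_cancel_left]
    exact hb N _ hmem t

end Grid

theorem theorem1 {M : ℕ} (G : Grid M)
    (hsym : ∀ v w, G.ρ₁ v = G.ρ₁ w ∧ G.ρ₂ v = G.ρ₂ w)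
    (hsteady : G.steadySet.Nonempty) :
    ∃ (xbar : Fin M → PState) (ubar : Fin M → PInput),
      G.IsSteadyVGNE xbar ubar ∧
      (∀ x u, G.IsSteadyVGNE x u → x = xbar ∧ u = ubar) ∧
      xbar ∈ G.region xbar ∧
      (∀ (π : ℕ → (Fin M → PState) → (Fin M → PInput)) (x : ℕ → Fin M → PState),
        (∀ t, x (t + 1) = G.step (x t) (π t (x t))) →
        (∀ t, x t ∈ G.states ∧ π t (x t) ∈ G.inputs) →
        Tendsto x atTop (𝓝 xbar) → x 0 ∈ G.region xbar) ∧
      ∃ (Nbar : ℕ) (η : ℝ → ℝ → ℝ) (γ : ℕ → ℝ),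
        IsClassKL η ∧ (∀ N, 0 ≤ γ N) ∧ Tendsto γ atTop (𝓝 0) ∧
        ∀ N, Nbar ≤ N → ∀ x₀ ∈ G.region xbar,
          ∃ (x : ℕ → Fin M → PState) (u : ℕ → Fin M → PInput),
            x 0 = x₀ ∧
            ∀ t : ℕ,
              G.feedback N (x t) = {u t} ∧
              x (t + 1) = G.step (x t) (u t) ∧
              x t ∈ G.states ∧ u t ∈ G.inputs ∧
              stackedNorm (x t - xbar) ≤ η (stackedNorm (x 0 - xbar)) t + γ N := by
  have hlargest : ∀ (xbar : Fin M → PState) (π : ℕ → (Fin M → PState) → (Fin M → PInput))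
      (x : ℕ → Fin M → PState), (∀ t, x (t + 1) = G.step (x t) (π t (x t))) →
      (∀ t, x t ∈ G.states ∧ π t (x t) ∈ G.inputs) →
      Tendsto x atTop (𝓝 xbar) → x 0 ∈ G.region xbar := fun xbar π x h1 h2 h3 =>
    ⟨x, fun t => π t (x t), rfl, h1, fun t => (h2 t).2, fun t => (h2 t).1, h3⟩
  obtain ⟨r, hr, hρ⟩ : ∃ r : ℝ, 0 < r ∧ ∀ v, G.ρ₁ v = r := by
    rcases isEmpty_or_nonempty (Fin M) with hM | ⟨⟨v⟩⟩
    · exact ⟨1, one_pos, fun v => isEmptyElim v⟩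
    · exact ⟨G.ρ₁ v, G.ρ₁_pos v, fun w => (hsym w v).1⟩
  obtain ⟨xbar, ubar, hE⟩ := Grid.exists_isSteadyVGNE hρ hr.le hsteady
  have hS : G.IsSteady xbar ubar :=
    have := ((Grid.isSteadyVGNE_iff hρ hr.le).1 hE).1
    ⟨this.1, this.2.1, this.2.2⟩
  refine ⟨xbar, ubar, hE, fun x u h => Grid.IsSteadyVGNE.unique hρ hr hE h, hS.mem_region,
    hlargest xbar, ?_⟩
  -- Without prosumers the coupling constraint is imposed on nobody, so the limits on the aggregate
  -- load may fail; the state space is then a single point and the claim is trivial.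
  rcases isEmpty_or_nonempty (Fin M) with hM | hM
  · obtain ⟨η, γ, hη, hγ, hγ0, -⟩ := exists_isClassKL_bound 0 (fun _ => ∅) (by simp) (by simp)
      (fun ε hε => ⟨1, one_pos, 0, by simp⟩) fun ε hε => ⟨0, 0, by simp⟩
    refine ⟨1, η, γ, hη, hγ, hγ0, fun N hN x₀ _ => ⟨fun _ => x₀, fun _ => ubar, rfl, fun t =>
      ⟨?_, Subsingleton.elim _ _, fun v => isEmptyElim v, fun v => isEmptyElim v, ?_⟩⟩⟩
    · refine Set.eq_singleton_iff_unique_mem.2 ⟨⟨hN, fun v => isEmptyElim v,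
        ⟨fun v => isEmptyElim v, fun z' _ => by simp⟩, Subsingleton.elim _ _⟩,
        fun _ _ => Subsingleton.elim _ _⟩
    · have : stackedNorm (x₀ - xbar) = 0 := by simp [stackedNorm]
      rw [this, hη.map_zero _ (Nat.cast_nonneg t), zero_add]
      exact hγ N
  · have hL := (Grid.mem_inputs_iff.1 hS.inputs).2
    obtain ⟨μ, hμ⟩ := Grid.exists_steady_multiplier hS hL hr hρ hE
    exact Grid.practical_stability hμ hρ
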